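/- **Setting.** Let $k$ be a number field, $p$ a prime, $n\ge 1$, $G_m=\mathrm{Res}_{k/\mathbb Q}\mathrm{GL}_m$, $j:G_n\to G_{n+1}$, $g\mapsto\mathrm{diag}(g,1)$, and write $\mathbb A_f$ for the ring of finite adeles of $k$, $(k\otimes\mathbb R)^0$ for the identity component of $(k\otimes\mathbb R)^\times$ and $d_{(c)}=\mathrm{diag}(c,1,\dots,1)$. Let $K_m^0\subset G_m(\mathbb R)$ be the identity component of the standard maximal compact subgroup, $GK_m$ the product of the groups $\mathrm{GO}(m)$ (real places) and $\mathrm{GU}(m)$ (complex places), and let $J_{m}$ be a group with $GK_m^0\subseteq J_m\subseteq GK_m$ ($m=n,n+1$). A compact open $L\subset \mathrm{GL}_m(\mathbb A_f)$ is called neat if all groups $\mathrm{GL}_m(k)\cap gLg^{-1}$ are torsion free. Put $$\mathscr X_m(L)=G_m(\mathbb Q)\backslash G_m(\mathbb A)/K_m^0L,\quad \mathscr X^{\rm ad}_m(L)=G_m(\mathbb Q)\backslash G_m(\mathbb A)/J_mL,\quad C(L)=k^\times\backslash\mathbb A_k^\times/(k\otimes\mathbb R)^0\det(L),$$ and for a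 finite idele $c$ let $\Gamma_c=\mathrm{GL}_m(k)\cap G_m(\mathbb R)^0\cap d_{(c)}Ld_{(c)}^{-1}$; the component of $\mathscr X_m(L)$ of class $c$ is $\mathscr X_m(L)[c]=\Gamma_c\backslash G_m(\mathbb R)^0/K_m^0$. Let $E$ be a field of characteristic $0$ and let $M_1$, $M_2$ be finite dimensional algebraic representations over $E$ of $G_{n+1}$ and $G_n$ (for example irreducible ones $M_{\boldsymbol\mu}(E)$, $M_{\boldsymbol\nu}(E)$ of highest weights $\boldsymbol\mu$, $\boldsymbol\nu$), and $M=M_1\otimes_E M_2$, regarded as a representation of $G_n$ via $j\times 1$. Let $d=b_{n+1}^k+b_n^k=\dim\mathscr X_n(L)$, where $b_m^k$ is the sum of $\lfloor m^2/4\rfloor$ over the real and of $m(m-1)/2$ over the complex places of $k$. Fix fundamental classes $F_{L}$ of the oriented manifolds $\mathscr X_n(L)$ in Borel–Moore homology with integral coefficients (on each component a generator), for all neat compact open $L\subset\mathrm{GL}_n(\mathbb A_f)$, compatible with the translations $\mathscr X_n(gLg^{-1})\to\mathscr X_n(L)$ and such that the pushforward of $F_L$ to $\mathscr X_n(L')$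 is $(L':L)F_{L'}$ for $L\subseteq L'$. For neat compact open $K\subset\mathrm{GL}_{n+1}(\mathbb A_f)$, $K'\subset \mathrm{GL}_n(\mathbb A_f)$ and $h\in \mathrm{GL}_{n+1}(\mathbb A_f)$, $h'\in\mathrm{GL}_n(\mathbb A_f)$, $c\in\mathbb A_f^\times$ put $K(h,h')=j^{-1}(hKh^{-1})\cap h'K'h'^{-1}$, $\Gamma_c^{h,h'}=\Gamma_c$ for $L=K(h,h')$, and let $$\mathscr P_{h,h',c}:H^d_c(\mathscr X^{\rm ad}_{n+1}(K)\times\mathscr X^{\rm ad}_n(K');\underline M)\to H^0(\Gamma_c^{h,h'};M),\quad \lambda\mapsto\int_{\mathscr X_n(K(h,h'))[c]}(j\times{\rm ad})^*t_{(h,h')}(\lambda)$$ be the modular symbol, where $t_{(h,h')}$ is translation by $(h,h')$, and where for a compactly supported class $\omega$ of top degree with values in $\underline M$ the integral is the unique $w\in H^0(\Gamma_c^{h,h'};M)$ such that $u(w)=\langle u(\omega),F\rangle$ for all $u\in H^0(\Gamma_c^{h,h'};M^\vee)$. Let $m>0$, and let $\varpi\in\mathbb A_f^\times$ have components $1$ away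 from $p$ and valuation at least $m$ at each $\mathfrak p\mid p$. Assume that $K$, $K'$ are neat compact open and that their $p$-components are the products of the mod $\mathfrak p^m$ Iwahori subgroups (upper triangular mod $\mathfrak p^m$), $\mathfrak p\mid p$. Let $t'=\mathrm{diag}(\varpi^n,\dots,\varpi)$, $t=j(t')$, let $h^{(1)}\in\mathrm{GL}_{n+1}(\mathbb A_f)$ have at all $\mathfrak p\mid p$ the component $\begin{pmatrix}w_n&e\\0&1\end{pmatrix}$, where $w_n$ is the antidiagonal permutation matrix and $e=(1,\dots,1)^{\rm t}$, and put $K(\varpi^v)=K(h^{(1)}t^v,t'^v)$, $\Gamma_x^{(v)}=\Gamma_x^{h^{(1)}t^v,t'^v}$, $U_v=k^\times\cap (k\otimes\mathbb R)^0\det K(\varpi^v)$. Let $\mathcal O_p=\mathcal O_k\otimes\mathbb Z_p$, considered inside $\mathbb A_f$ by components $0$ away from $p$. Let $\lambda\in H^d_c(\mathscr X^{\rm ad}_{n+1}(K)\times\mathscr X^{\rm ad}_n(K');\underline M)$ be an eigenclass of $U_p=KtK\otimes K't'K'$ with eigenvalue $\kappa\in E^\times$, and put, for $v\geq 1$ and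 $x\in\mathbb A_f^\times$, $$\tilde\mu_\lambda(x+(\varpi^v))=\kappa^{-v}\,\mathscr P_{h^{(1)}t^v,t'^v,x}(\lambda).$$ **Theorem.** (1) $\tilde\mu_\lambda(x+(\varpi^v))$ is a well defined element of $H^0(\Gamma_x^{(v)};M)\subseteq M$. (2) As an element of $M$ it only depends on the coset $x\det K(\varpi^v)$. (3) For all $v\ge1$ and all $x\in\mathbb A_f^\times$ with unit components at all $\mathfrak p\mid p$, $$(U_v:U_{v+1})\cdot\tilde\mu_\lambda(x+(\varpi^v))=\sum_{a\bmod\varpi}\tilde\mu_\lambda(x+a\varpi^v+(\varpi^{v+1})),$$ where $a$ runs through representatives of $\mathcal O_p/\varpi\mathcal O_p$. (4) Assume that the arithmetic groups $\Gamma_c^{(0)}$, $c\in\mathbb A_f^\times$, are neat in the sense that for each of their elements the group generated by its eigenvalues under all embeddings $k\to\mathbb C$ is torsion free. Then, for $v$ and $x$ as in (3), $$\tilde\mu_\lambda(x+(\varpi^v))=\sum_{a}\tilde\mu_\lambda(x+a\varpi^v+(\varpi^{v+1})),$$ where $a$ runs through elements of $\mathcal O_p$ such that $x+a\varpi^v$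 runs once through the classes in $C(K(\varpi^{v+1}))$ represented by elements of $x+\varpi^v\mathcal O_p$. Moreover, after fixing finite ideles representing the classes in $C(K(\varpi^0))$, $\tilde\mu_\lambda$ defines a distribution on $C(K(p^\infty))=\varprojlim_v C(K(\varpi^v))$ with values in $H^0(\Gamma_n;M)$, where $\Gamma_n$ is the algebraic hull of the torsion free arithmetic subgroups of $G_n$ (the intersection of their Zariski closures): there is a unique $E$-linear map $D$ from the locally constant $E$-valued functions on $C(K(p^\infty))$ to $H^0(\Gamma_n;M)$ which, for all $v\ge1$ and all $x\in\mathbb A_f^\times$ that differ by an element of $\det K(\varpi^0)$ from the chosen representative of the class of $x$ in $C(K(\varpi^0))$, sends the characteristic function of the set of points over the class of $x$ in $C(K(\varpi^v))$ to $\tilde\mu_\lambda(x+(\varpi^v))$. -/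

import Mathlib

open NumberField IsDedekindDomain Matrix
open scoped TensorProduct

noncomputable section

set_option linter.unusedSectionVars false

namespace RankinSelberg

/-! ## Groups over `k`, over the archimedean completions and over the finite adeles -/

/-- The ring of finite adeles of `k`. -/
abbrev Af (k : Type*) [Field k] [NumberField k] := FiniteAdeleRing (𝓞 k) k

/-- `G_m(ℚ) = GL_m(k)`. -/
abbrev GLk (k : Type*) [Field k] (m : ℕ) := GL (Fin m) k

/-- `G_m(ℝ) = GL_m(k ⊗ ℝ)`. -/
abbrev GLinf (k : Type*) [Field k] (m : ℕ) := GL (Fin m) (InfiniteAdeleRing k)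

/-- `G_m` over the finite adeles. -/
abbrev GLf (k : Type*) [Field k] [NumberField k] (m : ℕ) := GL (Fin m) (Af k)

section Groups

variable {k : Type*} [Field k] [NumberField k]

/-- The diagonal embedding `G_m(ℚ) → G_m(ℝ)`. -/
def toInf {m : ℕ} : GLk k m →* GLinf k m :=
  GeneralLinearGroup.map (algebraMap k (InfiniteAdeleRing k))

/-- The diagonal embedding of `G_m(ℚ)` into the finite adelic points of `G_m`. -/
def toFin {m : ℕ} : GLk k m →* GLf k m :=
  GeneralLinearGroup.map (algebraMap k (Af k))

/-- The embedding `g ↦ diag(g, 1)` on matrices. -/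
def jMat {n : ℕ} {R : Type*} [CommRing R] :
    Matrix (Fin n) (Fin n) R →* Matrix (Fin (n + 1)) (Fin (n + 1)) R where
  toFun A := reindex finSumFinEquiv finSumFinEquiv
    (fromBlocks A 0 0 (1 : Matrix (Fin 1) (Fin 1) R))
  map_one' := by simp [fromBlocks_one]
  map_mul' A B := by
    simp only [reindex_apply]
    rw [submatrix_mul_equiv, fromBlocks_multiply]
    simp

/-- The embedding `j : GL_n → GL_{n+1}`, `g ↦ diag(g, 1)`. -/
def jEmb {n : ℕ} {R : Type*} [CommRing R] : GL (Fin n) R →* GL (Fin (n + 1)) R :=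
  Units.map jMat

/-- The diagonal matrix with given invertible entries. -/
def diagGL {m : ℕ} {R : Type*} [CommRing R] (f : Fin m → Rˣ) : GL (Fin m) R :=
  Units.map (diagonalRingHom (Fin m) R).toMonoidHom (MulEquiv.piUnits.symm f)

/-- `d_(c) = diag(c, 1, …, 1)`. -/
def dElt {m : ℕ} {R : Type*} [CommRing R] (c : Rˣ) : GL (Fin m) R :=
  diagGL fun i => if i.val = 0 then c else 1

variable (k)

/-- The component at `v` of an element of `G_m(ℝ)`, as a complex matrix (with real entries if `v` is
real). -/
def compInf {m : ℕ} (v : InfinitePlace k) : GLinf k m →* GL (Fin m) ℂ :=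
  GeneralLinearGroup.map ((InfinitePlace.Completion.extensionEmbedding v).comp
    (Pi.evalRingHom (fun v : InfinitePlace k => v.Completion) v))

/-- The unitary group `U(m)`. -/
def unitaryGL (m : ℕ) : Subgroup (GL (Fin m) ℂ) where
  carrier := {g | (g : Matrix (Fin m) (Fin m) ℂ)ᴴ * (g : Matrix (Fin m) (Fin m) ℂ) = 1}
  one_mem' := by simp
  mul_mem' := by
    intro a b ha hb
    simp only [Set.mem_ofPred_eq, Units.val_mul, conjTranspose_mul] at *
    rw [Matrix.mul_assoc, ← Matrix.mul_assoc _ a.val, ha, Matrix.one_mul, hb]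
  inv_mem' := by
    intro a ha
    simp only [Set.mem_ofPred_eq] at *
    have h : ((a⁻¹ : GL (Fin m) ℂ) : Matrix (Fin m) (Fin m) ℂ) = (a : Matrix _ _ ℂ)ᴴ := 
      Units.inv_eq_of_mul_eq_one_left ha
    rw [h, conjTranspose_conjTranspose, ← h, Units.mul_inv]

/-- The group of unitary similitudes `GU(m)`. -/
def similitudeGL (m : ℕ) : Subgroup (GL (Fin m) ℂ) where
  carrier := {g | ∃ r : ℂ, r ≠ 0 ∧ r.im = 0 ∧
    (g : Matrix (Fin m) (Fin m) ℂ)ᴴ * (g : Matrix (Fin m) (Fin m) ℂ) = r • 1}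
  one_mem' := ⟨1, by simp⟩
  mul_mem' := by
    rintro a b ⟨r, hr, hr', ha⟩ ⟨s, hs, hs', hb⟩
    refine ⟨r * s, mul_ne_zero hr hs, by simp [hr', hs'], ?_⟩
    simp only [Units.val_mul, conjTranspose_mul] at *
    rw [Matrix.mul_assoc, ← Matrix.mul_assoc _ a.val, ha, Matrix.smul_mul, Matrix.mul_smul,
      Matrix.one_mul, hb, smul_smul]
  inv_mem' := by
    rintro a ⟨r, hr, hr', ha⟩
    have hstar : star r = r := Complex.conj_eq_iff_im.2 hr'
    have h : ((a⁻¹ : GL (Fin m) ℂ) : Matrix (Fin m) (Fin m) ℂ) = r⁻¹ • (a : Matrix _ _ ℂ)ᴴ := by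
      refine Units.inv_eq_of_mul_eq_one_left ?_
      rw [Matrix.smul_mul, ha, smul_smul, inv_mul_cancel₀ hr, one_smul]
    refine ⟨r⁻¹, inv_ne_zero hr, by simp [Complex.inv_im, hr'], ?_⟩
    have h2 : ((a⁻¹ : GL (Fin m) ℂ) : Matrix (Fin m) (Fin m) ℂ)ᴴ = r⁻¹ • (a : Matrix _ _ ℂ) := by
      rw [h, conjTranspose_smul, conjTranspose_conjTranspose, star_inv₀, hstar]
    rw [h2, Matrix.smul_mul, Units.mul_inv]

/-- The identity component of `(k ⊗ ℝ)ˣ`: positive at all real places. -/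
def posUnits : Subgroup (InfiniteAdeleRing k)ˣ where
  carrier := {u | ∀ (v : InfinitePlace k) (hv : v.IsReal),
    0 < InfinitePlace.Completion.extensionEmbeddingOfIsReal hv ((u : InfiniteAdeleRing k) v)}
  one_mem' := by
    intro v hv
    have : ((1 : (InfiniteAdeleRing k)ˣ) : InfiniteAdeleRing k) v = 1 := rfl
    rw [this, map_one]
    exact one_pos
  mul_mem' := by
    intro a b ha hb v hv
    have : ((a * b : (InfiniteAdeleRing k)ˣ) : InfiniteAdeleRing k) v
      = (a : InfiniteAdeleRing k) v * (b : InfiniteAdeleRing k) v := rfl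
    rw [this, map_mul]
    exact mul_pos (ha v hv) (hb v hv)
  inv_mem' := by
    intro a ha v hv
    have h1 : (a : InfiniteAdeleRing k) v * ((a⁻¹ : (InfiniteAdeleRing k)ˣ) : InfiniteAdeleRing k) v
        = 1 := congrFun (Units.mul_inv a) v
    have h2 := congrArg (InfinitePlace.Completion.extensionEmbeddingOfIsReal hv) h1
    rw [map_mul, map_one] at h2
    by_contra h
    have := mul_nonpos_of_nonneg_of_nonpos (ha v hv).le (not_lt.1 h)
    linarith

/-- The identity component `G_m(ℝ)⁰`. -/
def posGL (m : ℕ) : Subgroup (GLinf k m) := (posUnits k).comap GeneralLinearGroup.det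

/-- The group `GK_m`, the product of the groups `GO(m)` resp. `GU(m)` over the real resp. complex
places. -/
def GK (m : ℕ) : Subgroup (GLinf k m) :=
  ⨅ v : InfinitePlace k, (similitudeGL m).comap (compInf k v)

/-- The identity component of `GK_m`. -/
def GK0 (m : ℕ) : Subgroup (GLinf k m) := GK k m ⊓ posGL k m

/-- The identity component `K_m⁰` of the standard maximal compact subgroup of `G_m(ℝ)`, the product
of the groups `SO(m)` resp. `U(m)` over the real resp. complex places. -/
def K0 (m : ℕ) : Subgroup (GLinf k m) :=
  (⨅ v : InfinitePlace k, (unitaryGL m).comap (compInf k v)) ⊓ posGL k m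

theorem K0_le_GK0 (m : ℕ) : K0 k m ≤ GK0 k m := by
  refine inf_le_inf_right _ (iInf_mono fun v => Subgroup.comap_mono fun g hg => ?_)
  exact ⟨1, one_ne_zero, by simp, by rw [one_smul]; exact hg⟩

theorem det_jEmb {n : ℕ} {R : Type*} [CommRing R] (g : GL (Fin n) R) :
    GeneralLinearGroup.det (jEmb g) = GeneralLinearGroup.det g := by
  ext
  simp [jEmb, jMat, GeneralLinearGroup.det]

theorem K0_le_comap_jEmb (n : ℕ) : K0 k n ≤ (K0 k (n + 1)).comap jEmb := by
  intro g hg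
  obtain ⟨h1, h2⟩ := Subgroup.mem_inf.1 hg
  refine Subgroup.mem_comap.2 (Subgroup.mem_inf.2 ⟨?_, ?_⟩)
  · simp only [Subgroup.mem_iInf, Subgroup.mem_comap] at h1 ⊢
    intro v
    have e : compInf k v (jEmb g) = jEmb (compInf k v g) := by
      ext i j
      simp only [compInf, jEmb, jMat, GeneralLinearGroup.map_apply, Units.coe_map,
        MonoidHom.coe_mk, OneHom.coe_mk, reindex_apply, submatrix_apply]
      rcases finSumFinEquiv.symm i with a | a <;> rcases finSumFinEquiv.symm j with b | b
      · simp [GeneralLinearGroup.map]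
      · simp only [fromBlocks_apply₁₂, Matrix.zero_apply]; exact map_zero _
      · simp only [fromBlocks_apply₂₁, Matrix.zero_apply]; exact map_zero _
      · simp only [fromBlocks_apply₂₂, one_apply]
        split_ifs
        · exact map_one _
        · exact map_zero _
    rw [e]
    have := h1 v
    change (jMat (compInf k v g).val)ᴴ * jMat (compInf k v g).val = 1
    have e2 : (jMat (compInf k v g).val)ᴴ = jMat (compInf k v g).valᴴ := by
      simp [jMat, conjTranspose_submatrix, fromBlocks_conjTranspose]
    rw [e2, ← map_mul, this, map_one]
  · simp only [posGL, Subgroup.mem_comap, det_jEmb] at h2 ⊢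
    exact h2

end Groups

/-! ## Singular simplices -/

/-- Singular `q`-simplices in `T`. -/
abbrev Sing (q : ℕ) (T : Type*) [TopologicalSpace T] := C(stdSimplex ℝ (Fin (q + 1)), T)

/-- The `i`-th face of a singular simplex. -/
def face {q : ℕ} {T : Type*} [TopologicalSpace T] (i : Fin (q + 2)) (σ : Sing (q + 1) T) :
    Sing q T :=
  σ.comp ⟨stdSimplex.map i.succAbove, stdSimplex.continuous_map _⟩

/-! ## Levels, component groups and arithmetic groups -/

section Levels

variable {k : Type*} [Field k] [NumberField k]

/-- `L` is neat: all arithmetic groups `G_m(ℚ) ∩ g L g⁻¹` are torsion free. -/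
def IsNeat {m : ℕ} (L : Subgroup (GLf k m)) : Prop :=
  ∀ (g : GLf k m) (γ : GLk k m), g⁻¹ * toFin γ * g ∈ L → IsOfFinOrder γ → γ = 1

/-- A neat compact open subgroup of the finite adelic points of `G_m`. -/
structure IsLevel {m : ℕ} (L : Subgroup (GLf k m)) : Prop where
  isOpen : IsOpen (L : Set (GLf k m))
  isCompact : IsCompact (L : Set (GLf k m))
  isNeat : IsNeat L

/-- The conjugate `g L g⁻¹`. -/
def conjLevel {m : ℕ} (g : GLf k m) (L : Subgroup (GLf k m)) : Subgroup (GLf k m) :=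
  L.map (MulAut.conj g).toMonoidHom

/-- `K(h, h') = j⁻¹(h K h⁻¹) ∩ h' K' h'⁻¹`. -/
def diagLevel {n : ℕ} (K : Subgroup (GLf k (n + 1))) (K' : Subgroup (GLf k n))
    (h : GLf k (n + 1)) (h' : GLf k n) : Subgroup (GLf k n) :=
  (conjLevel h K).comap jEmb ⊓ conjLevel h' K'

/-- `det(L)`. -/
def detLevel {m : ℕ} (L : Subgroup (GLf k m)) : Subgroup (Af k)ˣ :=
  L.map GeneralLinearGroup.det

variable (k) in
/-- The diagonal embedding of `kˣ` into the ideles. -/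
def principal : kˣ →* (InfiniteAdeleRing k)ˣ × (Af k)ˣ :=
  (Units.map (algebraMap k (InfiniteAdeleRing k)).toMonoidHom).prod
    (Units.map (algebraMap k (Af k)).toMonoidHom)

/-- `C(L) = kˣ \ 𝔸ˣ / (k ⊗ ℝ)⁰ det(L)`, with the discrete topology. -/
def ClassSet {m : ℕ} (L : Subgroup (GLf k m)) : Type _ :=
  ((InfiniteAdeleRing k)ˣ × (Af k)ˣ) ⧸ ((principal k).range ⊔ (posUnits k).prod (detLevel L))

instance {m : ℕ} (L : Subgroup (GLf k m)) : TopologicalSpace (ClassSet L) := ⊥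

instance {m : ℕ} (L : Subgroup (GLf k m)) : DiscreteTopology (ClassSet L) := ⟨rfl⟩

/-- The class of an idele. -/
def ideleClass {m : ℕ} (L : Subgroup (GLf k m)) (y : (InfiniteAdeleRing k)ˣ × (Af k)ˣ) :
    ClassSet L :=
  QuotientGroup.mk y

/-- The class of a finite idele. -/
def finClass {m : ℕ} (L : Subgroup (GLf k m)) (x : (Af k)ˣ) : ClassSet L := ideleClass L (1, x)

/-- The units `kˣ ∩ (k ⊗ ℝ)⁰ det(L)`. -/
def unitGroup {m : ℕ} (L : Subgroup (GLf k m)) : Subgroup kˣ :=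
  ((posUnits k).prod (detLevel L)).comap (principal k)

/-- The arithmetic group `Γ_c = G_m(ℚ) ∩ G_m(ℝ)⁰ ∩ d_(c) L d_(c)⁻¹`, whose quotient
`Γ_c \ G_m(ℝ)⁰ / K_m⁰` is the component of `G_m(ℚ) \ G_m(𝔸) / K_m⁰ L` of class `c`. -/
def arithGroup {m : ℕ} (L : Subgroup (GLf k m)) (c : (Af k)ˣ) : Subgroup (GLk k m) :=
  (posGL k m).comap toInf ⊓ (conjLevel (dElt c) L).comap toFin

variable (k) in
/-- `b_m^k`, the sum of `⌊m² / 4⌋` over the real and of `m (m - 1) / 2` over the complex places. -/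
def bottomDegree (m : ℕ) : ℕ := by
  classical
  exact ∑ v : InfinitePlace k, if v.IsReal then m ^ 2 / 4 else m * (m - 1) / 2

variable (k) in
/-- `b_{n+1}^k + b_n^k`, which is the dimension of `G_n(ℝ)⁰ / K_n⁰`. -/
def degree (n : ℕ) : ℕ := bottomDegree k (n + 1) + bottomDegree k n

end Levels

/-! ## Algebraic representations and the algebraic hull of arithmetic groups -/

section Algebraic

variable {k : Type*} [Field k] [NumberField k]

variable (k) in
/-- The regular functions over `E` on `G_m = Res_{k/ℚ} GL_m`, restricted to the (Zariski dense) set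
`G_m(ℚ) = GL_m(k)`: polynomials over `E` in the rational coordinates of the entries of `g` and of
`g⁻¹`. -/
def regularFunctions (E : Type*) [Field E] [CharZero E] (m : ℕ) : Subalgebra E (GLk k m → E) :=
  Algebra.adjoin E
    ({f | ∃ (τ : k →ₗ[ℚ] ℚ) (i j : Fin m), f = fun g => ((τ (g.val i j) : ℚ) : E)} ∪
      {f | ∃ (τ : k →ₗ[ℚ] ℚ) (i j : Fin m), f = fun g => ((τ ((g⁻¹).val i j) : ℚ) : E)})

/-- A representation of `GL_m(k)` over `E` is algebraic (i.e. comes from a representation of the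
algebraic group `Res_{k/ℚ} GL_m` over `E`) if its matrix coefficients are regular functions. -/
def IsAlgebraicRep {E V : Type*} [Field E] [CharZero E] [AddCommGroup V] [Module E V] {m : ℕ}
    (ρ : Representation E (GLk k m) V) : Prop :=
  ∀ (w : V) (l : Module.Dual E V), (fun g => l (ρ g w)) ∈ regularFunctions k E m

/-- The rational points of the Zariski closure in `Res_{k/ℚ} GL_m` of a set of rational points. -/
def zariskiClosure {m : ℕ} (S : Set (GLk k m)) : Set (GLk k m) :=
  {g | ∀ f ∈ regularFunctions k ℚ m, (∀ s ∈ S, f s = 0) → f g = 0}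

/-- `Γ` is a torsion free arithmetic subgroup of `G_m`. -/
def IsTorsionFreeArithmetic {m : ℕ} (Γ : Subgroup (GLk k m)) : Prop :=
  Γ.Commensurable (GeneralLinearGroup.map (n := Fin m) (algebraMap (𝓞 k) k)).range ∧
    ∀ γ ∈ Γ, IsOfFinOrder γ → γ = 1

variable (k) in
/-- The algebraic hull of the torsion free arithmetic subgroups of `G_m` (the intersection of
the Zariski closures of all of them, so that no choice is involved). -/
def algebraicHull (m : ℕ) : Set (GLk k m) :=
  {g | ∀ Γ : Subgroup (GLk k m), IsTorsionFreeArithmetic Γ → g ∈ zariskiClosure (Γ : Set (GLk k m))}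

/-- The invariants under a set of group elements. -/
def invariantsOf {E V G : Type*} [Field E] [AddCommGroup V] [Module E V] [Group G]
    (ρ : Representation E G V) (S : Set G) : Submodule E V where
  carrier := {w | ∀ g ∈ S, ρ g w = w}
  add_mem' := by
    intro a b ha hb g hg
    rw [map_add, ha g hg, hb g hg]
  zero_mem' := by
    intro g _
    exact map_zero _
  smul_mem' := by
    intro c a ha g hg
    rw [map_smul, ha g hg]

/-- An element of `GL_m(k)` is neat if the group generated by all its eigenvalues, under all complex
embeddings of `k`, is torsion free. -/
def IsNeatElement {m : ℕ} (γ : GLk k m) : Prop :=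
  ∀ z ∈ Subgroup.closure {z : ℂˣ | ∃ ι : k →+* ℂ,
      ((γ.val.map ι).charpoly).IsRoot (z : ℂ)}, IsOfFinOrder z → z = 1

end Algebraic

/-! ## Cohomology with compact supports -/

section Cohomology

variable {k : Type*} [Field k] [NumberField k]

variable (k) in
/-- A group between the identity component of `GK_m` and `GK_m`. -/
structure AdGroup (m : ℕ) where
  grp : Subgroup (GLinf k m)
  GK0_le : GK0 k m ≤ grp
  le_GK : grp ≤ GK k m

/-- The archimedean part of the cover of `X^ad_{n+1}(K) × X^ad_n(K')`. -/
abbrev AdCover {n : ℕ} (J : AdGroup k (n + 1)) (J' : AdGroup k n) : Type _ :=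
  (GLinf k (n + 1) ⧸ J.grp) × (GLinf k n ⧸ J'.grp)

/-- The action of `G_{n+1}(ℚ) × G_n(ℚ)` on `AdCover`. -/
def adAct {n : ℕ} (J : AdGroup k (n + 1)) (J' : AdGroup k n) (γ : GLk k (n + 1) × GLk k n) :
    C(AdCover J J', AdCover J J') :=
  ⟨fun t => (toInf γ.1 • t.1, toInf γ.2 • t.2), by fun_prop⟩

variable {n : ℕ} {E M₁ M₂ : Type*} [Field E] [AddCommGroup M₁] [Module E M₁] [AddCommGroup M₂]
  [Module E M₂]

/-- `M_{μ × ν}` as a representation of `G_{n+1}(ℚ) × G_n(ℚ)`. -/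
def prodRep (ρ₁ : Representation E (GLk k (n + 1)) M₁) (ρ₂ : Representation E (GLk k n) M₂) :
    Representation E (GLk k (n + 1) × GLk k n) (M₁ ⊗[E] M₂) :=
  Representation.tprod (ρ₁.comp (MonoidHom.fst _ _)) (ρ₂.comp (MonoidHom.snd _ _))

/-- `M_{μ × ν}` as a representation of `G_n(ℚ)` via the diagonal embedding `j × 1`. -/
def diagRep (ρ₁ : Representation E (GLk k (n + 1)) M₁) (ρ₂ : Representation E (GLk k n) M₂) :
    Representation E (GLk k n) (M₁ ⊗[E] M₂) :=
  Representation.tprod (ρ₁.comp jEmb) ρ₂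

/-- `M`-valued functions on the singular `q`-simplices of
`G_{n+1}(𝔸) / J × G_n(𝔸) / J'` with constant finite adelic part. -/
abbrev Cochain (q : ℕ) (J : AdGroup k (n + 1)) (J' : AdGroup k n) (M : Type*) : Type _ :=
  Sing q (AdCover J J') → GLf k (n + 1) × GLf k n → M

/-- The coboundary. -/
def coboundary (q : ℕ) (J : AdGroup k (n + 1)) (J' : AdGroup k n) (E M : Type*) [Field E]
    [AddCommGroup M] [Module E M] : Cochain q J J' M →ₗ[E] Cochain (q + 1) J J' M where
  toFun φ := fun σ a => ∑ i : Fin (q + 2), (-1 : E) ^ (i : ℕ) • φ (face i σ) a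
  map_add' φ ψ := by
    funext σ a
    simp [Finset.sum_add_distrib]
  map_smul' c φ := by
    funext σ a
    simp [Finset.smul_sum, smul_smul, mul_comm]

/-- The compactly supported singular cochains on `X^ad_{n+1}(K) × X^ad_n(K')` with values in the
local system of `M_{μ × ν}(E)`. The manifold is the quotient by `G_{n+1}(ℚ) × G_n(ℚ)` of its cover
`AdCover J J' × (finite adelic points modulo K × K')`, the second factor being discrete, and a cochain
with values in the local system is an equivariant `M`-valued cochain on this cover. It has compact
support if, for some compact subset of the manifold, it vanishes on all simplices that do not meet
this subset; here the compact subset is the image of `C × S`. -/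
def compactCochains (ρ₁ : Representation E (GLk k (n + 1)) M₁) (ρ₂ : Representation E (GLk k n) M₂)
    (J : AdGroup k (n + 1)) (J' : AdGroup k n)
    (K : Subgroup (GLf k (n + 1))) (K' : Subgroup (GLf k n)) (q : ℕ) :
    Submodule E (Cochain q J J' (M₁ ⊗[E] M₂)) where
  carrier := {φ |
    (∀ (γ : GLk k (n + 1) × GLk k n) σ a,
      φ ((adAct J J' γ).comp σ) (toFin γ.1 * a.1, toFin γ.2 * a.2) = prodRep ρ₁ ρ₂ γ (φ σ a)) ∧
    (∀ σ a, ∀ b ∈ K.prod K', φ σ (a * b) = φ σ a) ∧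
    ∃ (C : Set (AdCover J J')) (S : Set (GLf k (n + 1) × GLf k n)), IsCompact C ∧ S.Finite ∧
      ∀ σ a, φ σ a ≠ 0 → ∃ (γ : GLk k (n + 1) × GLk k n) (t : stdSimplex ℝ (Fin (q + 1))),
        adAct J J' γ (σ t) ∈ C ∧
        ∃ s ∈ S, s⁻¹ * (toFin γ.1 * a.1, toFin γ.2 * a.2) ∈ K.prod K'}
  add_mem' := by
    rintro φ ψ ⟨h1, h2, C, S, hC, hS, h3⟩ ⟨h1', h2', C', S', hC', hS', h3'⟩
    refine ⟨fun γ σ a => by simp [h1, h1'], fun σ a b hb => by simp [h2 σ a b hb, h2' σ a b hb],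
      C ∪ C', S ∪ S', hC.union hC', hS.union hS', fun σ a h => ?_⟩
    by_cases h0 : φ σ a = 0
    · have h0' : ψ σ a ≠ 0 := by
        intro h'
        exact h (by simp [h0, h'])
      obtain ⟨γ, t, ht, s, hs, hs'⟩ := h3' σ a h0'
      exact ⟨γ, t, Or.inr ht, s, Or.inr hs, hs'⟩
    · obtain ⟨γ, t, ht, s, hs, hs'⟩ := h3 σ a h0
      exact ⟨γ, t, Or.inl ht, s, Or.inl hs, hs'⟩
  zero_mem' := ⟨fun γ σ a => by simp, fun σ a b hb => rfl, ∅, ∅, isCompact_empty, Set.finite_empty,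
    fun σ a h => absurd rfl h⟩
  smul_mem' := by
    rintro c φ ⟨h1, h2, C, S, hC, hS, h3⟩
    refine ⟨fun γ σ a => by simp [h1], fun σ a b hb => by simp [h2 σ a b hb], C, S, hC, hS,
      fun σ a h => h3 σ a fun h0 => h (by simp [h0])⟩

/-- Compactly supported cocycles. -/
def cocycles (ρ₁ : Representation E (GLk k (n + 1)) M₁) (ρ₂ : Representation E (GLk k n) M₂)
    (J : AdGroup k (n + 1)) (J' : AdGroup k n)
    (K : Subgroup (GLf k (n + 1))) (K' : Subgroup (GLf k n)) (q : ℕ) :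
    Submodule E (Cochain q J J' (M₁ ⊗[E] M₂)) :=
  compactCochains ρ₁ ρ₂ J J' K K' q ⊓ LinearMap.ker (coboundary q J J' E (M₁ ⊗[E] M₂))

/-- Coboundaries of compactly supported cochains. -/
def coboundaries (ρ₁ : Representation E (GLk k (n + 1)) M₁) (ρ₂ : Representation E (GLk k n) M₂)
    (J : AdGroup k (n + 1)) (J' : AdGroup k n)
    (K : Subgroup (GLf k (n + 1))) (K' : Subgroup (GLf k n)) :
    (q : ℕ) → Submodule E (Cochain q J J' (M₁ ⊗[E] M₂))
  | 0 => ⊥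
  | q + 1 => (compactCochains ρ₁ ρ₂ J J' K K' q).map (coboundary q J J' E (M₁ ⊗[E] M₂))

/-- The cohomology with compact supports `H_c^q(X^ad_{n+1}(K) × X^ad_n(K'); M_{μ × ν}(E))`. -/
abbrev HC (ρ₁ : Representation E (GLk k (n + 1)) M₁) (ρ₂ : Representation E (GLk k n) M₂)
    (J : AdGroup k (n + 1)) (J' : AdGroup k n)
    (K : Subgroup (GLf k (n + 1))) (K' : Subgroup (GLf k n)) (q : ℕ) : Type _ :=
  cocycles ρ₁ ρ₂ J J' K K' q ⧸
    (coboundaries ρ₁ ρ₂ J J' K K' q).submoduleOf (cocycles ρ₁ ρ₂ J J' K K' q)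

/-- The Hecke operator `K g K ⊗ K' g' K'` on cochains: the sum of the translates
`φ(σ, a g_i, a' g'_j)` over the cosets `g_i K` in `K g K` and `g'_j K'` in `K' g' K'`. -/
def hecke {M : Type*} [AddCommGroup M] {q : ℕ} {J : AdGroup k (n + 1)} {J' : AdGroup k n}
    (K : Subgroup (GLf k (n + 1))) (K' : Subgroup (GLf k n)) (g : GLf k (n + 1)) (g' : GLf k n)
    (φ : Cochain q J J' M) : Cochain q J J' M :=
  fun σ a => ∑ᶠ (x : GLf k (n + 1) ⧸ K) (_ : x.out ∈ DoubleCoset.doubleCoset g K K)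
    (y : GLf k n ⧸ K') (_ : y.out ∈ DoubleCoset.doubleCoset g' K' K'),
      φ σ (a.1 * x.out, a.2 * y.out)

/-- `l` is an eigenclass of the Hecke operator `K g K ⊗ K' g' K'` with eigenvalue `κ`. -/
def IsHeckeEigenclass {ρ₁ : Representation E (GLk k (n + 1)) M₁} {ρ₂ : Representation E (GLk k n) M₂}
    {J : AdGroup k (n + 1)} {J' : AdGroup k n} {K : Subgroup (GLf k (n + 1))}
    {K' : Subgroup (GLf k n)} {q : ℕ} (g : GLf k (n + 1)) (g' : GLf k n)
    (l : HC ρ₁ ρ₂ J J' K K' q) (κ : E) : Prop :=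
  ∃ φ : cocycles ρ₁ ρ₂ J J' K K' q, Submodule.Quotient.mk φ = l ∧
    hecke K K' g g' φ.val - κ • φ.val ∈ coboundaries ρ₁ ρ₂ J J' K K' q

end Cohomology

/-! ## Fundamental classes in Borel-Moore homology -/

section Fundamental

variable {k : Type*} [Field k] [NumberField k]

variable (k) in
/-- The archimedean part `G_n(ℝ) / K_n⁰` of the cover of `X_n(L)`. -/
abbrev SymCover (n : ℕ) : Type _ := GLinf k n ⧸ K0 k n

/-- The action of `G_n(ℚ)` on `SymCover`. -/
def symAct {n : ℕ} (γ : GLk k n) : C(SymCover k n, SymCover k n) :=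
  ⟨fun t => toInf γ • t, by fun_prop⟩

variable (k) in
/-- Integral functions on the singular `q`-simplices of `G_n(𝔸) / K_n⁰` with constant finite
adelic part. -/
abbrev Chain (n q : ℕ) : Type _ := Sing q (SymCover k n) → GLf k n → ℤ

/-- Locally finite singular chains on `X_n(L) = G_n(ℚ) \ G_n(𝔸) / K_n⁰ L`, given by their pullback to
the cover `G_n(𝔸) / K_n⁰ L`, on which `G_n(ℚ)` acts freely and properly discontinuously if `L` is
neat. -/
structure IsLocallyFiniteChain {n q : ℕ} (L : Subgroup (GLf k n)) (z : Chain k n q) : Prop where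
  invariant : ∀ (γ : GLk k n) σ a, z ((symAct γ).comp σ) (toFin γ * a) = z σ a
  level : ∀ σ a, ∀ b ∈ L, z σ (a * b) = z σ a
  locallyFinite : ∀ (a : GLf k n) (C : Set (SymCover k n)), IsCompact C →
    {σ | z σ a ≠ 0 ∧ ∃ t, σ t ∈ C}.Finite

/-- The boundary of a locally finite chain. -/
def boundary {n q : ℕ} (z : Chain k n (q + 1)) : Chain k n q := by
  classical
  exact fun τ a => ∑ᶠ σ : Sing (q + 1) (SymCover k n),
    ∑ i : Fin (q + 2), if face i σ = τ then (-1 : ℤ) ^ (i : ℕ) * z σ a else 0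

/-- Locally finite cycles. -/
def IsCycle {n : ℕ} (L : Subgroup (GLf k n)) : {q : ℕ} → Chain k n q → Prop
  | 0, z => IsLocallyFiniteChain L z
  | _ + 1, z => IsLocallyFiniteChain L z ∧ boundary z = 0

/-- Equality of the classes of two locally finite cycles in the Borel-Moore homology of `X_n(L)`. -/
def Homologous {n q : ℕ} (L : Subgroup (GLf k n)) (z z' : Chain k n q) : Prop :=
  ∃ w : Chain k n (q + 1), IsLocallyFiniteChain L w ∧ boundary w = z - z'

/-- A cycle represents a fundamental class of `X_n(L)` if on each component its class generates the
Borel-Moore homology, i.e. if every cycle is homologous to a locally constant multiple of it. -/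
def IsFundamentalCycle {n q : ℕ} (L : Subgroup (GLf k n)) (z : Chain k n q) : Prop :=
  IsCycle L z ∧ ∀ z' : Chain k n q, IsCycle L z' →
    ∃ N : SymCover k n → GLf k n → ℤ,
      (∀ a, IsLocallyConstant fun t => N t a) ∧
      (∀ (γ : GLk k n) t a, N (symAct γ t) (toFin γ * a) = N t a) ∧
      (∀ t a, ∀ b ∈ L, N t (a * b) = N t a) ∧
      Homologous L z' fun σ a => N (σ (stdSimplex.vertex 0)) a * z σ a

variable (k) in
/-- A choice of fundamental classes `F_L = (F_{L,c})_c` of `X_n(L) = ⊔_c X_n(L)[c]` for all neat compact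
open `L`, represented by locally finite cycles, compatible with translations and projections. -/
structure FundamentalClasses (n : ℕ) where
  cyc : Subgroup (GLf k n) → Chain k n (degree k n)
  isFundamental : ∀ L, IsLevel L → IsFundamentalCycle L (cyc L)
  /-- Compatibility with `t_g : X_n(g L g⁻¹) → X_n(L)`. -/
  translate : ∀ L, IsLevel L → ∀ g : GLf k n,
    Homologous L (fun σ a => cyc (conjLevel g L) σ (a * g⁻¹)) (cyc L)
  /-- The pushforward of `F_L` along the projection `X_n(L) → X_n(L')` is `(L' : L) F_{L'}`. -/
  project : ∀ L L', IsLevel L → IsLevel L' → L ≤ L' →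
    Homologous L' (fun σ a => ∑ᶠ b : L' ⧸ L.subgroupOf L', cyc L σ (a * (b.out : GLf k n)))
      (fun σ a => (L.relIndex L' : ℤ) * cyc L' σ a)

end Fundamental

/-! ## The modular symbol -/

section ModularSymbol

variable {k : Type*} [Field k] [NumberField k] {n : ℕ}

theorem continuous_jEmb : Continuous (jEmb : GLinf k n → GLinf k (n + 1)) := by
  refine Continuous.units_map _ ?_
  change Continuous fun A : Matrix (Fin n) (Fin n) (InfiniteAdeleRing k) =>
    (fromBlocks A 0 0 (1 : Matrix (Fin 1) (Fin 1) (InfiniteAdeleRing k))).submatrix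
      finSumFinEquiv.symm finSumFinEquiv.symm
  exact (continuous_id.matrix_fromBlocks continuous_const continuous_const
    continuous_const).matrix_submatrix _ _

/-- The archimedean part `g K_n⁰ ↦ (j(g) J, g J')` of the map `j × ad`. -/
def diagMap (J : AdGroup k (n + 1)) (J' : AdGroup k n) : C(SymCover k n, AdCover J J') where
  toFun t := Quotient.liftOn' t
    (fun g : GLinf k n => ((QuotientGroup.mk (jEmb g), QuotientGroup.mk g) : AdCover J J')) (by
      intro a b hab
      rw [QuotientGroup.leftRel_apply] at hab
      refine Prod.ext (QuotientGroup.eq.2 ?_) (QuotientGroup.eq.2 ?_)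
      · rw [← map_inv, ← map_mul]
        exact J.GK0_le (K0_le_GK0 k _ (K0_le_comap_jEmb k n hab))
      · exact J'.GK0_le (K0_le_GK0 k _ hab))
  continuous_toFun := by
    refine Continuous.quotient_lift ?_ _
    exact (QuotientGroup.continuous_mk.comp continuous_jEmb).prodMk QuotientGroup.continuous_mk

variable (k n) in
/-- The component `G_n(ℝ)⁰ / K_n⁰` of `G_n(ℝ) / K_n⁰`. -/
def posPart : Set (SymCover k n) := QuotientGroup.mk '' (posGL k n : Set (GLinf k n))

variable (k n) in
/-- Singular simplices in `G_n(ℝ)⁰ / K_n⁰`. -/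
abbrev PosSing (q : ℕ) : Type _ := {σ : Sing q (SymCover k n) // ∀ t, σ t ∈ posPart k n}

/-- Two simplices in `G_n(ℝ)⁰ / K_n⁰` are equivalent if they have the same image in
`Γ \ G_n(ℝ)⁰ / K_n⁰`. -/
def orbitSetoid (Γ : Subgroup (GLk k n)) (q : ℕ) : Setoid (PosSing k n q) where
  r σ τ := ∃ γ ∈ Γ, τ.val = (symAct γ).comp σ.val
  iseqv :=
    { refl := fun σ => ⟨1, one_mem _, by ext t; simp [symAct]⟩
      symm := by
        rintro σ τ ⟨γ, hγ, h⟩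
        exact ⟨γ⁻¹, inv_mem hγ, by ext t; simp [h, symAct]⟩
      trans := by
        rintro σ τ ω ⟨γ, hγ, h⟩ ⟨δ, hδ, h'⟩
        exact ⟨δ * γ, mul_mem hδ hγ, by ext t; simp [h, h', symAct, mul_smul]⟩ }

/-- The evaluation of a fundamental cycle of `X_n(L)`, restricted to the component
`Γ_c \ G_n(ℝ)⁰ / K_n⁰` of class `c`, on a function on singular simplices which is invariant under
`Γ_c`: the sum runs over the simplices of this component. -/
def evalOnComponent {E : Type*} [Field E] (F : FundamentalClasses k n) (L : Subgroup (GLf k n))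
    (c : (Af k)ˣ) (f : Sing (degree k n) (SymCover k n) → E) : E :=
  ∑ᶠ o : Quotient (orbitSetoid (arithGroup L c) (degree k n)),
    (F.cyc L o.out.val (dElt c) : E) * f o.out.val

variable {E M₁ M₂ : Type*} [Field E] [AddCommGroup M₁] [Module E M₁] [AddCommGroup M₂] [Module E M₂]
  {ρ₁ : Representation E (GLk k (n + 1)) M₁} {ρ₂ : Representation E (GLk k n) M₂}
  {J : AdGroup k (n + 1)} {J' : AdGroup k n}
  {K : Subgroup (GLf k (n + 1))} {K' : Subgroup (GLf k n)}

/-- `w` is the integral over `X_n(K(h,h'))[c]` of `(j × ad)^* t_{(h,h')}(l)`, as an element of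
`H⁰(Γ_c^{h,h'}; M)`: the isomorphism `∫ : H_c^{top}(X[c]; M) → H⁰(X[c]; M)` is characterized through the
pairing of `H_c^{top}(X[c]; M)` with `H⁰(X[c]; M^∨)` given by the fundamental class. The cochain
`(j × ad)^* t_{(h,h')}(φ)` on the component of class `c` is
`σ ↦ φ((j × ad) ∘ σ, (j(d_(c)) h, d_(c) h'))`. -/
def IsModularSymbolValue (F : FundamentalClasses k n) (l : HC ρ₁ ρ₂ J J' K K' (degree k n))
    (h : GLf k (n + 1)) (h' : GLf k n) (c : (Af k)ˣ) (w : M₁ ⊗[E] M₂) : Prop :=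
  w ∈ invariantsOf (diagRep ρ₁ ρ₂) (arithGroup (diagLevel K K' h h') c : Set (GLk k n)) ∧
  ∀ φ : cocycles ρ₁ ρ₂ J J' K K' (degree k n), Submodule.Quotient.mk φ = l →
  ∀ u ∈ invariantsOf (diagRep ρ₁ ρ₂).dual
      (arithGroup (diagLevel K K' h h') c : Set (GLk k n)),
    u w = evalOnComponent F (diagLevel K K' h h') c fun σ =>
      u (φ.val ((diagMap J J').comp σ) (jEmb (dElt c) * h, dElt c * h'))

/-- The modular symbol `𝒫_{h,h',c}^{K,K'}(l)`. -/
def modularSymbol (F : FundamentalClasses k n) (l : HC ρ₁ ρ₂ J J' K K' (degree k n))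
    (h : GLf k (n + 1)) (h' : GLf k n) (c : (Af k)ˣ) : M₁ ⊗[E] M₂ :=
  Classical.epsilon (IsModularSymbolValue F l h h' c)

end ModularSymbol

/-! ## The situation at `p` -/

section AtP

variable {k : Type*} [Field k] [NumberField k]

/-- The prime `q` of `k` lies above `p`. -/
def Above (p : ℕ) (q : HeightOneSpectrum (𝓞 k)) : Prop := (p : 𝓞 k) ∈ q.asIdeal

/-- The component of `g` at `q` lies in the Iwahori subgroup mod `q^r` of `GL_m(k_q)`: it is in
`GL_m(𝒪_q)` and upper triangular mod `q^r`. -/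
def IsIwahoriAt {m : ℕ} (r : ℕ) (q : HeightOneSpectrum (𝓞 k)) (g : GLf k m) : Prop :=
  (∀ i j, Valued.v ((g.val i j : Af k) q) ≤ 1) ∧
  Valued.v ((g.val.det : Af k) q) = 1 ∧
  ∀ i j, j < i → Valued.v ((g.val i j : Af k) q) ≤ WithZero.exp (-(r : ℤ))

/-- The `p`-component of `L` is the product of the Iwahori subgroups mod `q^r` for `q ∣ p` (and `L`
is the product of its `p`-component and its component away from `p`). -/
def HasIwahoriComponent {m : ℕ} (p r : ℕ) (L : Subgroup (GLf k m)) : Prop :=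
  (∀ g ∈ L, ∀ q, Above p q → IsIwahoriAt r q g) ∧
  ∀ g : GLf k m, (∀ q, Above p q → IsIwahoriAt r q g) →
    (∀ q, ¬ Above p q → ∀ i j,
      (g.val i j : Af k) q = ((1 : Matrix (Fin m) (Fin m) (Af k)) i j : Af k) q) → g ∈ L

/-- `h` has the component
`h^(1) = (w_n, e; 0, 1)` at all `q ∣ p`, where `w_n` is antidiagonal and `e = (1, …, 1)ᵗ`. -/
def HasMagicComponent {n : ℕ} (p : ℕ) (h : GLf k (n + 1)) : Prop :=
  ∀ q, Above p q → ∀ i j : Fin (n + 1), (h.val i j : Af k) q =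
    if j.val = n ∨ i.val + j.val + 1 = n then 1 else 0

/-- `t'_(p) = diag(ϖ^n, ϖ^{n-1}, …, ϖ)`. -/
def tElt' (n : ℕ) (ϖ : (Af k)ˣ) : GLf k n := diagGL fun i => ϖ ^ (n - i.val)

/-- `t_(p) = j(t'_(p)) = diag(ϖ^n, ϖ^{n-1}, …, 1)`. -/
def tElt (n : ℕ) (ϖ : (Af k)ˣ) : GLf k (n + 1) := jEmb (tElt' n ϖ)

variable (k) in
/-- `𝒪_p = 𝒪_k ⊗ ℤ_p`, as a subset of the finite adeles (with components `0` away from `p`). -/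
def Op (p : ℕ) : Set (Af k) :=
  {a | (∀ q, Above p q → Valued.v (a q) ≤ 1) ∧ ∀ q, ¬ Above p q → a q = 0}

/-- `R` is a system of representatives of `𝒪_p` modulo `ϖ`. -/
def IsRepresentatives (p : ℕ) (ϖ : (Af k)ˣ) (R : Finset (Af k)) : Prop :=
  (∀ a ∈ R, a ∈ Op k p) ∧ ∀ b ∈ Op k p, ∃! a, a ∈ R ∧ ∃ c ∈ Op k p, b - a = ϖ.val * c

variable {n : ℕ}

/-- `K(ϖ^v) = K(h t_(p)^v, (t'_(p))^v)`. -/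
def levelAt (K : Subgroup (GLf k (n + 1))) (K' : Subgroup (GLf k n)) (h : GLf k (n + 1))
    (ϖ : (Af k)ˣ) (v : ℕ) : Subgroup (GLf k n) :=
  diagLevel K K' (h * tElt n ϖ ^ v) (tElt' n ϖ ^ v)

/-- `C(K(p^∞)) = lim_v C(K(ϖ^v))`: sequences of classes such that each one maps to the preceding one
under the projection `C(K(ϖ^{v+1})) → C(K(ϖ^v))`. -/
def ClassLimit (K : Subgroup (GLf k (n + 1))) (K' : Subgroup (GLf k n)) (h : GLf k (n + 1))
    (ϖ : (Af k)ˣ) : Type _ :=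
  {s : ∀ v : ℕ, ClassSet (levelAt K K' h ϖ v) // ∀ v, ∃ y,
    ideleClass (levelAt K K' h ϖ (v + 1)) y = s (v + 1) ∧ ideleClass (levelAt K K' h ϖ v) y = s v}

instance (K : Subgroup (GLf k (n + 1))) (K' : Subgroup (GLf k n)) (h : GLf k (n + 1))
    (ϖ : (Af k)ˣ) : TopologicalSpace (ClassLimit K K' h ϖ) :=
  inferInstanceAs (TopologicalSpace {s : ∀ v : ℕ, ClassSet (levelAt K K' h ϖ v) // ∀ v, ∃ y,
    ideleClass (levelAt K K' h ϖ (v + 1)) y = s (v + 1) ∧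
      ideleClass (levelAt K K' h ϖ v) y = s v})

/-- The set of elements of `C(K(p^∞))` that map to a given class in `C(K(ϖ^v))`. -/
def cylinder {K : Subgroup (GLf k (n + 1))} {K' : Subgroup (GLf k n)} {h : GLf k (n + 1)}
    {ϖ : (Af k)ˣ} {v : ℕ} (c : ClassSet (levelAt K K' h ϖ v)) : Set (ClassLimit K K' h ϖ) :=
  {s | s.val v = c}

theorem isClopen_cylinder {K : Subgroup (GLf k (n + 1))} {K' : Subgroup (GLf k n)}
    {h : GLf k (n + 1)} {ϖ : (Af k)ˣ} {v : ℕ} (c : ClassSet (levelAt K K' h ϖ v)) :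
    IsClopen (cylinder c) :=
  (isClopen_discrete ({c} : Set (ClassSet (levelAt K K' h ϖ v)))).preimage
    ((continuous_apply v).comp continuous_subtype_val)

variable {E M₁ M₂ : Type*} [Field E] [AddCommGroup M₁] [Module E M₁] [AddCommGroup M₂] [Module E M₂]
  {ρ₁ : Representation E (GLk k (n + 1)) M₁} {ρ₂ : Representation E (GLk k n) M₂}
  {J : AdGroup k (n + 1)} {J' : AdGroup k n}
  {K : Subgroup (GLf k (n + 1))} {K' : Subgroup (GLf k n)}

/-- `μ̃_l(x + (ϖ^v)) = κ^{-v} 𝒫_{h t_(p)^v, (t'_(p))^v, x}^{K,K'}(l)`. -/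
def muTilde (F : FundamentalClasses k n) (l : HC ρ₁ ρ₂ J J' K K' (degree k n)) (κ : E)
    (h : GLf k (n + 1)) (ϖ : (Af k)ˣ) (v : ℕ) (x : (Af k)ˣ) : M₁ ⊗[E] M₂ :=
  (κ ^ v)⁻¹ • modularSymbol F l (h * tElt n ϖ ^ v) (tElt' n ϖ ^ v) x

/-- `H⁰(Γ_n; M_{μ × ν}(E))`. -/
abbrev hullInvariants (ρ₁ : Representation E (GLk k (n + 1)) M₁)
    (ρ₂ : Representation E (GLk k n) M₂) : Submodule E (M₁ ⊗[E] M₂) :=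
  invariantsOf (diagRep ρ₁ ρ₂) (algebraicHull k n)

end AtP

end RankinSelberg

end

open RankinSelberg

set_option linter.unusedSectionVars false
set_option linter.unusedSimpArgs false

namespace RankinSelberg

section

/-! ## Exponential polynomials and neat elements -/

/-- Sequences annihilated by a product of operators `T - z`, where `T` is the shift and `z ∈ Λ`. -/
inductive IsExpPoly (Λ : Subgroup ℂˣ) : (ℕ → ℂ) → Prop
  | zero : IsExpPoly Λ 0
  | step (f : ℕ → ℂ) (z : ℂˣ) (hz : z ∈ Λ) (h : IsExpPoly Λ fun m => f (m + 1) - z * f m) :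
      IsExpPoly Λ f

namespace IsExpPoly

variable {Λ : Subgroup ℂˣ} {f g : ℕ → ℂ}

theorem shift (h : IsExpPoly Λ f) : IsExpPoly Λ fun m => f (m + 1) := by
  induction h with
  | zero => exact zero
  | step f z hz _ ih => exact step _ z hz ih

theorem const_mul (c : ℂ) (h : IsExpPoly Λ f) : IsExpPoly Λ fun m => c * f m := by
  induction h with
  | zero => simpa using! zero
  | step f z hz _ ih =>
    refine step _ z hz ?_
    convert! ih using 2
    ring

theorem add (hf : IsExpPoly Λ f) (hg : IsExpPoly Λ g) : IsExpPoly Λ fun m => f m + g m := by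
  induction hf generalizing g with
  | zero => simpa using! hg
  | step f z hz _ ih =>
    refine step _ z hz ?_
    convert! ih (g := fun m => g (m + 1) + (-z) * g m) ?_ using 2
    · ring
    · induction hg with
      | zero => simpa using! zero
      | step g y hy _ ihg =>
        refine step _ y hy ?_
        convert! ihg using 2
        ring

theorem sum {ι : Type*} (s : Finset ι) {f : ι → ℕ → ℂ} (h : ∀ i ∈ s, IsExpPoly Λ (f i)) :
    IsExpPoly Λ fun m => ∑ i ∈ s, f i m := by
  classical
  induction s using Finset.induction_on with
  | empty => simpa using! zero
  | insert a s ha ih =>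
    simp only [Finset.sum_insert ha]
    exact (h a (Finset.mem_insert_self _ _)).add
      (ih fun i hi => h i (Finset.mem_insert_of_mem hi))

theorem mul (hf : IsExpPoly Λ f) (hg : IsExpPoly Λ g) : IsExpPoly Λ fun m => f m * g m := by
  induction hf generalizing g with
  | zero => simpa using! zero
  | step f z hz _ ih =>
    induction hg with
    | zero => simpa using! zero
    | step g y hy hg ihg =>
      refine step _ (z * y) (mul_mem hz hy) ?_
      convert! (ih (step g y hy hg).shift).add (ihg.const_mul z) using 2
      push_cast
      ring

theorem const (c : ℂ) : IsExpPoly Λ fun _ => c :=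
  step _ 1 (one_mem _) (by simpa using! zero)

theorem eq_of_periodic (hf : IsExpPoly Λ f) (hΛ : ∀ z ∈ Λ, IsOfFinOrder z → z = 1) {N : ℕ}
    (hN : 0 < N) (hper : ∀ m, f (m + N) = f m) (m : ℕ) : f m = f 0 := by
  induction hf generalizing m with
  | zero => rfl
  | step f z hz _ ih =>
    set c := f 1 - z * f 0 with hc
    have hrec : ∀ m, f (m + 1) = z * f m + c := by
      intro m
      have := ih (fun m => by
        have h1 := hper (m + 1)
        rw [show m + 1 + N = m + N + 1 by ring] at h1
        simp only [hper m, h1]) m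
      simp only [zero_add] at this
      linear_combination this
    by_cases h1 : z = 1
    · have hlin : ∀ m : ℕ, f m = f 0 + m * c := by
        intro m
        induction m with
        | zero => simp
        | succ m ih => rw [hrec, ih, h1]; push_cast; ring
      have h2 := hper 0
      rw [zero_add, hlin N] at h2
      have h3 : (N : ℂ) * c = 0 := by linear_combination h2
      have h4 : c = 0 := (mul_eq_zero.1 h3).resolve_left (by exact_mod_cast hN.ne')
      rw [hlin m, h4, mul_zero, add_zero]
    · have hz1 : (1 : ℂ) - z ≠ 0 := by
        intro h
        apply h1
        ext
        simpa using (sub_eq_zero.1 h).symm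
      set a := c / (1 - z) with ha
      have hca : c = a * (1 - z) := by rw [ha]; field_simp
      have hexp : ∀ m : ℕ, f m = (z : ℂ) ^ m * (f 0 - a) + a := by
        intro m
        induction m with
        | zero => simp
        | succ m ih => rw [hrec, ih, hca]; ring
      have h2 := hper 0
      rw [zero_add, hexp N] at h2
      have h3 : ((z : ℂ) ^ N - 1) * (f 0 - a) = 0 := by linear_combination h2
      rcases mul_eq_zero.1 h3 with h4 | h4
      · exfalso
        apply h1
        refine hΛ z hz (isOfFinOrder_iff_pow_eq_one.2 ⟨N, hN, ?_⟩)
        ext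
        simpa using sub_eq_zero.1 h4
      · rw [hexp m, h4]
        linear_combination -h4

end IsExpPoly

section PowEntries

variable {Λ : Subgroup ℂˣ} {n : ℕ}

theorem isExpPoly_pow_apply (A : Matrix (Fin n) (Fin n) ℂ) (i j : Fin n) (s : List ℂˣ)
    (hs : ∀ z ∈ s, z ∈ Λ) (B : Matrix (Fin n) (Fin n) ℂ)
    (hB : (s.map fun z : ℂˣ => A - (z : ℂ) • (1 : Matrix (Fin n) (Fin n) ℂ)).prod * B = 0) :
    IsExpPoly Λ fun m => (A ^ m * B) i j := by
  induction s using List.reverseRecOn generalizing B with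
  | nil =>
    have : B = 0 := by simpa using hB
    simpa [this] using! IsExpPoly.zero
  | append_singleton s z ih =>
    refine IsExpPoly.step _ z (hs z (by simp)) ?_
    convert! ih (fun y hy => hs y (by simp [hy])) ((A - (z : ℂ) • 1) * B) (by
      simpa [Matrix.mul_assoc] using hB) using 2 with m
    rw [sub_mul, Matrix.mul_sub, Matrix.sub_apply, ← Matrix.mul_assoc, ← pow_succ]
    simp

theorem isExpPoly_inv_pow_apply (A : GL (Fin n) ℂ) (i j : Fin n) (s : List ℂˣ)
    (hs : ∀ z ∈ s, z ∈ Λ) (B : Matrix (Fin n) (Fin n) ℂ)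
    (hB : (s.map fun z : ℂˣ => A.val - (z : ℂ) • (1 : Matrix (Fin n) (Fin n) ℂ)).prod * B = 0) :
    IsExpPoly Λ fun m => ((A⁻¹).val ^ m * B) i j := by
  refine isExpPoly_pow_apply (A⁻¹).val i j (s.map fun z => z⁻¹) (fun z hz => ?_) B ?_
  · obtain ⟨y, hy, rfl⟩ := List.mem_map.1 hz
    exact inv_mem (hs y hy)
  · have key : ∀ s : List ℂˣ, ∃ C : Matrix (Fin n) (Fin n) ℂ,
        ((s.map fun z => z⁻¹).map fun z : ℂˣ => (A⁻¹).val - (z : ℂ) • 1).prod =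
          C * (s.map fun z : ℂˣ => A.val - (z : ℂ) • (1 : Matrix (Fin n) (Fin n) ℂ)).prod ∧
        Commute C A.val := by
      intro s
      induction s with
      | nil => exact ⟨1, by simp, Commute.one_left _⟩
      | cons z s ih =>
        obtain ⟨C, hC, hcomm⟩ := ih
        have hA : Commute (A⁻¹).val A.val := by
          simp [Commute, SemiconjBy]
        refine ⟨(-(z : ℂ)⁻¹) • ((A⁻¹).val * C), ?_, (hA.mul_left hcomm).smul_left _⟩
        have e : (A⁻¹).val - ((z⁻¹ : ℂˣ) : ℂ) • (1 : Matrix (Fin n) (Fin n) ℂ) =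
            (-(z : ℂ)⁻¹) • ((A⁻¹).val * (A.val - (z : ℂ) • 1)) := by
          rw [Matrix.mul_sub, Units.inv_mul]
          ext a b
          simp
          field_simp
          ring
        have hc2 : Commute (A.val - (z : ℂ) • (1 : Matrix (Fin n) (Fin n) ℂ)) C :=
          (hcomm.symm.sub_left ((Commute.one_left C).smul_left _))
        simp only [List.map_cons, List.prod_cons, hC]
        rw [e, Matrix.smul_mul, Matrix.smul_mul]
        congr 1
        rw [Matrix.mul_assoc, Matrix.mul_assoc, ← Matrix.mul_assoc _ C, hc2.eq]
        simp only [Matrix.mul_assoc]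
    obtain ⟨C, hC, -⟩ := key s
    rw [hC, Matrix.mul_assoc, hB, Matrix.mul_zero]

end PowEntries

end

section

theorem eq_of_forall_dual {E M : Type*} [Field E] [CharZero E] [AddCommGroup M] [Module E M] {a b : M}
    (h : ∀ (l : Module.Dual E M) (θ : E →ₗ[ℚ] ℚ), θ (l a) = θ (l b)) : a = b := by
  rw [← sub_eq_zero, ← Module.forall_dual_apply_eq_zero_iff E]
  intro l
  rw [← Module.forall_dual_apply_eq_zero_iff ℚ]
  intro θ
  rw [map_sub, map_sub, h l θ, sub_self]

section Neat

variable {k : Type*} [Field k] [NumberField k] {n : ℕ}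

/-- Every rational linear form on `k` is a complex combination of the complex embeddings. -/
theorem exists_linearForm_eq_sum_embeddings (τ : k →ₗ[ℚ] ℚ) :
    ∃ c : (k →ₐ[ℚ] ℂ) → ℂ, ∀ x, ((τ x : ℚ) : ℂ) = ∑ ι : k →ₐ[ℚ] ℂ, c ι * ι x := by
  classical
  have hli := linearIndependent_toLinearMap ℚ k ℂ
  have hcard : Fintype.card (k →ₐ[ℚ] ℂ) = Module.finrank ℂ (k →ₗ[ℚ] ℂ) := by
    rw [Module.finrank_linearMap_self, AlgHom.card]
  have htop := hli.span_eq_top_of_card_eq_finrank' hcard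
  have hmem : (Algebra.linearMap ℚ ℂ).comp τ ∈
      Submodule.span ℂ (Set.range (AlgHom.toLinearMap : (k →ₐ[ℚ] ℂ) → k →ₗ[ℚ] ℂ)) := by
    rw [htop]; trivial
  obtain ⟨c, hc⟩ := (Submodule.mem_span_range_iff_exists_fun ℂ).1 hmem
  refine ⟨c, fun x => ?_⟩
  have := LinearMap.congr_fun hc x
  simpa [LinearMap.sum_apply] using this.symm

theorem isExpPoly_regularFunction {f : GLk k n → ℚ} (hf : f ∈ regularFunctions k ℚ n)
    (γ : GLk k n) : IsExpPoly (Subgroup.closure {z : ℂˣ | ∃ ι : k →+* ℂ,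
      ((γ.val.map ι).charpoly).IsRoot (z : ℂ)}) fun m => ((f (γ ^ m) : ℚ) : ℂ) := by
  set Λ := Subgroup.closure {z : ℂˣ | ∃ ι : k →+* ℂ,
      ((γ.val.map ι).charpoly).IsRoot (z : ℂ)} with hΛ
  have hroots : ∀ ι : k →+* ℂ, ∃ s : List ℂˣ, (∀ z ∈ s, z ∈ Λ) ∧
      (s.map fun z : ℂˣ => γ.val.map ι - (z : ℂ) • (1 : Matrix (Fin n) (Fin n) ℂ)).prod = 0 := by
    intro ι
    set P := (γ.val.map ι).charpoly with hP
    have hdet : IsUnit (γ.val.map ι) := by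
      have := (GeneralLinearGroup.map ι γ).isUnit
      exact this
    have hne : ∀ z ∈ P.roots.toList, z ≠ 0 := by
      intro z hz h0
      rw [Multiset.mem_toList, Polynomial.mem_roots (charpoly_monic _).ne_zero, h0,
        Polynomial.IsRoot.def, ← Polynomial.coeff_zero_eq_eval_zero] at hz
      rw [Matrix.isUnit_iff_isUnit_det, Matrix.det_eq_sign_charpoly_coeff, ← hP, hz] at hdet
      simp at hdet
    refine ⟨P.roots.toList.attach.map fun z => Units.mk0 z.1 (hne z.1 z.2), ?_, ?_⟩
    · intro z hz
      obtain ⟨y, -, rfl⟩ := List.mem_map.1 hz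
      refine Subgroup.subset_closure ⟨ι, ?_⟩
      have := y.2
      rw [Multiset.mem_toList, Polynomial.mem_roots (charpoly_monic _).ne_zero] at this
      exact this
    · have h1 := Matrix.aeval_self_charpoly (γ.val.map ι)
      have hs : P = (P.roots.map fun a => Polynomial.X - Polynomial.C a).prod :=
        (IsAlgClosed.splits P).eq_prod_roots_of_monic (charpoly_monic _)
      rw [← hP, hs, ← Multiset.coe_toList P.roots, Multiset.map_coe, Multiset.prod_coe,
        map_list_prod, List.map_map] at h1
      rw [List.map_map, ← h1]
      congr 1
      conv_rhs => rw [← List.attach_map_subtype_val P.roots.toList]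
      rw [List.map_map]
      refine List.map_congr_left fun z _ => ?_
      simp [Algebra.algebraMap_eq_smul_one]
  refine Algebra.adjoin_induction (p := fun (f : GLk k n → ℚ) _ =>
    IsExpPoly Λ fun m => ((f (γ ^ m) : ℚ) : ℂ)) ?_ ?_ ?_ ?_ hf
  · rintro f (⟨τ, i, j, rfl⟩ | ⟨τ, i, j, rfl⟩)
    · obtain ⟨c, hc⟩ := exists_linearForm_eq_sum_embeddings τ
      simp only [Rat.cast_id, hc]
      refine IsExpPoly.sum _ fun ι _ => IsExpPoly.const_mul _ ?_
      obtain ⟨s, hs, hs'⟩ := hroots (ι : k →+* ℂ)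
      convert! isExpPoly_pow_apply (γ.val.map (ι : k →+* ℂ)) i j s hs 1 (by rw [hs']; simp) using 2
        with m
      rw [Matrix.mul_one, Units.val_pow_eq_pow_val, ← Matrix.map_pow]
      rfl
    · obtain ⟨c, hc⟩ := exists_linearForm_eq_sum_embeddings τ
      simp only [Rat.cast_id, hc]
      refine IsExpPoly.sum _ fun ι _ => IsExpPoly.const_mul _ ?_
      obtain ⟨s, hs, hs'⟩ := hroots (ι : k →+* ℂ)
      convert! isExpPoly_inv_pow_apply (GeneralLinearGroup.map (ι : k →+* ℂ) γ) i j s hs 1 (by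
        change (List.map (fun z : ℂˣ => γ.val.map (ι : k →+* ℂ) - (z : ℂ) • 1) s).prod * 1 = 0
        rw [hs']; simp) using 2 with m
      rw [Matrix.mul_one, ← Units.val_pow_eq_pow_val, inv_pow, ← map_pow, ← map_inv]
      rfl
  · intro r
    simpa using! IsExpPoly.const (r : ℂ)
  · intro f g _ _ hf hg
    simpa using! hf.add hg
  · intro f g _ _ hf hg
    simpa using! hf.mul hg

variable {E V : Type*} [Field E] [CharZero E] [AddCommGroup V] [Module E V]

theorem regularFunctions_rat_of_linearForm {f : GLk k n → E} (hf : f ∈ regularFunctions k E n)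
    (θ : E →ₗ[ℚ] ℚ) : (fun g => θ (f g)) ∈ regularFunctions k ℚ n := by
  have hmon : ∀ f ∈ Submonoid.closure
      ({f : GLk k n → E | ∃ (τ : k →ₗ[ℚ] ℚ) (i j : Fin n), f = fun g => ((τ (g.val i j) : ℚ) : E)} ∪
      {f | ∃ (τ : k →ₗ[ℚ] ℚ) (i j : Fin n), f = fun g => ((τ ((g⁻¹).val i j) : ℚ) : E)}),
      ∃ f₀ ∈ regularFunctions k ℚ n, f = fun g => ((f₀ g : ℚ) : E) := by
    intro f hf
    refine Submonoid.closure_induction (motive := fun f _ => ∃ f₀ ∈ regularFunctions k ℚ n,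
      f = fun g => ((f₀ g : ℚ) : E)) ?_ ?_ ?_ hf
    · rintro f (⟨τ, i, j, rfl⟩ | ⟨τ, i, j, rfl⟩)
      · exact ⟨_, Algebra.subset_adjoin (Or.inl ⟨τ, i, j, rfl⟩), by simp⟩
      · exact ⟨_, Algebra.subset_adjoin (Or.inr ⟨τ, i, j, rfl⟩), by simp⟩
    · exact ⟨1, one_mem _, by ext; simp⟩
    · rintro _ _ _ _ ⟨f, hf, rfl⟩ ⟨g, hg, rfl⟩
      exact ⟨f * g, mul_mem hf hg, by ext; simp⟩
  rw [regularFunctions, ← Subalgebra.mem_toSubmodule, Algebra.adjoin_eq_span] at hf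
  refine Submodule.span_induction (p := fun f _ => ∀ θ : E →ₗ[ℚ] ℚ,
    (fun g => θ (f g)) ∈ regularFunctions k ℚ n) ?_ ?_ ?_ ?_ hf θ
  · intro f hf θ
    obtain ⟨f₀, hf₀, rfl⟩ := hmon f hf
    have : (fun g => θ ((f₀ g : ℚ) : E)) = (θ 1) • f₀ := by
      ext g
      have h1 : ((f₀ g : ℚ) : E) = (f₀ g) • (1 : E) := by
        rw [Algebra.smul_def, mul_one]; simp
      rw [h1, map_smul, Pi.smul_apply, smul_eq_mul, smul_eq_mul, mul_comm]
    rw [this]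
    exact Subalgebra.smul_mem _ hf₀ _
  · intro θ
    simp only [Pi.zero_apply, map_zero]
    exact zero_mem (regularFunctions k ℚ n)
  · intro f g _ _ hf hg θ
    simpa using! add_mem (hf θ) (hg θ)
  · intro c f _ hf θ
    exact hf (θ.comp (LinearMap.mulLeft ℚ c))

/-- A vector which is fixed by a power of a neat element is fixed by the element itself. -/
theorem IsAlgebraicRep.apply_eq_of_pow {ρ : Representation E (GLk k n) V} (hρ : IsAlgebraicRep ρ)
    {γ : GLk k n} (hγ : IsNeatElement γ) {N : ℕ} (hN : 0 < N) {w : V} (hw : ρ (γ ^ N) w = w) :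
    ρ γ w = w := by
  refine eq_of_forall_dual (E := E) fun l θ => ?_
  have h1 := isExpPoly_regularFunction (regularFunctions_rat_of_linearForm (hρ w l) θ) γ
  have h2 := h1.eq_of_periodic hγ hN (fun m => by
    rw [pow_add, map_mul, Module.End.mul_apply, hw]) 1
  simpa using h2

theorem isNeatElement_of_sub_one_sq {γ : GLk k n} (h : (γ.val - 1) * (γ.val - 1) = 0) :
    IsNeatElement γ := by
  intro z hz _
  suffices {z : ℂˣ | ∃ ι : k →+* ℂ, ((γ.val.map ι).charpoly).IsRoot (z : ℂ)} ⊆ {1} by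
    have h2 := Subgroup.closure_mono this hz
    rw [Subgroup.mem_closure_singleton] at h2
    obtain ⟨_, h2⟩ := h2
    simpa using h2.symm
  rintro z ⟨ι, hι⟩
  have h1 : (γ.val.map ι - 1) * (γ.val.map ι - 1) = 0 := by
    have := congrArg (fun A : Matrix (Fin n) (Fin n) k => A.map ι) h
    simpa [Matrix.map_mul, Matrix.map_sub] using this
  have hev : Module.End.HasEigenvalue (Matrix.toLin' (γ.val.map ι)) (z : ℂ) := by
    rw [Module.End.hasEigenvalue_iff_isRoot_charpoly]
    simpa using hι
  obtain ⟨v, hv⟩ := hev.exists_hasEigenvector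
  have h3 : (γ.val.map ι) *ᵥ v = (z : ℂ) • v := by simpa using hv.apply_eq_smul
  have h4 : (γ.val.map ι - 1) *ᵥ v = ((z : ℂ) - 1) • v := by
    rw [Matrix.sub_mulVec, h3, Matrix.one_mulVec, sub_smul, one_smul]
  have h5 : ((γ.val.map ι - 1) * (γ.val.map ι - 1)) *ᵥ v =
      (((z : ℂ) - 1) * ((z : ℂ) - 1)) • v := by
    rw [← Matrix.mulVec_mulVec, h4, Matrix.mulVec_smul, h4, smul_smul]
  rw [h1, Matrix.zero_mulVec] at h5
  have h6 := (smul_eq_zero.1 h5.symm).resolve_right hv.2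
  have h7 : (z : ℂ) - 1 = 0 := by simpa using h6
  rw [Set.mem_singleton_iff]
  ext
  simpa using sub_eq_zero.1 h7

/-- Invariants of a torsion free arithmetic group are invariants of the algebraic hull. -/
theorem IsAlgebraicRep.mem_invariantsOf_zariskiClosure {ρ : Representation E (GLk k n) V}
    (hρ : IsAlgebraicRep ρ) {S : Set (GLk k n)} {w : V} (hw : w ∈ invariantsOf ρ S) :
    w ∈ invariantsOf ρ (zariskiClosure S) := by
  intro g hg
  refine eq_of_forall_dual (E := E) fun l θ => ?_
  have h1 := regularFunctions_rat_of_linearForm (hρ w l) θ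
  have h2 := hg (fun g => θ (l (ρ g w)) - θ (l w))
    (sub_mem h1 (Subalgebra.algebraMap_mem (regularFunctions k ℚ n) (θ (l w))))
    (fun s hs => by rw [hw s hs, sub_self])
  exact sub_eq_zero.1 h2

end Neat

end

section

/-! ## Complete reducibility -/

/-- The `D`-th tensor power of a matrix representation. -/
def matrixTensorPow {G ι E : Type*} [Monoid G] [Fintype ι] [DecidableEq ι] [CommRing E]
    (π : G →* Matrix ι ι E) (D : ℕ) : G →* Matrix (Fin D → ι) (Fin D → ι) E where
  toFun g := Matrix.of fun a b => ∏ i, π g (a i) (b i)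
  map_one' := by
    ext a b
    rw [map_one, Matrix.of_apply]
    by_cases h : a = b
    · subst h; simp
    · obtain ⟨i, hi⟩ := Function.ne_iff.1 h
      rw [Matrix.one_apply_ne h]
      exact Finset.prod_eq_zero (Finset.mem_univ i) (Matrix.one_apply_ne hi)
  map_mul' g g' := by
    ext a b
    simp only [Matrix.of_apply, map_mul, Matrix.mul_apply]
    rw [Finset.prod_univ_sum, Fintype.piFinset_univ]
    simp [Finset.prod_mul_distrib]

theorem trace_matrixTensorPow {G ι E : Type*} [Monoid G] [Fintype ι] [DecidableEq ι] [CommRing E]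
    (π : G →* Matrix ι ι E) (D : ℕ) (g : G) :
    (matrixTensorPow π D g).trace = (π g).trace ^ D := by
  simp only [Matrix.trace, Matrix.diag_apply, matrixTensorPow, MonoidHom.coe_mk, OneHom.coe_mk,
    Matrix.of_apply]
  rw [Finset.sum_pow', Fintype.piFinset_univ]

section Semisimple

variable {E V G κ : Type*} [Field E] [AddCommGroup V] [Module E V] [FiniteDimensional E V] [Group G]
  [Fintype κ] [DecidableEq κ]

/-- If the character of a representation `π` separates the elements of the group algebra from the
annihilator of `π` and `ρ`, then `ρ` is completely reducible. -/
theorem exists_isCompl_of_trace (ρ : Representation E G V) (π : G →* Matrix κ κ E)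
    (H : ∀ x : G →₀ E,
      (∀ h, x.sum (fun g c => c * (π (g * h)).trace) = 0) →
        x.sum (fun g c => c • π g) = 0 ∧ x.sum (fun g c => c • ρ g) = 0)
    (S : Submodule E V) (hS : ∀ g, ∀ v ∈ S, ρ g v ∈ S) :
    ∃ T : Submodule E V, (∀ g, ∀ v ∈ T, ρ g v ∈ T) ∧ IsCompl S T := by
  classical
  let π' : Representation E G (κ → E) :=
    (Matrix.toLinAlgEquiv' : Matrix κ κ E ≃ₐ[E] _).toMonoidHom.comp π
  have hπ' : ∀ g w, π' g w = π g *ᵥ w := fun g w => Matrix.toLinAlgEquiv'_apply _ _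
  let σ : Representation E G (V × (κ → E)) := ρ.prod π'
  let B : Subalgebra E (Module.End E (V × (κ → E))) := σ.asAlgebraHom.range
  have : IsArtinianRing B := IsArtinianRing.of_finite E B
  have hσ : ∀ x : MonoidAlgebra E G, σ.asAlgebraHom x =
      LinearMap.prodMap (x.coeff.sum fun g c => c • ρ g)
        (Matrix.toLin' (x.coeff.sum fun g c => c • π g)) := by
    intro x
    rw [Representation.asAlgebraHom_def, MonoidAlgebra.lift_apply]
    refine LinearMap.ext fun w => Prod.ext ?_ ?_
    · simp [Finsupp.sum, LinearMap.sum_apply, σ, Prod.fst_sum]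
    · simp [Finsupp.sum, LinearMap.sum_apply, σ, Prod.snd_sum, hπ']
  have hss : IsSemisimpleRing B := by
    rw [IsArtinianRing.isSemisimpleRing_iff_jacobson, eq_bot_iff]
    intro b hb
    obtain ⟨x, hx⟩ := b.2
    have hmain : ∀ h, x.coeff.sum (fun g c => c * (π (g * h)).trace) = 0 := by
      intro h
      let bh : B := ⟨σ h, ⟨MonoidAlgebra.of E G h, by simp⟩⟩
      have h1 : b * bh ∈ Ring.jacobson B := Ideal.mul_mem_right bh _ hb
      have hnil : IsNilpotent (Ring.jacobson B) := IsSemiprimaryRing.isNilpotent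
      obtain ⟨N, hN⟩ := hnil
      have h2 : (b * bh) ^ N = 0 := by
        have := Ideal.pow_mem_pow h1 N
        rw [hN] at this
        exact (Submodule.mem_bot B).1 this
      have h3 : (b.val * σ h) ^ N = 0 := by
        have := congrArg Subtype.val h2
        simpa using this
      have e : b.val * σ h = LinearMap.prodMap (x.coeff.sum (fun g c => c • ρ (g * h)))
          (Matrix.toLin' (x.coeff.sum fun g c => c • π (g * h))) := by
        have hx' : b.val = σ.asAlgebraHom x := hx.symm
        rw [hx', hσ]
        refine LinearMap.ext fun w => Prod.ext ?_ ?_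
        · simp [Finsupp.sum, LinearMap.sum_apply, σ]
        · simp [Finsupp.sum, LinearMap.sum_apply, σ, hπ']
      have h4 : (x.coeff.sum fun g c => c • π (g * h)) ^ N = 0 := by
        have h5 : ∀ m : ℕ, ∀ w, ((b.val * σ h) ^ m) (0, w) =
            (0, ((x.coeff.sum fun g c => c • π (g * h)) ^ m) *ᵥ w) := by
          intro m
          induction m with
          | zero => intro w; simp
          | succ m ih =>
            intro w
            rw [pow_succ, Module.End.mul_apply, e, LinearMap.prodMap_apply, map_zero, ← e,
              Matrix.toLin'_apply, ih, Matrix.mulVec_mulVec, ← pow_succ]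
        refine Matrix.toLin'.injective (LinearMap.ext fun w => ?_)
        have := h5 N w
        rw [h3] at this
        rw [Matrix.toLin'_apply, Matrix.toLin'_apply, Matrix.zero_mulVec]
        exact (congrArg Prod.snd this).symm
      have h6 : (x.coeff.sum fun g c => c • π (g * h)).trace = 0 :=
        (Matrix.isNilpotent_trace_of_isNilpotent ⟨N, h4⟩).eq_zero
      rw [← h6]
      simp [Finsupp.sum, Matrix.trace_sum]
    obtain ⟨h1, h2⟩ := H x.coeff hmain
    have h3 := hσ x
    rw [h1, h2] at h3
    have h4 : b.val = 0 := by
      rw [← hx]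
      refine h3.trans ?_
      refine LinearMap.ext fun w => ?_
      simp
    rw [Submodule.mem_bot]
    exact Subtype.ext h4
  have hB : ∀ b : B, ∀ v : V, b.val (v, 0) = ((b.val (v, 0)).1, 0) := by
    rintro ⟨b, x, rfl⟩ v
    have := hσ x
    change σ.asAlgebraHom x (v, 0) = ((σ.asAlgebraHom x (v, 0)).1, 0)
    rw [this]
    simp
  let S' : Submodule B (V × (κ → E)) :=
    { carrier := {w | w.1 ∈ S ∧ w.2 = 0}
      add_mem' := by
        rintro a b ⟨h1, h2⟩ ⟨h3, h4⟩
        exact ⟨S.add_mem h1 h3, by simp [h2, h4]⟩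
      zero_mem' := ⟨S.zero_mem, rfl⟩
      smul_mem' := by
        rintro b ⟨v, w⟩ ⟨h1, h2⟩
        obtain rfl : w = 0 := h2
        refine ⟨?_, by
          change (b.val (v, 0)).2 = 0
          rw [hB]⟩
        change (b.val (v, 0)).1 ∈ S
        obtain ⟨b, x, rfl⟩ := b
        change (σ.asAlgebraHom x (v, 0)).1 ∈ S
        rw [hσ x]
        simp only [LinearMap.prodMap_apply, Finsupp.sum, LinearMap.sum_apply]
        exact S.sum_mem fun g _ => S.smul_mem _ (hS g v h1) }
  obtain ⟨T', hT'⟩ := (inferInstance : IsSemisimpleModule B (V × (κ → E))).exists_isCompl S'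
  let bg : G → B := fun g => ⟨σ g, ⟨MonoidAlgebra.of E G g, by simp⟩⟩
  refine ⟨{ carrier := {v | (v, 0) ∈ T'}
            add_mem' := by
              intro a b ha hb
              have := T'.add_mem ha hb
              simpa using this
            zero_mem' := T'.zero_mem
            smul_mem' := by
              intro c a ha
              have := T'.smul_mem (algebraMap E B c) ha
              have e : (algebraMap E B c) • ((a, 0) : V × (κ → E)) = (c • a, 0) := by
                change (algebraMap E (Module.End E (V × (κ → E))) c) (a, 0) = _
                simp [Module.algebraMap_end_apply]
              rw [e] at this
              exact this }, ?_, ?_⟩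
  · intro g v hv
    have := T'.smul_mem (bg g) hv
    have e : (bg g) • ((v, 0) : V × (κ → E)) = (ρ g v, 0) := by
      change σ g (v, 0) = _
      simp [σ]
    rw [e] at this
    exact this
  · constructor
    · rw [Submodule.disjoint_def]
      intro v h1 h2
      have := (Submodule.disjoint_def.1 hT'.disjoint) (v, 0) ⟨h1, rfl⟩ h2
      exact congrArg Prod.fst this
    · rw [codisjoint_iff, eq_top_iff]
      intro v _
      have h1 : ((v, 0) : V × (κ → E)) ∈ S' ⊔ T' := by
        rw [codisjoint_iff.1 hT'.codisjoint]; trivial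
      obtain ⟨⟨s, z⟩, ⟨h2, h2'⟩, t, h3, h4⟩ := Submodule.mem_sup.1 h1
      obtain rfl : z = 0 := h2'
      refine Submodule.mem_sup.2 ⟨s, h2, v - s, ?_, by simp⟩
      have : t = (v - s, 0) := by
        rw [eq_sub_of_add_eq' h4]; simp
      rw [this] at h3
      exact h3

end Semisimple

end

section

section Polarization

variable {E X ι : Type*} [Field E] [CharZero E] [AddCommGroup X] [Module ℚ X]

theorem sum_prod_eq_zero_of_sum_pow (s : Finset ι) (c : ι → E) (p : ι → X) (D : ℕ)
    (H : ∀ l : X →ₗ[ℚ] ℚ, ∑ i ∈ s, c i * (1 + ((l (p i) : ℚ) : E)) ^ D = 0)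
    (L : List (X →ₗ[ℚ] ℚ)) (hL : L.length ≤ D) (l : X →ₗ[ℚ] ℚ) :
    ∑ i ∈ s, c i * (L.map fun l' => ((l' (p i) : ℚ) : E)).prod *
      (1 + ((l (p i) : ℚ) : E)) ^ (D - L.length) = 0 := by
  induction L generalizing l with
  | nil => simpa using H l
  | cons l' L ih =>
    have hlen : L.length + 1 ≤ D := by simpa using hL
    obtain ⟨r, hr⟩ : ∃ r, D - L.length = r + 1 := ⟨D - L.length - 1, by omega⟩
    have hr' : D - (l' :: L).length = r := by simp; omega
    let a : ι → E := fun i => c i * (L.map fun l' => ((l' (p i) : ℚ) : E)).prod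
    let P : Polynomial E := ∑ i ∈ s, Polynomial.C (a i) *
      (Polynomial.C (1 + ((l (p i) : ℚ) : E)) +
        Polynomial.C ((l' (p i) : ℚ) : E) * Polynomial.X) ^ (r + 1)
    have hP : P = 0 := by
      refine Polynomial.eq_zero_of_infinite_isRoot P
        (Set.infinite_of_injective_forall_mem (f := fun t : ℕ => (t : E)) Nat.cast_injective ?_)
      intro t
      have := ih (by omega) (l + t • l')
      rw [hr] at this
      simp only [Set.mem_ofPred_eq, Polynomial.IsRoot.def, P, Polynomial.eval_finsetSum]
      rw [← this]
      refine Finset.sum_congr rfl fun i _ => ?_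
      simp only [a, Polynomial.eval_mul, Polynomial.eval_pow, Polynomial.eval_add,
        Polynomial.eval_C, Polynomial.eval_X, LinearMap.add_apply, LinearMap.smul_apply, nsmul_eq_mul]
      push_cast
      ring
    have h2 := congrArg (fun Q : Polynomial E => Q.derivative.eval 0) hP
    simp only [P, Polynomial.derivative_sum, Polynomial.eval_finsetSum, Polynomial.derivative_zero,
      Polynomial.eval_zero] at h2
    have h3 : ((r : E) + 1) * ∑ i ∈ s, c i * ((l' :: L).map fun l' => ((l' (p i) : ℚ) : E)).prod *
      (1 + ((l (p i) : ℚ) : E)) ^ (D - (l' :: L).length) = 0 := by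
      rw [← h2, Finset.mul_sum, hr']
      refine Finset.sum_congr rfl fun i _ => ?_
      simp [a, Polynomial.derivative_pow]
      ring
    exact (mul_eq_zero.1 h3).resolve_left (by exact_mod_cast Nat.succ_ne_zero r)

end Polarization

section RatMat

variable (k : Type*) [Field k] [NumberField k] (n : ℕ)

/-- A matrix over `k` as a matrix over `ℚ`. -/
noncomputable def ratMat : Matrix (Fin n) (Fin n) k →+*
    Matrix (Fin n × Fin (Module.finrank ℚ k)) (Fin n × Fin (Module.finrank ℚ k)) ℚ :=
  (Matrix.compRingEquiv (Fin n) (Fin (Module.finrank ℚ k)) ℚ).toRingHom.comp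
    (Algebra.leftMulMatrix (Module.finBasis ℚ k)).toRingHom.mapMatrix

variable {k n}

theorem ratMat_apply (A : Matrix (Fin n) (Fin n) k) (i j) :
    ratMat k n A i j =
      Algebra.leftMulMatrix (Module.finBasis ℚ k) (A i.1 j.1) i.2 j.2 := rfl

theorem trace_ratMat (A : Matrix (Fin n) (Fin n) k) :
    (ratMat k n A).trace = Algebra.trace ℚ k A.trace := by
  simp only [Matrix.trace, Matrix.diag_apply, ratMat_apply, Fintype.sum_prod_type]
  rw [map_sum]
  simp only [Algebra.trace_eq_matrix_trace (Module.finBasis ℚ k), Matrix.trace, Matrix.diag_apply]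

theorem exists_linearForm_eq_trace (l : Matrix (Fin n) (Fin n) k →ₗ[ℚ] ℚ) :
    ∃ h : Matrix (Fin n) (Fin n) k, ∀ A, l A = (ratMat k n (A * h)).trace := by
  let Θ : Matrix (Fin n) (Fin n) k →ₗ[ℚ] Module.Dual ℚ (Matrix (Fin n) (Fin n) k) :=
    LinearMap.mk₂ ℚ (fun h A => (ratMat k n (A * h)).trace)
      (fun h h' A => by rw [Matrix.mul_add, map_add, Matrix.trace_add])
      (fun c h A => by rw [Matrix.mul_smul, trace_ratMat, trace_ratMat]; simp)
      (fun h A A' => by rw [Matrix.add_mul, map_add, Matrix.trace_add])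
      (fun c h A => by rw [Matrix.smul_mul, trace_ratMat, trace_ratMat]; simp)
  have hinj : Function.Injective Θ := by
    rw [← LinearMap.ker_eq_bot, LinearMap.ker_eq_bot']
    intro h hh
    by_contra h0
    obtain ⟨i, j, hij⟩ : ∃ i j, h i j ≠ 0 := by
      by_contra hc
      push Not at hc
      exact h0 (Matrix.ext hc)
    have h1 := LinearMap.congr_fun hh (Matrix.single j i (h i j)⁻¹)
    have h2 : Θ h (Matrix.single j i (h i j)⁻¹) =
        (ratMat k n (Matrix.single j i (h i j)⁻¹ * h)).trace := rfl
    rw [h2, trace_ratMat] at h1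
    have h3 : (Matrix.single j i (h i j)⁻¹ * h).trace = 1 := by
      rw [Matrix.trace_single_mul]
      simp [hij]
    rw [h3] at h1
    have h4 := Algebra.trace_algebraMap (R := ℚ) (S := k) 1
    rw [map_one, h1] at h4
    simp at h4
    exact (Module.finrank_pos (R := ℚ) (M := k)).ne' (by exact_mod_cast h4.symm)
  have hsurj := (LinearMap.injective_iff_surjective_of_finrank_eq_finrank
    (Subspace.dual_finrank_eq).symm).1 hinj
  obtain ⟨h, hh⟩ := hsurj l
  exact ⟨h, fun A => (LinearMap.congr_fun hh A).symm⟩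

variable {E : Type*} [Field E] [CharZero E]

theorem sum_trace_pow_eq_zero_of_forall_GL {ι : Type*} (s : Finset ι) (c : ι → E)
    (p : ι → GLk k n) (D : ℕ)
    (H : ∀ h : GLk k n,
      ∑ i ∈ s, c i * (1 + (((ratMat k n ((p i).val * h.val)).trace : ℚ) : E)) ^ D = 0)
    (h : Matrix (Fin n) (Fin n) k) :
    ∑ i ∈ s, c i * (1 + (((ratMat k n ((p i).val * h)).trace : ℚ) : E)) ^ D = 0 := by
  classical
  let P : Polynomial E := ∑ i ∈ s, Polynomial.C (c i) *
    (Polynomial.C (1 + (((ratMat k n ((p i).val * h)).trace : ℚ) : E)) +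
      Polynomial.C (((ratMat k n (p i).val).trace : ℚ) : E) * Polynomial.X) ^ D
  have hroots : {t : ℕ | ((-h).charpoly).eval (t : k) = 0}.Finite := by
    have h1 : ((-h).charpoly.roots.toFinset : Set k).Finite := Finset.finite_toSet _
    refine (h1.preimage (f := fun t : ℕ => (t : k)) Nat.cast_injective.injOn).subset ?_
    intro t ht
    simpa [Polynomial.mem_roots (charpoly_monic _).ne_zero] using ht
  have hinf : {t : ℕ | ((-h).charpoly).eval (t : k) = 0}ᶜ.Infinite := hroots.infinite_compl
  have hP : P = 0 := by
    refine Polynomial.eq_zero_of_infinite_isRoot P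
      ((hinf.image (f := fun t : ℕ => (t : E)) Nat.cast_injective.injOn).mono ?_)
    rintro _ ⟨t, ht, rfl⟩
    have hdet : (h + (t : k) • (1 : Matrix (Fin n) (Fin n) k)).det ≠ 0 := by
      have e : ((-h).charpoly).eval (t : k) = (h + (t : k) • (1 : Matrix (Fin n) (Fin n) k)).det := by
        rw [Matrix.eval_charpoly, sub_neg_eq_add, add_comm]
        congr 2
        rw [Matrix.scalar_apply, Matrix.smul_one_eq_diagonal]
      rw [← e]
      exact ht
    have := H (GeneralLinearGroup.mkOfDetNeZero _ hdet)
    simp only [Set.mem_ofPred_eq, Polynomial.IsRoot.def, P, Polynomial.eval_finsetSum]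
    rw [← this]
    refine Finset.sum_congr rfl fun i _ => ?_
    have e : ((ratMat k n ((p i).val * (GeneralLinearGroup.mkOfDetNeZero _ hdet).val)).trace : ℚ) =
        (ratMat k n ((p i).val * h)).trace + t * (ratMat k n (p i).val).trace := by
      rw [trace_ratMat, trace_ratMat, trace_ratMat]
      change Algebra.trace ℚ k ((p i).val * (h + (t : k) • 1)).trace = _
      rw [Matrix.mul_add, Matrix.mul_smul, Matrix.mul_one, Matrix.trace_add, Matrix.trace_smul,
        map_add]
      congr 1
      have : (t : k) • (p i).val.trace = (t : ℚ) • (p i).val.trace := by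
        rw [Algebra.smul_def (A := k) (t : ℚ)]; simp
      rw [this, map_smul, smul_eq_mul]
    rw [e]
    simp only [Polynomial.eval_mul, Polynomial.eval_pow, Polynomial.eval_add,
        Polynomial.eval_C, Polynomial.eval_X]
    push_cast
    ring
  have := congrArg (Polynomial.eval 0) hP
  simpa [P, Polynomial.eval_finsetSum] using this

end RatMat

end

section

section PolyFunctions

variable (k : Type*) [Field k] [NumberField k] (E : Type*) [Field E] [CharZero E] (n : ℕ)

/-- Polynomial functions on `GL_n(k)` in the rational coordinates. -/
def polyFunctions : Subalgebra E (GLk k n → E) :=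
  Algebra.adjoin E {f | ∃ l : Matrix (Fin n) (Fin n) k →ₗ[ℚ] ℚ, f = fun g => ((l g.val : ℚ) : E)}

/-- Polynomial functions of degree at most `D`. -/
def polyFunctionsDegreeLE (D : ℕ) : Submodule E (GLk k n → E) :=
  Submodule.span E {f | ∃ L : List (Matrix (Fin n) (Fin n) k →ₗ[ℚ] ℚ), L.length ≤ D ∧
    f = fun g => (L.map fun l => ((l g.val : ℚ) : E)).prod}

variable {k E n}

theorem polyFunctionsDegreeLE_mono {D D' : ℕ} (h : D ≤ D') :
    polyFunctionsDegreeLE k E n D ≤ polyFunctionsDegreeLE k E n D' :=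
  Submodule.span_mono fun _ ⟨L, hL, hf⟩ => ⟨L, hL.trans h, hf⟩

theorem exists_mem_polyFunctionsDegreeLE {f : GLk k n → E} (hf : f ∈ polyFunctions k E n) :
    ∃ D, f ∈ polyFunctionsDegreeLE k E n D := by
  rw [polyFunctions, ← Subalgebra.mem_toSubmodule, Algebra.adjoin_eq_span] at hf
  refine Submodule.span_induction (p := fun f _ => ∃ D, f ∈ polyFunctionsDegreeLE k E n D)
    ?_ ?_ ?_ ?_ hf
  · intro f hf
    obtain ⟨L, hL⟩ : ∃ L : List (Matrix (Fin n) (Fin n) k →ₗ[ℚ] ℚ),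
        f = fun g => (L.map fun l => ((l g.val : ℚ) : E)).prod := by
      refine Submonoid.closure_induction (motive := fun f _ =>
        ∃ L : List (Matrix (Fin n) (Fin n) k →ₗ[ℚ] ℚ),
        f = fun g => (L.map fun l => ((l g.val : ℚ) : E)).prod) ?_ ?_ ?_ hf
      · rintro f ⟨l, rfl⟩
        exact ⟨[l], by simp⟩
      · exact ⟨[], by ext; simp⟩
      · rintro _ _ _ _ ⟨L, rfl⟩ ⟨L', rfl⟩
        exact ⟨L ++ L', by ext; simp⟩
    exact ⟨L.length, Submodule.subset_span ⟨L, le_rfl, hL⟩⟩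
  · exact ⟨0, zero_mem _⟩
  · rintro f g _ _ ⟨D, hD⟩ ⟨D', hD'⟩
    exact ⟨max D D', add_mem (polyFunctionsDegreeLE_mono (le_max_left _ _) hD)
      (polyFunctionsDegreeLE_mono (le_max_right _ _) hD')⟩
  · rintro c f _ ⟨D, hD⟩
    exact ⟨D, Submodule.smul_mem _ c hD⟩

theorem mul_mem_polyFunctionsDegreeLE {D D' : ℕ} {f g : GLk k n → E}
    (hf : f ∈ polyFunctionsDegreeLE k E n D) (hg : g ∈ polyFunctionsDegreeLE k E n D') :
    f * g ∈ polyFunctionsDegreeLE k E n (D + D') := by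
  have := Submodule.mul_mem_mul hf hg
  rw [polyFunctionsDegreeLE, polyFunctionsDegreeLE, Submodule.span_mul_span] at this
  refine Submodule.span_mono ?_ this
  rintro _ ⟨_, ⟨L, hL, rfl⟩, _, ⟨L', hL', rfl⟩, rfl⟩
  exact ⟨L ++ L', by simp; omega, by ext; simp⟩

theorem prod_mem_polyFunctionsDegreeLE (D : ℕ) (f : Fin D → GLk k n → E)
    (hf : ∀ i, f i ∈ polyFunctionsDegreeLE k E n 1) :
    (fun g => ∏ i, f i g) ∈ polyFunctionsDegreeLE k E n D := by
  induction D with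
  | zero => exact Submodule.subset_span ⟨[], by simp, by ext; simp⟩
  | succ D ih =>
    have := mul_mem_polyFunctionsDegreeLE (hf 0) (ih (fun i => f i.succ) fun i => hf i.succ)
    rw [add_comm] at this
    convert! this using 1
    ext g
    simp [Fin.prod_univ_succ]

theorem const_mem_polyFunctionsDegreeLE (c : E) :
    (fun _ => c) ∈ polyFunctionsDegreeLE k E n 1 := by
  have : (fun _ => (1 : E)) ∈ polyFunctionsDegreeLE k E n 1 :=
    Submodule.subset_span ⟨[], by simp, by ext; simp⟩
  convert! Submodule.smul_mem _ c this using 1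
  ext
  simp

theorem exists_ratMat_apply_eq (i j) : ∃ l : Matrix (Fin n) (Fin n) k →ₗ[ℚ] ℚ,
    ∀ A, ratMat k n A i j = l A := by
  refine ⟨(Matrix.entryLinearMap ℚ ℚ i.2 j.2).comp
    ((Algebra.leftMulMatrix (Module.finBasis ℚ k)).toLinearMap.comp
      (Matrix.entryLinearMap ℚ k i.1 j.1)), fun A => ?_⟩
  rw [ratMat_apply]
  rfl

variable (k E n) in
/-- The determinant of `g` over `ℚ`. -/
noncomputable def ratDet : GLk k n →* E where
  toFun g := (((ratMat k n g.val).det : ℚ) : E)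
  map_one' := by simp
  map_mul' g h := by simp

theorem ratDet_ne_zero (g : GLk k n) : ratDet k E n g ≠ 0 := by
  have h : ratDet k E n g * ratDet k E n g⁻¹ = 1 := by rw [← map_mul, mul_inv_cancel, map_one]
  exact left_ne_zero_of_mul_eq_one h

theorem ratMat_mem_polyFunctions (i j) :
    (fun g : GLk k n => ((ratMat k n g.val i j : ℚ) : E)) ∈ polyFunctions k E n := by
  obtain ⟨l, hl⟩ := exists_ratMat_apply_eq (k := k) i j
  exact Algebra.subset_adjoin ⟨l, by ext g; rw [hl]⟩

theorem det_mem_of_forall_mem {ι X : Type*} [Fintype ι] [DecidableEq ι] (S : Subalgebra E (X → E))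
    (A : X → Matrix ι ι ℚ) (h : ∀ i j, (fun x => ((A x i j : ℚ) : E)) ∈ S) :
    (fun x => (((A x).det : ℚ) : E)) ∈ S := by
  have e : (fun x => (((A x).det : ℚ) : E)) = ∑ σ : Equiv.Perm ι,
      ((σ.sign : ℤ) : E) • ∏ i, fun x => ((A x (σ i) i : ℚ) : E) := by
    ext x
    rw [Matrix.det_apply]
    simp only [Rat.cast_sum, Finset.sum_apply, Pi.smul_apply, Finset.prod_apply]
    refine Finset.sum_congr rfl fun σ _ => ?_
    rw [Units.smul_def, zsmul_eq_mul]
    push_cast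
    simp
  rw [e]
  exact sum_mem fun σ _ => Subalgebra.smul_mem _ (prod_mem fun i _ => h _ _) _

theorem ratDet_mem_polyFunctions : (ratDet k E n : GLk k n → E) ∈ polyFunctions k E n :=
  det_mem_of_forall_mem _ (fun g : GLk k n => ratMat k n g.val) ratMat_mem_polyFunctions

theorem exists_mul_ratDet_pow_mem {f : GLk k n → E} (hf : f ∈ regularFunctions k E n) :
    ∃ N : ℕ, ∀ N', N ≤ N' → f * (ratDet k E n) ^ N' ∈ polyFunctions k E n := by
  suffices ∃ N : ℕ, f * (ratDet k E n) ^ N ∈ polyFunctions k E n by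
    obtain ⟨N, hN⟩ := this
    refine ⟨N, fun N' h => ?_⟩
    obtain ⟨r, rfl⟩ := Nat.exists_eq_add_of_le h
    rw [pow_add, ← mul_assoc]
    exact mul_mem hN (pow_mem ratDet_mem_polyFunctions _)
  refine Algebra.adjoin_induction (p := fun (f : GLk k n → E) _ =>
    ∃ N : ℕ, f * (ratDet k E n) ^ N ∈ polyFunctions k E n) ?_ ?_ ?_ ?_ hf
  · rintro f (⟨τ, i, j, rfl⟩ | ⟨τ, i, j, rfl⟩)
    · refine ⟨0, ?_⟩
      rw [pow_zero, mul_one]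
      exact Algebra.subset_adjoin ⟨τ.comp (Matrix.entryLinearMap ℚ k i j), rfl⟩
    · refine ⟨1, ?_⟩
      set b := Module.finBasis ℚ k
      have hτ : ∀ x : k, τ x =
          ∑ a, ∑ c, τ (b a) * (Algebra.leftMulMatrix b x a c * b.repr 1 c) := by
        intro x
        have h1 := Algebra.leftMulMatrix_mulVec_repr b x 1
        rw [mul_one] at h1
        conv_lhs => rw [← b.sum_repr x]
        rw [map_sum]
        refine Finset.sum_congr rfl fun a _ => ?_
        rw [map_smul, smul_eq_mul, mul_comm, ← congrFun h1 a, Matrix.mulVec, dotProduct,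
          Finset.mul_sum]
      have hadj : ∀ (g : GLk k n) (a c), ratMat k n (g⁻¹).val (i, a) (j, c) *
          (ratMat k n g.val).det = (ratMat k n g.val).adjugate (i, a) (j, c) := by
        intro g a c
        have h1 : ratMat k n (g⁻¹).val * ratMat k n g.val = 1 := by
          rw [← map_mul, Units.inv_mul, map_one]
        have h2 := congrArg (fun A => A * (ratMat k n g.val).adjugate) h1
        simp only [Matrix.mul_assoc, Matrix.mul_adjugate, Matrix.one_mul] at h2
        rw [← h2]
        simp [mul_comm]
      have e : (fun g : GLk k n => ((τ ((g⁻¹).val i j) : ℚ) : E)) * (ratDet k E n) ^ 1 =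
          ∑ a, ∑ c, ((τ (b a) * b.repr 1 c : ℚ) : E) •
            fun g : GLk k n => (((ratMat k n g.val).adjugate (i, a) (j, c) : ℚ) : E) := by
        ext g
        simp only [Pi.mul_apply, pow_one, Finset.sum_apply, Pi.smul_apply, ← hadj]
        rw [hτ]
        change _ * (((ratMat k n g.val).det : ℚ) : E) = _
        push_cast
        rw [Finset.sum_mul]
        refine Finset.sum_congr rfl fun a _ => ?_
        rw [Finset.sum_mul]
        refine Finset.sum_congr rfl fun c _ => ?_
        rw [ratMat_apply, smul_eq_mul]
        ring
      rw [e]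
      refine sum_mem fun a _ => sum_mem fun c _ => Subalgebra.smul_mem _ ?_ _
      simp only [Matrix.adjugate_apply]
      refine det_mem_of_forall_mem _ (fun g : GLk k n =>
        (ratMat k n g.val).updateRow (j, c) (Pi.single (i, a) 1)) fun i' j' => ?_
      by_cases hi : i' = (j, c)
      · subst hi
        simp only [Matrix.updateRow_self]
        exact Subalgebra.algebraMap_mem (polyFunctions k E n) _
      · simp only [Matrix.updateRow_ne hi]
        exact ratMat_mem_polyFunctions _ _
  · intro r
    exact ⟨0, by rw [pow_zero, mul_one]; exact Subalgebra.algebraMap_mem _ _⟩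
  · rintro f g _ _ ⟨N, hN⟩ ⟨M, hM⟩
    refine ⟨N + M, ?_⟩
    have h1 := add_mem (mul_mem hN (pow_mem (ratDet_mem_polyFunctions (k := k) (E := E) (n := n)) M))
      (mul_mem hM (pow_mem (ratDet_mem_polyFunctions (k := k) (E := E) (n := n)) N))
    convert! h1 using 1
    ring
  · rintro f g _ _ ⟨N, hN⟩ ⟨M, hM⟩
    refine ⟨N + M, ?_⟩
    convert! mul_mem hN hM using 1
    ring

end PolyFunctions

end

section

section CompleteReducibility

variable {k : Type*} [Field k] [NumberField k] {n : ℕ}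
  {E V : Type*} [Field E] [CharZero E] [AddCommGroup V] [Module E V]

theorem IsAlgebraicRep.exists_isCompl [FiniteDimensional E V] {ρ : Representation E (GLk k n) V}
    (hρ : IsAlgebraicRep ρ) (S : Submodule E V) (hS : ∀ g, ∀ v ∈ S, ρ g v ∈ S) :
    ∃ T : Submodule E V, (∀ g, ∀ v ∈ T, ρ g v ∈ T) ∧ IsCompl S T := by
  classical
  set b := Module.finBasis E V
  set δ : GLk k n →* E := ratDet k E n with hδ
  choose N hN using fun i j => exists_mul_ratDet_pow_mem (hρ (b j) (b.coord i))
  set N₀ := ∑ i, ∑ j, N i j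
  have hN₀ : ∀ i j, (fun g => b.coord i (ρ g (b j))) * (δ : GLk k n → E) ^ N₀ ∈
      polyFunctions k E n := fun i j => hN i j N₀
    ((Finset.single_le_sum (f := fun j => N i j) (fun _ _ => Nat.zero_le _) (Finset.mem_univ j)).trans
      (Finset.single_le_sum (f := fun i => ∑ j, N i j) (fun _ _ => Nat.zero_le _)
        (Finset.mem_univ i)))
  choose D hD using fun i j => exists_mem_polyFunctionsDegreeLE (hN₀ i j)
  set D₀ := ∑ i, ∑ j, D i j
  have hD₀ : ∀ i j, (fun g => b.coord i (ρ g (b j))) * (δ : GLk k n → E) ^ N₀ ∈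
      polyFunctionsDegreeLE k E n D₀ := fun i j => polyFunctionsDegreeLE_mono
    ((Finset.single_le_sum (f := fun j => D i j) (fun _ _ => Nat.zero_le _) (Finset.mem_univ j)).trans
      (Finset.single_le_sum (f := fun i => ∑ j, D i j) (fun _ _ => Nat.zero_le _)
        (Finset.mem_univ i))) (hD i j)
  let r : GLk k n →* Matrix (Unit ⊕ (Fin n × Fin (Module.finrank ℚ k)))
      (Unit ⊕ (Fin n × Fin (Module.finrank ℚ k))) E :=
    { toFun := fun g => Matrix.fromBlocks 1 0 0 ((ratMat k n g.val).map (Rat.castHom E))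
      map_one' := by
        rw [Units.val_one, map_one, Matrix.map_one _ (map_zero _) (map_one _),
          Matrix.fromBlocks_one]
      map_mul' := fun g h => by
        rw [Matrix.fromBlocks_multiply, Units.val_mul, map_mul, Matrix.map_mul]
        simp }
  have hr1 : ∀ a c, (fun g => r g a c) ∈ polyFunctionsDegreeLE k E n 1 := by
    rintro (a | a) (c | c)
    · exact const_mem_polyFunctionsDegreeLE _
    · exact const_mem_polyFunctionsDegreeLE _
    · exact const_mem_polyFunctionsDegreeLE _
    · obtain ⟨l, hl⟩ := exists_ratMat_apply_eq (k := k) a c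
      refine Submodule.subset_span ⟨[l], by simp, ?_⟩
      ext g
      simp [r, hl]
  have hrtr : ∀ g, (r g).trace = 1 + (((ratMat k n g.val).trace : ℚ) : E) := by
    intro g
    simp [r, Matrix.trace]
  let π : GLk k n →* Matrix (Fin D₀ → (Unit ⊕ (Fin n × Fin (Module.finrank ℚ k))))
      (Fin D₀ → (Unit ⊕ (Fin n × Fin (Module.finrank ℚ k)))) E :=
    { toFun := fun g => (δ g ^ N₀)⁻¹ • matrixTensorPow r D₀ g
      map_one' := by simp
      map_mul' := fun g h => by
        rw [map_mul, map_mul, Matrix.smul_mul, Matrix.mul_smul, smul_smul, mul_pow, mul_inv] }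
  refine exists_isCompl_of_trace ρ π (fun x hx => ?_) S hS
  have hδ0 : ∀ g, δ g ≠ 0 := ratDet_ne_zero
  have key : ∀ f : GLk k n → E, f * (δ : GLk k n → E) ^ N₀ ∈ polyFunctionsDegreeLE k E n D₀ →
      ∑ g ∈ x.support, x g * f g = 0 := by
    have h1 : ∀ h : GLk k n, ∑ g ∈ x.support, (x g * (δ g ^ N₀)⁻¹) *
        (1 + (((ratMat k n (g.val * h.val)).trace : ℚ) : E)) ^ D₀ = 0 := by
      intro h
      have h2 := hx h
      have h3 : x.sum (fun g c => c * (π (g * h)).trace) =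
          (δ h ^ N₀)⁻¹ * ∑ g ∈ x.support, (x g * (δ g ^ N₀)⁻¹) *
            (1 + (((ratMat k n (g.val * h.val)).trace : ℚ) : E)) ^ D₀ := by
        rw [Finsupp.sum, Finset.mul_sum]
        refine Finset.sum_congr rfl fun g _ => ?_
        change x g * ((δ (g * h) ^ N₀)⁻¹ • matrixTensorPow r D₀ (g * h)).trace = _
        rw [Matrix.trace_smul, trace_matrixTensorPow, hrtr, Units.val_mul, map_mul, mul_pow,
          mul_inv, smul_eq_mul]
        ring
      rw [h3] at h2
      exact (mul_eq_zero.1 h2).resolve_left (inv_ne_zero (pow_ne_zero _ (hδ0 h)))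
    have h2 := sum_trace_pow_eq_zero_of_forall_GL x.support (fun g => x g * (δ g ^ N₀)⁻¹)
      (fun g => g) D₀ h1
    have h3 : ∀ l : Matrix (Fin n) (Fin n) k →ₗ[ℚ] ℚ, ∑ g ∈ x.support, (x g * (δ g ^ N₀)⁻¹) *
        (1 + ((l g.val : ℚ) : E)) ^ D₀ = 0 := by
      intro l
      obtain ⟨h, hh⟩ := exists_linearForm_eq_trace l
      simp only [hh]
      exact h2 h
    have h4 := sum_prod_eq_zero_of_sum_pow x.support (fun g => x g * (δ g ^ N₀)⁻¹)
      (fun g : GLk k n => g.val) D₀ h3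
    intro f hf
    have h5 : ∀ F ∈ polyFunctionsDegreeLE k E n D₀,
        ∑ g ∈ x.support, (x g * (δ g ^ N₀)⁻¹) * F g = 0 := by
      intro F hF
      refine Submodule.span_induction (p := fun F _ =>
        ∑ g ∈ x.support, (x g * (δ g ^ N₀)⁻¹) * F g = 0) ?_ ?_ ?_ ?_ hF
      · rintro _ ⟨L, hL, rfl⟩
        simpa using h4 L hL 0
      · simp
      · intro F G _ _ hF hG
        simp [mul_add, Finset.sum_add_distrib, hF, hG]
      · intro c F _ hF
        have : ∑ g ∈ x.support, (x g * (δ g ^ N₀)⁻¹) * (c • F) g =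
            c * ∑ g ∈ x.support, (x g * (δ g ^ N₀)⁻¹) * F g := by
          rw [Finset.mul_sum]
          refine Finset.sum_congr rfl fun g _ => ?_
          rw [Pi.smul_apply, smul_eq_mul]
          ring
        rw [this, hF, mul_zero]
    rw [← h5 _ hf]
    refine Finset.sum_congr rfl fun g _ => ?_
    have := pow_ne_zero N₀ (hδ0 g)
    simp only [Pi.mul_apply, Pi.pow_apply]
    field_simp
  constructor
  · ext a c
    have := key (fun g => π g a c) (by
      convert! prod_mem_polyFunctionsDegreeLE D₀ (fun i g => r g (a i) (c i))
        (fun i => hr1 _ _) using 1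
      ext g
      have := pow_ne_zero N₀ (hδ0 g)
      simp only [Pi.mul_apply, Pi.pow_apply]
      change ((δ g ^ N₀)⁻¹ * ∏ i, r g (a i) (c i)) * δ g ^ N₀ = _
      field_simp)
    rw [Finsupp.sum, Matrix.sum_apply]
    simpa using this
  · refine b.ext fun j => b.ext_elem fun i => ?_
    have := key (fun g => b.coord i (ρ g (b j))) (hD₀ i j)
    simpa [Finsupp.sum, LinearMap.sum_apply] using this

end CompleteReducibility

section Pairing

variable {E V G : Type*} [Field E] [AddCommGroup V] [Module E V] [Group G]

theorem mem_invariantsOf_dual {ρ : Representation E G V} {H : Subgroup G} {u : Module.Dual E V} :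
    u ∈ invariantsOf ρ.dual (H : Set G) ↔ ∀ g ∈ H, ∀ v, u (ρ g v) = u v := by
  constructor
  · intro hu g hg v
    have := LinearMap.congr_fun (hu g⁻¹ (inv_mem hg)) v
    simpa only [Representation.dual_apply, inv_inv] using! this
  · intro hu g hg
    ext v
    exact hu g⁻¹ (inv_mem hg) v

/-- For a completely reducible representation, the invariants of a normal subgroup are in perfect
duality with its invariants in the dual representation. -/
theorem existsUnique_invariant [FiniteDimensional E V] (ρ : Representation E G V)
    (hρ : ∀ S : Submodule E V, (∀ g, ∀ v ∈ S, ρ g v ∈ S) →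
      ∃ T : Submodule E V, (∀ g, ∀ v ∈ T, ρ g v ∈ T) ∧ IsCompl S T)
    (H : Subgroup G) [H.Normal] (Λ : invariantsOf ρ.dual (H : Set G) →ₗ[E] E) :
    ∃! w, w ∈ invariantsOf ρ (H : Set G) ∧
      ∀ u : invariantsOf ρ.dual (H : Set G), u.val w = Λ u := by
  classical
  set I := invariantsOf ρ (H : Set G) with hI
  have hIst : ∀ g, ∀ v ∈ I, ρ g v ∈ I := by
    intro g v hv h hh
    have h1 := hv (g⁻¹ * h * g) (by
      have := ‹H.Normal›.conj_mem h hh g⁻¹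
      simpa using this)
    rw [← Module.End.mul_apply, ← map_mul]
    conv_rhs => rw [← h1]
    rw [← Module.End.mul_apply, ← map_mul]
    congr 2
    group
  obtain ⟨N, hN, hc⟩ := hρ I hIst
  let pr : V →ₗ[E] I := Submodule.projectionOnto I N hc
  have hpr : ∀ l : Module.Dual E I, l.comp pr ∈ invariantsOf ρ.dual (H : Set G) := by
    intro l
    rw [mem_invariantsOf_dual]
    intro g hg v
    obtain ⟨a, ha, c, hc', rfl⟩ : ∃ a ∈ I, ∃ c ∈ N, a + c = v :=
      Submodule.mem_sup.1 (by rw [codisjoint_iff.1 hc.codisjoint]; trivial)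
    have h1 : pr c = 0 := (Submodule.projectionOnto_apply_eq_zero_iff hc).2 hc'
    have h2 : pr (ρ g c) = 0 := (Submodule.projectionOnto_apply_eq_zero_iff hc).2 (hN g c hc')
    simp only [LinearMap.comp_apply, map_add, h1, h2, ha g hg]
  have hvan : ∀ u ∈ invariantsOf ρ.dual (H : Set G), ∀ v ∈ N, u v = 0 := by
    intro u hu v hv
    rw [mem_invariantsOf_dual] at hu
    let S : Submodule E V :=
      { carrier := {v | v ∈ N ∧ ∀ g, u (ρ g v) = 0}
        add_mem' := by
          rintro a c ⟨h1, h2⟩ ⟨h3, h4⟩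
          exact ⟨N.add_mem h1 h3, fun g => by simp [h2, h4]⟩
        zero_mem' := ⟨N.zero_mem, fun g => by simp⟩
        smul_mem' := by
          rintro c a ⟨h1, h2⟩
          exact ⟨N.smul_mem c h1, fun g => by simp [h2]⟩ }
    obtain ⟨T, hT, hST⟩ := hρ S (by
      rintro g v ⟨h1, h2⟩
      refine ⟨hN g v h1, fun g' => ?_⟩
      rw [← Module.End.mul_apply, ← map_mul]
      exact h2 _)
    obtain ⟨s, hs, t, ht, hst⟩ : ∃ s ∈ S, ∃ t ∈ T, s + t = v :=
      Submodule.mem_sup.1 (by rw [codisjoint_iff.1 hST.codisjoint]; trivial)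
    have htN : t ∈ N := by
      rw [eq_sub_of_add_eq' hst]
      exact N.sub_mem hv hs.1
    have htI : t ∈ I := by
      intro h hh
      have h1 : ρ h t - t ∈ S := by
        refine ⟨N.sub_mem (hN h t htN) htN, fun g => ?_⟩
        rw [map_sub, map_sub, ← Module.End.mul_apply, ← map_mul]
        have h2 : g * h = (g * h * g⁻¹) * g := by group
        rw [h2, map_mul, Module.End.mul_apply, hu _ (‹H.Normal›.conj_mem h hh g), sub_self]
      have h3 : ρ h t - t ∈ T := T.sub_mem (hT h t ht) ht
      exact sub_eq_zero.1 (Submodule.disjoint_def.1 hST.disjoint _ h1 h3)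
    have ht0 : t = 0 := Submodule.disjoint_def.1 hc.disjoint t htI htN
    rw [ht0, add_zero] at hst
    rw [← hst]
    simpa using hs.2 1
  let Φ : Module.Dual E I →ₗ[E] invariantsOf ρ.dual (H : Set G) :=
    { toFun := fun l => ⟨l.comp pr, hpr l⟩
      map_add' := fun l l' => by ext; simp
      map_smul' := fun c l => by ext; simp }
  obtain ⟨w, hw⟩ := (Module.evalEquiv E I).surjective (Λ.comp Φ)
  have hw' : ∀ l : Module.Dual E I, l w = Λ (Φ l) := fun l => by
    have := LinearMap.congr_fun hw l
    simpa using this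
  have hΦ : ∀ u : invariantsOf ρ.dual (H : Set G), Φ (u.val.comp I.subtype) = u := by
    intro u
    ext v
    obtain ⟨a, ha, c, hc', rfl⟩ : ∃ a ∈ I, ∃ c ∈ N, a + c = v :=
      Submodule.mem_sup.1 (by rw [codisjoint_iff.1 hc.codisjoint]; trivial)
    have h1 : pr c = 0 := (Submodule.projectionOnto_apply_eq_zero_iff hc).2 hc'
    have h2 : pr a = ⟨a, ha⟩ := Submodule.projectionOnto_apply_left hc ⟨a, ha⟩
    change u.val (pr (a + c)).val = u.val (a + c)
    rw [map_add, h1, h2, add_zero, map_add, hvan u.val u.2 c hc', add_zero]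
  refine ⟨w.val, ⟨w.2, fun u => ?_⟩, ?_⟩
  · have := hw' (u.val.comp I.subtype)
    rw [hΦ] at this
    exact this
  · rintro w' ⟨hw1, hw2⟩
    have h1 : (⟨w', hw1⟩ : I) = w := by
      rw [← sub_eq_zero, ← Module.forall_dual_apply_eq_zero_iff E]
      intro l
      rw [map_sub, hw' l, ← hw2 (Φ l), sub_eq_zero]
      change l ⟨w', hw1⟩ = l (pr w')
      rw [show pr w' = ⟨w', hw1⟩ from Submodule.projectionOnto_apply_left hc ⟨w', hw1⟩]
    exact congrArg Subtype.val h1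

end Pairing

end

section

/-! ## Generation of the special linear group by elementary matrices -/

section Elementary

variable {R : Type*} [CommRing R] {n : ℕ}

/-- The submonoid of `GL_n` generated by the elementary matrices. -/
def elementary (n : ℕ) (R : Type*) [CommRing R] : Submonoid (GL (Fin n) R) :=
  Submonoid.closure {t | ∃ (i j : Fin n) (c : R), i ≠ j ∧ t.val = Matrix.transvection i j c}

/-- The matrix `1 + a bᵗ`, which is invertible if `b` is orthogonal to `a`. -/
def rankOneGL (a b : Fin n → R) (h : b ⬝ᵥ a = 0) : GL (Fin n) R where
  val := 1 + Matrix.vecMulVec a b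
  inv := 1 - Matrix.vecMulVec a b
  val_inv := by
    rw [Matrix.mul_sub, Matrix.mul_one, Matrix.add_mul, Matrix.one_mul,
      Matrix.vecMulVec_mul_vecMulVec, h]
    simp
  inv_val := by
    rw [Matrix.mul_add, Matrix.mul_one, Matrix.sub_mul, Matrix.one_mul,
      Matrix.vecMulVec_mul_vecMulVec, h]
    simp

theorem pi_induction_of_apply_eq_zero {m : Fin n} {P : (Fin n → R) → Prop} (h0 : P 0)
    (hP : ∀ b a, b m = 0 → a ≠ m → P (Function.update b a 0) → P b) (b : Fin n → R)
    (hb : b m = 0) : P b := by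
  classical
  suffices key : ∀ s : Finset (Fin n), ∀ b : Fin n → R, b m = 0 → (∀ i ∉ s, b i = 0) → P b from
    key Finset.univ b hb (by simp)
  intro s
  induction s using Finset.induction_on with
  | empty =>
    intro b _ h
    obtain rfl : b = 0 := funext fun i => h i (by simp)
    exact h0
  | insert a s ha ih =>
    intro b hb h
    by_cases ham : a = m
    · exact ih b hb fun i hi => by
        by_cases hia : i = a
        · rw [hia, ham, hb]
        · exact h i (by simp [hia, hi])
    · refine hP b a hb ham (ih _ (by rw [Function.update_of_ne (Ne.symm ham), hb]) fun i hi => ?_)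
      by_cases hia : i = a
      · rw [hia, Function.update_self]
      · rw [Function.update_of_ne hia]; exact h i (by simp [hia, hi])

theorem rankOneGL_single_left_mem (m : Fin n) (b : Fin n → R) (hb : b m = 0) :
    rankOneGL (Pi.single m 1) b (by simpa using hb) ∈ elementary n R := by
  refine pi_induction_of_apply_eq_zero (P := fun b => ∀ hb : b m = 0,
      rankOneGL (Pi.single m 1) b (by simpa using hb) ∈ elementary n R) ?_ ?_ b hb hb
  · intro hb
    convert! one_mem (elementary n R) using 1
    ext i j
    simp [rankOneGL, Matrix.vecMulVec_apply]
  · intro b a hb ham h1 _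
    replace h1 := h1 (by rw [Function.update_of_ne (Ne.symm ham), hb])
    have h2 : rankOneGL (Pi.single m 1) (Pi.single a (b a)) (by simp [ham]) ∈
        elementary n R := by
      refine Submonoid.subset_closure ⟨m, a, b a, Ne.symm ham, ?_⟩
      ext i j
      by_cases hi : m = i <;> by_cases hj : a = j <;>
        simp_all [rankOneGL, Matrix.vecMulVec_apply, Matrix.transvection, Matrix.single_apply,
          Pi.single_apply, eq_comm]
    convert! mul_mem h2 h1 using 1
    refine Units.ext ?_
    change 1 + Matrix.vecMulVec _ _ = (1 + Matrix.vecMulVec _ _) * (1 + Matrix.vecMulVec _ _)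
    rw [Matrix.mul_add, Matrix.mul_one, Matrix.add_mul, Matrix.one_mul,
      Matrix.vecMulVec_mul_vecMulVec]
    ext i j
    by_cases hj : j = a
    · subst hj; simp [ham, Matrix.vecMulVec_apply]
    · simp [ham, hj, Matrix.vecMulVec_apply]

theorem rankOneGL_single_right_mem (m : Fin n) (a : Fin n → R) (ha : a m = 0) :
    rankOneGL a (Pi.single m 1) (by simpa using ha) ∈ elementary n R := by
  refine pi_induction_of_apply_eq_zero (P := fun b => ∀ hb : b m = 0,
      rankOneGL b (Pi.single m 1) (by simpa using hb) ∈ elementary n R) ?_ ?_ a ha ha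
  · intro hb
    convert! one_mem (elementary n R) using 1
    ext i j
    simp [rankOneGL, Matrix.vecMulVec_apply]
  · intro b a hb ham h1 _
    replace h1 := h1 (by rw [Function.update_of_ne (Ne.symm ham), hb])
    have h2 : rankOneGL (Pi.single a (b a)) (Pi.single m 1)  (by simp [Ne.symm ham]) ∈
        elementary n R := by
      refine Submonoid.subset_closure ⟨a, m, b a, ham, ?_⟩
      ext i j
      by_cases hi : a = i <;> by_cases hj : m = j <;>
        simp_all [rankOneGL, Matrix.vecMulVec_apply, Matrix.transvection, Matrix.single_apply,
          Pi.single_apply, eq_comm]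
    convert! mul_mem h1 h2 using 1
    refine Units.ext ?_
    change 1 + Matrix.vecMulVec _ _ = (1 + Matrix.vecMulVec _ _) * (1 + Matrix.vecMulVec _ _)
    rw [Matrix.mul_add, Matrix.mul_one, Matrix.add_mul, Matrix.one_mul,
      Matrix.vecMulVec_mul_vecMulVec]
    ext i j
    by_cases hj : i = a
    · subst hj; simp [Ne.symm ham, Matrix.vecMulVec_apply]
    · simp [Ne.symm ham, hj, Matrix.vecMulVec_apply]

theorem rankOneGL_mul_apply (a b : Fin n → R) (h : b ⬝ᵥ a = 0) (g : GL (Fin n) R) (i j : Fin n) :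
    (rankOneGL a b h * g).val i j = g.val i j + a i * ∑ l, b l * g.val l j := by
  change ((1 + Matrix.vecMulVec a b) * g.val) i j = _
  rw [Matrix.add_mul, Matrix.one_mul, Matrix.add_apply, Matrix.vecMulVec_mul,
    Matrix.vecMulVec_apply]
  rfl

theorem rankOneGL_inv (a b : Fin n → R) (h : b ⬝ᵥ a = 0) :
    (rankOneGL a b h)⁻¹ = rankOneGL a (-b) (by simp [h]) := by
  refine Units.ext ?_
  change 1 - Matrix.vecMulVec a b = 1 + Matrix.vecMulVec a (-b)
  rw [Matrix.vecMulVec_neg]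
  abel

theorem det_rankOneGL (a b : Fin n → R) (h : b ⬝ᵥ a = 0) :
    (rankOneGL a b h).val.det = 1 := by
  change (1 + Matrix.vecMulVec a b).det = 1
  rw [Matrix.vecMulVec_eq Unit, Matrix.det_one_add_replicateCol_mul_replicateRow, h, add_zero]

/-- Over a ring of stable range one, the special linear group is generated by elementary matrices. -/
theorem mem_elementary_of_det_eq_one
    (hR : ∀ a b x y : R, x * a + y * b = 1 → ∃ t, IsUnit (a + t * b))
    (g : GL (Fin n) R) (hg : g.val.det = 1) : g ∈ elementary n R := by
  classical
  -- `Q m`: reduction of matrices whose first `m` columns are those of the identity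
  suffices H : ∀ d m : ℕ, m + d = n → ∀ g : GL (Fin n) R, g.val.det = 1 →
      (∀ i j : Fin n, j.val < m → g.val i j = (1 : Matrix _ _ R) i j) → g ∈ elementary n R from
    H n 0 (by simp) g hg (by simp)
  intro d
  induction d with
  | zero =>
    intro m hm g _ hcol
    convert! one_mem (elementary n R) using 1
    refine Units.ext (Matrix.ext fun i j => hcol i j (by omega))
  | succ d ih =>
    intro m hm g hg hcol
    have hmul : ∀ (e g : GL (Fin n) R), e⁻¹ ∈ elementary n R → e * g ∈ elementary n R →
        g ∈ elementary n R := by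
      intro e g h1 h2
      have := mul_mem h1 h2
      rwa [inv_mul_cancel_left] at this
    let p : Fin n := ⟨m, by omega⟩
    have hzero : ∀ i j : Fin n, j.val < m → m ≤ i.val → g.val i j = 0 := by
      intro i j hj hi
      rw [hcol i j hj, Matrix.one_apply_ne]
      intro h; rw [h] at hi; omega
    -- clearing a column with pivot `1`
    have clear : ∀ g : GL (Fin n) R, g.val.det = 1 →
        (∀ i j : Fin n, j.val < m → g.val i j = (1 : Matrix _ _ R) i j) → g.val p p = 1 →
        g ∈ elementary n R := by
      intro g hg hcol hp
      let a : Fin n → R := fun i => if i = p then 0 else -g.val i p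
      have ha : a p = 0 := by simp [a]
      refine hmul (rankOneGL a (Pi.single p 1) (by simpa using ha)) g ?_
        (ih (m + 1) (by omega) _ ?_ ?_)
      · have h2 : (rankOneGL a (Pi.single p 1) (by simpa using ha))⁻¹ =
            rankOneGL (-a) (Pi.single p 1) (by simpa using ha) := by
          rw [rankOneGL_inv]
          refine Units.ext ?_
          change 1 + Matrix.vecMulVec _ _ = 1 + Matrix.vecMulVec _ _
          rw [Matrix.vecMulVec_neg, Matrix.neg_vecMulVec]
        rw [h2]
        exact rankOneGL_single_right_mem p (-a) (by simpa using ha)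
      · rw [Units.val_mul, Matrix.det_mul, det_rankOneGL, hg, one_mul]
      · intro i j hj
        rw [rankOneGL_mul_apply]
        have hsum : ∑ l, (Pi.single p 1 : Fin n → R) l * g.val l j = g.val p j := by
          simp [Pi.single_apply]
        rw [hsum]
        rcases Nat.lt_succ_iff_lt_or_eq.1 hj with hj' | hj'
        · rw [hcol i j hj', hcol p j hj', Matrix.one_apply_ne (i := p), mul_zero, add_zero]
          intro h
          rw [← h] at hj'
          simp [p] at hj'
        · have hjp : j = p := Fin.ext hj'
          rw [hjp, hp]
          by_cases hi : i = p
          · rw [hi]; simp [a, hp]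
          · simp [a, hi, Matrix.one_apply_ne hi]
    have hinv : ∑ i, (g⁻¹).val p i * g.val i p = 1 := by
      have := congrFun (congrFun (Units.inv_mul g) p) p
      rwa [Matrix.mul_apply, Matrix.one_apply_eq] at this
    have hinv0 : ∀ i : Fin n, i.val < m → (g⁻¹).val p i = 0 := by
      intro i hi
      have h1 := congrFun (congrFun (Units.inv_mul g) p) i
      rw [Matrix.mul_apply, Matrix.one_apply_ne (by
        intro h; rw [← h] at hi; simp [p] at hi)] at h1
      rw [← h1]
      symm
      rw [Finset.sum_eq_single i]
      · rw [hcol i i hi, Matrix.one_apply_eq, mul_one]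
      · intro l _ hl
        rw [hcol l i hi, Matrix.one_apply_ne hl, mul_zero]
      · simp
    rcases Nat.eq_zero_or_pos d with hd | hd
    · -- the last column
      refine clear g hg hcol ?_
      have htri : g.val.BlockTriangular id := by
        intro i j hij
        have h1 := i.2
        have h2 : j.val < i.val := hij
        rw [hcol i j (by omega), Matrix.one_apply_ne (by intro h; rw [h] at h2; omega)]
      rw [Matrix.det_of_isUpperTriangular htri, Finset.prod_eq_single p] at hg
      · exact hg
      · intro i _ hi
        rw [hcol i i, Matrix.one_apply_eq]
        have h1 := i.2
        have h2 : i.val ≠ m := fun h => hi (Fin.ext h)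
        omega
      · simp
    · let q : Fin n := ⟨m + 1, by omega⟩
      have hpq : p ≠ q := by simp [p, q]
      let x : Fin n → R := fun i => (g⁻¹).val p i
      have hsplit : x p * g.val p p + 1 * ∑ i ∈ Finset.univ.erase p, x i * g.val i p = 1 := by
        rw [one_mul, Finset.add_sum_erase _ (fun i => x i * g.val i p) (Finset.mem_univ p)]
        exact hinv
      obtain ⟨t, ht⟩ := hR _ _ _ _ hsplit
      -- first make the pivot a unit
      let b : Fin n → R := fun i => if i = p then 0 else t * x i
      have hb : b p = 0 := by simp [b]
      have hb0 : ∀ i : Fin n, i.val < m → b i = 0 := by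
        intro i hi
        simp only [b, x, hinv0 i hi, mul_zero, ite_self]
      let e₁ := rankOneGL (Pi.single p 1) b (by simpa using hb)
      have key : ∀ (r : Fin n) (c : Fin n → R) (hc : c r = 0) (g : GL (Fin n) R), m ≤ r.val →
          (∀ i : Fin n, i.val < m → c i = 0) →
          g.val.det = 1 → (∀ i j : Fin n, j.val < m → g.val i j = (1 : Matrix _ _ R) i j) →
          (rankOneGL (Pi.single r 1) c (by simpa using hc) * g).val.det = 1 ∧
          (∀ i j : Fin n, j.val < m →
            (rankOneGL (Pi.single r 1) c (by simpa using hc) * g).val i j =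
              (1 : Matrix _ _ R) i j) ∧
          (rankOneGL (Pi.single r 1) c (by simpa using hc) * g ∈ elementary n R →
            g ∈ elementary n R) := by
        intro r c hc g hr hc0 hg hcol
        refine ⟨by rw [Units.val_mul, Matrix.det_mul, det_rankOneGL, hg, one_mul], ?_, ?_⟩
        · intro i j hj
          rw [rankOneGL_mul_apply, Finset.sum_eq_zero, mul_zero, add_zero, hcol i j hj]
          intro l _
          by_cases hl : l.val < m
          · rw [hc0 l hl, zero_mul]
          · rw [hcol l j hj, Matrix.one_apply_ne (by intro h; rw [h] at hl; omega), mul_zero]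
        · refine hmul _ g ?_
          rw [rankOneGL_inv]
          exact rankOneGL_single_left_mem r (-c) (by simpa using hc)
      obtain ⟨h11, h12, h13⟩ := key p b hb g le_rfl hb0 hg hcol
      refine h13 ?_
      set g₁ := rankOneGL (Pi.single p 1) b (by simpa using hb) * g with hg₁
      have hu : IsUnit (g₁.val p p) := by
        rw [hg₁, rankOneGL_mul_apply]
        convert ht using 1
        rw [Pi.single_eq_same, one_mul, Finset.mul_sum,
          ← Finset.add_sum_erase _ _ (Finset.mem_univ p), hb, zero_mul, zero_add]
        congr 1
        refine Finset.sum_congr rfl fun i hi => ?_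
        simp only [b, if_neg (Finset.ne_of_mem_erase hi)]
        ring
      obtain ⟨u, hu⟩ := hu
      -- then make the entry below the pivot equal to `1`
      let b₂ : Fin n → R := Pi.single p ((1 - g₁.val q p) * (u⁻¹ : Rˣ))
      have hb₂ : b₂ q = 0 := by simp [b₂, hpq.symm]
      obtain ⟨h21, h22, h23⟩ := key q b₂ hb₂ g₁ (by simp [q]) (fun i hi => by
        have : i ≠ p := by intro h; rw [h] at hi; simp [p] at hi
        simp [b₂, this]) h11 h12
      refine h23 ?_
      set g₂ := rankOneGL (Pi.single q 1) b₂ (by simpa using hb₂) * g₁ with hg₂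
      have hq2 : g₂.val q p = 1 := by
        rw [hg₂, rankOneGL_mul_apply, Pi.single_eq_same, one_mul]
        have : ∑ l, b₂ l * g₁.val l p = (1 - g₁.val q p) * (u⁻¹ : Rˣ) * g₁.val p p := by
          simp [b₂, Pi.single_apply]
        rw [this, ← hu, mul_assoc, Units.inv_mul]
        ring
      have hp2 : g₂.val p p = u := by
        rw [hg₂, rankOneGL_mul_apply, Pi.single_eq_of_ne hpq, zero_mul, add_zero, hu]
      -- then the pivot
      let b₃ : Fin n → R := Pi.single q (1 - u)
      have hb₃ : b₃ p = 0 := by simp [b₃, hpq]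
      obtain ⟨h31, h32, h33⟩ := key p b₃ hb₃ g₂ le_rfl (fun i hi => by
        have : i ≠ q := by intro h; rw [h] at hi; simp [q] at hi
        simp [b₃, this]) h21 h22
      refine h33 (clear _ h31 h32 ?_)
      rw [rankOneGL_mul_apply, Pi.single_eq_same, one_mul]
      have : ∑ l, b₃ l * g₂.val l p = (1 - u) * g₂.val q p := by
        simp [b₃, Pi.single_apply]
      rw [this, hq2, hp2]
      ring

end Elementary

end

section

section AlgebraicReps

variable {k : Type*} [Field k] [NumberField k] {n : ℕ}
  {E V : Type*} [Field E] [CharZero E] [AddCommGroup V] [Module E V]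

theorem regularFunctions_comp_inv {f : GLk k n → E} (hf : f ∈ regularFunctions k E n) :
    (fun g => f g⁻¹) ∈ regularFunctions k E n := by
  refine Algebra.adjoin_induction (p := fun (f : GLk k n → E) _ =>
    (fun g => f g⁻¹) ∈ regularFunctions k E n) ?_ ?_ ?_ ?_ hf
  · rintro f (⟨τ, i, j, rfl⟩ | ⟨τ, i, j, rfl⟩)
    · exact Algebra.subset_adjoin (Or.inr ⟨τ, i, j, rfl⟩)
    · exact Algebra.subset_adjoin (Or.inl ⟨τ, i, j, by simp⟩)
  · intro r
    exact Subalgebra.algebraMap_mem (regularFunctions k E n) r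
  · intro f g _ _ hf hg
    exact add_mem hf hg
  · intro f g _ _ hf hg
    exact mul_mem hf hg

theorem jEmb_apply {R : Type*} [CommRing R] (g : GL (Fin n) R) (i j : Fin (n + 1)) :
    (jEmb g).val i j = Matrix.fromBlocks g.val 0 0 (1 : Matrix (Fin 1) (Fin 1) R)
      (finSumFinEquiv.symm i) (finSumFinEquiv.symm j) := rfl

theorem regularFunctions_comp_jEmb {f : GLk k (n + 1) → E}
    (hf : f ∈ regularFunctions k E (n + 1)) :
    (fun g => f (jEmb g)) ∈ regularFunctions k E n := by
  refine Algebra.adjoin_induction (p := fun (f : GLk k (n + 1) → E) _ =>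
    (fun g => f (jEmb g)) ∈ regularFunctions k E n) ?_ ?_ ?_ ?_ hf
  · rintro f (⟨τ, i, j, rfl⟩ | ⟨τ, i, j, rfl⟩)
    · simp only [jEmb_apply]
      rcases finSumFinEquiv.symm i with a | a <;> rcases finSumFinEquiv.symm j with b | b
      · exact Algebra.subset_adjoin (Or.inl ⟨τ, a, b, rfl⟩)
      all_goals
        simp only [Matrix.fromBlocks_apply₁₂, Matrix.fromBlocks_apply₂₁, Matrix.fromBlocks_apply₂₂,
          Matrix.zero_apply]
        exact Subalgebra.algebraMap_mem (regularFunctions k E n) _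
    · simp only [← map_inv, jEmb_apply]
      rcases finSumFinEquiv.symm i with a | a <;> rcases finSumFinEquiv.symm j with b | b
      · exact Algebra.subset_adjoin (Or.inr ⟨τ, a, b, rfl⟩)
      all_goals
        simp only [Matrix.fromBlocks_apply₁₂, Matrix.fromBlocks_apply₂₁, Matrix.fromBlocks_apply₂₂,
          Matrix.zero_apply]
        exact Subalgebra.algebraMap_mem (regularFunctions k E n) _
  · intro r
    exact Subalgebra.algebraMap_mem (regularFunctions k E n) r
  · intro f g _ _ hf hg
    exact add_mem hf hg
  · intro f g _ _ hf hg
    exact mul_mem hf hg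

theorem IsAlgebraicRep.dual [FiniteDimensional E V] {ρ : Representation E (GLk k n) V}
    (hρ : IsAlgebraicRep ρ) : IsAlgebraicRep ρ.dual := by
  intro u l
  obtain ⟨v, rfl⟩ := (Module.evalEquiv E V).surjective l
  exact regularFunctions_comp_inv (hρ v u)

theorem isAlgebraicRep_diagRep {M₁ M₂ : Type*} [AddCommGroup M₁] [Module E M₁]
    [FiniteDimensional E M₁] [AddCommGroup M₂] [Module E M₂]
    {ρ₁ : Representation E (GLk k (n + 1)) M₁} {ρ₂ : Representation E (GLk k n) M₂}
    (hρ₁ : IsAlgebraicRep ρ₁) (hρ₂ : IsAlgebraicRep ρ₂) : IsAlgebraicRep (diagRep ρ₁ ρ₂) := by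
  intro w l
  induction w using TensorProduct.induction_on with
  | zero =>
    simp only [map_zero]
    exact zero_mem (regularFunctions k E n)
  | add a b ha hb =>
    simp only [map_add]
    exact add_mem ha hb
  | tmul a b =>
    let e := Module.finBasis E M₁
    have h : (fun g => l (diagRep ρ₁ ρ₂ g (a ⊗ₜ[E] b))) =
        ∑ i, (fun g : GLk k n => e.coord i (ρ₁ (jEmb g) a)) *
          fun g => (l.comp (TensorProduct.mk E M₁ M₂ (e i))) (ρ₂ g b) := by
      ext g
      have h1 : diagRep ρ₁ ρ₂ g (a ⊗ₜ[E] b) = (ρ₁ (jEmb g) a) ⊗ₜ[E] (ρ₂ g b) := rfl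
      rw [h1]
      conv_lhs => rw [← e.sum_repr (ρ₁ (jEmb g) a)]
      rw [TensorProduct.sum_tmul, map_sum]
      rw [Finset.sum_apply]
      refine Finset.sum_congr rfl fun i _ => ?_
      rw [← TensorProduct.smul_tmul', map_smul]
      rfl
    rw [h]
    exact sum_mem fun i _ => mul_mem (regularFunctions_comp_jEmb (hρ₁ a (e.coord i))) (hρ₂ b _)

/-- A subgroup of `GL_n(k)` which contains a power of every elementary matrix. -/
def HasUnipotents (Γ : Subgroup (GLk k n)) : Prop :=
  ∀ (t : GLk k n) (i j : Fin n) (c : k), i ≠ j → t.val = Matrix.transvection i j c →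
    ∃ N, 0 < N ∧ t ^ N ∈ Γ

theorem IsAlgebraicRep.apply_eq_of_det_eq_one {ρ : Representation E (GLk k n) V}
    (hρ : IsAlgebraicRep ρ) {Γ : Subgroup (GLk k n)} (hΓ : HasUnipotents Γ) {w : V}
    (hw : w ∈ invariantsOf ρ (Γ : Set (GLk k n))) {g : GLk k n}
    (hg : GeneralLinearGroup.det g = 1) : ρ g w = w := by
  have hel : g ∈ elementary n k := by
    refine mem_elementary_of_det_eq_one ?_ g (congrArg Units.val hg)
    intro a b x y h
    by_cases ha : a = 0
    · refine ⟨1, ?_⟩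
      rw [ha, mul_zero, zero_add] at h
      rw [ha, zero_add, one_mul]
      exact IsUnit.of_mul_eq_one_right _ h
    · exact ⟨0, by simpa using ha⟩
  refine Submonoid.closure_induction (motive := fun g _ => ρ g w = w) ?_ ?_ ?_ hel
  · rintro t ⟨i, j, c, hij, ht⟩
    obtain ⟨N, hN, hmem⟩ := hΓ t i j c hij ht
    refine hρ.apply_eq_of_pow (isNeatElement_of_sub_one_sq ?_) hN (hw _ hmem)
    rw [ht, Matrix.transvection, add_sub_cancel_left, Matrix.single_mul_single_of_ne _ _ _ _ hij.symm]
  · simp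
  · intro a b _ _ ha hb
    rw [map_mul, Module.End.mul_apply, hb, ha]

/-- The group of all elements whose determinant is the determinant of an element of `Γ`. -/
def detSaturation (Γ : Subgroup (GLk k n)) : Subgroup (GLk k n) :=
  (Γ.map GeneralLinearGroup.det).comap GeneralLinearGroup.det

theorem IsAlgebraicRep.invariantsOf_detSaturation {ρ : Representation E (GLk k n) V}
    (hρ : IsAlgebraicRep ρ) {Γ : Subgroup (GLk k n)} (hΓ : HasUnipotents Γ) :
    invariantsOf ρ (Γ : Set (GLk k n)) = invariantsOf ρ (detSaturation Γ : Set (GLk k n)) := by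
  ext w
  constructor
  · rintro hw g ⟨γ, hγ, hdet⟩
    have : g = γ * (γ⁻¹ * g) := by group
    rw [this, map_mul, Module.End.mul_apply, hρ.apply_eq_of_det_eq_one hΓ hw, hw γ hγ]
    rw [map_mul, map_inv, hdet, inv_mul_cancel]
  · intro hw g hg
    exact hw g ⟨g, hg, rfl⟩

/-- The invariants of an arithmetic group are in perfect duality with its invariants in the dual
representation. -/
theorem IsAlgebraicRep.existsUnique_invariant [FiniteDimensional E V]
    {ρ : Representation E (GLk k n) V} (hρ : IsAlgebraicRep ρ) {Γ : Subgroup (GLk k n)}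
    (hΓ : HasUnipotents Γ) (Λ : invariantsOf ρ.dual (Γ : Set (GLk k n)) →ₗ[E] E) :
    ∃! w, w ∈ invariantsOf ρ (Γ : Set (GLk k n)) ∧
      ∀ u : invariantsOf ρ.dual (Γ : Set (GLk k n)), u.val w = Λ u := by
  have h1 := hρ.invariantsOf_detSaturation hΓ
  have h2 := hρ.dual.invariantsOf_detSaturation hΓ
  have : (detSaturation Γ).Normal := by unfold detSaturation; infer_instance
  have key := RankinSelberg.existsUnique_invariant ρ (fun S hS => hρ.exists_isCompl S hS)
    (detSaturation Γ)
    (Λ.comp (LinearEquiv.ofEq _ _ h2.symm).toLinearMap)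
  rw [h1]
  obtain ⟨w, ⟨hw1, hw2⟩, hw3⟩ := key
  refine ⟨w, ⟨hw1, fun u => ?_⟩, ?_⟩
  · exact hw2 ⟨u.val, h2 ▸ u.2⟩
  · rintro w' ⟨h3, h4⟩
    exact hw3 w' ⟨h3, fun u => h4 ⟨u.val, h2.symm ▸ u.2⟩⟩

end AlgebraicReps

end

section

variable {k : Type*} [Field k] [NumberField k]

open scoped WithZero

/-- The component of a finite adele at a prime. -/
def evalAf (q : HeightOneSpectrum (𝓞 k)) : Af k →+* q.adicCompletion k where
  toFun a := a q
  map_one' := rfl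
  map_mul' _ _ := rfl
  map_zero' := rfl
  map_add' _ _ := rfl

theorem valued_evalAf_algebraMap (q : HeightOneSpectrum (𝓞 k)) (x : k) :
    Valued.v (evalAf q (algebraMap k (Af k) x)) = q.valuation k x :=
  HeightOneSpectrum.valuedAdicCompletion_eq_valuation' q x

theorem valued_natCast_le_one (q : HeightOneSpectrum (𝓞 k)) (N : ℕ) :
    Valued.v ((N : q.adicCompletion k)) ≤ 1 := by
  have h := valued_evalAf_algebraMap q (algebraMap (𝓞 k) k (N : 𝓞 k))
  simp only [map_natCast] at h
  rw [h]
  have := q.valuation_le_one (K := k) (N : 𝓞 k)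
  simpa using this

variable (k) in
/-- The ring of integral finite adeles. -/
def intAdeles : Subring (Af k) where
  carrier := {a | ∀ q, Valued.v (evalAf q a) ≤ 1}
  one_mem' q := by simp
  mul_mem' {a b} ha hb q := by
    rw [map_mul, map_mul]
    exact mul_le_one' (ha q) (hb q)
  zero_mem' q := by simp
  add_mem' {a b} ha hb q := by
    rw [map_add]
    exact (Valuation.map_add _ _ _).trans (max_le (ha q) (hb q))
  neg_mem' {a} ha q := by
    rw [map_neg, Valuation.map_neg]
    exact ha q

theorem algebraMap_mem_intAdeles_iff {x : k} :
    algebraMap k (Af k) x ∈ intAdeles k ↔ x ∈ (algebraMap (𝓞 k) k).range := by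
  constructor
  · intro h
    refine HeightOneSpectrum.mem_integers_of_valuation_le_one k x fun q => ?_
    rw [← valued_evalAf_algebraMap]
    exact h q
  · rintro ⟨r, rfl⟩ q
    rw [valued_evalAf_algebraMap]
    exact q.valuation_le_one _

theorem isOpen_intAdeles : IsOpen (intAdeles k : Set (Af k)) := by
  have := RestrictedProduct.isOpen_forall_mem
    (R := fun q : HeightOneSpectrum (𝓞 k) => q.adicCompletion k)
    (A := fun q => (q.adicCompletionIntegers k : Set (q.adicCompletion k)))
    fun q => Valued.isOpen_valuationSubring _
  exact this

theorem valued_absNorm_le (q : HeightOneSpectrum (𝓞 k)) :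
    Valued.v (Ideal.absNorm q.asIdeal : q.adicCompletion k) ≤ WithZero.exp (-1 : ℤ) := by
  have h := valued_evalAf_algebraMap q (algebraMap (𝓞 k) k (Ideal.absNorm q.asIdeal : 𝓞 k))
  rw [q.valuation_of_algebraMap] at h
  simp only [map_natCast] at h
  rw [h]
  have := (q.intValuation_le_pow_iff_mem (Ideal.absNorm q.asIdeal : 𝓞 k) 1).2
    (by rw [pow_one]; exact Ideal.absNorm_mem _)
  simpa using this

theorem exists_nat_mul_mem_intAdeles (a : Af k) : ∃ N : ℕ, 0 < N ∧ (N : Af k) * a ∈ intAdeles k := by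
  have hfin : {q : HeightOneSpectrum (𝓞 k) | ¬ Valued.v (evalAf q a) ≤ 1}.Finite := a.2
  have hloc : ∀ q : HeightOneSpectrum (𝓞 k), ∃ N : ℕ, 0 < N ∧
      Valued.v ((N : q.adicCompletion k) * evalAf q a) ≤ 1 := by
    intro q
    obtain ⟨e, he⟩ : ∃ e : ℕ, Valued.v (evalAf q a) ≤ WithZero.exp (e : ℤ) := by
      by_cases h0 : Valued.v (evalAf q a) = 0
      · exact ⟨0, by rw [h0]; exact zero_le⟩
      · refine ⟨(WithZero.log (Valued.v (evalAf q a))).toNat, ?_⟩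
        conv_lhs => rw [← WithZero.exp_log h0]
        rw [WithZero.exp_le_exp]
        exact Int.self_le_toNat _
    refine ⟨Ideal.absNorm q.asIdeal ^ e, pow_pos (Nat.pos_of_ne_zero ?_) _, ?_⟩
    · exact Ideal.absNorm_eq_zero_iff.not.2 q.ne_bot
    rw [map_mul, Nat.cast_pow, map_pow]
    calc _ ≤ (WithZero.exp (-1 : ℤ)) ^ e * WithZero.exp (e : ℤ) :=
          mul_le_mul' (pow_le_pow_left₀ zero_le (valued_absNorm_le q) e) he
      _ = 1 := by
          rw [← WithZero.exp_nsmul, ← WithZero.exp_add]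
          simp
  classical
  choose M hM0 hM using hloc
  refine ⟨∏ q ∈ hfin.toFinset, M q, Finset.prod_pos fun q _ => hM0 q, fun q => ?_⟩
  rw [map_mul, map_natCast]
  by_cases hq : q ∈ hfin.toFinset
  · rw [← Finset.mul_prod_erase _ _ hq, Nat.cast_mul, mul_comm (M q : q.adicCompletion k), mul_assoc,
      map_mul]
    exact mul_le_one' (valued_natCast_le_one q _) (hM q)
  · rw [map_mul]
    refine mul_le_one' (valued_natCast_le_one q _) ?_
    simpa using hq

theorem isOpen_setOf_valued_le (q : HeightOneSpectrum (𝓞 k)) (e : ℤ) :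
    IsOpen {x : q.adicCompletion k | Valued.v x ≤ WithZero.exp e} := by
  obtain ⟨π, hπ⟩ := HeightOneSpectrum.valuedAdicCompletion_surjective k q (WithZero.exp e)
  have hπ0 : π ≠ 0 := by
    rintro rfl
    rw [map_zero] at hπ
    exact WithZero.exp_ne_zero hπ.symm
  have := (Valued.isOpen_integer (q.adicCompletion k)).preimage
    (f := fun x => π⁻¹ * x) (by fun_prop)
  convert! this using 1
  ext x
  change _ ↔ Valued.v (π⁻¹ * x) ≤ 1
  rw [map_mul, map_inv₀, hπ, inv_mul_le_iff₀ (by simp), mul_one]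
  rfl

/-- An integral local element is approximated by algebraic integers. -/
theorem exists_integer_sub_le (q : HeightOneSpectrum (𝓞 k)) (a : q.adicCompletion k)
    (ha : Valued.v a ≤ 1) (e : ℕ) : ∃ r : 𝓞 k,
      Valued.v (a - evalAf q (algebraMap k (Af k) (algebraMap (𝓞 k) k r))) ≤
        WithZero.exp (-(e : ℤ)) := by
  set γ : (ℤᵐ⁰)ˣ := Units.mk0 (WithZero.exp (-(e : ℤ))) WithZero.exp_ne_zero
  have hγ : (γ : ℤᵐ⁰) = WithZero.exp (-(e : ℤ)) := rfl
  have hopen : IsOpen {x : q.adicCompletion k | Valued.v (a - x) ≤ WithZero.exp (-(e : ℤ))} :=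
    (isOpen_setOf_valued_le q (-(e : ℤ))).preimage (f := fun x => a - x) (by fun_prop)
  obtain ⟨x, hx⟩ := (HeightOneSpectrum.denseRange_algebraMap k q).exists_mem_open hopen
    ⟨a, by simp⟩
  have hx' : Valued.v (a - evalAf q (algebraMap k (Af k) x)) ≤ WithZero.exp (-(e : ℤ)) := hx
  have hx1 : q.valuation k x ≤ 1 := by
    rw [← valued_evalAf_algebraMap]
    have h2 : evalAf q (algebraMap k (Af k) x) = a - (a - evalAf q (algebraMap k (Af k) x)) := by ring
    rw [h2]
    refine (Valuation.map_sub _ _ _).trans (max_le ha (hx'.trans ?_))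
    rw [← WithZero.exp_zero, WithZero.exp_le_exp]
    omega
  obtain ⟨r, hr⟩ := q.exists_valuation_sub_lt_of_integer hx1 γ
  refine ⟨r, ?_⟩
  have h3 : a - evalAf q (algebraMap k (Af k) (algebraMap (𝓞 k) k r))
      = (a - evalAf q (algebraMap k (Af k) x)) -
        evalAf q (algebraMap k (Af k) (algebraMap (𝓞 k) k r - x)) := by
    simp only [map_sub]
    ring
  rw [h3]
  refine (Valuation.map_sub _ _ _).trans (max_le hx' ?_)
  rw [valued_evalAf_algebraMap, ← hγ]
  exact hr.le

/-- Integral adeles are congruent to algebraic integers modulo `N`. -/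
theorem exists_integer_sub_mem {a : Af k} (ha : a ∈ intAdeles k) {N : ℕ} (hN : 0 < N) :
    ∃ (r : 𝓞 k), ∃ b ∈ intAdeles k, a = algebraMap k (Af k) (algebraMap (𝓞 k) k r) + N * b := by
  have hN0 : (N : 𝓞 k) ≠ 0 := Nat.cast_ne_zero.2 hN.ne'
  have hNk : (N : k) ≠ 0 := Nat.cast_ne_zero.2 hN.ne'
  have hNq : ∀ q : HeightOneSpectrum (𝓞 k),
      Valued.v ((N : q.adicCompletion k)) = q.intValuation (N : 𝓞 k) := by
    intro q
    have h := valued_evalAf_algebraMap q (algebraMap (𝓞 k) k (N : 𝓞 k))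
    rw [q.valuation_of_algebraMap] at h
    simpa using h
  have hfin : {q : HeightOneSpectrum (𝓞 k) | q.intValuation (N : 𝓞 k) < 1}.Finite := by
    simp_rw [HeightOneSpectrum.intValuation_lt_one_iff_dvd]
    exact Ideal.finite_factors (by simpa using hN0)
  have hex : ∀ q : HeightOneSpectrum (𝓞 k), ∃ e : ℕ,
      WithZero.exp (-(e : ℤ)) ≤ q.intValuation (N : 𝓞 k) := by
    intro q
    refine ⟨(-WithZero.log (q.intValuation (N : 𝓞 k))).toNat, ?_⟩
    conv_rhs => rw [← WithZero.exp_log (q.intValuation_ne_zero _ hN0)]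
    rw [WithZero.exp_le_exp]
    have := Int.self_le_toNat (-WithZero.log (q.intValuation (N : 𝓞 k)))
    omega
  choose e he using hex
  choose r hr using fun q => exists_integer_sub_le q (evalAf q a) (ha q) (e q)
  obtain ⟨y, hy⟩ := IsDedekindDomain.exists_forall_sub_mem_ideal (s := hfin.toFinset)
    (fun q : HeightOneSpectrum (𝓞 k) => q.asIdeal) e (fun q _ => q.prime)
    (fun i _ j _ hij h => hij (HeightOneSpectrum.ext h)) fun q => r q
  have hNinv : (N : Af k) * algebraMap k (Af k) (N : k)⁻¹ = 1 := by
    rw [← map_natCast (algebraMap k (Af k)), ← map_mul, mul_inv_cancel₀ hNk, map_one]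
  refine ⟨y, algebraMap k (Af k) (N : k)⁻¹ * (a - algebraMap k (Af k) (algebraMap (𝓞 k) k y)), ?_,
    by rw [← mul_assoc, hNinv]; ring⟩
  intro q
  have h1 : Valued.v (evalAf q a - evalAf q (algebraMap k (Af k) (algebraMap (𝓞 k) k y))) ≤
      Valued.v (N : q.adicCompletion k) := by
    rw [hNq]
    by_cases hq : q ∈ hfin.toFinset
    · have h2 := hy q hq
      rw [← HeightOneSpectrum.intValuation_le_pow_iff_mem,
        ← HeightOneSpectrum.valuation_of_algebraMap (K := k), ← valued_evalAf_algebraMap] at h2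
      have h3 : evalAf q a - evalAf q (algebraMap k (Af k) (algebraMap (𝓞 k) k y))
        = (evalAf q a - evalAf q (algebraMap k (Af k) (algebraMap (𝓞 k) k (r q)))) -
          evalAf q (algebraMap k (Af k) (algebraMap (𝓞 k) k (y - r q))) := by
        simp only [map_sub]
        ring
      rw [h3]
      exact (Valuation.map_sub _ _ _).trans (max_le ((hr q).trans (he q)) (h2.trans (he q)))
    · have h2 : q.intValuation (N : 𝓞 k) = 1 := by
        refine le_antisymm (q.intValuation_le_one _) ?_
        simpa using hq
      rw [h2]
      refine (Valuation.map_sub _ _ _).trans (max_le (ha q) ?_)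
      rw [valued_evalAf_algebraMap]
      exact q.valuation_le_one _
  have h4 : Valued.v (evalAf q (algebraMap k (Af k) (N : k)⁻¹)) * Valued.v (N : q.adicCompletion k)
      = 1 := by
    rw [← map_mul, ← map_natCast (evalAf q), ← map_mul, mul_comm, hNinv, map_one, map_one]
  rw [map_mul, map_mul, map_sub, ← h4]
  exact mul_le_mul_right h1 _

/-- Every finite adele is congruent modulo `N` times the integral adeles to an element of `k`. -/
theorem exists_sub_mem_nat_mul (a : Af k) {N : ℕ} (hN : 0 < N) :
    ∃ (x : k), ∃ b ∈ intAdeles k, a = algebraMap k (Af k) x + N * b := by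
  obtain ⟨M, hM, ha⟩ := exists_nat_mul_mem_intAdeles a
  obtain ⟨r, b, hb, h⟩ := exists_integer_sub_mem ha (Nat.mul_pos hM hN)
  have hMk : (M : k) ≠ 0 := Nat.cast_ne_zero.2 hM.ne'
  have hMinv : algebraMap k (Af k) (M : k)⁻¹ * (M : Af k) = 1 := by
    rw [← map_natCast (algebraMap k (Af k)), ← map_mul, inv_mul_cancel₀ hMk, map_one]
  refine ⟨(M : k)⁻¹ * algebraMap (𝓞 k) k r, b, hb, ?_⟩
  calc a = algebraMap k (Af k) (M : k)⁻¹ * (M * a) := by rw [← mul_assoc, hMinv, one_mul]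
    _ = _ := by
      rw [h, Nat.cast_mul, map_mul]
      linear_combination (N * b : Af k) * hMinv

/-- The multiples of the integral adeles form a basis of neighbourhoods of zero. -/
theorem exists_nat_mul_subset_of_mem_nhds {U : Set (Af k)} (hU : U ∈ nhds (0 : Af k)) :
    ∃ N : ℕ, 0 < N ∧ ∀ a ∈ intAdeles k, (N : Af k) * a ∈ U := by
  have h0 := RestrictedProduct.nhds_zero_eq_map_structureMap
    (R := fun q : HeightOneSpectrum (𝓞 k) => q.adicCompletion k)
    (B := fun q => q.adicCompletionIntegers k)
    fun q => Valued.isOpen_valuationSubring _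
  have hU' : U ∈ Filter.map (RestrictedProduct.structureMap
    (fun q : HeightOneSpectrum (𝓞 k) => q.adicCompletion k)
    (fun q => (q.adicCompletionIntegers k : Set (q.adicCompletion k))) Filter.cofinite) (nhds 0) := by
    rw [← h0]
    exact hU
  replace hU' := Filter.mem_map.1 hU'
  rw [nhds_pi, Filter.mem_pi] at hU'
  obtain ⟨I, hI, t, ht, hsub⟩ := hU'
  have hloc : ∀ q : HeightOneSpectrum (𝓞 k), ∃ N : ℕ, 0 < N ∧ ∀ (M : ℕ)
      (a : q.adicCompletionIntegers k), ((N * M : ℕ) : q.adicCompletionIntegers k) * a ∈ t q := by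
    intro q
    have h1 := ht q
    rw [Pi.zero_apply, nhds_subtype_eq_comap, Filter.mem_comap] at h1
    obtain ⟨s, hs, hst⟩ := h1
    obtain ⟨γ', hγ'⟩ := (Valued.mem_nhds_zero).1 hs
    obtain ⟨γ, hγ⟩ : ∃ γ : (ℤᵐ⁰)ˣ, {x : q.adicCompletion k | Valued.v x < (γ : ℤᵐ⁰)} ⊆ s := by
      refine ⟨Units.map (MonoidWithZeroHom.ValueGroup₀.embedding
        (f := .ofClass (Valued.v (R := q.adicCompletion k)))).toMonoidHom γ', fun x hx => hγ' ?_⟩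
      exact (Valuation.restrict_lt_iff_lt_embedding _).2 hx
    obtain ⟨e, he⟩ : ∃ e : ℕ, WithZero.exp (-(e : ℤ)) < (γ : ℤᵐ⁰) := by
      refine ⟨(-WithZero.log (γ : ℤᵐ⁰) + 1).toNat, ?_⟩
      conv_rhs => rw [← WithZero.exp_log (Units.ne_zero γ)]
      rw [WithZero.exp_lt_exp]
      have := Int.self_le_toNat (-WithZero.log (γ : ℤᵐ⁰) + 1)
      omega
    refine ⟨Ideal.absNorm q.asIdeal ^ e, pow_pos (Nat.pos_of_ne_zero ?_) _, fun M a => hst ?_⟩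
    · exact Ideal.absNorm_eq_zero_iff.not.2 q.ne_bot
    refine hγ ?_
    simp only [Set.mem_ofPred_eq, Nat.cast_mul, Nat.cast_pow, MulMemClass.coe_mul,
      SubmonoidClass.coe_pow, map_mul, map_pow]
    refine lt_of_le_of_lt ?_ he
    calc _ ≤ (WithZero.exp (-1 : ℤ)) ^ e * 1 * 1 :=
          mul_le_mul' (mul_le_mul' (pow_le_pow_left₀ zero_le (valued_absNorm_le q) e) (valued_natCast_le_one q M)) a.2
      _ = _ := by
          rw [← WithZero.exp_nsmul]
          simp
  classical
  choose M hM0 hM using hloc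
  refine ⟨∏ q ∈ hI.toFinset, M q, Finset.prod_pos fun q _ => hM0 q, fun a ha => ?_⟩
  have hmem := hsub (a := fun q => ((∏ q ∈ hI.toFinset, M q : ℕ) : q.adicCompletionIntegers k) *
    ⟨evalAf q a, ha q⟩) (by
      intro q hq
      have := hM q (∏ q' ∈ hI.toFinset.erase q, M q') ⟨evalAf q a, ha q⟩
      rw [Finset.mul_prod_erase hI.toFinset M (hI.mem_toFinset.2 hq)] at this
      exact this)
  convert! hmem using 1

theorem denseRange_algebraMap_Af : DenseRange (algebraMap k (Af k)) := by
  intro a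
  rw [mem_closure_iff_nhds]
  intro U hU
  have h1 : (fun b => a - b) ⁻¹' U ∈ nhds (0 : Af k) := by
    refine (Continuous.continuousAt (by fun_prop)).preimage_mem_nhds ?_
    simpa using hU
  obtain ⟨N, hN, hsub⟩ := exists_nat_mul_subset_of_mem_nhds h1
  obtain ⟨x, b, hb, h⟩ := exists_sub_mem_nat_mul a hN
  refine ⟨algebraMap k (Af k) x, ?_, x, rfl⟩
  have := hsub b hb
  rw [Set.mem_preimage, h] at this
  simpa using this

end

section

variable {k : Type*} [Field k] [NumberField k]

/-- The ring of finite adeles has stable range one. -/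
theorem exists_isUnit_add_mul_Af (a b x y : Af k) (hab : x * a + y * b = 1) :
    ∃ t, IsUnit (a + t * b) := by
  classical
  let P : HeightOneSpectrum (𝓞 k) → Prop := fun q =>
    Valued.v (evalAf q a) = 1 ∨ (evalAf q a ≠ 0 ∧ Valued.v (evalAf q (a + b)) ≠ 1)
  let t : Af k := ⟨fun q => if P q then 0 else 1, by
    refine Filter.Eventually.of_forall fun q => ?_
    simp only [SetLike.mem_coe]
    split_ifs
    · exact zero_mem _
    · exact one_mem _⟩
  have ht : ∀ q, evalAf q t = if P q then 0 else 1 := fun q => rfl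
  have hloc : ∀ q, evalAf q x * evalAf q a + evalAf q y * evalAf q b = 1 := by
    intro q
    rw [← map_mul, ← map_mul, ← map_add, hab, map_one]
  refine ⟨t, FiniteAdeleRing.isUnit_iff.2 ⟨fun q => ?_, ?_⟩⟩
  · change evalAf q (a + t * b) ≠ 0
    rw [map_add, map_mul, ht]
    split_ifs with hP
    · rw [zero_mul, add_zero]
      rcases hP with hP | hP
      · intro h
        simp [h] at hP
      · exact hP.1
    · rw [one_mul]
      simp only [P, not_or, not_and_or, not_not] at hP
      rcases hP.2 with h | h
      · rw [h, zero_add]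
        intro h'
        have := hloc q
        simp [h, h'] at this
      · intro h'
        rw [map_add, h', map_zero] at h
        exact zero_ne_one h
  · have hint : ∀ c : Af k, ∀ᶠ q in Filter.cofinite, Valued.v (evalAf q c) ≤ 1 := fun c => c.2
    filter_upwards [hint a, hint b, hint x, hint y] with q ha hb hx hy
    change Valued.v (evalAf q (a + t * b)) = 1
    rw [map_add, map_mul, ht]
    have key : Valued.v (evalAf q a) ≠ 1 → Valued.v (evalAf q (a + b)) = 1 := by
      intro h
      have ha' := lt_of_le_of_ne ha h
      have hb' : Valued.v (evalAf q b) = 1 := by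
        refine le_antisymm hb (not_lt.1 fun hb' => ?_)
        have := congrArg Valued.v (hloc q)
        rw [map_one] at this
        refine absurd this (ne_of_lt (lt_of_le_of_lt (Valuation.map_add _ _ _) (max_lt ?_ ?_)))
        · rw [map_mul]
          exact lt_of_le_of_lt (mul_le_of_le_one_left' hx) ha'
        · rw [map_mul]
          exact lt_of_le_of_lt (mul_le_of_le_one_left' hy) hb'
      rw [map_add, Valuation.map_add_eq_of_lt_right _ (by rwa [hb']), hb']
    split_ifs with hP
    · rw [zero_mul, add_zero]
      rcases hP with hP | hP
      · exact hP
      · by_contra h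
        exact hP.2 (key h)
    · rw [one_mul, ← map_add]
      simp only [P, not_or] at hP
      exact key hP.1

/-- An open neighbourhood of one contains a principal congruence set. -/
theorem exists_congruence_subset {m : ℕ} {W : Set (GLf k m)} (hW : W ∈ nhds (1 : GLf k m)) :
    ∃ N : ℕ, 0 < N ∧ ∀ g : GLf k m,
      (∀ i j, ∃ b ∈ intAdeles k, g.val i j = (1 : Matrix (Fin m) (Fin m) (Af k)) i j + N * b) →
      (∀ i j, ∃ b ∈ intAdeles k, (g⁻¹).val i j = (1 : Matrix (Fin m) (Fin m) (Af k)) i j + N * b) →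
      g ∈ W := by
  have hmat : ∀ {V : Set (Fin m → Fin m → Af k)},
      V ∈ nhds (fun i j => (1 : Matrix (Fin m) (Fin m) (Af k)) i j) → ∃ N : ℕ, 0 < N ∧
      ∀ (M : ℕ) (A : Fin m → Fin m → Af k),
        (∀ i j, ∃ b ∈ intAdeles k, A i j = (1 : Matrix (Fin m) (Fin m) (Af k)) i j +
          ((N * M : ℕ) : Af k) * b) → A ∈ V := by
    intro V hV
    rw [nhds_pi, Filter.mem_pi'] at hV
    obtain ⟨I, t, ht, hsub⟩ := hV
    have hrow : ∀ i, ∃ N : ℕ, 0 < N ∧ ∀ (M : ℕ) (A : Fin m → Af k),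
        (∀ j, ∃ b ∈ intAdeles k, A j = (1 : Matrix (Fin m) (Fin m) (Af k)) i j +
          ((N * M : ℕ) : Af k) * b) → A ∈ t i := by
      intro i
      have hi := ht i
      rw [nhds_pi, Filter.mem_pi'] at hi
      obtain ⟨I', t', ht', hsub'⟩ := hi
      have hent : ∀ j, ∃ N : ℕ, 0 < N ∧ ∀ b ∈ intAdeles k,
          (1 : Matrix (Fin m) (Fin m) (Af k)) i j + (N : Af k) * b ∈ t' j := by
        intro j
        have h1 : (fun b => (1 : Matrix (Fin m) (Fin m) (Af k)) i j + b) ⁻¹' (t' j) ∈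
            nhds (0 : Af k) := by
          refine (Continuous.continuousAt (by fun_prop)).preimage_mem_nhds ?_
          simpa using ht' j
        exact exists_nat_mul_subset_of_mem_nhds h1
      choose N hN hN' using hent
      refine ⟨∏ j, N j, Finset.prod_pos fun j _ => hN j, fun M A hA => hsub' fun j _ => ?_⟩
      obtain ⟨b, hb, h⟩ := hA j
      rw [h]
      have := hN' j (((∏ j' ∈ Finset.univ.erase j, N j' : ℕ) * M : ℕ) * b)
        (mul_mem (natCast_mem _ _) hb)
      convert! this using 2
      rw [← Finset.mul_prod_erase _ _ (Finset.mem_univ j)]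
      push_cast
      ring
    choose N hN hN' using hrow
    refine ⟨∏ i, N i, Finset.prod_pos fun j _ => hN j, fun M A hA => hsub fun i _ => ?_⟩
    refine hN' i ((∏ i' ∈ Finset.univ.erase i, N i') * M) (A i) fun j => ?_
    rw [← mul_assoc, Finset.mul_prod_erase _ _ (Finset.mem_univ i)]
    exact hA i j
  rw [Units.isEmbedding_embedProduct.nhds_eq_comap, Filter.mem_comap] at hW
  obtain ⟨V, hV, hVW⟩ := hW
  rw [map_one, Prod.one_eq_mk, nhds_prod_eq, Filter.mem_prod_iff] at hV
  obtain ⟨V₁, hV₁, V₂, hV₂, hV⟩ := hV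
  obtain ⟨N₁, hN₁, h₁⟩ := hmat hV₁
  have hV₂' : MulOpposite.op ⁻¹' V₂ ∈ nhds (1 : Matrix (Fin m) (Fin m) (Af k)) :=
    MulOpposite.continuous_op.continuousAt.preimage_mem_nhds (by simpa using hV₂)
  obtain ⟨N₂, hN₂, h₂⟩ := hmat hV₂'
  refine ⟨N₁ * N₂, Nat.mul_pos hN₁ hN₂, fun g hg hg' => hVW (hV ⟨h₁ N₂ _ hg, ?_⟩)⟩
  refine h₂ N₁ _ fun i j => ?_
  rw [mul_comm]
  exact hg' i j

theorem map_transvection_val {m : ℕ} {R S : Type*} [CommRing R] [CommRing S] (f : R →+* S)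
    (i j : Fin m) (c : R) :
    (Matrix.transvection i j c).map f = Matrix.transvection i j (f c) := by
  ext a b
  simp only [Matrix.transvection, Matrix.map_apply, Matrix.add_apply, Matrix.one_apply,
    Matrix.single_apply, map_add]
  split_ifs <;> simp

/-- Strong approximation for `SL_m`. -/
theorem exists_toFin_mem_of_det_eq_one {m : ℕ} (W : Subgroup (GLf k m))
    (hW : IsOpen (W : Set (GLf k m))) (g : GLf k m) (hg : GeneralLinearGroup.det g = 1) :
    ∃ γ : GLk k m, GeneralLinearGroup.det γ = 1 ∧ g⁻¹ * toFin γ ∈ W := by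
  let H : Subgroup (GLf k m) := (MonoidHom.ker (GeneralLinearGroup.det (R := k) (n := Fin m))).map toFin
  have key : g ∈ H.topologicalClosure := by
    have hmem := mem_elementary_of_det_eq_one exists_isUnit_add_mul_Af g
      (by rw [← GeneralLinearGroup.val_det_apply, hg]; rfl)
    refine Submonoid.closure_induction (motive := fun g _ => g ∈ H.topologicalClosure) ?_ (one_mem _)
      (fun _ _ _ _ => mul_mem) hmem
    rintro t ⟨i, j, c, hij, ht⟩
    let T : Af k → GLf k m := fun c => ⟨Matrix.transvection i j c, Matrix.transvection i j (-c),
      by rw [Matrix.transvection_mul_transvection_same i j hij]; simp,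
      by rw [Matrix.transvection_mul_transvection_same i j hij]; simp⟩
    have hT : Continuous T := by
      have h1 : Continuous fun c : Af k => (Matrix.transvection i j c : Matrix (Fin m) (Fin m) (Af k)) := by
        refine continuous_matrix fun a b => ?_
        simp only [Matrix.transvection, Matrix.add_apply, Matrix.single_apply]
        split_ifs <;> fun_prop
      exact Units.continuous_iff.2 ⟨h1, h1.comp continuous_neg⟩
    have htT : t = T c := Units.ext ht
    rw [htT]
    have hsub : T '' (closure (Set.range (algebraMap k (Af k)))) ⊆ closure (H : Set (GLf k m)) := by
      refine (image_closure_subset_closure_image hT).trans (closure_mono ?_)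
      rintro _ ⟨_, ⟨x, rfl⟩, rfl⟩
      refine ⟨⟨Matrix.transvection i j x, Matrix.transvection i j (-x),
        by rw [Matrix.transvection_mul_transvection_same i j hij]; simp,
        by rw [Matrix.transvection_mul_transvection_same i j hij]; simp⟩, ?_, ?_⟩
      · refine MonoidHom.mem_ker.2 (Units.ext ?_)
        simp [Matrix.det_transvection_of_ne i j hij]
      · refine Units.ext ?_
        exact map_transvection_val _ _ _ _
    exact hsub ⟨c, denseRange_algebraMap_Af c, rfl⟩
  have hopen : IsOpen ((fun x => g⁻¹ * x) ⁻¹' (W : Set (GLf k m))) := hW.preimage (by fun_prop)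
  obtain ⟨_, h1, γ, hγ, rfl⟩ := mem_closure_iff.1 key _ hopen (by simp)
  exact ⟨γ, hγ, h1⟩

end

section

variable {k : Type*} [Field k] [NumberField k]

theorem mem_conjLevel {m : ℕ} {g x : GLf k m} {L : Subgroup (GLf k m)} :
    x ∈ conjLevel g L ↔ g⁻¹ * x * g ∈ L := by
  constructor
  · rintro ⟨y, hy, rfl⟩
    simpa [MulAut.conj_apply, mul_assoc] using hy
  · intro h
    exact ⟨_, h, by simp [MulAut.conj_apply, mul_assoc]⟩

theorem mem_arithGroup {m : ℕ} {L : Subgroup (GLf k m)} {c : (Af k)ˣ} {γ : GLk k m} :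
    γ ∈ arithGroup L c ↔ toInf γ ∈ posGL k m ∧ (dElt c)⁻¹ * toFin γ * dElt c ∈ L := by
  rw [arithGroup, Subgroup.mem_inf, Subgroup.mem_comap, Subgroup.mem_comap, mem_conjLevel]

theorem arithGroup_mono {m : ℕ} {L L' : Subgroup (GLf k m)} (h : L ≤ L') (c : (Af k)ˣ) :
    arithGroup L c ≤ arithGroup L' c := fun _ hγ =>
  mem_arithGroup.2 ⟨(mem_arithGroup.1 hγ).1, h (mem_arithGroup.1 hγ).2⟩

theorem isOpen_conjLevel {m : ℕ} (g : GLf k m) {L : Subgroup (GLf k m)}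
    (hL : IsOpen (L : Set (GLf k m))) : IsOpen (conjLevel g L : Set (GLf k m)) := by
  have : (conjLevel g L : Set (GLf k m)) = (fun x => g⁻¹ * x * g) ⁻¹' L := by
    ext x
    exact mem_conjLevel
  rw [this]
  exact hL.preimage (by fun_prop)

theorem isCompact_conjLevel {m : ℕ} (g : GLf k m) {L : Subgroup (GLf k m)}
    (hL : IsCompact (L : Set (GLf k m))) : IsCompact (conjLevel g L : Set (GLf k m)) := by
  have : (conjLevel g L : Set (GLf k m)) = (fun x => g * x * g⁻¹) '' L := rfl
  rw [this]
  exact hL.image (by fun_prop)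

theorem isLevel_conjLevel {m : ℕ} (g : GLf k m) {L : Subgroup (GLf k m)} (hL : IsLevel L) :
    IsLevel (conjLevel g L) where
  isOpen := isOpen_conjLevel g hL.isOpen
  isCompact := isCompact_conjLevel g hL.isCompact
  isNeat x γ h := hL.isNeat (x * g) γ (by
    rw [mem_conjLevel] at h
    simpa [mul_assoc] using h)

theorem IsLevel.of_le {m : ℕ} {L L' : Subgroup (GLf k m)} (hL : IsLevel L) (h : L' ≤ L)
    (hL' : IsOpen (L' : Set (GLf k m))) : IsLevel L' where
  isOpen := hL'
  isCompact := hL.isCompact.of_isClosed_subset (L'.isClosed_of_isOpen hL') h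
  isNeat x γ hx := hL.isNeat x γ (h hx)

theorem continuous_jEmb_of_ring {n : ℕ} {R : Type*} [CommRing R] [TopologicalSpace R]
    [IsTopologicalRing R] : Continuous (jEmb : GL (Fin n) R → GL (Fin (n + 1)) R) := by
  refine Continuous.units_map _ ?_
  change Continuous fun A : Matrix (Fin n) (Fin n) R =>
    (fromBlocks A 0 0 (1 : Matrix (Fin 1) (Fin 1) R)).submatrix
      finSumFinEquiv.symm finSumFinEquiv.symm
  exact (continuous_id.matrix_fromBlocks continuous_const continuous_const
    continuous_const).matrix_submatrix _ _

theorem isLevel_diagLevel {n : ℕ} {K : Subgroup (GLf k (n + 1))} {K' : Subgroup (GLf k n)}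
    (hK : IsLevel K) (hK' : IsLevel K') (h : GLf k (n + 1)) (h' : GLf k n) :
    IsLevel (diagLevel K K' h h') := by
  refine (isLevel_conjLevel h' hK').of_le inf_le_right ?_
  exact ((isOpen_conjLevel h hK.isOpen).preimage continuous_jEmb_of_ring).inter
    (isOpen_conjLevel h' hK'.isOpen)

theorem relIndex_ne_zero_of_isOpen {G : Type*} [Group G] [TopologicalSpace G] [IsTopologicalGroup G]
    {H L : Subgroup G} (hH : IsOpen (H : Set G)) (hL : IsCompact (L : Set G)) : H.relIndex L ≠ 0 := by
  have : CompactSpace L := isCompact_iff_compactSpace.1 hL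
  have h1 : IsOpen ((H.subgroupOf L : Subgroup L) : Set L) := hH.preimage continuous_subtype_val
  have := Subgroup.quotient_finite_of_isOpen _ h1
  exact Subgroup.index_ne_zero_of_finite

theorem relIndex_arithGroup_ne_zero {m : ℕ} {L L' : Subgroup (GLf k m)}
    (hL : IsCompact (L : Set (GLf k m))) (hL' : IsOpen (L' : Set (GLf k m))) (c : (Af k)ˣ) :
    (arithGroup L' c).relIndex (arithGroup L c) ≠ 0 := by
  have h1 : (conjLevel (dElt c) L').relIndex (conjLevel (dElt c) L) ≠ 0 :=
    relIndex_ne_zero_of_isOpen (isOpen_conjLevel _ hL') (isCompact_conjLevel _ hL)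
  have h2 := Subgroup.relIndex_comap_ne_zero (toFin (k := k) (m := m)) h1
  have h3 : arithGroup L' c ⊓ arithGroup L c =
    ((conjLevel (dElt c) L').comap toFin) ⊓ arithGroup L c := by
    ext γ
    simp only [arithGroup, Subgroup.mem_inf]
    tauto
  rw [← Subgroup.inf_relIndex_right, h3, Subgroup.inf_relIndex_right]
  exact fun h => h2 (Subgroup.relIndex_eq_zero_of_le_right inf_le_right h)

theorem val_dElt {m : ℕ} {R : Type*} [CommRing R] (c : Rˣ) :
    (dElt c : GL (Fin m) R).val = Matrix.diagonal fun i => if i.val = 0 then (c : R) else 1 := by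
  ext i j
  simp only [dElt, diagGL, Units.coe_map]
  change Matrix.diagonal (fun i => ((if i.val = 0 then c else 1 : Rˣ) : R)) i j = _
  simp only [Matrix.diagonal_apply]
  split_ifs <;> simp

theorem dElt_mul {m : ℕ} {R : Type*} [CommRing R] (c d : Rˣ) :
    (dElt (c * d) : GL (Fin m) R) = dElt c * dElt d := by
  ext i j
  rw [Units.val_mul, val_dElt, val_dElt, val_dElt, Matrix.diagonal_mul_diagonal]
  simp only [Matrix.diagonal_apply]
  split_ifs <;> simp

theorem dElt_one {m : ℕ} {R : Type*} [CommRing R] : (dElt (1 : Rˣ) : GL (Fin m) R) = 1 := by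
  ext i j
  rw [val_dElt]
  simp [Matrix.diagonal_apply, Matrix.one_apply]

theorem dElt_inv {m : ℕ} {R : Type*} [CommRing R] (c : Rˣ) :
    (dElt c⁻¹ : GL (Fin m) R) = (dElt c)⁻¹ := by
  rw [eq_inv_iff_mul_eq_one, ← dElt_mul, inv_mul_cancel, dElt_one]

theorem det_dElt {m : ℕ} {R : Type*} [CommRing R] (hm : 1 ≤ m) (c : Rˣ) :
    GeneralLinearGroup.det (dElt c : GL (Fin m) R) = c := by
  ext
  rw [GeneralLinearGroup.val_det_apply, val_dElt, Matrix.det_diagonal]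
  rw [Finset.prod_eq_single (⟨0, hm⟩ : Fin m)]
  · simp
  · intro b _ hb
    rw [if_neg fun h => hb (Fin.ext h)]
  · simp

theorem map_dElt {m : ℕ} {R S : Type*} [CommRing R] [CommRing S] (f : R →+* S) (c : Rˣ) :
    GeneralLinearGroup.map f (dElt c : GL (Fin m) R) = dElt (Units.map f.toMonoidHom c) := by
  ext i j
  rw [GeneralLinearGroup.map_apply, val_dElt, val_dElt]
  simp only [Matrix.diagonal_apply]
  split_ifs <;> simp

theorem det_map {m : ℕ} {R S : Type*} [CommRing R] [CommRing S] (f : R →+* S) (g : GL (Fin m) R) :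
    GeneralLinearGroup.det (GeneralLinearGroup.map f g) =
      Units.map f.toMonoidHom (GeneralLinearGroup.det g) := by
  ext
  exact (RingHom.map_det f g.val).symm

theorem det_toFin {m : ℕ} (γ : GLk k m) : GeneralLinearGroup.det (toFin γ) =
    (principal k (GeneralLinearGroup.det γ)).2 := det_map _ _

theorem det_toInf {m : ℕ} (γ : GLk k m) : GeneralLinearGroup.det (toInf γ) =
    (principal k (GeneralLinearGroup.det γ)).1 := det_map _ _

theorem toInf_mem_posGL {m : ℕ} {γ : GLk k m} :
    toInf γ ∈ posGL k m ↔ (principal k (GeneralLinearGroup.det γ)).1 ∈ posUnits k := by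
  rw [posGL, Subgroup.mem_comap, det_toInf]

/-- Strong approximation in the form of a transitivity statement. -/
theorem exists_toFin_conj_mem {m : ℕ} (hm : 1 ≤ m) {L : Subgroup (GLf k m)}
    (hL : IsOpen (L : Set (GLf k m))) (δ : kˣ) (x x' : (Af k)ˣ)
    (hx : x⁻¹ * (principal k δ).2⁻¹ * x' ∈ detLevel L) :
    ∃ γ : GLk k m, GeneralLinearGroup.det γ = δ ∧ (dElt x')⁻¹ * toFin γ * dElt x ∈ L := by
  obtain ⟨b, hb, hbd⟩ := hx
  let g : GLf k m := dElt x' * b⁻¹ * (dElt x)⁻¹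
  have hδ : toFin (dElt δ : GLk k m) = dElt (principal k δ).2 := map_dElt _ _
  obtain ⟨γ₁, h1, h2⟩ := exists_toFin_mem_of_det_eq_one (conjLevel (dElt x) L)
    (isOpen_conjLevel _ hL) ((toFin (dElt δ))⁻¹ * g) (by
      simp only [g, map_mul, map_inv, hδ, det_dElt hm, hbd]
      group)
  refine ⟨dElt δ * γ₁, by rw [map_mul, h1, det_dElt hm, mul_one], ?_⟩
  rw [mem_conjLevel] at h2
  have h3 : (dElt x')⁻¹ * toFin (dElt δ * γ₁) * dElt x =
    b⁻¹ * ((dElt x)⁻¹ * (((toFin (dElt δ))⁻¹ * g)⁻¹ * toFin γ₁) * dElt x) := by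
    simp only [g, map_mul]
    group
  rw [h3]
  exact mul_mem (inv_mem hb) h2

/-- The determinant maps the arithmetic group onto the group of units. -/
theorem map_det_arithGroup {m : ℕ} (hm : 1 ≤ m) {L : Subgroup (GLf k m)}
    (hL : IsOpen (L : Set (GLf k m))) (x : (Af k)ˣ) :
    (arithGroup L x).map GeneralLinearGroup.det = unitGroup L := by
  ext ε
  constructor
  · rintro ⟨γ, hγ, rfl⟩
    obtain ⟨h1, h2⟩ := mem_arithGroup.1 hγ
    refine ⟨toInf_mem_posGL.1 h1, ?_⟩
    refine ⟨_, h2, ?_⟩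
    simp only [map_mul, map_inv, det_toFin]
    rw [mul_right_comm, inv_mul_cancel, one_mul]
  · intro hε
    obtain ⟨γ, hγ, h⟩ := exists_toFin_conj_mem hm hL ε x x (by
      have : x⁻¹ * (principal k ε).2⁻¹ * x = ((principal k ε).2)⁻¹ := by
        rw [mul_right_comm, inv_mul_cancel, one_mul]
      rw [this]
      exact inv_mem hε.2)
    exact ⟨γ, mem_arithGroup.2 ⟨toInf_mem_posGL.2 (by rw [hγ]; exact hε.1), h⟩, hγ⟩

theorem conj_transvection {m : ℕ} {R : Type*} [CommRing R] (D : GL (Fin m) R) (d e : Fin m → R)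
    (hD : D.val = Matrix.diagonal d) (hD' : (D⁻¹).val = Matrix.diagonal e) (i j : Fin m) (c : R) :
    (D⁻¹).val * Matrix.transvection i j c * D.val = Matrix.transvection i j (e i * c * d j) := by
  rw [Matrix.transvection, mul_add, mul_one, add_mul, ← Units.val_mul, inv_mul_cancel, Units.val_one,
    Matrix.transvection, hD, hD']
  congr 1
  ext a b
  rw [Matrix.mul_diagonal, Matrix.diagonal_mul, Matrix.single_apply, Matrix.single_apply]
  split_ifs with h
  · rw [h.1, h.2]
  · simp

theorem hasUnipotents_arithGroup {m : ℕ} {L : Subgroup (GLf k m)}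
    (hL : IsOpen (L : Set (GLf k m))) (x : (Af k)ˣ) : HasUnipotents (arithGroup L x) := by
  intro t i j c hij ht
  obtain ⟨N, hN, hsub⟩ := exists_congruence_subset (hL.mem_nhds (one_mem L))
  set D : GLf k m := dElt x
  let f : Fin m → Af k := fun i => if i.val = 0 then (x : Af k) else 1
  let e : Fin m → Af k := fun i => if i.val = 0 then ((x⁻¹ : (Af k)ˣ) : Af k) else 1
  have hD : D.val = Matrix.diagonal f := val_dElt x
  have hD' : (D⁻¹).val = Matrix.diagonal e := by
    rw [← dElt_inv]
    exact val_dElt x⁻¹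
  set c' : Af k := e i * algebraMap k (Af k) c * f j
  obtain ⟨M, hM, hM'⟩ := exists_nat_mul_mem_intAdeles c'
  have hpow : ∀ r : ℕ, (t ^ r).val = Matrix.transvection i j (r * c) := by
    intro r
    induction r with
    | zero => simp
    | succ r ih =>
      rw [pow_succ, Units.val_mul, ih, ht, Matrix.transvection_mul_transvection_same i j hij]
      push_cast
      ring_nf
  have hconj : ((dElt x)⁻¹ * toFin (t ^ (N * M)) * dElt x : GLf k m).val =
      Matrix.transvection i j (N * (M * c')) := by
    rw [Units.val_mul, Units.val_mul]
    have h1 : (toFin (t ^ (N * M)) : GLf k m).val =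
        Matrix.transvection i j (algebraMap k (Af k) ((N * M : ℕ) * c)) := by
      rw [← map_transvection_val, ← hpow]
      rfl
    rw [h1, conj_transvection D f e hD hD']
    congr 1
    simp only [c', map_mul, map_natCast]
    push_cast
    ring
  have hentry : ∀ b ∈ intAdeles k, ∀ i' j', ∃ b' ∈ intAdeles k,
      (Matrix.transvection i j (N * b) : Matrix (Fin m) (Fin m) (Af k)) i' j' =
        (1 : Matrix (Fin m) (Fin m) (Af k)) i' j' + N * b' := by
    intro b hb i' j'
    refine ⟨if i = i' ∧ j = j' then b else 0, ?_, ?_⟩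
    · split_ifs
      · exact hb
      · exact zero_mem _
    · rw [Matrix.transvection, Matrix.add_apply, Matrix.single_apply]
      split_ifs <;> simp
  refine ⟨N * M, Nat.mul_pos hN hM, mem_arithGroup.2 ⟨toInf_mem_posGL.2 ?_, hsub _ ?_ ?_⟩⟩
  · have : GeneralLinearGroup.det (t ^ (N * M)) = 1 := by
      ext
      rw [GeneralLinearGroup.val_det_apply, hpow, Matrix.det_transvection_of_ne i j hij]
      rfl
    rw [this, map_one]
    exact one_mem _
  · intro i' j'
    rw [hconj]
    exact hentry _ hM' i' j'
  · intro i' j'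
    have : (((dElt x)⁻¹ * toFin (t ^ (N * M)) * dElt x : GLf k m)⁻¹).val =
        Matrix.transvection i j (N * (-(M * c'))) := by
      refine Units.inv_eq_of_mul_eq_one_left ?_
      rw [hconj, Matrix.transvection_mul_transvection_same i j hij]
      simp
    rw [this]
    exact hentry _ (neg_mem hM') i' j'

end

section

variable {k : Type*} [Field k] [NumberField k]

/-- The group of positive elements has finite index. -/
theorem index_posUnits_ne_zero : (posUnits k).index ≠ 0 := by
  let s : {v : InfinitePlace k // v.IsReal} → (InfiniteAdeleRing k)ˣ →* SignTypeˣ := fun v =>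
    (Units.map (signHom (α := ℝ)).toMonoidHom).comp (Units.map
      ((InfinitePlace.Completion.extensionEmbeddingOfIsReal v.2).comp
        (Pi.evalRingHom (fun v : InfinitePlace k => v.Completion) v.1)).toMonoidHom)
  have h1 : posUnits k = ⨅ v, (s v).ker := by
    ext u
    rw [Subgroup.mem_iInf]
    have h2 : ∀ v, u ∈ (s v).ker ↔
        0 < InfinitePlace.Completion.extensionEmbeddingOfIsReal v.2 ((u : InfiniteAdeleRing k) v.1) := by
      intro v
      rw [MonoidHom.mem_ker, Units.ext_iff]
      change SignType.sign (InfinitePlace.Completion.extensionEmbeddingOfIsReal v.2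
        ((u : InfiniteAdeleRing k) v.1)) = 1 ↔ _
      exact sign_eq_one_iff
    exact ⟨fun h v => (h2 v).2 (h v.1 v.2), fun h v hv => (h2 ⟨v, hv⟩).1 (h ⟨v, hv⟩)⟩
  rw [h1]
  refine Subgroup.index_iInf_ne_zero fun v => ?_
  rw [Subgroup.index_ker]
  exact Nat.card_pos.ne'

theorem relIndex_posGL_ne_zero {m : ℕ} (Γ : Subgroup (GLk k m)) :
    ((posGL k m).comap toInf).relIndex Γ ≠ 0 := by
  refine fun h => index_posUnits_ne_zero (k := k) ?_
  have h1 := Subgroup.index_eq_zero_of_relIndex_eq_zero h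
  rw [posGL, Subgroup.comap_comap, Subgroup.index_comap] at h1
  exact Subgroup.index_eq_zero_of_relIndex_eq_zero h1

theorem finite_quotient_natCast {N : ℕ} (hN : 0 < N) : Finite (𝓞 k ⧸ Ideal.span {(N : 𝓞 k)}) := by
  refine Ideal.finiteQuotientOfFreeOfNeBot _ ?_
  rw [Ne, Ideal.span_singleton_eq_bot]
  exact Nat.cast_ne_zero.2 hN.ne'

variable (k) in
/-- The group `GL_m` of the integral adeles. -/
def intLevel (m : ℕ) : Subgroup (GLf k m) where
  carrier := {g | (∀ i j, g.val i j ∈ intAdeles k) ∧ ∀ i j, (g⁻¹).val i j ∈ intAdeles k}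
  one_mem' := by
    have : ∀ i j, (1 : Matrix (Fin m) (Fin m) (Af k)) i j ∈ intAdeles k := by
      intro i j
      rw [Matrix.one_apply]
      split_ifs
      · exact one_mem _
      · exact zero_mem _
    exact ⟨this, by simpa using this⟩
  mul_mem' {a b} ha hb := by
    refine ⟨fun i j => ?_, fun i j => ?_⟩
    · rw [Units.val_mul, Matrix.mul_apply]
      exact sum_mem fun l _ => mul_mem (ha.1 i l) (hb.1 l j)
    · rw [_root_.mul_inv_rev, Units.val_mul, Matrix.mul_apply]
      exact sum_mem fun l _ => mul_mem (hb.2 i l) (ha.2 l j)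
  inv_mem' {a} ha := ⟨ha.2, by rw [inv_inv]; exact ha.1⟩

theorem isOpen_intLevel {m : ℕ} : IsOpen (intLevel k m : Set (GLf k m)) := by
  have h : (intLevel k m : Set (GLf k m)) =
      (⋂ i, ⋂ j, (fun g : GLf k m => g.val i j) ⁻¹' (intAdeles k)) ∩
      ⋂ i, ⋂ j, (fun g : GLf k m => (g⁻¹).val i j) ⁻¹' (intAdeles k) := by
    ext g
    simp only [Set.mem_inter_iff, Set.mem_iInter, Set.mem_preimage]
    rfl
  rw [h]
  refine IsOpen.inter ?_ ?_
  · refine isOpen_iInter_of_finite fun i => isOpen_iInter_of_finite fun j => ?_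
    exact isOpen_intAdeles.preimage (Units.continuous_val.matrix_elem i j)
  · refine isOpen_iInter_of_finite fun i => isOpen_iInter_of_finite fun j => ?_
    exact isOpen_intAdeles.preimage ((Units.continuous_val.comp continuous_inv).matrix_elem i j)

theorem comap_toFin_intLevel {m : ℕ} : (intLevel k m).comap toFin =
    (GeneralLinearGroup.map (n := Fin m) (algebraMap (𝓞 k) k)).range := by
  ext γ
  constructor
  · rintro ⟨h1, h2⟩
    choose A hA using fun i j => algebraMap_mem_intAdeles_iff.1 (h1 i j)
    rw [← map_inv] at h2
    choose B hB using fun i j => algebraMap_mem_intAdeles_iff.1 (h2 i j)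
    have hA' : (Matrix.of A).map (algebraMap (𝓞 k) k) = γ.val := Matrix.ext hA
    have hB' : (Matrix.of B).map (algebraMap (𝓞 k) k) = (γ⁻¹).val := Matrix.ext hB
    have hinj : Function.Injective (fun C : Matrix (Fin m) (Fin m) (𝓞 k) => C.map (algebraMap (𝓞 k) k)) :=
      Matrix.map_injective (FaithfulSMul.algebraMap_injective (𝓞 k) k)
    refine ⟨⟨Matrix.of A, Matrix.of B, hinj ?_, hinj ?_⟩, Units.ext hA'⟩
    · simp only [Matrix.map_mul, hA', hB', Units.mul_inv]
      simp
    · simp only [Matrix.map_mul, hA', hB', Units.inv_mul]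
      simp
  · rintro ⟨g, rfl⟩
    refine ⟨fun i j => algebraMap_mem_intAdeles_iff.2 ⟨_, rfl⟩, fun i j => ?_⟩
    rw [← map_inv, ← map_inv]
    exact algebraMap_mem_intAdeles_iff.2 ⟨_, rfl⟩

/-- The arithmetic groups attached to levels are torsion free and arithmetic. -/
theorem isTorsionFreeArithmetic_arithGroup {m : ℕ} {L : Subgroup (GLf k m)} (hL : IsLevel L)
    (c : (Af k)ˣ) : IsTorsionFreeArithmetic (arithGroup L c) := by
  refine ⟨⟨?_, ?_⟩, fun γ hγ hfin => hL.isNeat (dElt c) γ (mem_arithGroup.1 hγ).2 hfin⟩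
  · refine Subgroup.relIndex_inf_ne_zero (relIndex_posGL_ne_zero _) ?_
    rw [← Subgroup.index_comap, Subgroup.comap_comap]
    obtain ⟨N, hN, hsub⟩ := exists_congruence_subset
      ((isOpen_conjLevel (dElt c) hL.isOpen).mem_nhds (one_mem _))
    have := finite_quotient_natCast (k := k) hN
    let r : GL (Fin m) (𝓞 k) →* GL (Fin m) (𝓞 k ⧸ Ideal.span {(N : 𝓞 k)}) :=
      GeneralLinearGroup.map (Ideal.Quotient.mk _)
    have hr : r.ker.index ≠ 0 := by
      rw [Subgroup.index_ker]
      exact Nat.card_pos.ne'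
    have hcong : ∀ g ∈ r.ker, ∀ i j, ∃ b ∈ intAdeles k,
        (toFin (GeneralLinearGroup.map (algebraMap (𝓞 k) k) g)).val i j =
          (1 : Matrix (Fin m) (Fin m) (Af k)) i j + N * b := by
      intro g hg i j
      have h1 := congrArg (fun h => h.val i j) (MonoidHom.mem_ker.1 hg)
      have h2 : Ideal.Quotient.mk (Ideal.span {(N : 𝓞 k)}) (g.val i j) =
          Ideal.Quotient.mk (Ideal.span {(N : 𝓞 k)}) ((1 : Matrix (Fin m) (Fin m) (𝓞 k)) i j) := by
        have h3 : Ideal.Quotient.mk (Ideal.span {(N : 𝓞 k)}) (g.val i j) =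
            (1 : Matrix (Fin m) (Fin m) (𝓞 k ⧸ Ideal.span {(N : 𝓞 k)})) i j := h1
        rw [h3]
        by_cases hij : i = j
        · subst hij
          rw [Matrix.one_apply_eq, Matrix.one_apply_eq, map_one]
        · rw [Matrix.one_apply_ne hij, Matrix.one_apply_ne hij, map_zero]
      rw [Ideal.Quotient.eq, Ideal.mem_span_singleton'] at h2
      obtain ⟨a, ha⟩ := h2
      refine ⟨algebraMap k (Af k) (algebraMap (𝓞 k) k a), algebraMap_mem_intAdeles_iff.2 ⟨_, rfl⟩, ?_⟩
      change algebraMap k (Af k) (algebraMap (𝓞 k) k (g.val i j)) = _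
      have h3 : g.val i j = (1 : Matrix (Fin m) (Fin m) (𝓞 k)) i j + N * a := by
        rw [mul_comm, ha]
        ring
      rw [h3, map_add, map_add, map_mul, map_mul, map_natCast, map_natCast, Matrix.one_apply,
        Matrix.one_apply]
      split_ifs <;> simp
    refine fun h0 => hr (Nat.eq_zero_of_zero_dvd (h0 ▸ Subgroup.index_dvd_of_le ?_))
    intro g hg
    refine hsub _ (hcong g hg) ?_
    have := hcong g⁻¹ (inv_mem hg)
    rw [map_inv, map_inv] at this
    exact this
  · rw [← comap_toFin_intLevel]
    have h1 : (intLevel k m).relIndex (conjLevel (dElt c) L) ≠ 0 :=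
      relIndex_ne_zero_of_isOpen isOpen_intLevel (isCompact_conjLevel _ hL.isCompact)
    exact fun h => Subgroup.relIndex_comap_ne_zero toFin h1
      (Subgroup.relIndex_eq_zero_of_le_right inf_le_right h)

theorem index_ne_zero_of_finite_map {G α : Type*} [Group G] [Finite α] {H : Subgroup G} (f : G → α)
    (hf : ∀ x y, f x = f y → x⁻¹ * y ∈ H) : H.index ≠ 0 := by
  have : Finite (G ⧸ H) := Finite.of_injective (fun x : G ⧸ H => f x.out) fun x y h => by
    have h1 := QuotientGroup.eq.2 (hf _ _ h)
    simpa using h1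
  exact Subgroup.index_ne_zero_of_finite

variable (k) in
/-- The units of the integral adeles. -/
def intUnits : Subgroup (Af k)ˣ where
  carrier := {x | ∀ q, Valued.v (evalAf q x.val) = 1}
  one_mem' q := by simp
  mul_mem' {a b} ha hb q := by rw [Units.val_mul, map_mul, map_mul, ha q, hb q, mul_one]
  inv_mem' {a} ha q := by
    have h1 : evalAf q a.val * evalAf q (a⁻¹).val = 1 := by rw [← map_mul, Units.mul_inv, map_one]
    have h2 := congrArg Valued.v h1
    rwa [map_mul, ha q, one_mul, map_one] at h2

theorem relIndex_detLevel_intUnits_ne_zero {m : ℕ} (hm : 1 ≤ m) {L : Subgroup (GLf k m)}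
    (hL : IsOpen (L : Set (GLf k m))) : (detLevel L).relIndex (intUnits k) ≠ 0 := by
  obtain ⟨N, hN, hsub⟩ := exists_congruence_subset (hL.mem_nhds (one_mem L))
  have := finite_quotient_natCast (k := k) hN
  have hint : ∀ x : intUnits k, x.val.val ∈ intAdeles k := fun x q => (x.2 q).le
  choose r b hb hr using fun x : intUnits k => exists_integer_sub_mem (hint x) hN
  refine index_ne_zero_of_finite_map
    (fun x : intUnits k => Ideal.Quotient.mk (Ideal.span {(N : 𝓞 k)}) (r x)) fun x y hxy => ?_
  have key : ∀ x y : intUnits k, Ideal.Quotient.mk (Ideal.span {(N : 𝓞 k)}) (r x) =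
      Ideal.Quotient.mk (Ideal.span {(N : 𝓞 k)}) (r y) →
      ∃ c ∈ intAdeles k, (x⁻¹ * y).val.val = 1 + N * c := by
    intro x y hxy
    rw [eq_comm, Ideal.Quotient.eq, Ideal.mem_span_singleton'] at hxy
    obtain ⟨a, ha⟩ := hxy
    refine ⟨(x⁻¹).val.val * (algebraMap k (Af k) (algebraMap (𝓞 k) k a) + (b y - b x)),
      mul_mem (hint _) (add_mem (algebraMap_mem_intAdeles_iff.2 ⟨_, rfl⟩) (sub_mem (hb y) (hb x))), ?_⟩
    have h1 : (x⁻¹).val.val * x.val.val = 1 := Units.inv_mul x.val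
    have h2 : y.val.val = x.val.val + N * (algebraMap k (Af k) (algebraMap (𝓞 k) k a) +
        (b y - b x)) := by
      have h3 := congrArg (fun t => algebraMap k (Af k) (algebraMap (𝓞 k) k t)) ha
      simp only [map_mul, map_sub, map_natCast] at h3
      rw [hr x, hr y]
      linear_combination -h3
    change (x⁻¹).val.val * y.val.val = _
    rw [h2]
    linear_combination h1
  have hent : ∀ (x : (Af k)ˣ), (∃ c ∈ intAdeles k, x.val = 1 + N * c) → ∀ i j,
      ∃ b ∈ intAdeles k, (dElt x : GLf k m).val i j =
        (1 : Matrix (Fin m) (Fin m) (Af k)) i j + N * b := by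
    rintro x ⟨c, hc, hx⟩ i j
    refine ⟨if i = j ∧ i.val = 0 then c else 0, ?_, ?_⟩
    · split_ifs
      · exact hc
      · exact zero_mem _
    · rw [val_dElt, Matrix.diagonal_apply, Matrix.one_apply]
      by_cases h1 : i = j <;> by_cases h2 : i.val = 0 <;> simp [h1, h2, hx]
      rw [if_pos (h1 ▸ h2), if_pos (h1 ▸ h2)]
      simp_all
  rw [Subgroup.mem_subgroupOf]
  refine ⟨dElt (x⁻¹ * y).val, hsub _ (hent _ (key x y hxy)) ?_, det_dElt hm _⟩
  have h5 := hent ((x⁻¹ * y)⁻¹).val (by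
    rw [_root_.mul_inv_rev, inv_inv]
    exact key y x hxy.symm)
  rw [Subgroup.coe_inv, dElt_inv] at h5
  exact h5

/-- The ideal of an integral idele. -/
def ideleIdeal (x : (Af k)ˣ) : Ideal (𝓞 k) where
  carrier := {r | ∀ q, Valued.v (evalAf q (algebraMap k (Af k) (algebraMap (𝓞 k) k r))) ≤
    Valued.v (evalAf q x.val)}
  zero_mem' q := by simp
  add_mem' {a b} ha hb q := by
    simp only [map_add]
    exact (Valuation.map_add _ _ _).trans (max_le (ha q) (hb q))
  smul_mem' c a ha q := by
    simp only [smul_eq_mul, map_mul]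
    refine (mul_le_of_le_one_left' ?_).trans (ha q)
    rw [valued_evalAf_algebraMap]
    exact q.valuation_le_one _

theorem evalAf_unit_ne_zero (x : (Af k)ˣ) (q : HeightOneSpectrum (𝓞 k)) : evalAf q x.val ≠ 0 := by
  intro h
  have h1 : evalAf q x.val * evalAf q (x⁻¹).val = 1 := by rw [← map_mul, Units.mul_inv, map_one]
  rw [h, zero_mul] at h1
  exact zero_ne_one h1

theorem exists_mem_ideleIdeal (x : (Af k)ˣ) (hx : x.val ∈ intAdeles k) (q : HeightOneSpectrum (𝓞 k)) :
    ∃ r ∈ ideleIdeal x, Valued.v (evalAf q (algebraMap k (Af k) (algebraMap (𝓞 k) k r))) =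
      Valued.v (evalAf q x.val) := by
  obtain ⟨N, hN, hNx⟩ := exists_nat_mul_mem_intAdeles (x⁻¹).val
  set M := Ideal.absNorm q.asIdeal
  have hM : 0 < M := Nat.pos_of_ne_zero (Ideal.absNorm_eq_zero_iff.not.2 q.ne_bot)
  have h1 : Valued.v ((M : q.adicCompletion k)) < 1 := by
    have h := valued_evalAf_algebraMap q (algebraMap (𝓞 k) k (M : 𝓞 k))
    rw [q.valuation_of_algebraMap] at h
    simp only [map_natCast] at h
    rw [h, HeightOneSpectrum.intValuation_lt_one_iff_mem]
    exact Ideal.absNorm_mem _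
  obtain ⟨r, b, hb, h⟩ := exists_integer_sub_mem hx (Nat.mul_pos hM hN)
  have hval : ∀ q', Valued.v (evalAf q' (N : Af k)) ≤ Valued.v (evalAf q' x.val) := by
    intro q'
    have h2 : (N : Af k) = (N * (x⁻¹).val) * x.val := by rw [mul_assoc, Units.inv_mul, mul_one]
    rw [h2, map_mul, map_mul]
    exact mul_le_of_le_one_left' (hNx q')
  have hr : algebraMap k (Af k) (algebraMap (𝓞 k) k r) = x.val - (M * N : ℕ) * b := by
    rw [h]; ring
  refine ⟨r, fun q' => ?_, ?_⟩
  · rw [hr, map_sub]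
    refine (Valuation.map_sub _ _ _).trans (max_le le_rfl ?_)
    rw [Nat.cast_mul, map_mul, map_mul, map_mul, map_mul, map_natCast (evalAf q') M]
    calc _ ≤ 1 * Valued.v (evalAf q' x.val) * 1 :=
          mul_le_mul' (mul_le_mul' (valued_natCast_le_one q' M) (hval q')) (hb q')
      _ = _ := by simp
  · rw [hr, map_sub]
    refine Valuation.map_sub_eq_of_lt_left _ ?_
    rw [Nat.cast_mul, map_mul, map_mul, map_mul, map_mul, map_natCast (evalAf q) M]
    have h0 : 0 < Valued.v (evalAf q x.val) := by
      rw [zero_lt_iff, Valuation.ne_zero_iff]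
      exact evalAf_unit_ne_zero x q
    calc _ ≤ Valued.v (M : q.adicCompletion k) * Valued.v (evalAf q x.val) * 1 :=
          mul_le_mul' (mul_le_mul' le_rfl (hval q)) (hb q)
      _ < _ := by
          rw [mul_one]
          exact mul_lt_of_lt_one_left h0 h1

theorem ideleIdeal_ne_bot (x : (Af k)ˣ) : ideleIdeal x ∈ nonZeroDivisors (Ideal (𝓞 k)) := by
  rw [mem_nonZeroDivisors_iff_ne_zero]
  intro h0
  obtain ⟨N, hN, hNx⟩ := exists_nat_mul_mem_intAdeles (x⁻¹).val
  have h1 : (N : 𝓞 k) ∈ ideleIdeal x := by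
    intro q
    simp only [map_natCast]
    rw [← map_natCast (evalAf q)]
    have h2 : (N : Af k) = (N * (x⁻¹).val) * x.val := by rw [mul_assoc, Units.inv_mul, mul_one]
    rw [h2, map_mul, map_mul]
    exact mul_le_of_le_one_left' (hNx q)
  rw [h0] at h1
  exact Nat.cast_ne_zero.2 hN.ne' ((Submodule.mem_bot _).1 h1)

theorem valued_le_of_span_mul_ideleIdeal {x y : (Af k)ˣ} (hx : x.val ∈ intAdeles k) {a b : 𝓞 k}
    (h : Ideal.span {a} * ideleIdeal x = Ideal.span {b} * ideleIdeal y)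
    (q : HeightOneSpectrum (𝓞 k)) :
    Valued.v (evalAf q (algebraMap k (Af k) (algebraMap (𝓞 k) k a) * x.val)) ≤
      Valued.v (evalAf q (algebraMap k (Af k) (algebraMap (𝓞 k) k b) * y.val)) := by
  obtain ⟨r, hr, hr'⟩ := exists_mem_ideleIdeal x hx q
  have h1 : a * r ∈ Ideal.span {b} * ideleIdeal y := by
    rw [← h]
    exact Ideal.mul_mem_mul (Ideal.mem_span_singleton_self a) hr
  rw [Ideal.mem_span_singleton_mul] at h1
  obtain ⟨z, hz, hz'⟩ := h1
  rw [map_mul, map_mul, ← hr', ← map_mul, ← map_mul, ← map_mul, ← map_mul, ← hz']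
  simp only [map_mul]
  exact mul_le_mul_right (hz q) _

theorem index_principal_sup_intUnits_ne_zero :
    ((Units.map (algebraMap k (Af k)).toMonoidHom).range ⊔ intUnits k).index ≠ 0 := by
  choose N hN hNx using fun x : (Af k)ˣ => exists_nat_mul_mem_intAdeles x.val
  have hNk : ∀ x, (N x : k) ≠ 0 := fun x => Nat.cast_ne_zero.2 (hN x).ne'
  let P : kˣ →* (Af k)ˣ := Units.map (algebraMap k (Af k)).toMonoidHom
  let X : (Af k)ˣ → (Af k)ˣ := fun x => P (Units.mk0 _ (hNk x)) * x
  have hX : ∀ x, (X x).val ∈ intAdeles k := by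
    intro x
    have : (X x).val = (N x : Af k) * x.val := by
      change algebraMap k (Af k) (N x : k) * x.val = _
      rw [map_natCast]
    rw [this]
    exact hNx x
  refine index_ne_zero_of_finite_map
    (fun x => ClassGroup.mk0 ⟨ideleIdeal (X x), ideleIdeal_ne_bot (X x)⟩) fun x y hxy => ?_
  obtain ⟨a, b, ha, hb, hab⟩ := ClassGroup.mk0_eq_mk0_iff.1 hxy
  simp only at hab
  have ha' : algebraMap (𝓞 k) k a ≠ 0 := by simpa using ha
  have hb' : algebraMap (𝓞 k) k b ≠ 0 := by simpa using hb
  let A := Units.mk0 _ ha'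
  let B := Units.mk0 _ hb'
  have hu : (P A * X x)⁻¹ * (P B * X y) ∈ intUnits k := by
    intro q
    have h1 := le_antisymm (valued_le_of_span_mul_ideleIdeal (hX x) hab q)
      (valued_le_of_span_mul_ideleIdeal (hX y) hab.symm q)
    have h2 : (P B * X y).val = (P A * X x).val * ((P A * X x)⁻¹ * (P B * X y)).val := by
      rw [← Units.val_mul]
      congr 1
      group
    have h3 : Valued.v (evalAf q (P A * X x).val) = Valued.v (evalAf q (P B * X y).val) := h1
    rw [h2, map_mul, map_mul] at h3
    have h0 : Valued.v (evalAf q (P A * X x).val) ≠ 0 := by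
      rw [Valuation.ne_zero_iff]
      exact evalAf_unit_ne_zero _ q
    exact (mul_right_eq_self₀.1 h3.symm).resolve_right h0
  have hfin : x⁻¹ * y = P (A * Units.mk0 _ (hNk x) * (B * Units.mk0 _ (hNk y))⁻¹) *
      ((P A * X x)⁻¹ * (P B * X y)) := by
    simp only [X, map_mul, map_inv, _root_.mul_inv_rev]
    generalize P (Units.mk0 _ (hNk x)) = s
    generalize P (Units.mk0 _ (hNk y)) = t
    generalize P A = s'
    generalize P B = t'
    apply Additive.ofMul.injective
    simp only [ofMul_mul, ofMul_inv]
    abel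
  rw [hfin]
  exact Subgroup.mul_mem_sup ⟨_, rfl⟩ hu

theorem finite_classSet {m : ℕ} (hm : 1 ≤ m) {L : Subgroup (GLf k m)}
    (hL : IsOpen (L : Set (GLf k m))) : Finite (ClassSet L) := by
  let A := (principal k).range
  let B := (posUnits k).prod (detLevel L)
  let I : Subgroup ((InfiniteAdeleRing k)ˣ × (Af k)ˣ) := (⊤ : Subgroup (InfiniteAdeleRing k)ˣ).prod (intUnits k)
  have h1 : (A ⊔ I).index ≠ 0 := by
    have h2 : (A ⊔ I) = ((Units.map (algebraMap k (Af k)).toMonoidHom).range ⊔ intUnits k).comap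
        (MonoidHom.snd _ _) := by
      ext z
      rw [Subgroup.mem_comap, Subgroup.mem_sup, Subgroup.mem_sup]
      constructor
      · rintro ⟨_, ⟨a, rfl⟩, y, hy, rfl⟩
        exact ⟨_, ⟨a, rfl⟩, y.2, hy.2, rfl⟩
      · rintro ⟨_, ⟨a, rfl⟩, y, hy, h⟩
        refine ⟨_, ⟨a, rfl⟩, ((principal k a).1⁻¹ * z.1, y), ⟨trivial, hy⟩, Prod.ext ?_ h⟩
        exact mul_inv_cancel_left _ _
    rw [h2, Subgroup.index_comap]
    exact fun h => index_principal_sup_intUnits_ne_zero (Subgroup.index_eq_zero_of_relIndex_eq_zero h)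
  have h2 : B.relIndex I ≠ 0 := by
    have h3 : B = (posUnits k).comap (MonoidHom.fst _ _) ⊓ (detLevel L).comap (MonoidHom.snd _ _) := by
      ext z
      rfl
    rw [h3]
    refine Subgroup.relIndex_inf_ne_zero ?_ ?_
    · refine fun h => index_posUnits_ne_zero (k := k) ?_
      have h4 := Subgroup.index_eq_zero_of_relIndex_eq_zero h
      rw [Subgroup.index_comap] at h4
      exact Subgroup.index_eq_zero_of_relIndex_eq_zero h4
    · rw [Subgroup.relIndex_comap]
      refine fun h => relIndex_detLevel_intUnits_ne_zero hm hL
        (Subgroup.relIndex_eq_zero_of_le_right ?_ h)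
      rintro _ ⟨z, hz, rfl⟩
      exact hz.2
  have h3 : (A ⊔ B).index ≠ 0 := by
    have h4 : (A ⊔ B).relIndex (A ⊔ I) ≠ 0 := by
      have h5 : (A ⊔ B).relIndex (I ⊔ (A ⊔ B)) ≠ 0 := by
        rw [Subgroup.relIndex_sup_right]
        exact fun h => h2 (Subgroup.relIndex_eq_zero_of_le_left le_sup_right h)
      exact fun h => h5 (Subgroup.relIndex_eq_zero_of_le_right (sup_le
        (le_sup_left.trans le_sup_right) le_sup_left) h)
    rw [← Subgroup.relIndex_top_right] at h1 ⊢
    exact Subgroup.relIndex_ne_zero_trans h4 h1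
  have : (A ⊔ B).FiniteIndex := ⟨h3⟩
  exact Subgroup.finite_quotient_of_finiteIndex (H := A ⊔ B)

end

section

variable {k : Type*} [Field k] [NumberField k]

/-- The component of an infinite adele. -/
noncomputable def evalInf (v : InfinitePlace k) : InfiniteAdeleRing k →+* v.Completion :=
  Pi.evalRingHom (fun v : InfinitePlace k => v.Completion) v

theorem continuous_evalInf (v : InfinitePlace k) : Continuous (evalInf (k := k) v) :=
  continuous_apply v

theorem norm_extensionEmbedding {v : InfinitePlace k} (x : v.Completion) :
    ‖InfinitePlace.Completion.extensionEmbedding v x‖ = ‖x‖ := by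
  have := (InfinitePlace.Completion.isometry_extensionEmbedding v).norm_map_of_map_zero (map_zero _) x
  exact this

theorem norm_evalInf_algebraMap (v : InfinitePlace k) (x : k) :
    ‖evalInf v (algebraMap k (InfiniteAdeleRing k) x)‖ = ‖v.embedding x‖ := by
  rw [← norm_extensionEmbedding]
  congr 1
  exact InfinitePlace.Completion.extensionEmbedding_coe v _

/-- The entries of `g` and of its inverse are bounded by `B` at all infinite places. -/
def InfBounded {m : ℕ} (B : ℝ) (g : GLinf k m) : Prop :=
  ∀ v i j, ‖evalInf v (g.val i j)‖ ≤ B ∧ ‖evalInf v ((g⁻¹).val i j)‖ ≤ B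

theorem InfBounded.inv {m : ℕ} {B : ℝ} {g : GLinf k m} (h : InfBounded B g) : InfBounded B g⁻¹ :=
  fun v i j => ⟨(h v i j).2, by rw [inv_inv]; exact (h v i j).1⟩

theorem norm_evalInf_mul_apply_le {m : ℕ} {B C : ℝ} (v : InfinitePlace k)
    {A A' : Matrix (Fin m) (Fin m) (InfiniteAdeleRing k)}
    (hA : ∀ i j, ‖evalInf v (A i j)‖ ≤ B) (hA' : ∀ i j, ‖evalInf v (A' i j)‖ ≤ C) (i j : Fin m) :
    ‖evalInf v ((A * A') i j)‖ ≤ m * (B * C) := by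
  rw [Matrix.mul_apply, map_sum]
  refine (norm_sum_le _ _).trans ?_
  refine (Finset.sum_le_card_nsmul _ _ (B * C) fun l _ => ?_).trans (by simp)
  rw [map_mul, norm_mul]
  exact mul_le_mul (hA i l) (hA' l j) (norm_nonneg _) ((norm_nonneg _).trans (hA i l))

theorem InfBounded.mul {m : ℕ} {B C : ℝ} {g h : GLinf k m} (hg : InfBounded B g)
    (hh : InfBounded C h) : InfBounded (m * (B * C)) (g * h) := by
  intro v i j
  constructor
  · rw [Units.val_mul]
    exact norm_evalInf_mul_apply_le v (fun i j => (hg v i j).1) (fun i j => (hh v i j).1) i j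
  · rw [_root_.mul_inv_rev, Units.val_mul, mul_comm B C]
    exact norm_evalInf_mul_apply_le v (fun i j => (hh v i j).2) (fun i j => (hg v i j).2) i j

theorem exists_infBounded {m : ℕ} (g : GLinf k m) : ∃ B : ℕ, InfBounded B g := by
  let f : InfinitePlace k × Fin m × Fin m → ℝ := fun x =>
    ‖evalInf x.1 (g.val x.2.1 x.2.2)‖ + ‖evalInf x.1 ((g⁻¹).val x.2.1 x.2.2)‖
  obtain ⟨B, hB⟩ := exists_nat_ge (∑ x, f x)
  refine ⟨B, fun v i j => ?_⟩
  have h1 : f (v, i, j) ≤ B := (Finset.single_le_sum (f := f)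
    (fun x _ => add_nonneg (norm_nonneg _) (norm_nonneg _)) (Finset.mem_univ _)).trans hB
  have h2 : ‖evalInf v (g.val i j)‖ + ‖evalInf v ((g⁻¹).val i j)‖ ≤ B := h1
  constructor <;> linarith [norm_nonneg (evalInf v (g.val i j)), norm_nonneg (evalInf v ((g⁻¹).val i j))]

theorem isCompact_setOf_norm_le (B : ℝ) :
    IsCompact {a : InfiniteAdeleRing k | ∀ v, ‖evalInf v a‖ ≤ B} := by
  have h1 : ∀ v : InfinitePlace k, IsCompact {x : v.Completion | ‖x‖ ≤ B} := by
    intro v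
    have h2 := (InfinitePlace.Completion.isometry_extensionEmbedding v).isClosedEmbedding.isCompact_preimage
      (isCompact_closedBall (0 : ℂ) B)
    convert! h2 using 1
    ext x
    rw [Set.mem_preimage, mem_closedBall_zero_iff, norm_extensionEmbedding]
    rfl
  have h3 := isCompact_univ_pi h1
  convert! h3 using 1
  ext a
  exact ⟨fun h v _ => h v, fun h v => h v trivial⟩

theorem isCompact_setOf_infBounded {m : ℕ} (B : ℝ) : IsCompact {g : GLinf k m | InfBounded B g} := by
  let S : Set (Matrix (Fin m) (Fin m) (InfiniteAdeleRing k)) :=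
    {A | ∀ i j, A i j ∈ {a : InfiniteAdeleRing k | ∀ v, ‖evalInf v a‖ ≤ B}}
  have hS : IsCompact S := by
    have h1 := isCompact_univ_pi fun _ : Fin m => isCompact_univ_pi fun _ : Fin m =>
      isCompact_setOf_norm_le (k := k) B
    convert! h1 using 1
    ext A
    exact ⟨fun h i _ j _ => h i j, fun h i j => h i trivial j trivial⟩
  have : T2Space (InfiniteAdeleRing k) := inferInstanceAs (T2Space (∀ v : InfinitePlace k, v.Completion))
  have hS' := (Units.isClosedEmbedding_embedProduct
    (α := Matrix (Fin m) (Fin m) (InfiniteAdeleRing k))).isCompact_preimage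
      (hS.prod (hS.image MulOpposite.continuous_op))
  refine hS'.of_isClosed_subset ?_ ?_
  · have h : {g : GLinf k m | InfBounded B g} = ⋂ v, ⋂ i, ⋂ j,
        ({g : GLinf k m | ‖evalInf v (g.val i j)‖ ≤ B} ∩
          {g : GLinf k m | ‖evalInf v ((g⁻¹).val i j)‖ ≤ B}) := by
      ext g
      simp only [Set.mem_iInter]
      rfl
    rw [h]
    refine isClosed_iInter fun v => isClosed_iInter fun i => isClosed_iInter fun j =>
      IsClosed.inter ?_ ?_
    · exact isClosed_le (((continuous_evalInf v).comp
        (Units.continuous_val.matrix_elem i j)).norm) continuous_const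
    · exact isClosed_le (((continuous_evalInf v).comp
        ((Units.continuous_val.comp continuous_inv).matrix_elem i j)).norm) continuous_const
  · intro g hg
    refine ⟨fun i j v => (hg v i j).1, (g⁻¹).val, fun i j v => (hg v i j).2, rfl⟩

theorem isOpen_setOf_norm_lt {m : ℕ} (B : ℝ) : IsOpen {g : GLinf k m | ∀ v i j,
    ‖evalInf v (g.val i j)‖ < B ∧ ‖evalInf v ((g⁻¹).val i j)‖ < B} := by
  have h : {g : GLinf k m | ∀ v i j,
      ‖evalInf v (g.val i j)‖ < B ∧ ‖evalInf v ((g⁻¹).val i j)‖ < B} = ⋂ v, ⋂ i, ⋂ j,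
      ({g : GLinf k m | ‖evalInf v (g.val i j)‖ < B} ∩
        {g : GLinf k m | ‖evalInf v ((g⁻¹).val i j)‖ < B}) := by
    ext g
    simp only [Set.mem_iInter]
    rfl
  rw [h]
  refine isOpen_iInter_of_finite fun v => isOpen_iInter_of_finite fun i =>
    isOpen_iInter_of_finite fun j => IsOpen.inter ?_ ?_
  · exact isOpen_lt (((continuous_evalInf v).comp
      (Units.continuous_val.matrix_elem i j)).norm) continuous_const
  · exact isOpen_lt (((continuous_evalInf v).comp
      ((Units.continuous_val.comp continuous_inv).matrix_elem i j)).norm) continuous_const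

/-- A compact subset of a quotient of `G_m(ℝ)` is the image of a bounded set. -/
theorem exists_infBounded_of_isCompact {m : ℕ} (H : Subgroup (GLinf k m)) {C : Set (GLinf k m ⧸ H)}
    (hC : IsCompact C) : ∃ B : ℝ, ∀ g : GLinf k m, (QuotientGroup.mk g : GLinf k m ⧸ H) ∈ C →
      ∃ κ ∈ H, InfBounded B (g * κ) := by
  let U : ℕ → Set (GLinf k m ⧸ H) := fun N => QuotientGroup.mk '' {g : GLinf k m | ∀ v i j,
    ‖evalInf v (g.val i j)‖ < N ∧ ‖evalInf v ((g⁻¹).val i j)‖ < N}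
  obtain ⟨N, hN⟩ := hC.elim_directed_cover U
    (fun N => QuotientGroup.isOpenMap_coe _ (isOpen_setOf_norm_lt _))
    (by
      intro x _
      obtain ⟨g, rfl⟩ := QuotientGroup.mk_surjective x
      obtain ⟨B, hB⟩ := exists_infBounded g
      refine Set.mem_iUnion.2 ⟨B + 1, g, fun v i j => ?_, rfl⟩
      rw [Nat.cast_add, Nat.cast_one]
      exact ⟨(hB v i j).1.trans_lt (lt_add_one _), (hB v i j).2.trans_lt (lt_add_one _)⟩)
    (directed_of_isDirected_le fun a b hab => Set.image_mono fun g hg v i j =>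
      ⟨(hg v i j).1.trans_le (Nat.cast_le.2 hab), (hg v i j).2.trans_le (Nat.cast_le.2 hab)⟩)
  refine ⟨N, fun g hg => ?_⟩
  obtain ⟨g', hg', h⟩ := hN hg
  refine ⟨g⁻¹ * g', QuotientGroup.eq.1 h.symm, ?_⟩
  rw [mul_inv_cancel_left]
  exact fun v i j => ⟨(hg' v i j).1.le, (hg' v i j).2.le⟩

/-- Similitudes have bounded condition number. -/
theorem norm_mul_norm_le_one_of_mem_GK {m : ℕ} {κ : GLinf k m} (hκ : κ ∈ GK k m) (v : InfinitePlace k)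
    (a b c d : Fin m) :
    ‖evalInf v ((κ⁻¹).val a b)‖ * ‖evalInf v (κ.val c d)‖ ≤ 1 := by
  obtain ⟨r, hr, hr', h⟩ := (Subgroup.mem_iInf.1 hκ v : compInf k v κ ∈ similitudeGL m)
  set A := compInf k v κ
  have hA : ∀ i j, ‖evalInf v (κ.val i j)‖ = ‖A.val i j‖ := fun i j =>
    (norm_extensionEmbedding _).symm
  have hA' : ∀ i j, ‖evalInf v ((κ⁻¹).val i j)‖ = ‖(A⁻¹).val i j‖ := by
    intro i j
    rw [← map_inv]
    exact (norm_extensionEmbedding _).symm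
  have hinv : (A⁻¹).val = r⁻¹ • A.valᴴ := by
    refine Units.inv_eq_of_mul_eq_one_left ?_
    rw [Matrix.smul_mul, h, smul_smul, inv_mul_cancel₀ hr, one_smul]
  have hbound : ∀ i j, ‖A.val i j‖ ^ 2 ≤ ‖r‖ := by
    intro i j
    have h1 := congrFun (congrFun h j) j
    rw [Matrix.mul_apply] at h1
    have h2 : ∀ l, (A.valᴴ j l * A.val l j) = ((‖A.val l j‖ ^ 2 : ℝ) : ℂ) := by
      intro l
      rw [Matrix.conjTranspose_apply, Complex.star_def, Complex.conj_mul']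
      push_cast
      rfl
    simp only [h2, ← Complex.ofReal_sum, Matrix.smul_apply, Matrix.one_apply_eq, smul_eq_mul,
      mul_one] at h1
    rw [← h1, Complex.norm_real, Real.norm_of_nonneg (Finset.sum_nonneg fun _ _ => by positivity)]
    exact Finset.single_le_sum (f := fun l => ‖A.val l j‖ ^ 2) (fun _ _ => by positivity)
      (Finset.mem_univ i)
  rw [hA, hA', hinv, Matrix.smul_apply, Matrix.conjTranspose_apply, smul_eq_mul, norm_mul, norm_inv,
    norm_star]
  have hr0 : 0 < ‖r‖ := norm_pos_iff.2 hr
  rw [mul_assoc, inv_mul_le_iff₀ hr0, mul_one]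
  nlinarith [hbound b a, hbound c d, sq_nonneg (‖A.val b a‖ - ‖A.val c d‖)]

/-- If a matrix is bounded up to a similitude, the products of its entries with those of its inverse
are bounded. -/
theorem norm_mul_norm_le_of_infBounded {m : ℕ} {B : ℝ} {A κ : GLinf k m} (hκ : κ ∈ GK k m)
    (hA : InfBounded B (A * κ)) (v : InfinitePlace k) (a b c d : Fin m) :
    ‖evalInf v (A.val a b * (A⁻¹).val c d)‖ ≤ m * (m * (B * B)) := by
  have h1 : A.val = (A * κ).val * (κ⁻¹).val := by rw [← Units.val_mul, mul_inv_cancel_right]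
  have h2 : (A⁻¹).val = κ.val * ((A * κ)⁻¹).val := by
    rw [← Units.val_mul]
    congr 1
    group
  have hB : 0 ≤ B := (norm_nonneg _).trans (hA v a b).1
  rw [h1, h2, Matrix.mul_apply, Matrix.mul_apply, Finset.sum_mul_sum, map_sum]
  refine (norm_sum_le _ _).trans ?_
  refine (Finset.sum_le_card_nsmul _ _ (m * (B * B)) fun l _ => ?_).trans (by simp)
  rw [map_sum]
  refine (norm_sum_le _ _).trans ?_
  refine (Finset.sum_le_card_nsmul _ _ (B * B) fun l' _ => ?_).trans (by simp)
  simp only [map_mul, norm_mul]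
  calc _ = ‖evalInf v ((A * κ).val a l)‖ * ‖evalInf v (((A * κ)⁻¹).val l' d)‖ *
        (‖evalInf v ((κ⁻¹).val l b)‖ * ‖evalInf v (κ.val c l')‖) := by ring
    _ ≤ B * B * 1 := mul_le_mul (mul_le_mul (hA v a l).1 (hA v l' d).2 (norm_nonneg _) hB)
        (norm_mul_norm_le_one_of_mem_GK hκ v l b c l') (by positivity) (by positivity)
    _ = B * B := mul_one _

/-- There are finitely many matrices over `k` with bounded denominators and bounded entries. -/
theorem finite_setOf_bounded (m : ℕ) {N : ℕ} (hN : 0 < N) (B : ℝ) :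
    {A : Matrix (Fin m) (Fin m) k | ∀ i j, (N : Af k) * algebraMap k (Af k) (A i j) ∈ intAdeles k ∧
      ∀ v, ‖evalInf v (algebraMap k (InfiniteAdeleRing k) (A i j))‖ ≤ B}.Finite := by
  have hNk : (N : k) ≠ 0 := Nat.cast_ne_zero.2 hN.ne'
  have h1 : {x : k | (N : Af k) * algebraMap k (Af k) x ∈ intAdeles k ∧
      ∀ v, ‖evalInf v (algebraMap k (InfiniteAdeleRing k) x)‖ ≤ B}.Finite := by
    refine Set.Finite.of_finite_image (f := fun x => (N : k) * x)
      ((Embeddings.finite_of_norm_le k ℂ (N * B)).subset ?_) (fun x _ y _ h => mul_left_cancel₀ hNk h)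
    rintro _ ⟨x, ⟨h1, h2⟩, rfl⟩
    refine ⟨?_, fun φ => ?_⟩
    · have h3 : algebraMap k (Af k) ((N : k) * x) ∈ intAdeles k := by
        rw [map_mul, map_natCast]
        exact h1
      obtain ⟨r, hr⟩ := algebraMap_mem_intAdeles_iff.1 h3
      simp only
      rw [← hr]
      exact r.2
    · have h3 := h2 (InfinitePlace.mk φ)
      rw [norm_evalInf_algebraMap, InfinitePlace.norm_embedding_eq, InfinitePlace.apply] at h3
      rw [map_mul, map_natCast, norm_mul, Complex.norm_natCast]
      exact mul_le_mul_of_nonneg_left h3 (Nat.cast_nonneg _)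
  have h2 := Set.Finite.pi fun _ : Fin m => Set.Finite.pi fun _ : Fin m => h1
  refine h2.subset ?_
  intro A hA i _ j _
  exact hA i j

/-- The entries of the elements of a compact subset of `G_m(𝔸_f)` have bounded denominators. -/
theorem exists_nat_mul_mem_of_isCompact {m : ℕ} {D : Set (GLf k m)} (hD : IsCompact D) :
    ∃ N : ℕ, 0 < N ∧ ∀ g ∈ D, ∀ i j, (N : Af k) * g.val i j ∈ intAdeles k ∧
      (N : Af k) * (g⁻¹).val i j ∈ intAdeles k := by
  have h1 : ∀ C : Set (Af k), IsCompact C → ∃ N : ℕ, 0 < N ∧ ∀ a ∈ C, (N : Af k) * a ∈ intAdeles k := by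
    intro C hC
    obtain ⟨N, hN⟩ := hC.elim_directed_cover
      (fun N : ℕ => {a : Af k | (N.factorial : Af k) * a ∈ intAdeles k})
      (fun N => isOpen_intAdeles.preimage (by fun_prop))
      (by
        intro a _
        obtain ⟨N, hN, h⟩ := exists_nat_mul_mem_intAdeles a
        refine Set.mem_iUnion.2 ⟨N, ?_⟩
        obtain ⟨M, hM⟩ := Nat.dvd_factorial hN le_rfl
        change (N.factorial : Af k) * a ∈ intAdeles k
        rw [hM, Nat.cast_mul, mul_comm (N : Af k), mul_assoc]
        exact mul_mem (natCast_mem _ _) h)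
      (directed_of_isDirected_le fun a b hab x hx => by
        obtain ⟨M, hM⟩ := Nat.factorial_dvd_factorial hab
        change (b.factorial : Af k) * x ∈ intAdeles k
        rw [hM, Nat.cast_mul, mul_comm (a.factorial : Af k), mul_assoc]
        exact mul_mem (natCast_mem _ _) hx)
    exact ⟨N.factorial, N.factorial_pos, fun a ha => hN ha⟩
  let C : Set (Af k) := (⋃ i, ⋃ j, (fun g : GLf k m => g.val i j) '' D) ∪
    ⋃ i, ⋃ j, (fun g : GLf k m => (g⁻¹).val i j) '' D
  have hC : IsCompact C := by
    refine IsCompact.union ?_ ?_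
    · exact isCompact_iUnion fun i => isCompact_iUnion fun j =>
        hD.image (Units.continuous_val.matrix_elem i j)
    · exact isCompact_iUnion fun i => isCompact_iUnion fun j =>
        hD.image ((Units.continuous_val.comp continuous_inv).matrix_elem i j)
  obtain ⟨N, hN, h⟩ := h1 C hC
  refine ⟨N, hN, fun g hg i j => ⟨h _ (Or.inl ?_), h _ (Or.inr ?_)⟩⟩
  · exact Set.mem_iUnion.2 ⟨i, Set.mem_iUnion.2 ⟨j, g, hg, rfl⟩⟩
  · exact Set.mem_iUnion.2 ⟨i, Set.mem_iUnion.2 ⟨j, g, hg, rfl⟩⟩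

/-- The arithmetic group of a level acts freely on the symmetric space. -/
theorem eq_one_of_smul_eq {m : ℕ} {L : Subgroup (GLf k m)} (hL : IsLevel L) {c : (Af k)ˣ}
    {γ : GLk k m} (hγ : γ ∈ arithGroup L c) {t : SymCover k m} (h : toInf γ • t = t) : γ = 1 := by
  refine hL.isNeat (dElt c) γ (mem_arithGroup.1 hγ).2 ?_
  obtain ⟨g, rfl⟩ := QuotientGroup.mk_surjective t
  have hκ : g⁻¹ * toInf γ * g ∈ K0 k m := by
    have h1 := QuotientGroup.eq.1 (h.symm : (QuotientGroup.mk g : SymCover k m) =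
      QuotientGroup.mk (toInf γ * g))
    rw [mul_assoc]
    exact h1
  set κ := g⁻¹ * toInf γ * g
  obtain ⟨B, hB⟩ := exists_infBounded g
  obtain ⟨N, hN, hN'⟩ := exists_nat_mul_mem_of_isCompact (isCompact_conjLevel (dElt c) hL.isCompact)
  have hKb : ∀ κ ∈ K0 k m, InfBounded (1 : ℝ) κ := by
    have h2 : ∀ κ ∈ K0 k m, ∀ v i j, ‖evalInf v (κ.val i j)‖ ≤ 1 := by
      intro κ hκ v i j
      have h1 : compInf k v κ ∈ unitaryGL m := (Subgroup.mem_iInf.1 (Subgroup.mem_inf.1 hκ).1 v :)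
      set A := compInf k v κ
      have hA : ‖evalInf v (κ.val i j)‖ = ‖A.val i j‖ := (norm_extensionEmbedding _).symm
      rw [hA]
      have h3 : A.val ∈ Matrix.unitaryGroup (Fin m) ℂ := Matrix.mem_unitaryGroup_iff'.2 h1
      exact entry_norm_bound_of_unitary h3 i j
    exact fun κ hκ v i j => ⟨h2 κ hκ v i j, h2 _ (inv_mem hκ) v i j⟩
  have hfin := finite_setOf_bounded (k := k) m hN (m * (m * (B * 1) * B))
  have hmem : ∀ r : ℕ, (γ ^ r).val ∈ {A : Matrix (Fin m) (Fin m) k | ∀ i j,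
      (N : Af k) * algebraMap k (Af k) (A i j) ∈ intAdeles k ∧
      ∀ v, ‖evalInf v (algebraMap k (InfiniteAdeleRing k) (A i j))‖ ≤ m * (m * (B * 1) * B)} := by
    intro r i j
    refine ⟨?_, fun v => ?_⟩
    · exact (hN' (toFin (γ ^ r)) (mem_conjLevel.2 (mem_arithGroup.1 (pow_mem hγ r)).2) i j).1
    · have h2 : toInf (γ ^ r) = g * κ ^ r * g⁻¹ := by
        rw [map_pow, ← conj_pow]
        simp [κ, mul_assoc]
      have h3 := ((hB.mul (hKb _ (pow_mem hκ r))).mul hB.inv) v i j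
      rw [← h2] at h3
      exact h3.1
  have hinj : ¬ Function.Injective fun r : ℕ => γ ^ r := by
    intro hinj
    have h1 : Function.Injective fun r : ℕ => (γ ^ r).val := Units.val_injective.comp hinj
    exact (Set.infinite_of_injective_forall_mem h1 hmem) hfin
  rw [injective_pow_iff_not_isOfFinOrder, not_not] at hinj
  exact hinj

end

section

variable {k : Type*} [Field k] [NumberField k]

/-- Up to an arithmetic group there are finitely many elements of `GL_n(k)` with bounded
denominators. -/
theorem exists_finite_coset_representatives {n : ℕ} {L : Subgroup (GLf k n)}
    (hL : IsOpen (L : Set (GLf k n))) (c : (Af k)ˣ) {N : ℕ} (hN : 0 < N) :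
    ∃ S : Set (GLk k n), S.Finite ∧ ∀ η : GLk k n,
      (∀ i j, (N : Af k) * algebraMap k (Af k) (η.val i j) ∈ intAdeles k) →
      (∀ i j, (N : Af k) * algebraMap k (Af k) ((η⁻¹).val i j) ∈ intAdeles k) →
      ∃ η₀ ∈ S, η₀⁻¹ * η ∈ arithGroup L c := by
  obtain ⟨M, hM, hsub⟩ := exists_congruence_subset
    ((isOpen_conjLevel (dElt c) hL).mem_nhds (one_mem _))
  have hNk : (N : k) ≠ 0 := Nat.cast_ne_zero.2 hN.ne'
  let T : Set (GLk k n) := {η | (∀ i j, (N : Af k) * algebraMap k (Af k) (η.val i j) ∈ intAdeles k) ∧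
    ∀ i j, (N : Af k) * algebraMap k (Af k) ((η⁻¹).val i j) ∈ intAdeles k}
  have hint : ∀ x : k, (N : Af k) * algebraMap k (Af k) x ∈ intAdeles k →
      ∃ r : 𝓞 k, algebraMap (𝓞 k) k r = N * x := by
    intro x hx
    have h3 : algebraMap k (Af k) ((N : k) * x) ∈ intAdeles k := by
      rw [map_mul, map_natCast]
      exact hx
    exact algebraMap_mem_intAdeles_iff.1 h3
  choose r hr using fun η : T => fun i j => hint _ (η.2.1 i j)
  have hNM : 0 < N * N * M := by positivity
  have hfin1 := finite_quotient_natCast (k := k) hNM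
  have hfin2 : Finite ((InfiniteAdeleRing k)ˣ ⧸ posUnits k) := by
    have : (posUnits k).FiniteIndex := ⟨index_posUnits_ne_zero⟩
    exact Subgroup.finite_quotient_of_finiteIndex
  let f : T → (Fin n → Fin n → 𝓞 k ⧸ Ideal.span {((N * N * M : ℕ) : 𝓞 k)}) ×
      ((InfiniteAdeleRing k)ˣ ⧸ posUnits k) := fun η =>
    (fun i j => Ideal.Quotient.mk _ (r η i j), QuotientGroup.mk (GeneralLinearGroup.det (toInf η.val)))
  obtain ⟨S, -, hS⟩ := Set.exists_subset_bijOn (Set.univ : Set T) f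
  refine ⟨Subtype.val '' S, (hS.finite_iff_finite.2 (Set.toFinite _)).image _, fun η h1 h2 => ?_⟩
  obtain ⟨η₀, hη₀, h⟩ := hS.surjOn ⟨⟨η, h1, h2⟩, trivial, rfl⟩
  refine ⟨η₀.val, ⟨η₀, hη₀, rfl⟩, ?_⟩
  have key : ∀ η η₀ : T, f η₀ = f η → ∀ i j, ∃ b ∈ intAdeles k,
      (toFin (η₀.val⁻¹ * η.val)).val i j = (1 : Matrix (Fin n) (Fin n) (Af k)) i j + M * b := by
    intro η η₀ h i j
    have h3 : ∀ l, ∃ a : 𝓞 k, η.val.val l j = η₀.val.val l j + N * M * algebraMap (𝓞 k) k a := by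
      intro l
      have h4 := congrFun (congrFun (congrArg Prod.fst h) l) j
      simp only [f] at h4
      rw [eq_comm, Ideal.Quotient.eq, Ideal.mem_span_singleton'] at h4
      obtain ⟨a, ha⟩ := h4
      refine ⟨a, ?_⟩
      have h5 := congrArg (algebraMap (𝓞 k) k) ha
      rw [map_mul, map_sub, hr, hr, map_natCast] at h5
      push_cast at h5
      have h6 : (N : k) * (η.val.val l j) = N * (η₀.val.val l j + N * M * algebraMap (𝓞 k) k a) := by
        linear_combination -h5
      exact mul_left_cancel₀ hNk h6
    choose a ha using h3
    refine ⟨∑ l, ((N : Af k) * algebraMap k (Af k) ((η₀.val⁻¹).val i l)) *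
      algebraMap k (Af k) (algebraMap (𝓞 k) k (a l)), sum_mem fun l _ => mul_mem (η₀.2.2 i l)
        (algebraMap_mem_intAdeles_iff.2 ⟨_, rfl⟩), ?_⟩
    have h7 : (η₀.val⁻¹ * η.val).val i j = (1 : Matrix (Fin n) (Fin n) k) i j +
        M * ∑ l, (N * (η₀.val⁻¹).val i l) * algebraMap (𝓞 k) k (a l) := by
      rw [Units.val_mul, Matrix.mul_apply]
      simp only [ha, mul_add, Finset.sum_add_distrib]
      rw [← Matrix.mul_apply, ← Units.val_mul, inv_mul_cancel, Units.val_one, Finset.mul_sum]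
      congr 1
      exact Finset.sum_congr rfl fun l _ => by ring
    change algebraMap k (Af k) ((η₀.val⁻¹ * η.val).val i j) = _
    rw [h7]
    simp only [map_add, map_mul, map_sum, map_natCast, Matrix.one_apply]
    split_ifs <;> simp
  rw [mem_arithGroup]
  refine ⟨?_, mem_conjLevel.1 (hsub _ (key ⟨η, h1, h2⟩ η₀ h) ?_)⟩
  · have h3 := QuotientGroup.eq.1 (congrArg Prod.snd h)
    rw [posGL, Subgroup.mem_comap, map_mul, map_mul, map_inv, map_inv]
    exact h3
  · have h3 := key η₀ ⟨η, h1, h2⟩ h.symm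
    have h4 : (η₀.val⁻¹ * η)⁻¹ = η⁻¹ * η₀.val := by group
    rw [← map_inv, h4]
    exact h3

section JEntries

variable {n : ℕ} {R : Type*} [CommRing R] (g : GL (Fin n) R)

theorem jEmb_castSucc_castSucc (a b : Fin n) :
    (jEmb g).val a.castSucc b.castSucc = g.val a b := by
  rw [jEmb_apply]
  have : ∀ a : Fin n, finSumFinEquiv.symm a.castSucc = Sum.inl a :=
    fun a => finSumFinEquiv_symm_apply_castAdd (n := 1) a
  rw [this, this, Matrix.fromBlocks_apply₁₁]

theorem finSumFinEquiv_symm_last' : finSumFinEquiv.symm (Fin.last n) = Sum.inr (0 : Fin 1) := by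
  rw [Equiv.symm_apply_eq]
  rfl

theorem jEmb_castSucc_last (a : Fin n) : (jEmb g).val a.castSucc (Fin.last n) = 0 := by
  rw [jEmb_apply, finSumFinEquiv_symm_last']
  rw [show finSumFinEquiv.symm a.castSucc = Sum.inl a from
    finSumFinEquiv_symm_apply_castAdd (n := 1) a]
  rfl

theorem jEmb_last_castSucc (a : Fin n) : (jEmb g).val (Fin.last n) a.castSucc = 0 := by
  rw [jEmb_apply, finSumFinEquiv_symm_last']
  rw [show finSumFinEquiv.symm a.castSucc = Sum.inl a from
    finSumFinEquiv_symm_apply_castAdd (n := 1) a]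
  rfl

theorem jEmb_last_last : (jEmb g).val (Fin.last n) (Fin.last n) = 1 := by
  rw [jEmb_apply, finSumFinEquiv_symm_last']
  rfl

/-- A matrix commuting with the projection to the last coordinate is block diagonal; this is the
quotient of its two blocks. -/
theorem exists_levi_quotient (β : GL (Fin (n + 1)) R)
    (h : ∀ a b, β.val a (Fin.last n) * (β⁻¹).val (Fin.last n) b =
      if a = Fin.last n ∧ b = Fin.last n then 1 else 0) :
    ∃ η : GL (Fin n) R,
      (∀ a b, η.val a b = (β⁻¹).val (Fin.last n) (Fin.last n) * β.val a.castSucc b.castSucc) ∧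
      ∀ a b, (η⁻¹).val a b = β.val (Fin.last n) (Fin.last n) * (β⁻¹).val a.castSucc b.castSucc := by
  have hll := h (Fin.last n) (Fin.last n)
  simp only [and_self, if_true] at hll
  have h1 : ∀ a : Fin n, β.val a.castSucc (Fin.last n) = 0 := by
    intro a
    have h2 := h a.castSucc (Fin.last n)
    rw [if_neg (by simp [Fin.castSucc_ne_last])] at h2
    calc _ = β.val (Fin.last n) (Fin.last n) * (β.val a.castSucc (Fin.last n) *
          (β⁻¹).val (Fin.last n) (Fin.last n)) := by linear_combination -(β.val a.castSucc (Fin.last n)) * hll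
      _ = 0 := by rw [h2, mul_zero]
  have h1' : ∀ a : Fin n, (β⁻¹).val (Fin.last n) a.castSucc = 0 := by
    intro a
    have h2 := h (Fin.last n) a.castSucc
    rw [if_neg (by simp [Fin.castSucc_ne_last])] at h2
    calc _ = (β⁻¹).val (Fin.last n) (Fin.last n) * (β.val (Fin.last n) (Fin.last n) *
          (β⁻¹).val (Fin.last n) a.castSucc) := by
            linear_combination -((β⁻¹).val (Fin.last n) a.castSucc) * hll
      _ = 0 := by rw [h2, mul_zero]
  have h2 : ∀ a b : Fin n, ∑ l : Fin n, β.val a.castSucc l.castSucc * (β⁻¹).val l.castSucc b.castSucc =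
      (1 : Matrix (Fin n) (Fin n) R) a b := by
    intro a b
    have h3 := congrFun (congrFun (Units.mul_inv β) a.castSucc) b.castSucc
    rw [Matrix.mul_apply, Fin.sum_univ_castSucc, h1, zero_mul, add_zero] at h3
    rw [h3, Matrix.one_apply, Matrix.one_apply]
    simp
  have h2' : ∀ a b : Fin n, ∑ l : Fin n, (β⁻¹).val a.castSucc l.castSucc * β.val l.castSucc b.castSucc =
      (1 : Matrix (Fin n) (Fin n) R) a b := by
    intro a b
    have h4 : (β⁻¹).val a.castSucc (Fin.last n) = 0 := by
      have h3 := congrFun (congrFun (Units.inv_mul β) a.castSucc) (Fin.last n)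
      rw [Matrix.mul_apply, Fin.sum_univ_castSucc] at h3
      simp only [h1, mul_zero, Finset.sum_const_zero, zero_add] at h3
      rw [Matrix.one_apply_ne (Fin.castSucc_ne_last a)] at h3
      linear_combination ((β⁻¹).val (Fin.last n) (Fin.last n)) * h3 -
        (β⁻¹).val a.castSucc (Fin.last n) * hll
    have h3 := congrFun (congrFun (Units.inv_mul β) a.castSucc) b.castSucc
    rw [Matrix.mul_apply, Fin.sum_univ_castSucc, h4, zero_mul, add_zero] at h3
    rw [h3, Matrix.one_apply, Matrix.one_apply]
    simp
  refine ⟨⟨Matrix.of fun a b => (β⁻¹).val (Fin.last n) (Fin.last n) * β.val a.castSucc b.castSucc,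
    Matrix.of fun a b => β.val (Fin.last n) (Fin.last n) * (β⁻¹).val a.castSucc b.castSucc, ?_, ?_⟩,
    fun a b => rfl, fun a b => rfl⟩
  · ext a b
    rw [← h2, Matrix.mul_apply]
    simp only [Matrix.of_apply]
    refine Finset.sum_congr rfl fun l _ => ?_
    linear_combination (β.val a.castSucc l.castSucc * (β⁻¹).val l.castSucc b.castSucc) * hll
  · ext a b
    rw [← h2', Matrix.mul_apply]
    simp only [Matrix.of_apply]
    refine Finset.sum_congr rfl fun l _ => ?_
    linear_combination ((β⁻¹).val a.castSucc l.castSucc * β.val l.castSucc b.castSucc) * hll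

end JEntries

/-- The projector onto the last coordinate, transported by `γ`. -/
def lastProjector {n : ℕ} (γ : GLk k (n + 1)) : Matrix (Fin (n + 1)) (Fin (n + 1)) k :=
  Matrix.of fun a b => γ.val a (Fin.last n) * (γ⁻¹).val (Fin.last n) b

theorem lastProjector_apply {n : ℕ} (γ : GLk k (n + 1)) (a b : Fin (n + 1)) :
    lastProjector γ a b = γ.val a (Fin.last n) * (γ⁻¹).val (Fin.last n) b := rfl

theorem inv_mul_of_lastProjector_eq {n : ℕ} {γ₀ γ : GLk k (n + 1)}
    (h : lastProjector γ = lastProjector γ₀) (a b : Fin (n + 1)) :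
    (γ₀⁻¹ * γ).val a (Fin.last n) * ((γ₀⁻¹ * γ)⁻¹).val (Fin.last n) b =
      if a = Fin.last n ∧ b = Fin.last n then 1 else 0 := by
  have h1 : ∀ γ : GLk k (n + 1), (γ₀⁻¹ * γ).val a (Fin.last n) * ((γ₀⁻¹ * γ)⁻¹).val (Fin.last n) b =
      ((γ₀⁻¹).val * lastProjector γ * γ₀.val) a b := by
    intro γ
    have h2 : (γ₀⁻¹ * γ)⁻¹ = γ⁻¹ * γ₀ := by group
    rw [h2, Units.val_mul, Units.val_mul, Matrix.mul_apply, Matrix.mul_apply, Matrix.mul_apply,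
      Finset.sum_mul_sum, Finset.sum_comm]
    refine Finset.sum_congr rfl fun y _ => ?_
    rw [Matrix.mul_apply, Finset.sum_mul]
    refine Finset.sum_congr rfl fun x _ => ?_
    rw [lastProjector_apply]
    ring
  rw [h1, h, ← h1, inv_mul_cancel, inv_one, Units.val_one, Matrix.one_apply, Matrix.one_apply]
  by_cases ha : a = Fin.last n <;> by_cases hb : b = Fin.last n <;>
    simp [ha, hb, eq_comm (a := Fin.last n)]

variable {n : ℕ} {E M₁ M₂ : Type*} [Field E] [AddCommGroup M₁] [Module E M₁] [AddCommGroup M₂]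
  [Module E M₂] {ρ₁ : Representation E (GLk k (n + 1)) M₁} {ρ₂ : Representation E (GLk k n) M₂}
  {J : AdGroup k (n + 1)} {J' : AdGroup k n}
  {K : Subgroup (GLf k (n + 1))} {K' : Subgroup (GLf k n)}

/-- The part of the symmetric space where a given projector comes from a bounded element is compact
modulo the arithmetic group. -/
theorem exists_isCompact_of_lastProjector {L : Subgroup (GLf k n)} (hL : IsOpen (L : Set (GLf k n)))
    (c : (Af k)ˣ) {N : ℕ} (hN : 0 < N) (B : ℝ) (γ₀ : GLk k (n + 1))
    (hγ₀ : ∀ i j, (N : Af k) * algebraMap k (Af k) (γ₀.val i j) ∈ intAdeles k ∧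
      (N : Af k) * algebraMap k (Af k) ((γ₀⁻¹).val i j) ∈ intAdeles k) :
    ∃ C : Set (SymCover k n), IsCompact C ∧ ∀ (γ₁ : GLk k (n + 1)),
      (∀ i j, (N : Af k) * algebraMap k (Af k) (γ₁.val i j) ∈ intAdeles k ∧
        (N : Af k) * algebraMap k (Af k) ((γ₁⁻¹).val i j) ∈ intAdeles k) →
      lastProjector γ₁ = lastProjector γ₀ → ∀ (g : GLinf k n), ∀ κ ∈ GK k (n + 1),
        InfBounded B (toInf γ₁ * jEmb g * κ) →
        ∃ γ ∈ arithGroup L c, toInf γ • (QuotientGroup.mk g : SymCover k n) ∈ C := by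
  obtain ⟨B₀, hB₀⟩ := exists_infBounded (toInf γ₀)
  set m : ℝ := ((n + 1 : ℕ) : ℝ)
  set B₁ : ℝ := m * (B₀ * B)
  set B₂ : ℝ := m * (m * (B₁ * B₁))
  obtain ⟨S, hS, hS'⟩ := exists_finite_coset_representatives hL c (N := N * N * (N * N)) (by positivity)
  refine ⟨⋃ η₀ ∈ S, (fun x : SymCover k n => (toInf η₀)⁻¹ • x) '' (QuotientGroup.mk ''
    {g : GLinf k n | InfBounded B₂ g}), ?_, ?_⟩
  · refine hS.isCompact_biUnion fun η₀ _ => ?_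
    exact ((isCompact_setOf_infBounded B₂).image QuotientGroup.continuous_mk).image (by fun_prop)
  intro γ₁ hγ₁ hP g κ hκ hb
  set β := γ₀⁻¹ * γ₁ with hβ
  obtain ⟨η, hη, hη'⟩ := exists_levi_quotient β (inv_mul_of_lastProjector_eq hP)
  have hint : ∀ (γ γ' : GLk k (n + 1)),
      (∀ i j, (N : Af k) * algebraMap k (Af k) (γ.val i j) ∈ intAdeles k) →
      (∀ i j, (N : Af k) * algebraMap k (Af k) (γ'.val i j) ∈ intAdeles k) → ∀ i j,
      ((N * N : ℕ) : Af k) * algebraMap k (Af k) ((γ * γ').val i j) ∈ intAdeles k := by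
    intro γ γ' h h' i j
    have : ((N * N : ℕ) : Af k) * algebraMap k (Af k) ((γ * γ').val i j) =
        ∑ l, ((N : Af k) * algebraMap k (Af k) (γ.val i l)) *
          ((N : Af k) * algebraMap k (Af k) (γ'.val l j)) := by
      rw [Units.val_mul, Matrix.mul_apply, map_sum, Finset.mul_sum]
      refine Finset.sum_congr rfl fun l _ => ?_
      rw [map_mul]
      push_cast
      ring
    rw [this]
    exact sum_mem fun l _ => mul_mem (h i l) (h' l j)
  have hβi := hint γ₀⁻¹ γ₁ (fun i j => (hγ₀ i j).2) (fun i j => (hγ₁ i j).1)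
  have hβi' := hint γ₁⁻¹ γ₀ (fun i j => (hγ₁ i j).2) (fun i j => (hγ₀ i j).1)
  have hβinv : β⁻¹ = γ₁⁻¹ * γ₀ := by rw [hβ]; group
  rw [← hβinv] at hβi'
  have hprod : ∀ x y : k, ((N * N : ℕ) : Af k) * algebraMap k (Af k) x ∈ intAdeles k →
      ((N * N : ℕ) : Af k) * algebraMap k (Af k) y ∈ intAdeles k →
      ((N * N * (N * N) : ℕ) : Af k) * algebraMap k (Af k) (x * y) ∈ intAdeles k := by
    intro x y hx hy
    have : ((N * N * (N * N) : ℕ) : Af k) * algebraMap k (Af k) (x * y) =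
      (((N * N : ℕ) : Af k) * algebraMap k (Af k) x) * (((N * N : ℕ) : Af k) * algebraMap k (Af k) y) := by
      rw [map_mul]
      push_cast
      ring
    rw [this]
    exact mul_mem hx hy
  obtain ⟨η₀, hη₀, hmem⟩ := hS' η
    (fun i j => by rw [hη]; exact hprod _ _ (hβi' _ _) (hβi _ _))
    (fun i j => by rw [hη']; exact hprod _ _ (hβi _ _) (hβi' _ _))
  refine ⟨η₀⁻¹ * η, hmem, Set.mem_biUnion hη₀ ⟨_, ⟨toInf η * g, ?_, rfl⟩, ?_⟩⟩
  · set Y : GLinf k (n + 1) := toInf β * jEmb g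
    have hY : InfBounded B₁ (Y * κ) := by
      have h1 : Y * κ = (toInf γ₀)⁻¹ * (toInf γ₁ * jEmb g * κ) := by
        simp only [Y, hβ, map_mul, map_inv, mul_assoc]
      rw [h1]
      exact hB₀.inv.mul hb
    have hbound := norm_mul_norm_le_of_infBounded hκ hY
    have hYinv : Y⁻¹ = jEmb g⁻¹ * toInf β⁻¹ := by
      simp only [Y, _root_.mul_inv_rev, map_inv]
    have e1 : ∀ a b : Fin n, Y.val a.castSucc b.castSucc = ∑ l : Fin n,
        algebraMap k (InfiniteAdeleRing k) (β.val a.castSucc l.castSucc) * g.val l b := by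
      intro a b
      rw [Units.val_mul, Matrix.mul_apply, Fin.sum_univ_castSucc, jEmb_last_castSucc, mul_zero, add_zero]
      simp only [jEmb_castSucc_castSucc]
      rfl
    have e2 : (Y⁻¹).val (Fin.last n) (Fin.last n) =
        algebraMap k (InfiniteAdeleRing k) ((β⁻¹).val (Fin.last n) (Fin.last n)) := by
      rw [hYinv, Units.val_mul, Matrix.mul_apply, Fin.sum_univ_castSucc, jEmb_last_last]
      simp only [jEmb_last_castSucc, zero_mul, Finset.sum_const_zero, zero_add, one_mul]
      rfl
    have e3 : ∀ a b : Fin n, (Y⁻¹).val a.castSucc b.castSucc = ∑ l : Fin n,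
        (g⁻¹).val a l * algebraMap k (InfiniteAdeleRing k) ((β⁻¹).val l.castSucc b.castSucc) := by
      intro a b
      rw [hYinv, Units.val_mul, Matrix.mul_apply, Fin.sum_univ_castSucc, jEmb_castSucc_last, zero_mul,
        add_zero]
      simp only [jEmb_castSucc_castSucc]
      rfl
    have e4 : Y.val (Fin.last n) (Fin.last n) =
        algebraMap k (InfiniteAdeleRing k) (β.val (Fin.last n) (Fin.last n)) := by
      rw [Units.val_mul, Matrix.mul_apply, Fin.sum_univ_castSucc, jEmb_last_last]
      simp only [jEmb_castSucc_last, mul_zero, Finset.sum_const_zero, zero_add, mul_one]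
      rfl
    intro v a b
    constructor
    · have h1 : (toInf η * g).val a b = Y.val a.castSucc b.castSucc *
          (Y⁻¹).val (Fin.last n) (Fin.last n) := by
        rw [e1, e2, Finset.sum_mul, Units.val_mul, Matrix.mul_apply]
        refine Finset.sum_congr rfl fun l _ => ?_
        change algebraMap k (InfiniteAdeleRing k) (η.val a l) * _ = _
        rw [hη, map_mul]
        ring
      rw [h1]
      exact hbound v _ _ _ _
    · have h1 : ((toInf η * g)⁻¹).val a b = Y.val (Fin.last n) (Fin.last n) *
          (Y⁻¹).val a.castSucc b.castSucc := by
        rw [e3, e4, Finset.mul_sum, _root_.mul_inv_rev, ← map_inv, Units.val_mul, Matrix.mul_apply]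
        refine Finset.sum_congr rfl fun l _ => ?_
        change _ * algebraMap k (InfiniteAdeleRing k) ((η⁻¹).val l b) = _
        rw [hη', map_mul]
        ring
      rw [h1]
      exact hbound v _ _ _ _
  · simp only [map_mul, map_inv, mul_smul]
    rfl

/-- The pullback of a compactly supported cochain along `j × ad` has compact support. -/
theorem exists_isCompact_of_mem_compactCochains (hK : IsCompact (K : Set (GLf k (n + 1)))) {q : ℕ}
    {φ : Cochain q J J' (M₁ ⊗[E] M₂)} (hφ : φ ∈ compactCochains ρ₁ ρ₂ J J' K K' q)
    {L : Subgroup (GLf k n)} (hL : IsOpen (L : Set (GLf k n))) (c : (Af k)ˣ)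
    (a : GLf k (n + 1) × GLf k n) :
    ∃ C : Set (SymCover k n), IsCompact C ∧ ∀ σ : Sing q (SymCover k n),
      φ ((diagMap J J').comp σ) a ≠ 0 → ∃ γ ∈ arithGroup L c, ∃ t, toInf γ • σ t ∈ C := by
  obtain ⟨-, -, C, S, hC, hS, h3⟩ := hφ
  obtain ⟨B, hB⟩ := exists_infBounded_of_isCompact J.grp (hC.image continuous_fst)
  let T : GLf k (n + 1) × GLf k n → GLf k (n + 1) → GLf k (n + 1) := fun s x => s.1 * x * a.1⁻¹
  have hT : ∀ s, Continuous (T s) := fun s =>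
    (continuous_const.mul continuous_id).mul continuous_const
  let D : Set (GLf k (n + 1)) := ⋃ s ∈ S, T s '' (K : Set (GLf k (n + 1)))
  have hD : IsCompact D := hS.isCompact_biUnion fun s _ => hK.image (hT s)
  obtain ⟨N, hN, hN'⟩ := exists_nat_mul_mem_of_isCompact hD
  have hPfin := finite_setOf_bounded (k := k) (n + 1) (N := N * N) (by positivity)
    ((n + 1 : ℕ) * ((n + 1 : ℕ) * (B * B)))
  set Pset := {A : Matrix (Fin (n + 1)) (Fin (n + 1)) k | ∀ i j,
    ((N * N : ℕ) : Af k) * algebraMap k (Af k) (A i j) ∈ intAdeles k ∧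
      ∀ v, ‖evalInf v (algebraMap k (InfiniteAdeleRing k) (A i j))‖ ≤
        (n + 1 : ℕ) * ((n + 1 : ℕ) * (B * B))}
  have hstep : ∀ P : Matrix (Fin (n + 1)) (Fin (n + 1)) k, ∃ C : Set (SymCover k n), IsCompact C ∧
      ∀ (γ₁ : GLk k (n + 1)),
      (∀ i j, (N : Af k) * algebraMap k (Af k) (γ₁.val i j) ∈ intAdeles k ∧
        (N : Af k) * algebraMap k (Af k) ((γ₁⁻¹).val i j) ∈ intAdeles k) →
      lastProjector γ₁ = P → ∀ (g : GLinf k n), ∀ κ ∈ GK k (n + 1),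
        InfBounded B (toInf γ₁ * jEmb g * κ) →
        ∃ γ ∈ arithGroup L c, toInf γ • (QuotientGroup.mk g : SymCover k n) ∈ C := by
    intro P
    by_cases hP : ∃ γ₀ : GLk k (n + 1),
      (∀ i j, (N : Af k) * algebraMap k (Af k) (γ₀.val i j) ∈ intAdeles k ∧
        (N : Af k) * algebraMap k (Af k) ((γ₀⁻¹).val i j) ∈ intAdeles k) ∧ lastProjector γ₀ = P
    · obtain ⟨γ₀, hγ₀, rfl⟩ := hP
      exact exists_isCompact_of_lastProjector hL c hN B γ₀ hγ₀
    · exact ⟨∅, isCompact_empty, fun γ₁ h1 h2 => absurd ⟨γ₁, h1, h2⟩ hP⟩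
  choose CP hCP hCP' using hstep
  refine ⟨⋃ P ∈ Pset, CP P, hPfin.isCompact_biUnion fun P _ => hCP P, fun σ hσ => ?_⟩
  obtain ⟨γ, t, ht, s, hs, hs'⟩ := h3 _ _ hσ
  obtain ⟨g, hg⟩ := QuotientGroup.mk_surjective (σ t)
  have ht1 : (QuotientGroup.mk (toInf γ.1 * jEmb g) : GLinf k (n + 1) ⧸ J.grp) ∈ Prod.fst '' C := by
    refine ⟨_, ht, ?_⟩
    change toInf γ.1 • (diagMap J J' (σ t)).1 = _
    rw [← hg]
    rfl
  obtain ⟨κ, hκ, hb⟩ := hB _ ht1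
  have hmemD : toFin γ.1 ∈ D := by
    refine Set.mem_biUnion hs ⟨s.1⁻¹ * (toFin γ.1 * a.1), hs'.1, ?_⟩
    simp [T, mul_assoc]
  have hint : ∀ i j, (N : Af k) * algebraMap k (Af k) (γ.1.val i j) ∈ intAdeles k ∧
      (N : Af k) * algebraMap k (Af k) ((γ.1⁻¹).val i j) ∈ intAdeles k := by
    intro i j
    have h5 := hN' _ hmemD i j
    rw [← map_inv] at h5
    exact h5
  have hPmem : lastProjector γ.1 ∈ Pset := by
    intro i j
    refine ⟨?_, fun v => ?_⟩
    · have : ((N * N : ℕ) : Af k) * algebraMap k (Af k) (lastProjector γ.1 i j) =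
          ((N : Af k) * algebraMap k (Af k) (γ.1.val i (Fin.last n))) *
          ((N : Af k) * algebraMap k (Af k) ((γ.1⁻¹).val (Fin.last n) j)) := by
        rw [lastProjector_apply, map_mul]
        push_cast
        ring
      rw [this]
      exact mul_mem (hint _ _).1 (hint _ _).2
    · have h5 := norm_mul_norm_le_of_infBounded (J.le_GK hκ) hb v i (Fin.last n) (Fin.last n) j
      have e1 : (toInf γ.1 * jEmb g).val i (Fin.last n) =
          algebraMap k (InfiniteAdeleRing k) (γ.1.val i (Fin.last n)) := by
        rw [Units.val_mul, Matrix.mul_apply, Fin.sum_univ_castSucc, jEmb_last_last]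
        simp only [jEmb_castSucc_last, mul_zero, Finset.sum_const_zero, zero_add, mul_one]
        rfl
      have e2 : ((toInf γ.1 * jEmb g)⁻¹).val (Fin.last n) j =
          algebraMap k (InfiniteAdeleRing k) ((γ.1⁻¹).val (Fin.last n) j) := by
        rw [_root_.mul_inv_rev, ← map_inv, ← map_inv, Units.val_mul, Matrix.mul_apply,
          Fin.sum_univ_castSucc, jEmb_last_last]
        simp only [jEmb_last_castSucc, zero_mul, Finset.sum_const_zero, zero_add, one_mul]
        rfl
      rw [e1, e2, ← map_mul] at h5
      exact h5
  obtain ⟨γ', hγ', hC'⟩ := hCP' _ γ.1 hint rfl g κ (J.le_GK hκ) hb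
  refine ⟨γ', hγ', t, Set.mem_biUnion hPmem ?_⟩
  rw [← hg]
  exact hC'

end

section

/-- The sum of a function over representatives of the classes of an equivalence relation. -/
noncomputable def quotSum {S E : Type*} [AddCommMonoid E] (r : Setoid S) (g : S → E) : E :=
  ∑ᶠ o : Quotient r, g o.out

section QuotSum

variable {S T E : Type*} [AddCommMonoid E]

/-- `g` vanishes outside finitely many classes. -/
def FiniteSupportMod (r : Setoid S) (g : S → E) : Prop :=
  ∃ A : Set S, A.Finite ∧ ∀ s, g s ≠ 0 → ∃ a ∈ A, r s a

theorem FiniteSupportMod.finite_support {r : Setoid S} {g : S → E} (h : FiniteSupportMod r g) :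
    (Function.support fun o : Quotient r => g o.out).Finite := by
  obtain ⟨A, hA, h⟩ := h
  refine (hA.image (Quotient.mk r)).subset fun o ho => ?_
  obtain ⟨a, ha, hr⟩ := h _ ho
  exact ⟨a, ha, by rw [← Quotient.out_eq o]; exact Quotient.sound (r.symm hr)⟩

theorem FiniteSupportMod.mono {E' : Type*} [AddCommMonoid E'] {r : Setoid S} {g : S → E} {g' : S → E'}
    (h : FiniteSupportMod r g) (hg : ∀ s, g' s ≠ 0 → g s ≠ 0) : FiniteSupportMod r g' := by
  obtain ⟨A, hA, h⟩ := h
  exact ⟨A, hA, fun s hs => h s (hg s hs)⟩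

theorem quotSum_congr {r : Setoid S} {g g' : S → E} (h : ∀ s, g s = g' s) :
    quotSum r g = quotSum r g' := by
  rw [funext h]

theorem quotSum_add {r : Setoid S} {g g' : S → E} (hg : FiniteSupportMod r g)
    (hg' : FiniteSupportMod r g') : quotSum r (fun s => g s + g' s) = quotSum r g + quotSum r g' :=
  finsum_add_distrib hg.finite_support hg'.finite_support

theorem quotSum_sum {ι : Type*} {r : Setoid S} (A : Finset ι) {g : ι → S → E}
    (hg : ∀ i ∈ A, FiniteSupportMod r (g i)) :
    quotSum r (fun s => ∑ i ∈ A, g i s) = ∑ i ∈ A, quotSum r (g i) :=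
  finsum_sum_comm A _ fun i hi => (hg i hi).finite_support

theorem quotSum_mul {E : Type*} [Field E] {r : Setoid S} (c : E) (g : S → E) :
    quotSum r (fun s => c * g s) = c * quotSum r g := by
  unfold quotSum
  simpa using (smul_finsum c fun o : Quotient r => g o.out).symm

theorem quotSum_sub {E : Type*} [AddCommGroup E] {r : Setoid S} {g g' : S → E}
    (hg : FiniteSupportMod r g) (hg' : FiniteSupportMod r g') :
    quotSum r (fun s => g s - g' s) = quotSum r g - quotSum r g' :=
  finsum_sub_distrib hg.finite_support hg'.finite_support

/-- Invariance of sums over classes under a map which induces an injection on classes. -/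
theorem quotSum_eq_quotSum_comp {r : Setoid S} {r' : Setoid T} (f : S → T)
    (hf : ∀ s s', r s s' ↔ r' (f s) (f s')) {F : T → E} (hF : ∀ t t', r' t t' → F t = F t')
    (hsupp : ∀ t, F t ≠ 0 → ∃ s, r' t (f s)) : quotSum r' F = quotSum r fun s => F (f s) := by
  let e : Quotient r → Quotient r' := Quotient.map f fun s s' h => (hf s s').1 h
  have he : Function.Injective e := by
    intro a b
    refine Quotient.inductionOn₂ a b fun s s' h => ?_
    exact Quotient.sound ((hf s s').2 (Quotient.exact h))
  have h1 : ∀ o, F (e o).out = F (f o.out) := by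
    intro o
    refine hF _ _ (Quotient.exact ?_)
    rw [Quotient.out_eq]
    conv_lhs => rw [← Quotient.out_eq o]
    rfl
  have h2 : Function.support (fun o : Quotient r' => F o.out) ⊆ Set.range e := by
    intro o ho
    obtain ⟨s, hs⟩ := hsupp _ ho
    refine ⟨Quotient.mk r s, ?_⟩
    rw [← Quotient.out_eq o]
    exact Quotient.sound (r'.symm hs)
  unfold quotSum
  rw [← finsum_mem_univ, ← finsum_mem_inter_support, Set.univ_inter,
    ← Set.inter_eq_self_of_subset_right h2, finsum_mem_inter_support, finsum_mem_range he]
  exact finsum_congr h1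

end QuotSum

section Action

variable {G S T E : Type*} [Group G] [MulAction G S] [MulAction G T] [AddCommMonoid E]

/-- The equivalence relation of a subgroup acting. -/
def actSetoid (Γ : Subgroup G) (S : Type*) [MulAction G S] : Setoid S where
  r s t := ∃ γ ∈ Γ, t = γ • s
  iseqv :=
    { refl := fun s => ⟨1, one_mem _, (one_smul _ _).symm⟩
      symm := by
        rintro s t ⟨γ, hγ, rfl⟩
        exact ⟨γ⁻¹, inv_mem hγ, (inv_smul_smul _ _).symm⟩
      trans := by
        rintro s t u ⟨γ, hγ, rfl⟩ ⟨δ, hδ, rfl⟩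
        exact ⟨δ * γ, mul_mem hδ hγ, (mul_smul _ _ _).symm⟩ }

open Classical in
/-- Summation over classes in two steps along an equivariant map to a set with a free action. -/
theorem quotSum_eq_quotSum_fiber (Γ : Subgroup G) (p : T → S) (hp : ∀ γ ∈ Γ, ∀ t, p (γ • t) = γ • p t)
    (hfree : ∀ γ ∈ Γ, ∀ s : S, γ • s = s → γ = 1) {F : T → E}
    (hF : ∀ γ ∈ Γ, ∀ t, F (γ • t) = F t) (hsupp : FiniteSupportMod (actSetoid Γ T) F) :
    quotSum (actSetoid Γ T) F =
      quotSum (actSetoid Γ S) fun s => ∑ᶠ t, if p t = s then F t else 0 := by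
  let R : Set S := Set.range fun o : Quotient (actSetoid Γ S) => o.out
  let T₀ : Set T := p ⁻¹' R
  have hR : ∀ s ∈ R, (Quotient.mk (actSetoid Γ S) s).out = s := by
    rintro _ ⟨o, rfl⟩
    simp only [Quotient.out_eq]
  have hRu : ∀ s ∈ R, ∀ γ ∈ Γ, γ • s ∈ R → γ = 1 := by
    intro s hs γ hγ hγs
    refine hfree γ hγ s ?_
    rw [← hR _ hγs, ← hR _ hs]
    congr 1
    exact Quotient.sound ⟨γ⁻¹, inv_mem hγ, by rw [hR _ hs, inv_smul_smul]⟩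
  have hRe : ∀ s : S, ∃ γ ∈ Γ, γ • s ∈ R := by
    intro s
    have : (actSetoid Γ S) s (Quotient.mk (actSetoid Γ S) s).out :=
      (actSetoid Γ S).symm (Quotient.mk_out s)
    obtain ⟨γ, hγ, h⟩ := this
    exact ⟨γ, hγ, by rw [← h]; exact ⟨_, rfl⟩⟩
  let e : T₀ → Quotient (actSetoid Γ T) := fun t => Quotient.mk _ t.val
  have he : Function.Bijective e := by
    constructor
    · rintro ⟨t, ht⟩ ⟨t', ht'⟩ h
      obtain ⟨γ, hγ, h'⟩ := (Quotient.exact h : actSetoid Γ T t t')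
      have h1 : γ = 1 := hRu (p t) ht γ hγ (by rw [← hp γ hγ, ← h']; exact ht')
      exact Subtype.ext (by simpa [h1] using h'.symm)
    · intro o
      obtain ⟨γ, hγ, h⟩ := hRe (p o.out)
      refine ⟨⟨γ • o.out, ?_⟩, ?_⟩
      · change p _ ∈ R
        rw [hp γ hγ]
        exact h
      · conv_rhs => rw [← Quotient.out_eq o]
        exact Quotient.sound ⟨γ⁻¹, inv_mem hγ, by simp⟩
  have hval : ∀ t : T₀, F (e t).out = F t.val := by
    intro t
    obtain ⟨γ, hγ, h⟩ := (Quotient.mk_out t.val : actSetoid Γ T _ _)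
    rw [h, hF γ hγ]
  have h1 : quotSum (actSetoid Γ T) F = ∑ᶠ t : T₀, F t.val :=
    (finsum_eq_of_bijective e he fun t => (hval t).symm).symm
  have hfin : (Function.support fun t : T₀ => F t.val).Finite := by
    refine Set.Finite.of_finite_image (f := e) (hsupp.finite_support.subset ?_) he.1.injOn
    rintro _ ⟨t, ht, rfl⟩
    rw [Function.mem_support, hval]
    exact ht
  let A : Finset T₀ := hfin.toFinset
  let cls : T₀ → Quotient (actSetoid Γ S) := fun t => Quotient.mk _ (p t.val)
  have hfib : ∀ o : Quotient (actSetoid Γ S),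
      (∑ᶠ t, if p t = o.out then F t else 0) = ∑ t ∈ A with cls t = o, F t.val := by
    intro o
    rw [finsum_eq_sum_of_support_subset (s := (A.filter fun t => cls t = o).map ⟨Subtype.val, Subtype.val_injective⟩)]
    · rw [Finset.sum_map]
      refine Finset.sum_congr rfl fun t ht => ?_
      rw [if_pos]
      · rfl
      · rw [← (Finset.mem_filter.1 ht).2]
        exact (hR _ t.2).symm
    · intro t ht
      rw [Function.mem_support, ne_eq, ite_eq_right_iff, Classical.not_imp] at ht
      rw [Finset.mem_coe, Finset.mem_map]
      have ht0 : t ∈ T₀ := by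
        change p t ∈ R
        rw [ht.1]
        exact ⟨o, rfl⟩
      refine ⟨⟨t, ht0⟩, Finset.mem_filter.2 ⟨hfin.mem_toFinset.2 ht.2, ?_⟩, rfl⟩
      simp only [cls, ht.1, Quotient.out_eq]
  have h2 : quotSum (actSetoid Γ S) (fun s => ∑ᶠ t, if p t = s then F t else 0) =
      ∑ o ∈ A.image cls, ∑ t ∈ A with cls t = o, F t.val := by
    unfold quotSum
    simp only [hfib]
    refine finsum_eq_sum_of_support_subset _ fun o ho => ?_
    obtain ⟨t, ht, -⟩ := Finset.exists_ne_zero_of_sum_ne_zero ho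
    rw [Finset.mem_filter] at ht
    rw [Finset.mem_coe, Finset.mem_image]
    exact ⟨t, ht.1, ht.2⟩
  rw [h1, h2, finsum_eq_sum _ hfin]
  exact (Finset.sum_fiberwise_of_maps_to (fun t ht => Finset.mem_image_of_mem _ ht) _).symm

end Action

end

section

variable {k : Type*} [Field k] [NumberField k] {n q : ℕ}

noncomputable instance singAction : MulAction (GLk k n) (Sing q (SymCover k n)) where
  smul γ σ := (symAct γ).comp σ
  one_smul σ := by
    ext t
    exact (congrArg (· • σ t) (map_one (toInf (k := k) (m := n)))).trans (one_smul _ _)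
  mul_smul γ δ σ := by
    ext t
    exact (congrArg (· • σ t) (map_mul (toInf (k := k) (m := n)) γ δ)).trans (mul_smul _ _ _)

theorem smul_sing_def (γ : GLk k n) (σ : Sing q (SymCover k n)) : γ • σ = (symAct γ).comp σ := rfl

theorem face_smul (i : Fin (q + 2)) (γ : GLk k n) (σ : Sing (q + 1) (SymCover k n)) :
    face i (γ • σ) = γ • face i σ := rfl

theorem mk_mem_posPart {g : GLinf k n} :
    (QuotientGroup.mk g : SymCover k n) ∈ posPart k n ↔ g ∈ posGL k n := by
  constructor
  · rintro ⟨g', hg', h⟩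
    have h1 : g'⁻¹ * g ∈ posGL k n := (QuotientGroup.eq.1 h : g'⁻¹ * g ∈ K0 k n).2
    simpa using mul_mem hg' h1
  · exact fun h => ⟨g, h, rfl⟩

theorem isOpen_posGL : IsOpen (posGL k n : Set (GLinf k n)) := by
  have h : (posGL k n : Set (GLinf k n)) = ⋂ v : {v : InfinitePlace k // v.IsReal},
      {g | 0 < InfinitePlace.Completion.extensionEmbeddingOfIsReal v.2 (evalInf v.1 g.val.det)} := by
    ext g
    simp only [Set.mem_iInter]
    exact ⟨fun h v => h v.1 v.2, fun h v hv => h ⟨v, hv⟩⟩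
  rw [h]
  refine isOpen_iInter_of_finite fun v => isOpen_lt continuous_const ?_
  exact (InfinitePlace.Completion.isometry_extensionEmbeddingOfIsReal v.2).continuous.comp
    ((continuous_evalInf v.1).comp Units.continuous_val.matrix_det)

theorem isClopen_posPart : IsClopen (posPart k n) := by
  have h : (QuotientGroup.mk : GLinf k n → SymCover k n) ⁻¹' posPart k n = posGL k n := by
    ext g
    exact mk_mem_posPart
  refine ⟨(QuotientGroup.isQuotientMap_mk _).isClosed_preimage.1 ?_,
    (QuotientGroup.isQuotientMap_mk _).isOpen_preimage.1 ?_⟩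
  · rw [h]
    exact (posGL k n).isClosed_of_isOpen isOpen_posGL
  · rw [h]
    exact isOpen_posGL

/-- A simplex in the component `G_n(ℝ)⁰ / K_n⁰`. -/
def IsPos (σ : Sing q (SymCover k n)) : Prop := ∀ t, σ t ∈ posPart k n

theorem isPos_of_apply_mem {σ : Sing q (SymCover k n)} {t : stdSimplex ℝ (Fin (q + 1))}
    (ht : σ t ∈ posPart k n) : IsPos σ := by
  have : PreconnectedSpace (stdSimplex ℝ (Fin (q + 1))) :=
    Subtype.preconnectedSpace (convex_stdSimplex ℝ _).isPreconnected
  have h1 := (isClopen_posPart (k := k) (n := n)).preimage σ.continuous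
  have h2 := h1.eq_univ ⟨t, ht⟩
  intro s
  exact (h2 ▸ Set.mem_univ s : s ∈ σ ⁻¹' posPart k n)

theorem isPos_face {i : Fin (q + 2)} {σ : Sing (q + 1) (SymCover k n)} :
    IsPos (face i σ) ↔ IsPos σ :=
  ⟨fun h => isPos_of_apply_mem (h (stdSimplex.vertex 0)), fun h t => h _⟩

theorem smul_mem_posPart {γ : GLk k n} (hγ : toInf γ ∈ posGL k n) {x : SymCover k n} :
    toInf γ • x ∈ posPart k n ↔ x ∈ posPart k n := by
  obtain ⟨g, rfl⟩ := QuotientGroup.mk_surjective x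
  have : toInf γ • (QuotientGroup.mk g : SymCover k n) = QuotientGroup.mk (toInf γ * g) := rfl
  rw [this, mk_mem_posPart, mk_mem_posPart]
  exact Subgroup.mul_mem_cancel_left _ hγ

theorem isPos_smul {γ : GLk k n} (hγ : toInf γ ∈ posGL k n) {σ : Sing q (SymCover k n)} :
    IsPos (γ • σ) ↔ IsPos σ :=
  forall_congr' fun _ => smul_mem_posPart hγ

variable {E : Type*} [Field E]

open Classical in
/-- The evaluation of a `Γ`-invariant chain on a `Γ`-invariant cochain, restricted to the component
`G_n(ℝ)⁰ / K_n⁰`. -/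
noncomputable def pairing (Γ : Subgroup (GLk k n)) (z : Sing q (SymCover k n) → ℤ)
    (f : Sing q (SymCover k n) → E) : E :=
  quotSum (actSetoid Γ _) fun σ => if IsPos σ then (z σ : E) * f σ else 0

/-- A group of positive elements acting freely. -/
structure ActsFreely (Γ : Subgroup (GLk k n)) : Prop where
  pos : ∀ γ ∈ Γ, toInf γ ∈ posGL k n
  free : ∀ γ ∈ Γ, ∀ x : SymCover k n, toInf γ • x = x → γ = 1

theorem ActsFreely.mono {Γ Γ' : Subgroup (GLk k n)} (h : ActsFreely Γ) (hΓ : Γ' ≤ Γ) : ActsFreely Γ' :=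
  ⟨fun γ hγ => h.pos γ (hΓ hγ), fun γ hγ => h.free γ (hΓ hγ)⟩

theorem actsFreely_arithGroup {L : Subgroup (GLf k n)} (hL : IsLevel L) (c : (Af k)ˣ) :
    ActsFreely (arithGroup L c) :=
  ⟨fun _ hγ => (mem_arithGroup.1 hγ).1, fun _ hγ _ => eq_one_of_smul_eq hL hγ⟩

theorem ActsFreely.free_sing {Γ : Subgroup (GLk k n)} (h : ActsFreely Γ) (γ : GLk k n) (hγ : γ ∈ Γ)
    (σ : Sing q (SymCover k n)) (hσ : γ • σ = σ) : γ = 1 :=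
  h.free γ hγ (σ (stdSimplex.vertex 0)) (congrArg (fun τ : Sing q (SymCover k n) =>
    τ (stdSimplex.vertex 0)) hσ)

/-- A `Γ`-invariant locally finite chain. -/
structure IsInvChain (Γ : Subgroup (GLk k n)) (z : Sing q (SymCover k n) → ℤ) : Prop where
  inv : ∀ γ ∈ Γ, ∀ σ, z (γ • σ) = z σ
  fin : ∀ C : Set (SymCover k n), IsCompact C → {σ | z σ ≠ 0 ∧ ∃ t, σ t ∈ C}.Finite

/-- A `Γ`-invariant cochain with compact support modulo `Γ`. -/
structure IsInvCochain (Γ : Subgroup (GLk k n)) (f : Sing q (SymCover k n) → E) : Prop where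
  inv : ∀ γ ∈ Γ, ∀ σ, f (γ • σ) = f σ
  supp : ∃ C : Set (SymCover k n), IsCompact C ∧ ∀ σ, f σ ≠ 0 → ∃ γ ∈ Γ, ∃ t, (γ • σ) t ∈ C

theorem IsInvChain.finiteSupportMod {E' : Type*} [AddCommMonoid E'] {Γ : Subgroup (GLk k n)}
    {z : Sing q (SymCover k n) → ℤ} (hz : IsInvChain Γ z) {C : Set (SymCover k n)} (hC : IsCompact C)
    {F : Sing q (SymCover k n) → E'}
    (hF : ∀ σ, F σ ≠ 0 → z σ ≠ 0 ∧ ∃ γ ∈ Γ, ∃ t, (γ • σ) t ∈ C) :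
    FiniteSupportMod (actSetoid Γ _) F := by
  refine ⟨_, hz.fin C hC, fun σ hσ => ?_⟩
  obtain ⟨h1, γ, hγ, t, ht⟩ := hF σ hσ
  exact ⟨γ • σ, ⟨by rwa [hz.inv γ hγ], t, ht⟩, γ, hγ, rfl⟩

open Classical in
theorem finiteSupportMod_pairing {Γ : Subgroup (GLk k n)} {z : Sing q (SymCover k n) → ℤ}
    (hz : IsInvChain Γ z) {f : Sing q (SymCover k n) → E} (hf : IsInvCochain Γ f) :
    FiniteSupportMod (actSetoid Γ _) fun σ => if IsPos σ then (z σ : E) * f σ else 0 := by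
  obtain ⟨C, hC, h⟩ := hf.supp
  refine hz.finiteSupportMod hC fun σ hσ => ?_
  rw [ne_eq, ite_eq_right_iff, Classical.not_imp] at hσ
  refine ⟨fun h0 => hσ.2 (by simp [h0]), h σ fun h0 => hσ.2 (by simp [h0])⟩

theorem pairing_sub_left {Γ : Subgroup (GLk k n)} {z z' : Sing q (SymCover k n) → ℤ}
    (hz : IsInvChain Γ z) (hz' : IsInvChain Γ z') {f : Sing q (SymCover k n) → E}
    (hf : IsInvCochain Γ f) : pairing Γ (fun σ => z σ - z' σ) f = pairing Γ z f - pairing Γ z' f := by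
  classical
  unfold pairing
  rw [← quotSum_sub (finiteSupportMod_pairing hz hf) (finiteSupportMod_pairing hz' hf)]
  refine quotSum_congr fun σ => ?_
  split_ifs
  · push_cast
    ring
  · simp

theorem pairing_sum_left {ι : Type*} (A : Finset ι) {Γ : Subgroup (GLk k n)}
    {z : ι → Sing q (SymCover k n) → ℤ} (hz : ∀ i ∈ A, IsInvChain Γ (z i))
    {f : Sing q (SymCover k n) → E} (hf : IsInvCochain Γ f) :
    pairing Γ (fun σ => ∑ i ∈ A, z i σ) f = ∑ i ∈ A, pairing Γ (z i) f := by
  classical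
  unfold pairing
  rw [← quotSum_sum A fun i hi => finiteSupportMod_pairing (hz i hi) hf]
  refine quotSum_congr fun σ => ?_
  split_ifs
  · push_cast
    rw [Finset.sum_mul]
  · simp

theorem pairing_mul_left {Γ : Subgroup (GLk k n)} (N : ℤ) (z : Sing q (SymCover k n) → ℤ)
    (f : Sing q (SymCover k n) → E) : pairing Γ (fun σ => N * z σ) f = N * pairing Γ z f := by
  classical
  unfold pairing
  rw [← quotSum_mul]
  refine quotSum_congr fun σ => ?_
  split_ifs
  · push_cast
    ring
  · simp

theorem pairing_add_right {Γ : Subgroup (GLk k n)} {z : Sing q (SymCover k n) → ℤ}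
    (hz : IsInvChain Γ z) {f f' : Sing q (SymCover k n) → E}
    (hf : IsInvCochain Γ f) (hf' : IsInvCochain Γ f') :
    pairing Γ z (fun σ => f σ + f' σ) = pairing Γ z f + pairing Γ z f' := by
  classical
  unfold pairing
  rw [← quotSum_add (finiteSupportMod_pairing hz hf) (finiteSupportMod_pairing hz hf')]
  refine quotSum_congr fun σ => ?_
  split_ifs
  · ring
  · simp

theorem pairing_mul_right {Γ : Subgroup (GLk k n)} (z : Sing q (SymCover k n) → ℤ)
    (c : E) (f : Sing q (SymCover k n) → E) :
    pairing Γ z (fun σ => c * f σ) = c * pairing Γ z f := by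
  classical
  unfold pairing
  rw [← quotSum_mul]
  refine quotSum_congr fun σ => ?_
  split_ifs
  · ring
  · simp

open Classical in
/-- Stokes' theorem: the boundary is adjoint to the coboundary. -/
theorem pairing_boundary {Γ : Subgroup (GLk k n)} (hΓ : ActsFreely Γ)
    {w : Sing (q + 1) (SymCover k n) → ℤ} (hw : IsInvChain Γ w)
    {f : Sing q (SymCover k n) → E} (hf : IsInvCochain Γ f) :
    pairing Γ (fun τ => ∑ᶠ σ : Sing (q + 1) (SymCover k n),
      ∑ i : Fin (q + 2), if face i σ = τ then (-1 : ℤ) ^ (i : ℕ) * w σ else 0) f =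
    pairing Γ w (fun σ => ∑ i : Fin (q + 2), (-1 : E) ^ (i : ℕ) * f (face i σ)) := by
  obtain ⟨C, hC, hsupp⟩ := hf.supp
  let F : Fin (q + 2) → Sing (q + 1) (SymCover k n) → E := fun i σ =>
    if IsPos σ then (-1 : E) ^ (i : ℕ) * w σ * f (face i σ) else 0
  have hFsupp : ∀ i σ, F i σ ≠ 0 → w σ ≠ 0 ∧ f (face i σ) ≠ 0 := by
    intro i σ h
    simp only [F, ne_eq, ite_eq_right_iff, Classical.not_imp] at h
    exact ⟨fun h0 => h.2 (by simp [h0]), fun h0 => h.2 (by simp [h0])⟩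
  have hFfin : ∀ i, FiniteSupportMod (actSetoid Γ _) (F i) := by
    intro i
    refine hw.finiteSupportMod hC fun σ hσ => ⟨(hFsupp i σ hσ).1, ?_⟩
    obtain ⟨γ, hγ, t, ht⟩ := hsupp _ (hFsupp i σ hσ).2
    exact ⟨γ, hγ, _, ht⟩
  have hFinv : ∀ i, ∀ γ ∈ Γ, ∀ σ, F i (γ • σ) = F i σ := by
    intro i γ hγ σ
    simp only [F, isPos_smul (hΓ.pos γ hγ), face_smul, hf.inv γ hγ, hw.inv γ hγ]
  have hfib : ∀ i, quotSum (actSetoid Γ _) (F i) =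
      quotSum (actSetoid Γ _) fun τ => ∑ᶠ σ, if face i σ = τ then F i σ else 0 := fun i =>
    quotSum_eq_quotSum_fiber Γ (face i) (fun γ _ σ => face_smul i γ σ)
      (fun γ hγ τ h => hΓ.free_sing γ hγ τ h) (hFinv i) (hFfin i)
  have hfin2 : ∀ i, FiniteSupportMod (actSetoid Γ (Sing q (SymCover k n)))
      fun τ => ∑ᶠ σ, if face i σ = τ then F i σ else 0 := by
    intro i
    obtain ⟨A, hA, h⟩ := hFfin i
    refine ⟨face i '' A, hA.image _, fun τ hτ => ?_⟩
    obtain ⟨σ, hσ⟩ : ∃ σ, (if face i σ = τ then F i σ else 0) ≠ 0 := by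
      by_contra h0
      refine hτ (finsum_eq_zero_of_forall_eq_zero fun σ => ?_)
      by_contra h1
      exact h0 ⟨σ, h1⟩
    rw [ne_eq, ite_eq_right_iff, Classical.not_imp] at hσ
    obtain ⟨a, ha, γ, hγ, rfl⟩ := h σ hσ.2
    exact ⟨_, ⟨_, ha, rfl⟩, γ, hγ, by rw [face_smul, hσ.1]⟩
  have hR : pairing Γ w (fun σ => ∑ i : Fin (q + 2), (-1 : E) ^ (i : ℕ) * f (face i σ)) =
      ∑ i, quotSum (actSetoid Γ _) (F i) := by
    rw [← quotSum_sum _ fun i _ => hFfin i]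
    refine quotSum_congr fun σ => ?_
    simp only [F]
    split_ifs
    · rw [Finset.mul_sum]
      exact Finset.sum_congr rfl fun i _ => by ring
    · simp
  rw [hR, Finset.sum_congr rfl fun i _ => hfib i, ← quotSum_sum _ fun i _ => hfin2 i]
  refine quotSum_congr fun τ => ?_
  have hτfin : {σ : Sing (q + 1) (SymCover k n) | w σ ≠ 0 ∧ ∃ i, face i σ = τ}.Finite := by
    refine (hw.fin (Set.range τ) (isCompact_range τ.continuous)).subset ?_
    rintro σ ⟨h1, i, rfl⟩
    exact ⟨h1, _, stdSimplex.vertex 0, rfl⟩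
  beta_reduce
  rw [finsum_eq_sum_of_support_subset (s := hτfin.toFinset) _ (fun σ hσ => by
    rw [Finset.mem_coe, hτfin.mem_toFinset]
    obtain ⟨i, -, hi⟩ := Finset.exists_ne_zero_of_sum_ne_zero hσ
    rw [ne_eq, ite_eq_right_iff, Classical.not_imp] at hi
    exact ⟨fun h0 => hi.2 (by simp [h0]), i, hi.1⟩)]
  have h3 : ∀ i : Fin (q + 2), (∑ᶠ σ, if face i σ = τ then F i σ else 0) =
      ∑ σ ∈ hτfin.toFinset, if face i σ = τ then F i σ else 0 := by
    intro i
    refine finsum_eq_sum_of_support_subset _ fun σ hσ => ?_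
    rw [Finset.mem_coe, hτfin.mem_toFinset]
    rw [Function.mem_support, ne_eq, ite_eq_right_iff, Classical.not_imp] at hσ
    exact ⟨(hFsupp i σ hσ.2).1, i, hσ.1⟩
  rw [Finset.sum_congr rfl fun i _ => h3 i]
  by_cases hpos : IsPos τ
  · rw [if_pos hpos, Finset.sum_comm]
    push_cast
    rw [Finset.sum_mul]
    refine Finset.sum_congr rfl fun i _ => ?_
    rw [Finset.sum_mul]
    refine Finset.sum_congr rfl fun σ _ => ?_
    by_cases hi : face i σ = τ
    · have : IsPos σ := by rwa [← isPos_face (i := i), hi]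
      rw [if_pos hi, if_pos hi]
      simp only [F]
      rw [if_pos this, hi]
    · rw [if_neg hi, if_neg hi, zero_mul]
  · rw [if_neg hpos]
    symm
    refine Finset.sum_eq_zero fun i _ => Finset.sum_eq_zero fun σ _ => ?_
    by_cases hi : face i σ = τ
    · have : ¬ IsPos σ := by rwa [← isPos_face (i := i), hi]
      rw [if_pos hi]
      simp only [F]
      rw [if_neg this]
    · rw [if_neg hi]

end

section

section Action

variable {G S X E : Type*} [Group G] [MulAction G S] [MulAction G X] [AddCommMonoid E]

open Classical in
/-- Unfolding of a sum over classes of `S` and over a finite set with an action: it becomes a sum over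
representatives of the orbits of the finite set and over classes of `S` modulo their stabilizers. -/
theorem quotSum_sum_eq_sum_quotSum (Γ : Subgroup G) (hfree : ∀ γ ∈ Γ, ∀ s : S, γ • s = s → γ = 1)
    (X₀ A : Finset X) (hX : ∀ γ ∈ Γ, ∀ x ∈ X₀, γ • x ∈ X₀) (hA : A ⊆ X₀)
    (hA' : ∀ x ∈ X₀, ∃! a, a ∈ A ∧ ∃ γ ∈ Γ, x = γ • a) {P : S → X → E}
    (hP : ∀ γ ∈ Γ, ∀ x ∈ X₀, ∀ s, P (γ • s) (γ • x) = P s x)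
    (hsupp : ∀ x ∈ X₀, FiniteSupportMod (actSetoid Γ S) fun s => P s x) :
    quotSum (actSetoid Γ S) (fun s => ∑ x ∈ X₀, P s x) =
      ∑ a ∈ A, quotSum (actSetoid (Γ ⊓ MulAction.stabilizer G a) S) fun s => P s a := by
  let H : S × X → E := fun t => if t.2 ∈ X₀ then P t.1 t.2 else 0
  let Ha : X → S × X → E := fun a t => if ∃ γ ∈ Γ, t.2 = γ • a then P t.1 t.2 else 0
  have hXiff : ∀ γ ∈ Γ, ∀ x, γ • x ∈ X₀ ↔ x ∈ X₀ := fun γ hγ x =>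
    ⟨fun h => by simpa using hX γ⁻¹ (inv_mem hγ) _ h, hX γ hγ x⟩
  have hHinv : ∀ γ ∈ Γ, ∀ t, H (γ • t) = H t := by
    rintro γ hγ ⟨s, x⟩
    simp only [H, Prod.smul_mk, hXiff γ hγ]
    split_ifs with h
    · exact hP γ hγ x h s
    · rfl
  have hHfin : FiniteSupportMod (actSetoid Γ (S × X)) H := by
    choose B hB h using hsupp
    refine ⟨⋃ x : X₀, B x.1 x.2 ×ˢ (X₀ : Set X),
      Set.finite_iUnion fun x => (hB x.1 x.2).prod X₀.finite_toSet, ?_⟩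
    rintro ⟨s, x⟩ hs
    simp only [H, ne_eq, ite_eq_right_iff, Classical.not_imp] at hs
    obtain ⟨b, hb, γ, hγ, rfl⟩ := h x hs.1 s hs.2
    exact ⟨(γ • s, γ • x), Set.mem_iUnion.2 ⟨⟨x, hs.1⟩, hb, hX γ hγ x hs.1⟩, γ, hγ, rfl⟩
  have hHa : ∀ a ∈ A, ∀ t, Ha a t ≠ 0 → H t ≠ 0 := by
    rintro a ha ⟨s, x⟩ h
    simp only [Ha, ne_eq, ite_eq_right_iff, Classical.not_imp] at h
    obtain ⟨⟨γ, hγ, hx⟩, h⟩ := h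
    simp only [H]
    rw [if_pos (by rw [hx]; exact hX γ hγ a (hA ha))]
    exact h
  have hHsum : ∀ t, H t = ∑ a ∈ A, Ha a t := by
    rintro ⟨s, x⟩
    simp only [H, Ha]
    split_ifs with hx
    · obtain ⟨a, ⟨ha, hax⟩, hu⟩ := hA' x hx
      rw [Finset.sum_eq_single_of_mem a ha, if_pos hax]
      intro b hb hba
      rw [if_neg fun h => hba (hu b ⟨hb, h⟩)]
    · symm
      refine Finset.sum_eq_zero fun a ha => if_neg ?_
      rintro ⟨γ, hγ, h⟩
      exact hx (by rw [h]; exact hX γ hγ a (hA ha))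
  have h1 : quotSum (actSetoid Γ (S × X)) H = quotSum (actSetoid Γ S) fun s => ∑ x ∈ X₀, P s x := by
    rw [quotSum_eq_quotSum_fiber Γ Prod.fst (fun _ _ _ => rfl) hfree hHinv hHfin]
    refine quotSum_congr fun s => ?_
    rw [finsum_eq_sum_of_support_subset (s := X₀.image fun x => (s, x))]
    · rw [Finset.sum_image fun x _ y _ h => congrArg Prod.snd h]
      refine Finset.sum_congr rfl fun x hx => ?_
      simp [H, hx]
    · rintro ⟨s', x⟩ h
      rw [Function.mem_support] at h
      simp only [H, ne_eq, ite_eq_right_iff, Classical.not_imp] at h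
      obtain ⟨rfl, hx, -⟩ := h
      simpa using hx
  rw [← h1, quotSum_congr hHsum, quotSum_sum A fun a ha => hHfin.mono (hHa a ha)]
  refine Finset.sum_congr rfl fun a ha => ?_
  rw [quotSum_eq_quotSum_comp (r := actSetoid (Γ ⊓ MulAction.stabilizer G a) S) (fun s => (s, a))]
  · refine quotSum_congr fun s => ?_
    simp only [Ha]
    rw [if_pos ⟨1, one_mem _, (one_smul _ _).symm⟩]
  · intro s s'
    constructor
    · rintro ⟨γ, hγ, rfl⟩
      exact ⟨γ, hγ.1, Prod.ext rfl (MulAction.mem_stabilizer_iff.1 hγ.2).symm⟩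
    · rintro ⟨γ, hγ, h⟩
      exact ⟨γ, ⟨hγ, MulAction.mem_stabilizer_iff.2 (congrArg Prod.snd h).symm⟩, congrArg Prod.fst h⟩
  · rintro ⟨s, x⟩ _ ⟨γ, hγ, rfl⟩
    have : (∃ δ ∈ Γ, γ • x = δ • a) ↔ ∃ δ ∈ Γ, x = δ • a := by
      constructor
      · rintro ⟨δ, hδ, h⟩
        exact ⟨γ⁻¹ * δ, mul_mem (inv_mem hγ) hδ, by rw [mul_smul, ← h, inv_smul_smul]⟩
      · rintro ⟨δ, hδ, rfl⟩
        exact ⟨γ * δ, mul_mem hγ hδ, (mul_smul _ _ _).symm⟩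
    simp only [Ha, Prod.smul_mk, this]
    split_ifs with h
    · obtain ⟨δ, hδ, rfl⟩ := h
      exact (hP γ hγ _ (hX δ hδ a (hA ha)) s).symm
    · rfl
  · rintro ⟨s, x⟩ h
    simp only [Ha, ne_eq, ite_eq_right_iff, Classical.not_imp] at h
    obtain ⟨⟨γ, hγ, rfl⟩, -⟩ := h
    exact ⟨γ⁻¹ • s, γ⁻¹, inv_mem hγ, by simp⟩

end Action

variable {k : Type*} [Field k] [NumberField k] {n q : ℕ} {E : Type*} [Field E]

/-- A cochain with vanishing coboundary. -/
def IsClosedCochain (f : Sing q (SymCover k n) → E) : Prop :=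
  ∀ σ : Sing (q + 1) (SymCover k n), ∑ i : Fin (q + 2), (-1 : E) ^ (i : ℕ) * f (face i σ) = 0

theorem IsLocallyFiniteChain.isInvChain {L : Subgroup (GLf k n)} {z : Chain k n q}
    (hz : IsLocallyFiniteChain L z) {Γ : Subgroup (GLk k n)} {a : GLf k n}
    (hΓ : ∀ γ ∈ Γ, a⁻¹ * toFin γ * a ∈ L) : IsInvChain Γ fun σ => z σ a := by
  refine ⟨fun γ hγ σ => ?_, hz.locallyFinite a⟩
  have h1 := hz.invariant γ σ (a * (a⁻¹ * toFin γ * a)⁻¹)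
  rw [hz.level σ a _ (inv_mem (hΓ γ hγ))] at h1
  rw [← h1, smul_sing_def]
  congr 1
  group

theorem IsCycle.isLocallyFiniteChain {L : Subgroup (GLf k n)} {z : Chain k n q} (hz : IsCycle L z) :
    IsLocallyFiniteChain L z := by
  cases q with
  | zero => exact hz
  | succ q => exact hz.1

theorem pairing_zero_left {Γ : Subgroup (GLk k n)} (f : Sing q (SymCover k n) → E) :
    pairing Γ (fun _ => 0) f = 0 := by
  simpa using pairing_mul_left (Γ := Γ) 0 0 f

theorem pairing_zero_right {Γ : Subgroup (GLk k n)} (z : Sing q (SymCover k n) → ℤ) :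
    pairing Γ z (fun _ => (0 : E)) = 0 := by
  simpa using pairing_mul_right (Γ := Γ) z (0 : E) 0

/-- Homologous chains have the same values on closed cochains. -/
theorem Homologous.pairing_eq {L : Subgroup (GLf k n)} {z z' : Chain k n q} (h : Homologous L z z')
    {Γ : Subgroup (GLk k n)} (hΓ : ActsFreely Γ) {a : GLf k n} (ha : ∀ γ ∈ Γ, a⁻¹ * toFin γ * a ∈ L)
    (hz : IsInvChain Γ fun σ => z σ a) (hz' : IsInvChain Γ fun σ => z' σ a)
    {f : Sing q (SymCover k n) → E} (hf : IsInvCochain Γ f) (hf' : IsClosedCochain f) :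
    pairing Γ (fun σ => z σ a) f = pairing Γ (fun σ => z' σ a) f := by
  obtain ⟨w, hw, hw'⟩ := h
  rw [← sub_eq_zero, ← pairing_sub_left hz hz' hf]
  have h1 := pairing_boundary hΓ (hw.isInvChain ha) hf
  rw [show (fun σ => ∑ i : Fin (q + 2), (-1 : E) ^ (i : ℕ) * f (face i σ)) = fun _ => (0 : E) from
    funext hf', pairing_zero_right] at h1
  rw [← h1]
  refine congrArg (fun z => pairing Γ z f) (funext fun τ => ?_)
  exact (congrFun (congrFun hw' τ) a).symm

/-- Cycles vanish on coboundaries. -/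
theorem IsCycle.pairing_coboundary {L : Subgroup (GLf k n)} {z : Chain k n (q + 1)} (hz : IsCycle L z)
    {Γ : Subgroup (GLk k n)} (hΓ : ActsFreely Γ) {a : GLf k n} (ha : ∀ γ ∈ Γ, a⁻¹ * toFin γ * a ∈ L)
    {f : Sing q (SymCover k n) → E} (hf : IsInvCochain Γ f) :
    pairing Γ (fun σ => z σ a)
      (fun σ => ∑ i : Fin (q + 2), (-1 : E) ^ (i : ℕ) * f (face i σ)) = 0 := by
  rw [← pairing_boundary hΓ (hz.1.isInvChain ha) hf, ← pairing_zero_left (Γ := Γ) f]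
  refine congrArg (fun z => pairing Γ z f) (funext fun τ => ?_)
  exact congrFun (congrFun hz.2 τ) a

theorem evalOnComponent_eq_pairing (F : FundamentalClasses k n) {L : Subgroup (GLf k n)}
    (hL : IsLevel L) (c : (Af k)ˣ) {f : Sing (degree k n) (SymCover k n) → E}
    (hf : ∀ γ ∈ arithGroup L c, ∀ σ, f (γ • σ) = f σ) :
    evalOnComponent F L c f = pairing (arithGroup L c) (fun σ => F.cyc L σ (dElt c)) f := by
  classical
  have hz := (F.isFundamental L hL).1.isLocallyFiniteChain.isInvChain
    (Γ := arithGroup L c) (a := dElt c) fun γ hγ => (mem_arithGroup.1 hγ).2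
  unfold pairing
  rw [quotSum_eq_quotSum_comp (r := orbitSetoid (arithGroup L c) (degree k n)) Subtype.val
    (fun _ _ => Iff.rfl)]
  · refine quotSum_congr (g := fun s : PosSing k n (degree k n) =>
      (F.cyc L s.val (dElt c) : E) * f s.val) fun s => ?_
    rw [if_pos (show IsPos s.val from s.2)]
  · rintro σ _ ⟨γ, hγ, rfl⟩
    simp only [isPos_smul (mem_arithGroup.1 hγ).1, hz.inv γ hγ, hf γ hγ]
  · intro σ hσ
    rw [ne_eq, ite_eq_right_iff, Classical.not_imp] at hσ
    exact ⟨⟨σ, hσ.1⟩, (actSetoid _ _).refl σ⟩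

theorem exists_finset_cosets {G : Type*} [Group G] {H H' : Subgroup G} (h : H'.relIndex H ≠ 0) :
    ∃ X : Finset (G ⧸ H'), X.card = H'.relIndex H ∧
      ∀ x, x ∈ X ↔ ∃ g ∈ H, x = (QuotientGroup.mk g : G ⧸ H') := by
  classical
  have : (H'.subgroupOf H).FiniteIndex := ⟨h⟩
  have := Fintype.ofFinite (H ⧸ H'.subgroupOf H)
  let e : H ⧸ H'.subgroupOf H → G ⧸ H' := Quotient.map' Subtype.val fun a b hab => by
    rw [QuotientGroup.leftRel_apply] at hab ⊢
    exact hab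
  have he : Function.Injective e := by
    intro a b
    induction a using QuotientGroup.induction_on
    induction b using QuotientGroup.induction_on
    intro hab
    exact QuotientGroup.eq.2 (QuotientGroup.eq.1 hab : _ ∈ H')
  refine ⟨Finset.univ.image e, ?_, fun x => ?_⟩
  · rw [Finset.card_image_of_injective _ he, Finset.card_univ, ← Nat.card_eq_fintype_card]
    rfl
  · simp only [Finset.mem_image, Finset.mem_univ, true_and]
    constructor
    · rintro ⟨a, rfl⟩
      induction a using QuotientGroup.induction_on with | H g =>
      exact ⟨g.1, g.2, rfl⟩
    · rintro ⟨g, hg, rfl⟩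
      exact ⟨QuotientGroup.mk ⟨g, hg⟩, rfl⟩

/-- Restriction to a subgroup of finite index multiplies the pairing with the index. -/
theorem pairing_of_le {Γ Γ' : Subgroup (GLk k n)} (hΓ : ActsFreely Γ) (hle : Γ' ≤ Γ)
    (hindex : Γ'.relIndex Γ ≠ 0) {z : Sing q (SymCover k n) → ℤ} (hz : IsInvChain Γ z)
    {f : Sing q (SymCover k n) → E} (hf : IsInvCochain Γ f) :
    pairing Γ' z f = Γ'.relIndex Γ * pairing Γ z f := by
  classical
  obtain ⟨X, hXcard, hX⟩ := exists_finset_cosets hindex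
  have h1X : (QuotientGroup.mk 1 : GLk k n ⧸ Γ') ∈ X := (hX _).2 ⟨1, one_mem _, rfl⟩
  have h := quotSum_sum_eq_sum_quotSum Γ (hΓ.free_sing (q := q)) X {QuotientGroup.mk 1}
    (P := fun σ _ => if IsPos σ then (z σ : E) * f σ else 0) (fun γ hγ x hx => by
      obtain ⟨g, hg, rfl⟩ := (hX x).1 hx
      exact (hX _).2 ⟨γ * g, mul_mem hγ hg, rfl⟩) (by simpa using h1X) (fun x hx => by
      obtain ⟨g, hg, rfl⟩ := (hX x).1 hx
      refine ⟨QuotientGroup.mk 1, ⟨Finset.mem_singleton_self _, g, hg, ?_⟩, ?_⟩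
      · exact congrArg QuotientGroup.mk (mul_one g).symm
      · rintro y ⟨hy, -⟩
        exact Finset.mem_singleton.1 hy) (fun γ hγ x hx σ => by
      simp only [isPos_smul (hΓ.pos γ hγ), hz.inv γ hγ, hf.inv γ hγ])
    fun x hx => finiteSupportMod_pairing hz hf
  have hst : Γ ⊓ MulAction.stabilizer (GLk k n) (QuotientGroup.mk 1 : GLk k n ⧸ Γ') = Γ' := by
    ext γ
    rw [Subgroup.mem_inf, MulAction.mem_stabilizer_iff]
    have : γ • (QuotientGroup.mk 1 : GLk k n ⧸ Γ') = QuotientGroup.mk 1 ↔ γ ∈ Γ' := by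
      rw [eq_comm, MulAction.Quotient.smul_mk, QuotientGroup.eq]
      simp
    rw [this]
    exact ⟨fun h => h.2, fun h => ⟨hle h, h⟩⟩
  simp only [Finset.sum_singleton, Finset.sum_const, nsmul_eq_mul, hXcard] at h
  rw [hst, quotSum_mul] at h
  exact h.symm

theorem IsInvCochain.of_le {Γ Γ' : Subgroup (GLk k n)} (hle : Γ' ≤ Γ) (hindex : Γ'.relIndex Γ ≠ 0)
    {f : Sing q (SymCover k n) → E} (hf : IsInvCochain Γ f) : IsInvCochain Γ' f := by
  refine ⟨fun γ hγ => hf.inv γ (hle hγ), ?_⟩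
  obtain ⟨X, -, hX⟩ := exists_finset_cosets hindex
  obtain ⟨C, hC, h⟩ := hf.supp
  refine ⟨⋃ x ∈ X, (fun t => toInf x.out⁻¹ • t) '' C, X.isCompact_biUnion fun x _ =>
    hC.image (continuous_const_smul _), fun σ hσ => ?_⟩
  obtain ⟨γ, hγ, t, ht⟩ := h σ hσ
  let x : GLk k n ⧸ Γ' := QuotientGroup.mk γ
  have hx : x.out⁻¹ * γ ∈ Γ' := QuotientGroup.eq.1 (QuotientGroup.out_eq' x)
  refine ⟨x.out⁻¹ * γ, hx, t, Set.mem_biUnion ((hX x).2 ⟨γ, hγ, rfl⟩) ⟨_, ht, ?_⟩⟩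
  rw [mul_smul]
  rfl

theorem IsInvChain.sum {ι : Type*} (A : Finset ι) {Γ : Subgroup (GLk k n)}
    {z : ι → Sing q (SymCover k n) → ℤ} (hz : ∀ i ∈ A, IsInvChain Γ (z i)) :
    IsInvChain Γ fun σ => ∑ i ∈ A, z i σ := by
  refine ⟨fun γ hγ σ => Finset.sum_congr rfl fun i hi => (hz i hi).inv γ hγ σ, fun C hC => ?_⟩
  refine (A.finite_toSet.biUnion fun i hi => (hz i hi).fin C hC).subset ?_
  rintro σ ⟨h, ht⟩
  obtain ⟨i, hi, h⟩ := Finset.exists_ne_zero_of_sum_ne_zero h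
  exact Set.mem_biUnion hi ⟨h, ht⟩

theorem IsInvChain.mul {Γ : Subgroup (GLk k n)} (N : ℤ) {z : Sing q (SymCover k n) → ℤ}
    (hz : IsInvChain Γ z) : IsInvChain Γ fun σ => N * z σ :=
  ⟨fun γ hγ σ => by rw [hz.inv γ hγ], fun C hC => (hz.fin C hC).subset fun _ h =>
    ⟨right_ne_zero_of_mul h.1, h.2⟩⟩

variable [CharZero E]

theorem FundamentalClasses.pairing_cyc_eq_of_normal (F : FundamentalClasses k n)
    {L L' : Subgroup (GLf k n)} (hL : IsLevel L) (hL' : IsLevel L') (hle : L' ≤ L)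
    (hnormal : ∀ b ∈ L, conjLevel b L' = L') {Γ : Subgroup (GLk k n)} (hΓ : ActsFreely Γ)
    {a : GLf k n} (ha : ∀ γ ∈ Γ, a⁻¹ * toFin γ * a ∈ L')
    {f : Sing (degree k n) (SymCover k n) → E} (hf : IsInvCochain Γ f) (hf' : IsClosedCochain f) :
    pairing Γ (fun σ => F.cyc L σ a) f = pairing Γ (fun σ => F.cyc L' σ a) f := by
  have hindex := relIndex_ne_zero_of_isOpen hL'.isOpen hL.isCompact
  have : (L'.subgroupOf L).FiniteIndex := ⟨hindex⟩
  have := Fintype.ofFinite (L ⧸ L'.subgroupOf L)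
  have hc := (F.isFundamental L hL).1.isLocallyFiniteChain
  have hc' := (F.isFundamental L' hL').1.isLocallyFiniteChain
  have hb : ∀ b ∈ L, IsInvChain Γ fun σ => F.cyc L' σ (a * b) := by
    intro b hb
    refine hc'.isInvChain fun γ hγ => ?_
    have h1 := ha γ hγ
    rw [← hnormal b hb, mem_conjLevel] at h1
    convert! h1 using 1
    group
  have h1 : ∀ b ∈ L, pairing Γ (fun σ => F.cyc L' σ (a * b)) f =
      pairing Γ (fun σ => F.cyc L' σ a) f := by
    intro b hbL
    have h2 := F.translate L' hL' b⁻¹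
    rw [hnormal _ (inv_mem hbL), inv_inv] at h2
    exact h2.pairing_eq hΓ ha (hb b hbL) (hc'.isInvChain ha) hf hf'
  have h3 := F.project L' L hL' hL hle
  simp only [finsum_eq_sum_of_fintype] at h3
  have h4 := h3.pairing_eq hΓ (fun γ hγ => hle (ha γ hγ))
    (IsInvChain.sum _ fun b _ => hb _ b.out.2)
    ((hc.isInvChain fun γ hγ => hle (ha γ hγ)).mul _) hf hf'
  rw [pairing_sum_left _ (fun b _ => hb _ b.out.2) hf, pairing_mul_left,
    Finset.sum_congr rfl fun b _ => h1 _ b.out.2, Finset.sum_const, Finset.card_univ,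
    ← Nat.card_eq_fintype_card, nsmul_eq_mul] at h4
  have h5 : ((Nat.card (L ⧸ L'.subgroupOf L) : ℕ) : E) ≠ 0 := Nat.cast_ne_zero.2 hindex
  refine (mul_left_cancel₀ h5 (h4.trans ?_)).symm
  rw [Int.cast_natCast]
  rfl

theorem exists_normal_level {L L' : Subgroup (GLf k n)} (hL : IsLevel L)
    (hL' : IsLevel L') :
    ∃ N : Subgroup (GLf k n), N ≤ L' ∧ IsLevel N ∧ ∀ b ∈ L, conjLevel b N = N := by
  have hindex := relIndex_ne_zero_of_isOpen hL'.isOpen hL.isCompact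
  have hfi : (L'.subgroupOf L).FiniteIndex := ⟨hindex⟩
  let N₀ : Subgroup L := (L'.subgroupOf L).normalCore
  have hN₀ : IsOpen (N₀ : Set L) := by
    refine Subgroup.isOpen_of_isClosed_of_finiteIndex _ (Subgroup.normalCore_isClosed _ ?_)
    exact Subgroup.isClosed_of_isOpen _ (hL'.isOpen.preimage continuous_subtype_val)
  have hNle : N₀.map L.subtype ≤ L' := by
    rintro _ ⟨x, hx, rfl⟩
    exact Subgroup.normalCore_le (L'.subgroupOf L) hx
  refine ⟨N₀.map L.subtype, hNle, hL'.of_le hNle ?_, fun b hb => ?_⟩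
  · exact hL.isOpen.isOpenMap_subtype_val _ hN₀
  · have key : ∀ b ∈ L, ∀ x ∈ N₀.map L.subtype, b⁻¹ * x * b ∈ N₀.map L.subtype := by
      rintro b hb _ ⟨x, hx, rfl⟩
      have h1 := (Subgroup.normalCore_normal (L'.subgroupOf L)).conj_mem x hx (⟨b, hb⟩ : L)⁻¹
      rw [inv_inv] at h1
      exact ⟨(⟨b, hb⟩ : L)⁻¹ * x * (⟨b, hb⟩ : L), h1, rfl⟩
    ext x
    rw [mem_conjLevel]
    refine ⟨fun h => ?_, key b hb x⟩
    simpa [mul_assoc] using key b⁻¹ (inv_mem hb) _ h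

/-- The fundamental cycles of two levels agree on cochains invariant under the smaller level. -/
theorem FundamentalClasses.pairing_cyc_eq (F : FundamentalClasses k n)
    {L L' : Subgroup (GLf k n)} (hL : IsLevel L) (hL' : IsLevel L') (hle : L' ≤ L) (y : (Af k)ˣ)
    {f : Sing (degree k n) (SymCover k n) → E} (hf : IsInvCochain (arithGroup L' y) f)
    (hf' : IsClosedCochain f) :
    pairing (arithGroup L' y) (fun σ => F.cyc L σ (dElt y)) f =
      pairing (arithGroup L' y) (fun σ => F.cyc L' σ (dElt y)) f := by
  obtain ⟨N, hNle, hN, hnormal⟩ := exists_normal_level hL hL'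
  have hc := (F.isFundamental L hL).1.isLocallyFiniteChain
  have hc' := (F.isFundamental L' hL').1.isLocallyFiniteChain
  have hΓ := actsFreely_arithGroup hL' y
  have hΓle : arithGroup N y ≤ arithGroup L' y := arithGroup_mono hNle y
  have hindex := relIndex_arithGroup_ne_zero hL'.isCompact hN.isOpen y
  have hfN := hf.of_le hΓle hindex
  have haN : ∀ γ ∈ arithGroup N y, (dElt y)⁻¹ * toFin γ * dElt y ∈ N := fun γ hγ =>
    (mem_arithGroup.1 hγ).2
  have haL' : ∀ γ ∈ arithGroup L' y, (dElt y)⁻¹ * toFin γ * dElt y ∈ L' := fun γ hγ =>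
    (mem_arithGroup.1 hγ).2
  have h1 := F.pairing_cyc_eq_of_normal hL hN (hNle.trans hle) hnormal (hΓ.mono hΓle) haN hfN hf'
  have h2 := F.pairing_cyc_eq_of_normal hL' hN hNle (fun b hb => hnormal b (hle hb)) (hΓ.mono hΓle)
    haN hfN hf'
  have h3 := h1.trans h2.symm
  rw [pairing_of_le hΓ hΓle hindex (hc.isInvChain fun γ hγ => hle (haL' γ hγ)) hf,
    pairing_of_le hΓ hΓle hindex (hc'.isInvChain haL') hf] at h3
  exact mul_left_cancel₀ (Nat.cast_ne_zero.2 hindex) h3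

end

section

theorem map_jEmb {n : ℕ} {R S : Type*} [CommRing R] [CommRing S] (f : R →+* S) (g : GL (Fin n) R) :
    GeneralLinearGroup.map f (jEmb g) = jEmb (GeneralLinearGroup.map f g) := by
  ext i j
  rw [GeneralLinearGroup.map_apply, jEmb_apply, jEmb_apply]
  rcases finSumFinEquiv.symm i with a | a <;> rcases finSumFinEquiv.symm j with b | b <;>
    simp [one_apply]

variable {k : Type*} [Field k] [NumberField k] {n q : ℕ} {E M₁ M₂ : Type*} [Field E]
  [AddCommGroup M₁] [Module E M₁] [AddCommGroup M₂] [Module E M₂]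
  {ρ₁ : Representation E (GLk k (n + 1)) M₁} {ρ₂ : Representation E (GLk k n) M₂}
  {J : AdGroup k (n + 1)} {J' : AdGroup k n}
  {K : Subgroup (GLf k (n + 1))} {K' : Subgroup (GLf k n)}

theorem diagMap_comp_smul (γ : GLk k n) (σ : Sing q (SymCover k n)) :
    (diagMap J J').comp (γ • σ) = (adAct J J' (jEmb γ, γ)).comp ((diagMap J J').comp σ) := by
  ext1 t
  change diagMap J J' (toInf γ • σ t) = adAct J J' (jEmb γ, γ) (diagMap J J' (σ t))
  obtain ⟨g, hg⟩ := QuotientGroup.mk_surjective (σ t)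
  rw [← hg]
  refine Prod.ext ?_ rfl
  change (QuotientGroup.mk (jEmb (toInf γ * g)) : GLinf k (n + 1) ⧸ J.grp) =
    QuotientGroup.mk (toInf (jEmb γ) * jEmb g)
  rw [map_mul, toInf, toInf, map_jEmb]

theorem prodRep_jEmb (γ : GLk k n) : prodRep ρ₁ ρ₂ (jEmb γ, γ) = diagRep ρ₁ ρ₂ γ := rfl

/-- The cochain `(j × ad)^* t_{(h,h')}(φ)` on `G_n(𝔸) / K_n⁰`. -/
noncomputable def pullback (φ : Cochain q J J' (M₁ ⊗[E] M₂)) (h : GLf k (n + 1)) (h' : GLf k n)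
    (σ : Sing q (SymCover k n)) (a : GLf k n) : M₁ ⊗[E] M₂ :=
  φ ((diagMap J J').comp σ) (jEmb a * h, a * h')

theorem mem_diagLevel {h : GLf k (n + 1)} {h' : GLf k n} {b : GLf k n} :
    b ∈ diagLevel K K' h h' ↔ h⁻¹ * jEmb b * h ∈ K ∧ h'⁻¹ * b * h' ∈ K' := by
  rw [diagLevel, Subgroup.mem_inf, Subgroup.mem_comap, mem_conjLevel, mem_conjLevel]

section Compact

variable {φ : Cochain q J J' (M₁ ⊗[E] M₂)}

theorem pullback_smul (hφ : φ ∈ compactCochains ρ₁ ρ₂ J J' K K' q)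
    (h : GLf k (n + 1)) (h' : GLf k n) (γ : GLk k n) (σ : Sing q (SymCover k n)) (a : GLf k n) :
    pullback φ h h' (γ • σ) (toFin γ * a) = diagRep ρ₁ ρ₂ γ (pullback φ h h' σ a) := by
  have h1 := hφ.1 (jEmb γ, γ) ((diagMap J J').comp σ) (jEmb a * h, a * h')
  rw [prodRep_jEmb] at h1
  rw [pullback, pullback, ← h1, diagMap_comp_smul, map_mul, toFin, toFin, map_jEmb, mul_assoc, mul_assoc]

theorem pullback_mul (hφ : φ ∈ compactCochains ρ₁ ρ₂ J J' K K' q)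
    (h : GLf k (n + 1)) (h' : GLf k n) {b : GLf k n} (hb : b ∈ diagLevel K K' h h') (σ : Sing q (SymCover k n))
    (a : GLf k n) : pullback φ h h' σ (a * b) = pullback φ h h' σ a := by
  have h1 := hφ.2.1 ((diagMap J J').comp σ) (jEmb a * h, a * h')
    (h⁻¹ * jEmb b * h, h'⁻¹ * b * h') (Subgroup.mem_prod.2 (mem_diagLevel.1 hb))
  rw [pullback, pullback, ← h1, map_mul]
  congr 1
  refine Prod.ext ?_ ?_
  · change jEmb a * jEmb b * h = jEmb a * h * (h⁻¹ * jEmb b * h)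
    group
  · change a * b * h' = a * h' * (h'⁻¹ * b * h')
    group

theorem isInvCochain_pullback (hφ : φ ∈ compactCochains ρ₁ ρ₂ J J' K K' q)
    (h : GLf k (n + 1)) (h' : GLf k n) (hK : IsCompact (K : Set (GLf k (n + 1)))) {L : Subgroup (GLf k n)}
    (hL : IsOpen (L : Set (GLf k n))) (c : (Af k)ˣ) (a : GLf k n)
    (ha : ∀ γ ∈ arithGroup L c, a⁻¹ * toFin γ * a ∈ diagLevel K K' h h') {u : Module.Dual E (M₁ ⊗[E] M₂)}
    (hu : u ∈ invariantsOf (diagRep ρ₁ ρ₂).dual (arithGroup L c : Set (GLk k n))) :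
    IsInvCochain (arithGroup L c) fun σ => u (pullback φ h h' σ a) := by
  constructor
  · intro γ hγ σ
    have h1 := pullback_smul hφ h h' γ σ (a * (a⁻¹ * toFin γ * a)⁻¹)
    rw [pullback_mul hφ h h' (inv_mem (ha γ hγ)),
      show toFin γ * (a * (a⁻¹ * toFin γ * a)⁻¹) = a by group] at h1
    rw [h1, mem_invariantsOf_dual.1 hu γ hγ]
  · obtain ⟨C, hC, h1⟩ := exists_isCompact_of_mem_compactCochains hK hφ hL c (jEmb a * h, a * h')
    exact ⟨C, hC, fun σ hσ => h1 σ fun h0 => hσ (by rw [pullback, h0, map_zero])⟩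

end Compact

theorem isClosedCochain_pullback {φ : Cochain q J J' (M₁ ⊗[E] M₂)}
    (hφ : φ ∈ cocycles ρ₁ ρ₂ J J' K K' q) (h : GLf k (n + 1)) (h' : GLf k n) (a : GLf k n)
    (u : Module.Dual E (M₁ ⊗[E] M₂)) : IsClosedCochain fun σ => u (pullback φ h h' σ a) := by
  intro σ
  have h1 := congrArg u (congrFun (congrFun (LinearMap.mem_ker.1 hφ.2) ((diagMap J J').comp σ))
    (jEmb a * h, a * h'))
  simp only [coboundary, LinearMap.coe_mk, AddHom.coe_mk, map_sum, map_smul, smul_eq_mul] at h1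
  exact h1.trans (map_zero u)

theorem IsInvCochain.coboundary {Γ : Subgroup (GLk k n)} {f : Sing q (SymCover k n) → E}
    (hf : IsInvCochain Γ f) :
    IsInvCochain Γ fun σ => ∑ i : Fin (q + 2), (-1 : E) ^ (i : ℕ) * f (face i σ) := by
  constructor
  · intro γ hγ σ
    exact Finset.sum_congr rfl fun i _ => by rw [face_smul, hf.inv γ hγ]
  · obtain ⟨C, hC, h⟩ := hf.supp
    refine ⟨C, hC, fun σ hσ => ?_⟩
    obtain ⟨i, -, hi⟩ := Finset.exists_ne_zero_of_sum_ne_zero hσ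
    obtain ⟨γ, hγ, t, ht⟩ := h _ (right_ne_zero_of_mul hi)
    exact ⟨γ, hγ, _, ht⟩

/-- Coboundaries are compactly supported cochains on which cycles vanish. -/
theorem pairing_pullback_of_mem_coboundaries (hK : IsCompact (K : Set (GLf k (n + 1))))
    {ψ : Cochain q J J' (M₁ ⊗[E] M₂)} (hψ : ψ ∈ coboundaries ρ₁ ρ₂ J J' K K' q)
    (h : GLf k (n + 1)) (h' : GLf k n) {L : Subgroup (GLf k n)}
    (hL : IsLevel L) (hLle : L ≤ diagLevel K K' h h') (c : (Af k)ˣ)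
    {u : Module.Dual E (M₁ ⊗[E] M₂)}
    (hu : u ∈ invariantsOf (diagRep ρ₁ ρ₂).dual (arithGroup L c : Set (GLk k n)))
    {z : Chain k n q} (hz : IsCycle L z) :
    IsInvCochain (arithGroup L c) (fun σ => u (pullback ψ h h' σ (dElt c))) ∧
      pairing (arithGroup L c) (fun σ => z σ (dElt c)) (fun σ => u (pullback ψ h h' σ (dElt c))) = 0 := by
  have ha : ∀ γ ∈ arithGroup L c, (dElt c)⁻¹ * toFin γ * dElt c ∈ L := fun γ hγ =>
    (mem_arithGroup.1 hγ).2
  cases q with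
  | zero =>
    obtain rfl : ψ = 0 := hψ
    have h0 : (fun σ : Sing 0 (SymCover k n) => u (pullback (0 : Cochain 0 J J' (M₁ ⊗[E] M₂)) h h' σ
        (dElt c))) = fun _ => 0 := funext fun σ => map_zero u
    rw [h0]
    exact ⟨⟨fun _ _ _ => rfl, ∅, isCompact_empty, fun _ h => absurd rfl h⟩, pairing_zero_right _⟩
  | succ q =>
    obtain ⟨η, hη, rfl⟩ := hψ
    have hf := isInvCochain_pullback hη h h' hK hL.isOpen c (dElt c)
      (fun γ hγ => hLle (ha γ hγ)) hu
    have h1 : (fun σ : Sing (q + 1) (SymCover k n) =>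
        u (pullback (coboundary q J J' E (M₁ ⊗[E] M₂) η) h h' σ (dElt c))) =
        fun σ => ∑ i : Fin (q + 2), (-1 : E) ^ (i : ℕ) * u (pullback η h h' (face i σ) (dElt c)) := by
      funext σ
      simp only [pullback, coboundary, LinearMap.coe_mk, AddHom.coe_mk, map_sum, map_smul, smul_eq_mul]
      rfl
    rw [h1]
    exact ⟨hf.coboundary, hz.pairing_coboundary (actsFreely_arithGroup hL c) ha hf⟩

section ModularSymbol

variable [CharZero E] [FiniteDimensional E M₁] [FiniteDimensional E M₂]

theorem isModularSymbolValue_iff (F : FundamentalClasses k n) (hK : IsLevel K) (hK' : IsLevel K')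
    (φ : cocycles ρ₁ ρ₂ J J' K K' (degree k n)) (h : GLf k (n + 1)) (h' : GLf k n) (c : (Af k)ˣ)
    (w : M₁ ⊗[E] M₂) :
    IsModularSymbolValue F (Submodule.Quotient.mk φ : HC ρ₁ ρ₂ J J' K K' (degree k n)) h h' c w ↔
    w ∈ invariantsOf (diagRep ρ₁ ρ₂) (arithGroup (diagLevel K K' h h') c : Set (GLk k n)) ∧
    ∀ u ∈ invariantsOf (diagRep ρ₁ ρ₂).dual (arithGroup (diagLevel K K' h h') c : Set (GLk k n)),
      u w = pairing (arithGroup (diagLevel K K' h h') c)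
        (fun σ => F.cyc (diagLevel K K' h h') σ (dElt c))
        fun σ => u (pullback φ.val h h' σ (dElt c)) := by
  have hL := isLevel_diagLevel hK hK' h h'
  have ha : ∀ γ ∈ arithGroup (diagLevel K K' h h') c,
    (dElt c)⁻¹ * toFin γ * dElt c ∈ diagLevel K K' h h' := fun γ hγ => (mem_arithGroup.1 hγ).2
  have hcyc := (F.isFundamental _ hL).1
  have hz := hcyc.isLocallyFiniteChain.isInvChain ha
  have hinv := fun (φ : cocycles ρ₁ ρ₂ J J' K K' (degree k n)) u hu =>
    isInvCochain_pullback (u := u) φ.2.1 h h' hK.isCompact hL.isOpen c (dElt c) ha hu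
  refine and_congr_right fun _ => ⟨fun H u hu => ?_, fun H φ' hφ' u hu => ?_⟩
  · rw [H φ rfl u hu]
    exact evalOnComponent_eq_pairing F hL c (hinv φ u hu).inv
  · rw [H u hu]
    refine Eq.trans ?_ (evalOnComponent_eq_pairing F hL c (hinv φ' u hu).inv).symm
    have h1 : φ.val - φ'.val ∈ coboundaries ρ₁ ρ₂ J J' K K' (degree k n) :=
      by
      have h0 := (Submodule.Quotient.eq _).1 hφ'.symm
      exact Submodule.mem_comap.1 h0
    obtain ⟨h2, h3⟩ := pairing_pullback_of_mem_coboundaries hK.isCompact h1 h h' hL le_rfl c hu hcyc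
    have h4 := pairing_add_right hz (hinv φ' u hu) h2
    rw [h3, add_zero] at h4
    refine Eq.trans ?_ h4
    refine congrArg (pairing _ _) (funext fun σ => ?_)
    rw [← map_add]
    refine congrArg u ?_
    change _ = φ'.val _ _ + (φ.val _ _ - φ'.val _ _)
    rw [add_sub_cancel]
    rfl

theorem existsUnique_isModularSymbolValue (hρ₁ : IsAlgebraicRep ρ₁) (hρ₂ : IsAlgebraicRep ρ₂)
    (F : FundamentalClasses k n) (hK : IsLevel K) (hK' : IsLevel K')
    (l : HC ρ₁ ρ₂ J J' K K' (degree k n)) (h : GLf k (n + 1)) (h' : GLf k n) (c : (Af k)ˣ) :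
    ∃! w, IsModularSymbolValue F l h h' c w := by
  obtain ⟨φ, rfl⟩ := Submodule.Quotient.mk_surjective _ l
  simp only [isModularSymbolValue_iff F hK hK']
  have hL := isLevel_diagLevel hK hK' h h'
  have ha : ∀ γ ∈ arithGroup (diagLevel K K' h h') c,
    (dElt c)⁻¹ * toFin γ * dElt c ∈ diagLevel K K' h h' := fun γ hγ => (mem_arithGroup.1 hγ).2
  have hz := (F.isFundamental _ hL).1.isLocallyFiniteChain.isInvChain ha
  have hinv := fun u hu => isInvCochain_pullback (u := u) φ.2.1 h h' hK.isCompact hL.isOpen c (dElt c) ha hu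
  let Λ : invariantsOf (diagRep ρ₁ ρ₂).dual
      (arithGroup (diagLevel K K' h h') c : Set (GLk k n)) →ₗ[E] E :=
    { toFun := fun u => pairing (arithGroup (diagLevel K K' h h') c)
        (fun σ => F.cyc (diagLevel K K' h h') σ (dElt c))
        fun σ => u.val (pullback φ.val h h' σ (dElt c))
      map_add' := fun u u' => pairing_add_right hz (hinv _ u.2) (hinv _ u'.2)
      map_smul' := fun e u => pairing_mul_right _ e _ }
  obtain ⟨w, ⟨h1, h2⟩, h3⟩ := (isAlgebraicRep_diagRep hρ₁ hρ₂).existsUnique_invariant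
    (hasUnipotents_arithGroup hL.isOpen c) Λ
  exact ⟨w, ⟨h1, fun u hu => h2 ⟨u, hu⟩⟩, fun w' hw' => h3 w' ⟨hw'.1, fun u => hw'.2 u.1 u.2⟩⟩

theorem isModularSymbolValue_modularSymbol (hρ₁ : IsAlgebraicRep ρ₁) (hρ₂ : IsAlgebraicRep ρ₂)
    (F : FundamentalClasses k n) (hK : IsLevel K) (hK' : IsLevel K')
    (l : HC ρ₁ ρ₂ J J' K K' (degree k n)) (h : GLf k (n + 1)) (h' : GLf k n) (c : (Af k)ˣ) :
    IsModularSymbolValue F l h h' c (modularSymbol F l h h' c) :=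
  Classical.epsilon_spec (existsUnique_isModularSymbolValue hρ₁ hρ₂ F hK hK' l h h' c).exists

end ModularSymbol

end

section

theorem IsAlgebraicRep.eq_of_forall_invariant {k E V : Type*} [Field k] [NumberField k] [Field E]
    [CharZero E] [AddCommGroup V] [Module E V] [FiniteDimensional E V] {n : ℕ}
    {ρ : Representation E (GLk k n) V} (hρ : IsAlgebraicRep ρ) {Γ : Subgroup (GLk k n)}
    (hΓ : HasUnipotents Γ) {w w' : V} (hw : w ∈ invariantsOf ρ (Γ : Set (GLk k n)))
    (hw' : w' ∈ invariantsOf ρ (Γ : Set (GLk k n)))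
    (h : ∀ u ∈ invariantsOf ρ.dual (Γ : Set (GLk k n)), u w = u w') : w = w' :=
  (hρ.existsUnique_invariant hΓ
    ((Module.Dual.eval E V w').comp (Submodule.subtype _))).unique
    ⟨hw, fun u => h u.1 u.2⟩ ⟨hw', fun _ => rfl⟩

variable {k : Type*} [Field k] [NumberField k] {n q : ℕ} {E M₁ M₂ : Type*} [Field E] [CharZero E]
  [AddCommGroup M₁] [Module E M₁] [AddCommGroup M₂] [Module E M₂] [FiniteDimensional E M₁]
  [FiniteDimensional E M₂]
  {ρ₁ : Representation E (GLk k (n + 1)) M₁} {ρ₂ : Representation E (GLk k n) M₂}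
  {J : AdGroup k (n + 1)} {J' : AdGroup k n}
  {K : Subgroup (GLf k (n + 1))} {K' : Subgroup (GLf k n)}

theorem modularSymbol_mem_invariantsOf (hρ₁ : IsAlgebraicRep ρ₁) (hρ₂ : IsAlgebraicRep ρ₂)
    (F : FundamentalClasses k n) (hK : IsLevel K) (hK' : IsLevel K')
    (l : HC ρ₁ ρ₂ J J' K K' (degree k n)) (h : GLf k (n + 1)) (h' : GLf k n) (c : (Af k)ˣ) :
    modularSymbol F l h h' c ∈
      invariantsOf (diagRep ρ₁ ρ₂) (arithGroup (diagLevel K K' h h') c : Set (GLk k n)) :=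
  (isModularSymbolValue_modularSymbol hρ₁ hρ₂ F hK hK' l h h' c).1

theorem apply_modularSymbol (hρ₁ : IsAlgebraicRep ρ₁) (hρ₂ : IsAlgebraicRep ρ₂)
    (F : FundamentalClasses k n) (hK : IsLevel K) (hK' : IsLevel K')
    (φ : cocycles ρ₁ ρ₂ J J' K K' (degree k n)) (h : GLf k (n + 1)) (h' : GLf k n) (c : (Af k)ˣ)
    {u : Module.Dual E (M₁ ⊗[E] M₂)} (hu : u ∈ invariantsOf (diagRep ρ₁ ρ₂).dual
      (arithGroup (diagLevel K K' h h') c : Set (GLk k n))) :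
    u (modularSymbol F (Submodule.Quotient.mk φ : HC ρ₁ ρ₂ J J' K K' (degree k n)) h h' c) =
      pairing (arithGroup (diagLevel K K' h h') c)
        (fun σ => F.cyc (diagLevel K K' h h') σ (dElt c))
        fun σ => u (pullback φ.val h h' σ (dElt c)) :=
  ((isModularSymbolValue_iff F hK hK' φ h h' c _).1
    (isModularSymbolValue_modularSymbol hρ₁ hρ₂ F hK hK' _ h h' c)).2 u hu

theorem mem_arithGroup_conj {L : Subgroup (GLf k n)} {γ : GLk k n} {x x' : (Af k)ˣ}
    (hγ : toInf γ ∈ posGL k n) (hmem : (dElt x')⁻¹ * toFin γ * dElt x ∈ L) {δ : GLk k n} :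
    γ * δ * γ⁻¹ ∈ arithGroup L x' ↔ δ ∈ arithGroup L x := by
  rw [mem_arithGroup, mem_arithGroup]
  have h1 : (dElt x' : GLf k n)⁻¹ * toFin (γ * δ * γ⁻¹) * dElt x' =
      ((dElt x')⁻¹ * toFin γ * dElt x) * ((dElt x)⁻¹ * toFin δ * dElt x) *
        ((dElt x')⁻¹ * toFin γ * dElt x)⁻¹ := by
    rw [map_mul, map_mul, map_inv]
    group
  rw [h1, map_mul, map_mul, map_inv, Subgroup.mul_mem_cancel_right _ (inv_mem hγ),
    Subgroup.mul_mem_cancel_left _ hγ, Subgroup.mul_mem_cancel_right _ (inv_mem hmem),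
    Subgroup.mul_mem_cancel_left _ hmem]

theorem modularSymbol_of_toFin_mem (hρ₁ : IsAlgebraicRep ρ₁) (hρ₂ : IsAlgebraicRep ρ₂)
    (F : FundamentalClasses k n) (hK : IsLevel K) (hK' : IsLevel K')
    (l : HC ρ₁ ρ₂ J J' K K' (degree k n)) (h : GLf k (n + 1)) (h' : GLf k n) {γ : GLk k n}
    {x x' : (Af k)ˣ} (hγ : toInf γ ∈ posGL k n)
    (hmem : (dElt x')⁻¹ * toFin γ * dElt x ∈ diagLevel K K' h h') :
    modularSymbol F l h h' x' = diagRep ρ₁ ρ₂ γ (modularSymbol F l h h' x) := by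
  classical
  obtain ⟨φ, rfl⟩ := Submodule.Quotient.mk_surjective _ l
  have hL := isLevel_diagLevel hK hK' h h'
  have hc := (F.isFundamental _ hL).1.isLocallyFiniteChain
  have hconj : ∀ δ, γ * δ * γ⁻¹ ∈ arithGroup (diagLevel K K' h h') x' ↔
    δ ∈ arithGroup (diagLevel K K' h h') x := fun δ => mem_arithGroup_conj hγ hmem
  have hconj' : ∀ δ ∈ arithGroup (diagLevel K K' h h') x',
      γ⁻¹ * δ * γ ∈ arithGroup (diagLevel K K' h h') x := fun δ hδ => (hconj _).1 (by
        simpa [mul_assoc] using hδ)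
  refine (isAlgebraicRep_diagRep hρ₁ hρ₂).eq_of_forall_invariant
    (hasUnipotents_arithGroup hL.isOpen x')
    (modularSymbol_mem_invariantsOf hρ₁ hρ₂ F hK hK' _ h h' x') ?_ fun u hu => ?_
  · intro δ hδ
    have h1 := modularSymbol_mem_invariantsOf hρ₁ hρ₂ F hK hK'
      (Submodule.Quotient.mk φ : HC ρ₁ ρ₂ J J' K K' (degree k n)) h h' x _ (hconj' δ hδ)
    conv_rhs => rw [← h1]
    rw [← Module.End.mul_apply, ← Module.End.mul_apply, ← map_mul, ← map_mul]
    congr 2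
    group
  · have hu' : u ∘ₗ diagRep ρ₁ ρ₂ γ ∈ invariantsOf (diagRep ρ₁ ρ₂).dual
        (arithGroup (diagLevel K K' h h') x : Set (GLk k n)) := by
      rw [mem_invariantsOf_dual] at hu ⊢
      intro δ hδ w
      have h1 := hu _ ((hconj δ).2 hδ) (diagRep ρ₁ ρ₂ γ w)
      rw [← Module.End.mul_apply, ← map_mul, inv_mul_cancel_right, map_mul, Module.End.mul_apply] at h1
      exact h1
    have h2 := apply_modularSymbol hρ₁ hρ₂ F hK hK' φ h h' x hu'
    refine (apply_modularSymbol hρ₁ hρ₂ F hK hK' φ h h' x' hu).trans (Eq.trans ?_ h2.symm)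
    have hd : ∀ w : M₁ ⊗[E] M₂, (u ∘ₗ diagRep ρ₁ ρ₂ γ) w = u (diagRep ρ₁ ρ₂ γ w) := fun _ => rfl
    have hx' : toFin γ * dElt x = dElt x' * ((dElt x')⁻¹ * toFin γ * dElt x) := by group
    have hcyc : ∀ σ, F.cyc (diagLevel K K' h h') (γ • σ) (dElt x') =
        F.cyc (diagLevel K K' h h') σ (dElt x) := by
      intro σ
      rw [← hc.level _ (dElt x') _ hmem, ← hx']
      exact hc.invariant γ σ _
    have hpull : ∀ σ, pullback φ.val h h' (γ • σ) (dElt x') =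
        diagRep ρ₁ ρ₂ γ (pullback φ.val h h' σ (dElt x)) := by
      intro σ
      rw [← pullback_mul φ.2.1 h h' hmem, ← hx', pullback_smul φ.2.1]
    unfold pairing
    rw [quotSum_eq_quotSum_comp (r := actSetoid (arithGroup (diagLevel K K' h h') x) _)
      (fun σ : Sing (degree k n) (SymCover k n) => γ • σ)]
    · refine quotSum_congr fun σ => ?_
      simp only [isPos_smul hγ, hcyc, hpull, hd]
    · intro σ σ'
      constructor
      · rintro ⟨δ, hδ, rfl⟩
        exact ⟨γ * δ * γ⁻¹, (hconj δ).2 hδ, by simp [mul_smul]⟩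
      · rintro ⟨δ, hδ, hσ⟩
        refine ⟨γ⁻¹ * δ * γ, hconj' δ hδ, ?_⟩
        rw [mul_smul, mul_smul, ← hσ, inv_smul_smul]
    · rintro σ _ ⟨δ, hδ, rfl⟩
      have ha : ∀ γ ∈ arithGroup (diagLevel K K' h h') x',
        (dElt x')⁻¹ * toFin γ * dElt x' ∈ diagLevel K K' h h' := fun γ hγ => (mem_arithGroup.1 hγ).2
      have h3 := (hc.isInvChain ha).inv δ hδ σ
      have h4 := (isInvCochain_pullback φ.2.1 h h' hK.isCompact hL.isOpen x' (dElt x') ha hu).inv δ hδ σ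
      simp only [isPos_smul (mem_arithGroup.1 hδ).1, h3, h4]
    · exact fun σ _ => ⟨γ⁻¹ • σ, by rw [smul_inv_smul]⟩

/-- Rational elements translate modular symbols; only their determinants matter. -/
theorem modularSymbol_eq_diagRep (hn : 1 ≤ n) (hρ₁ : IsAlgebraicRep ρ₁) (hρ₂ : IsAlgebraicRep ρ₂)
    (F : FundamentalClasses k n) (hK : IsLevel K) (hK' : IsLevel K')
    (l : HC ρ₁ ρ₂ J J' K K' (degree k n)) (h : GLf k (n + 1)) (h' : GLf k n) (γ : GLk k n)
    {x x' : (Af k)ˣ} (hγ : (principal k (GeneralLinearGroup.det γ)).1 ∈ posUnits k)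
    (hx : x⁻¹ * (principal k (GeneralLinearGroup.det γ)).2⁻¹ * x' ∈ detLevel (diagLevel K K' h h')) :
    modularSymbol F l h h' x' = diagRep ρ₁ ρ₂ γ (modularSymbol F l h h' x) := by
  have hL := isLevel_diagLevel hK hK' h h'
  obtain ⟨γ₁, h1, h2⟩ := exists_toFin_conj_mem hn hL.isOpen _ x x' hx
  rw [modularSymbol_of_toFin_mem hρ₁ hρ₂ F hK hK' l h h'
    (toInf_mem_posGL.2 (by rw [h1]; exact hγ)) h2]
  have h3 := (isAlgebraicRep_diagRep hρ₁ hρ₂).apply_eq_of_det_eq_one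
    (hasUnipotents_arithGroup hL.isOpen x)
    (modularSymbol_mem_invariantsOf hρ₁ hρ₂ F hK hK' l h h' x) (g := γ⁻¹ * γ₁) (by
      rw [map_mul, map_inv, h1, inv_mul_cancel])
  conv_rhs => rw [← h3]
  rw [← Module.End.mul_apply, ← map_mul, mul_inv_cancel_left]

theorem modularSymbol_mul (hn : 1 ≤ n) (hρ₁ : IsAlgebraicRep ρ₁) (hρ₂ : IsAlgebraicRep ρ₂)
    (F : FundamentalClasses k n) (hK : IsLevel K) (hK' : IsLevel K')
    (l : HC ρ₁ ρ₂ J J' K K' (degree k n)) (h : GLf k (n + 1)) (h' : GLf k n)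
    (x : (Af k)ˣ) {d : (Af k)ˣ} (hd : d ∈ detLevel (diagLevel K K' h h')) :
    modularSymbol F l h h' (x * d) = modularSymbol F l h h' x := by
  have h1 := modularSymbol_eq_diagRep hn hρ₁ hρ₂ F hK hK' l h h' 1 (x := x) (x' := x * d)
    (by rw [map_one, map_one]; exact one_mem _) (by
      rw [map_one, map_one]
      simpa using hd)
  simpa using h1

theorem detLevel_mono {L L' : Subgroup (GLf k n)} (h : L ≤ L') : detLevel L ≤ detLevel L' :=
  Subgroup.map_mono h

theorem finClass_eq_iff {L : Subgroup (GLf k n)} {x y : (Af k)ˣ} :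
    finClass L x = finClass L y ↔ ∃ δ : kˣ, (principal k δ).1 ∈ posUnits k ∧
      x⁻¹ * (principal k δ).2⁻¹ * y ∈ detLevel L := by
  have h1 : finClass L x = finClass L y ↔
      ((1, x) : (InfiniteAdeleRing k)ˣ × (Af k)ˣ)⁻¹ * (1, y) ∈
        (principal k).range ⊔ (posUnits k).prod (detLevel L) := QuotientGroup.eq
  rw [h1, Subgroup.mem_sup]
  constructor
  · rintro ⟨_, ⟨δ, rfl⟩, ⟨a, b⟩, hab, h⟩
    obtain ⟨ha, hb⟩ := Subgroup.mem_prod.1 hab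
    have h2 := congrArg Prod.fst h
    have h3 := congrArg Prod.snd h
    simp only [Prod.fst_mul, Prod.snd_mul, Prod.fst_inv, Prod.snd_inv, mul_one, inv_one] at h2 h3 ha hb
    refine ⟨δ, ?_, ?_⟩
    · rw [eq_inv_of_mul_eq_one_left h2]
      exact inv_mem ha
    · have : x⁻¹ * (principal k δ).2⁻¹ * y = b := by
        rw [mul_right_comm, ← h3, mul_right_comm, mul_inv_cancel, one_mul]
      rw [this]
      exact hb
  · rintro ⟨δ, h2, h3⟩
    refine ⟨_, ⟨δ, rfl⟩, ((principal k δ).1⁻¹, x⁻¹ * (principal k δ).2⁻¹ * y),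
      Subgroup.mem_prod.2 ⟨inv_mem h2, h3⟩, ?_⟩
    refine Prod.ext ?_ ?_
    · simp
    · change (principal k δ).2 * (x⁻¹ * (principal k δ).2⁻¹ * y) = x⁻¹ * y
      rw [mul_right_comm, mul_comm, mul_assoc, inv_mul_cancel, mul_one]

theorem mem_unitGroup {L : Subgroup (GLf k n)} {δ : kˣ} :
    δ ∈ unitGroup L ↔ (principal k δ).1 ∈ posUnits k ∧ (principal k δ).2 ∈ detLevel L := by
  rw [unitGroup, Subgroup.mem_comap, Subgroup.mem_prod]

section Neat

variable {L₀ : Subgroup (GLf k n)}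

theorem diagRep_modularSymbol_of_neat (hρ₁ : IsAlgebraicRep ρ₁) (hρ₂ : IsAlgebraicRep ρ₂)
    (F : FundamentalClasses k n) (hK : IsLevel K) (hK' : IsLevel K')
    (l : HC ρ₁ ρ₂ J J' K K' (degree k n)) (h : GLf k (n + 1)) (h' : GLf k n)
    (hL₀ : IsCompact (L₀ : Set (GLf k n))) (x : (Af k)ˣ)
    (hneat : ∀ γ ∈ arithGroup L₀ x, IsNeatElement γ) {γ : GLk k n} (hγ : γ ∈ arithGroup L₀ x) :
    diagRep ρ₁ ρ₂ γ (modularSymbol F l h h' x) = modularSymbol F l h h' x := by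
  have hL := isLevel_diagLevel hK hK' h h'
  obtain ⟨N, hN, -, hmem⟩ := Subgroup.exists_pow_mem_of_relIndex_ne_zero
    (relIndex_arithGroup_ne_zero hL₀ hL.isOpen x) hγ
  exact (isAlgebraicRep_diagRep hρ₁ hρ₂).apply_eq_of_pow (hneat γ hγ) hN
    (modularSymbol_mem_invariantsOf hρ₁ hρ₂ F hK hK' l h h' x _ hmem.1)

/-- If the arithmetic groups of some level are neat, then modular symbols only depend on the class of
`x`, as long as `x` varies in a coset of the determinants of this level. -/
theorem modularSymbol_eq_of_finClass_eq (hn : 1 ≤ n) (hρ₁ : IsAlgebraicRep ρ₁)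
    (hρ₂ : IsAlgebraicRep ρ₂) (F : FundamentalClasses k n) (hK : IsLevel K) (hK' : IsLevel K')
    (l : HC ρ₁ ρ₂ J J' K K' (degree k n)) (h : GLf k (n + 1)) (h' : GLf k n)
    (hL₀ : IsLevel L₀) (hle : diagLevel K K' h h' ≤ L₀) (x x' : (Af k)ˣ)
    (hneat : ∀ γ ∈ arithGroup L₀ x, IsNeatElement γ) (hxx' : x⁻¹ * x' ∈ detLevel L₀)
    (hclass : finClass (diagLevel K K' h h') x = finClass (diagLevel K K' h h') x') :
    modularSymbol F l h h' x' = modularSymbol F l h h' x := by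
  obtain ⟨δ, h1, h2⟩ := finClass_eq_iff.1 hclass
  have h3 : δ ∈ unitGroup L₀ := by
    refine mem_unitGroup.2 ⟨h1, ?_⟩
    have h4 := mul_mem (inv_mem (detLevel_mono hle h2)) hxx'
    have h5 : (x⁻¹ * (principal k δ).2⁻¹ * x')⁻¹ * (x⁻¹ * x') = (principal k δ).2 := by
      rw [mul_right_comm, _root_.mul_inv_rev, inv_inv, mul_assoc, inv_mul_cancel, mul_one]
    rwa [h5] at h4
  rw [← map_det_arithGroup hn hL₀.isOpen x] at h3
  obtain ⟨γ, hγ, rfl⟩ := h3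
  rw [modularSymbol_eq_diagRep hn hρ₁ hρ₂ F hK hK' l h h' γ h1 h2,
    diagRep_modularSymbol_of_neat hρ₁ hρ₂ F hK hK' l h h' hL₀.isCompact x hneat hγ]

end Neat

end

section

variable {k : Type*} [Field k] [NumberField k] {n q : ℕ}

/-- Strong approximation: a rational element with given determinant between two cosets. -/
theorem exists_toFin_mem (hn : 1 ≤ n) {L : Subgroup (GLf k n)} (hL : IsOpen (L : Set (GLf k n)))
    (δ : kˣ) (g g' : GLf k n) (hg : (GeneralLinearGroup.det g)⁻¹ * (principal k δ).2⁻¹ *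
      GeneralLinearGroup.det g' ∈ detLevel L) :
    ∃ γ : GLk k n, GeneralLinearGroup.det γ = δ ∧ g'⁻¹ * toFin γ * g ∈ L := by
  obtain ⟨b, hb, hbd⟩ := hg
  have hδ : toFin (dElt δ : GLk k n) = dElt (principal k δ).2 := map_dElt _ _
  obtain ⟨γ₁, h1, h2⟩ := exists_toFin_mem_of_det_eq_one (conjLevel g L)
    (isOpen_conjLevel _ hL) ((toFin (dElt δ))⁻¹ * (g' * b⁻¹ * g⁻¹)) (by
      simp only [map_mul, map_inv, hδ, det_dElt hn, hbd]
      group)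
  refine ⟨dElt δ * γ₁, by rw [map_mul, h1, det_dElt hn, mul_one], ?_⟩
  rw [mem_conjLevel] at h2
  have h3 := mul_mem (inv_mem hb) h2
  convert! h3 using 1
  rw [map_mul]
  group

variable {E M₁ M₂ : Type*} [Field E]
  [AddCommGroup M₁] [Module E M₁] [AddCommGroup M₂] [Module E M₂]
  {ρ₁ : Representation E (GLk k (n + 1)) M₁} {ρ₂ : Representation E (GLk k n) M₂}
  {J : AdGroup k (n + 1)} {J' : AdGroup k n}
  {K : Subgroup (GLf k (n + 1))} {K' : Subgroup (GLf k n)}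

theorem mul_mem_doubleCoset {G : Type*} [Group G] {K : Subgroup G} {t a b g : G} (ha : a ∈ K) (hb : b ∈ K)
    (hg : g ∈ DoubleCoset.doubleCoset t K K) : a * g * b ∈ DoubleCoset.doubleCoset t K K := by
  rw [DoubleCoset.mem_doubleCoset] at hg ⊢
  obtain ⟨x, hx, y, hy, rfl⟩ := hg
  exact ⟨a * x, mul_mem ha hx, y * b, mul_mem hy hb, by group⟩

theorem mk_out_mem_doubleCoset {G : Type*} [Group G] {K : Subgroup G} {t g : G}
    (hg : g ∈ DoubleCoset.doubleCoset t K K) :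
    (QuotientGroup.mk g : G ⧸ K).out ∈ DoubleCoset.doubleCoset t K K := by
  obtain ⟨b, hb⟩ := QuotientGroup.mk_out_eq_mul K g
  rw [hb]
  simpa using mul_mem_doubleCoset (one_mem K) b.2 hg

/-- The group `K(h, h')` acts simply transitively, up to `K(h t, h' t')`, on the cosets in the double
cosets of `t` and `t'`. -/
def IsTransitive (K : Subgroup (GLf k (n + 1))) (K' : Subgroup (GLf k n)) (h t : GLf k (n + 1))
    (h' t' : GLf k n) : Prop :=
  ∀ g ∈ DoubleCoset.doubleCoset t K K, ∀ g' ∈ DoubleCoset.doubleCoset t' K' K',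
    ∃ b ∈ diagLevel K K' h h', g⁻¹ * (h⁻¹ * jEmb b * h * t) ∈ K ∧ g'⁻¹ * (h'⁻¹ * b * h' * t') ∈ K'

theorem pullback_hecke {φ : Cochain q J J' (M₁ ⊗[E] M₂)} (hφ : φ ∈ compactCochains ρ₁ ρ₂ J J' K K' q)
    {h t : GLf k (n + 1)} {h' t' : GLf k n} (htrans : IsTransitive K K' h t h' t')
    {X : Finset (GLf k n ⧸ diagLevel K K' (h * t) (h' * t'))}
    (hX : ∀ x, x ∈ X ↔ ∃ b ∈ diagLevel K K' h h', x = QuotientGroup.mk b)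
    (σ : Sing q (SymCover k n)) (a : GLf k n) :
    pullback (hecke K K' t t' φ) h h' σ a =
      ∑ x ∈ X, pullback φ (h * t) (h' * t') σ (a * x.out) := by
  classical
  let A : Set (GLf k (n + 1) ⧸ K) := {x | x.out ∈ DoubleCoset.doubleCoset t K K}
  let B : Set (GLf k n ⧸ K') := {y | y.out ∈ DoubleCoset.doubleCoset t' K' K'}
  let e : GLf k n ⧸ diagLevel K K' (h * t) (h' * t') → (GLf k (n + 1) ⧸ K) × (GLf k n ⧸ K') :=
    fun x => (QuotientGroup.mk (h⁻¹ * jEmb x.out * h * t), QuotientGroup.mk (h'⁻¹ * x.out * h' * t'))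
  have he : ∀ b, e (QuotientGroup.mk b) =
      (QuotientGroup.mk (h⁻¹ * jEmb b * h * t), QuotientGroup.mk (h'⁻¹ * b * h' * t')) := by
    intro b
    obtain ⟨c, hc⟩ := QuotientGroup.mk_out_eq_mul (diagLevel K K' (h * t) (h' * t')) b
    obtain ⟨h1, h2⟩ := mem_diagLevel.1 c.2
    simp only [e, hc]
    refine Prod.ext (QuotientGroup.eq.2 ?_) (QuotientGroup.eq.2 ?_)
    · convert! inv_mem h1 using 1
      rw [map_mul]
      group
    · convert! inv_mem h2 using 1
      group
  have hinj : Function.Injective e := by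
    intro x y
    obtain ⟨b, rfl⟩ := QuotientGroup.mk_surjective x
    obtain ⟨c, rfl⟩ := QuotientGroup.mk_surjective y
    rw [he, he, Prod.mk.injEq, QuotientGroup.eq, QuotientGroup.eq]
    rintro ⟨h1, h2⟩
    refine QuotientGroup.eq.2 (mem_diagLevel.2 ⟨?_, ?_⟩)
    · convert! h1 using 1
      rw [map_mul, map_inv]
      group
    · convert! h2 using 1
      group
  have himage : ∀ z, z ∈ X.image e ↔ z.1 ∈ A ∧ z.2 ∈ B := by
    intro z
    rw [Finset.mem_image]
    constructor
    · rintro ⟨x, hx, rfl⟩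
      obtain ⟨b, hb, rfl⟩ := (hX x).1 hx
      obtain ⟨h1, h2⟩ := mem_diagLevel.1 hb
      rw [he]
      refine ⟨mk_out_mem_doubleCoset ?_, mk_out_mem_doubleCoset ?_⟩
      · simpa using mul_mem_doubleCoset h1 (one_mem K) (DoubleCoset.mem_doubleCoset_self K K t)
      · simpa using mul_mem_doubleCoset h2 (one_mem K') (DoubleCoset.mem_doubleCoset_self K' K' t')
    · rintro ⟨h1, h2⟩
      obtain ⟨b, hb, h3, h4⟩ := htrans _ h1 _ h2
      refine ⟨QuotientGroup.mk b, (hX _).2 ⟨b, hb, rfl⟩, ?_⟩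
      rw [he]
      refine Prod.ext ?_ ?_
      · rw [← QuotientGroup.out_eq' z.1]
        exact (QuotientGroup.eq.2 h3).symm
      · rw [← QuotientGroup.out_eq' z.2]
        exact (QuotientGroup.eq.2 h4).symm
  have hA0 : (QuotientGroup.mk t : GLf k (n + 1) ⧸ K) ∈ A :=
    mk_out_mem_doubleCoset (DoubleCoset.mem_doubleCoset_self K K t)
  have hB0 : (QuotientGroup.mk t' : GLf k n ⧸ K') ∈ B :=
    mk_out_mem_doubleCoset (DoubleCoset.mem_doubleCoset_self K' K' t')
  have hA : A.Finite := ((X.image e).finite_toSet.image Prod.fst).subset fun x hx =>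
    ⟨(x, QuotientGroup.mk t'), (himage _).2 ⟨hx, hB0⟩, rfl⟩
  have hB : B.Finite := ((X.image e).finite_toSet.image Prod.snd).subset fun y hy =>
    ⟨(QuotientGroup.mk t, y), (himage _).2 ⟨hA0, hy⟩, rfl⟩
  have hprod : X.image e = hA.toFinset ×ˢ hB.toFinset := by
    ext z
    rw [himage, Finset.mem_product, hA.mem_toFinset, hB.mem_toFinset]
  have h1 : pullback (hecke K K' t t' φ) h h' σ a = ∑ᶠ (x : GLf k (n + 1) ⧸ K) (_ : x ∈ A)
      (y : GLf k n ⧸ K') (_ : y ∈ B),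
      φ ((diagMap J J').comp σ) (jEmb a * h * x.out, a * h' * y.out) := rfl
  rw [h1, finsum_mem_eq_finite_toFinset_sum _ hA]
  simp only [finsum_mem_eq_finite_toFinset_sum _ hB]
  rw [← Finset.sum_product', ← hprod, Finset.sum_image hinj.injOn]
  refine Finset.sum_congr rfl fun x _ => ?_
  obtain ⟨b₁, hb₁⟩ := QuotientGroup.mk_out_eq_mul K (h⁻¹ * jEmb x.out * h * t)
  obtain ⟨b₂, hb₂⟩ := QuotientGroup.mk_out_eq_mul K' (h'⁻¹ * x.out * h' * t')
  simp only [e, hb₁, hb₂, pullback]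
  rw [← hφ.2.1 _ (jEmb (a * x.out) * (h * t), a * x.out * (h' * t')) (b₁.1, b₂.1)
    (Subgroup.mem_prod.2 ⟨b₁.2, b₂.2⟩)]
  congr 1
  refine Prod.ext ?_ ?_
  · change _ = jEmb (a * x.out) * (h * t) * b₁
    rw [map_mul]
    group
  · change _ = a * x.out * (h' * t') * b₂
    group

end

section

variable {k : Type*} [Field k] [NumberField k] {n : ℕ} {E M₁ M₂ : Type*} [Field E] [CharZero E]
  [AddCommGroup M₁] [Module E M₁] [AddCommGroup M₂] [Module E M₂] [FiniteDimensional E M₁]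
  [FiniteDimensional E M₂]
  {ρ₁ : Representation E (GLk k (n + 1)) M₁} {ρ₂ : Representation E (GLk k n) M₂}
  {J : AdGroup k (n + 1)} {J' : AdGroup k n}
  {K : Subgroup (GLf k (n + 1))} {K' : Subgroup (GLf k n)}

theorem finClass_eq_of_inv_mul_mem {L : Subgroup (GLf k n)} {x y : (Af k)ˣ}
    (h : x⁻¹ * y ∈ detLevel L) : finClass L x = finClass L y :=
  finClass_eq_iff.2 ⟨1, by rw [map_one]; exact one_mem _, by rw [map_one]; simpa using h⟩

/-- The pairing of a Hecke translate as a sum over a finite set of cosets. -/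
theorem mul_apply_modularSymbol_eq_quotSum (hρ₁ : IsAlgebraicRep ρ₁)
    (hρ₂ : IsAlgebraicRep ρ₂) (F : FundamentalClasses k n) (hK : IsLevel K) (hK' : IsLevel K')
    {h t : GLf k (n + 1)} {h' t' : GLf k n} (htrans : IsTransitive K K' h t h' t')
    {φ : cocycles ρ₁ ρ₂ J J' K K' (degree k n)} {κ : E}
    (hφ : hecke K K' t t' φ.val - κ • φ.val ∈ coboundaries ρ₁ ρ₂ J J' K K' (degree k n))
    {X : Finset (GLf k n ⧸ diagLevel K K' (h * t) (h' * t'))}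
    (hX : ∀ x, x ∈ X ↔ ∃ b ∈ diagLevel K K' h h', x = QuotientGroup.mk b) (x : (Af k)ˣ)
    {u : Module.Dual E (M₁ ⊗[E] M₂)} (hu : u ∈ invariantsOf (diagRep ρ₁ ρ₂).dual
      (arithGroup (diagLevel K K' h h') x : Set (GLk k n))) :
    κ * u (modularSymbol F (Submodule.Quotient.mk φ : HC ρ₁ ρ₂ J J' K K' (degree k n)) h h' x) =
      pairing (arithGroup (diagLevel K K' h h') x)
        (fun σ => F.cyc (diagLevel K K' h h') σ (dElt x)) fun σ =>
          ∑ ξ ∈ X, u (pullback φ.val (h * t) (h' * t') σ (dElt x * ξ.out)) := by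
  have hL := isLevel_diagLevel hK hK' h h'
  have ha : ∀ γ ∈ arithGroup (diagLevel K K' h h') x,
    (dElt x)⁻¹ * toFin γ * dElt x ∈ diagLevel K K' h h' := fun γ hγ => (mem_arithGroup.1 hγ).2
  have hcyc := (F.isFundamental _ hL).1
  have hz := hcyc.isLocallyFiniteChain.isInvChain ha
  have hinv := isInvCochain_pullback φ.2.1 h h' hK.isCompact hL.isOpen x (dElt x) ha hu
  obtain ⟨h2, h3⟩ := pairing_pullback_of_mem_coboundaries hK.isCompact hφ h h' hL le_rfl x hu hcyc
  have hinv' : IsInvCochain (arithGroup (diagLevel K K' h h') x)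
      fun σ => κ * u (pullback φ.val h h' σ (dElt x)) := by
    refine ⟨fun γ hγ σ => congrArg (κ * ·) (hinv.inv γ hγ σ), ?_⟩
    obtain ⟨C, hC, h4⟩ := hinv.supp
    exact ⟨C, hC, fun σ hσ => h4 σ (right_ne_zero_of_mul hσ)⟩
  have h4 := pairing_add_right hz hinv' h2
  rw [h3, add_zero, pairing_mul_right, ← apply_modularSymbol hρ₁ hρ₂ F hK hK' φ h h' x hu] at h4
  rw [← h4]
  refine congrArg (pairing _ _) (funext fun σ => ?_)
  rw [← map_sum, ← pullback_hecke φ.2.1 htrans hX, ← smul_eq_mul, ← map_smul, ← map_add]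
  refine congrArg u ?_
  change κ • φ.val _ _ + (hecke K K' t t' φ.val _ _ - κ • φ.val _ _) = _
  rw [add_sub_cancel]
  rfl

/-- The effect of a Hecke operator on modular symbols. -/
theorem mul_apply_modularSymbol_eq_sum (hn : 1 ≤ n) (hρ₁ : IsAlgebraicRep ρ₁)
    (hρ₂ : IsAlgebraicRep ρ₂) (F : FundamentalClasses k n) (hK : IsLevel K) (hK' : IsLevel K')
    {h t : GLf k (n + 1)} {h' t' : GLf k n}
    (hle : diagLevel K K' (h * t) (h' * t') ≤ diagLevel K K' h h')
    (htrans : IsTransitive K K' h t h' t')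
    {l : HC ρ₁ ρ₂ J J' K K' (degree k n)} {κ : E} (hl : IsHeckeEigenclass t t' l κ)
    (x : (Af k)ˣ) (A : Finset (Af k)ˣ) (hA : ∀ e ∈ A, dElt e ∈ diagLevel K K' h h')
    (hA' : ∀ d ∈ detLevel (diagLevel K K' h h'), ∃! e, e ∈ A ∧
      finClass (diagLevel K K' (h * t) (h' * t')) (x * e) =
        finClass (diagLevel K K' (h * t) (h' * t')) (x * d))
    {u : Module.Dual E (M₁ ⊗[E] M₂)} (hu : u ∈ invariantsOf (diagRep ρ₁ ρ₂).dual
      (arithGroup (diagLevel K K' h h') x : Set (GLk k n))) :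
    κ * u (modularSymbol F l h h' x) =
      ∑ e ∈ A, u (modularSymbol F l (h * t) (h' * t') (x * e)) := by
  classical
  obtain ⟨φ, rfl, hφ⟩ := hl
  have hL := isLevel_diagLevel hK hK' h h'
  have hL' := isLevel_diagLevel hK hK' (h * t) (h' * t')
  set L := diagLevel K K' h h' with hLdef
  set L' := diagLevel K K' (h * t) (h' * t') with hL'def
  obtain ⟨X, -, hX⟩ := exists_finset_cosets (relIndex_ne_zero_of_isOpen hL'.isOpen hL.isCompact)
  rw [mul_apply_modularSymbol_eq_quotSum hρ₁ hρ₂ F hK hK' htrans hφ hX x hu]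
  have ha : ∀ γ ∈ arithGroup L x, (dElt x)⁻¹ * toFin γ * dElt x ∈ L := fun γ hγ =>
    (mem_arithGroup.1 hγ).2
  have hc := (F.isFundamental L hL).1.isLocallyFiniteChain
  have hz := hc.isInvChain ha
  let _ : MulAction (GLk k n) (GLf k n ⧸ L') := MulAction.compHom _ (toFin (k := k) (m := n))
  have hact : ∀ (γ : GLk k n) (g : GLf k n),
    γ • (QuotientGroup.mk g : GLf k n ⧸ L') = QuotientGroup.mk (toFin γ * g) := fun _ _ => rfl
  have hout : ∀ σ (g : GLf k n), pullback φ.val (h * t) (h' * t') σ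
      (QuotientGroup.mk g : GLf k n ⧸ L').out = pullback φ.val (h * t) (h' * t') σ g := by
    intro σ g
    obtain ⟨b, hb⟩ := QuotientGroup.mk_out_eq_mul L' g
    rw [hb, pullback_mul φ.2.1 _ _ b.2]
  let P : Sing (degree k n) (SymCover k n) → GLf k n ⧸ L' → E := fun σ ξ =>
    if IsPos σ then (F.cyc L σ (dElt x) : E) * u (pullback φ.val (h * t) (h' * t') σ ξ.out) else 0
  let f : GLf k n ⧸ L' → GLf k n ⧸ L' := fun ξ => (dElt x : GLf k n) • ξ
  have hf : Function.Injective f := MulAction.injective _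
  let X₀ := X.image f
  have hX₀ : ∀ ξ, ξ ∈ X₀ ↔ ∃ b ∈ L, ξ = QuotientGroup.mk (dElt x * b) := by
    intro ξ
    rw [Finset.mem_image]
    constructor
    · rintro ⟨η, hη, rfl⟩
      obtain ⟨b, hb, rfl⟩ := (hX η).1 hη
      exact ⟨b, hb, rfl⟩
    · rintro ⟨b, hb, rfl⟩
      exact ⟨QuotientGroup.mk b, (hX _).2 ⟨b, hb, rfl⟩, rfl⟩
  let f' : (Af k)ˣ → GLf k n ⧸ L' := fun e => QuotientGroup.mk (dElt (x * e))
  have hedet : ∀ e ∈ A, e ∈ detLevel L := fun e he => ⟨dElt e, hA e he, det_dElt hn e⟩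
  have hf' : Set.InjOn f' A := by
    intro e he e' he' hee
    have h1 := (QuotientGroup.eq.1 hee : (dElt (x * e))⁻¹ * dElt (x * e') ∈ L')
    have h2 : (x * e)⁻¹ * (x * e') ∈ detLevel L' := ⟨_, h1, by
      rw [map_mul, map_inv, det_dElt hn, det_dElt hn]⟩
    exact (hA' e' (hedet e' he')).unique ⟨he, finClass_eq_of_inv_mul_mem h2⟩ ⟨he', rfl⟩
  have hquot : pairing (arithGroup L x) (fun σ => F.cyc L σ (dElt x)) (fun σ =>
      ∑ ξ ∈ X, u (pullback φ.val (h * t) (h' * t') σ (dElt x * ξ.out))) =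
      quotSum (actSetoid (arithGroup L x) _) fun σ => ∑ ξ ∈ X₀, P σ ξ := by
    refine quotSum_congr fun σ => ?_
    rw [Finset.sum_image hf.injOn]
    by_cases hσ : IsPos σ
    · rw [if_pos hσ, Finset.mul_sum]
      refine Finset.sum_congr rfl fun ξ _ => ?_
      simp only [P, if_pos hσ]
      rw [← hout σ (dElt x * ξ.out)]
      congr 3
      conv_rhs => rw [← QuotientGroup.out_eq' ξ]
      rfl
    · rw [if_neg hσ]
      exact (Finset.sum_eq_zero fun ξ _ => if_neg hσ).symm
  rw [hquot, quotSum_sum_eq_sum_quotSum (arithGroup L x)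
    (actsFreely_arithGroup hL x).free_sing X₀ (A.image f')]
  · rw [Finset.sum_image hf']
    refine Finset.sum_congr rfl fun e he => ?_
    have hdx : dElt (x * e) = (dElt x * dElt e : GLf k n) := dElt_mul x e
    have hstab : arithGroup L x ⊓ MulAction.stabilizer (GLk k n) (f' e) = arithGroup L' (x * e) := by
      ext γ
      rw [Subgroup.mem_inf, MulAction.mem_stabilizer_iff, mem_arithGroup, mem_arithGroup]
      have h1 : γ • f' e = f' e ↔ (dElt (x * e))⁻¹ * toFin γ * dElt (x * e) ∈ L' := by
        rw [eq_comm]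
        refine Iff.trans QuotientGroup.eq ?_
        rw [mul_assoc]
        rfl
      rw [h1]
      refine ⟨fun h => ⟨h.1.1, h.2⟩, fun h => ⟨⟨h.1, ?_⟩, h.2⟩⟩
      have h2 := mul_mem (mul_mem (hA e he) (hle h.2)) (inv_mem (hA e he))
      convert! h2 using 1
      rw [hdx]
      group
    have hle' : arithGroup L' (x * e) ≤ arithGroup L x := by
      rw [← hstab]
      exact inf_le_left
    have hu' : u ∈ invariantsOf (diagRep ρ₁ ρ₂).dual (arithGroup L' (x * e) : Set (GLk k n)) :=
      fun γ hγ => hu γ (hle' hγ)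
    rw [hstab, apply_modularSymbol hρ₁ hρ₂ F hK hK' φ (h * t) (h' * t') (x * e) hu']
    rw [← F.pairing_cyc_eq hL hL' hle (x * e) (isInvCochain_pullback φ.2.1 _ _ hK.isCompact
      hL'.isOpen (x * e) (dElt (x * e)) (fun γ hγ => (mem_arithGroup.1 hγ).2) hu')
      (isClosedCochain_pullback φ.2 _ _ _ u)]
    refine quotSum_congr fun σ => ?_
    simp only [P, f']
    rw [hout, hdx, hc.level σ (dElt x) _ (hA e he)]
  · intro γ hγ ξ hξ
    obtain ⟨b, hb, rfl⟩ := (hX₀ ξ).1 hξ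
    refine (hX₀ _).2 ⟨_, mul_mem (ha γ hγ) hb, ?_⟩
    rw [hact]
    congr 1
    group
  · intro ξ hξ
    obtain ⟨e, he, rfl⟩ := Finset.mem_image.1 hξ
    exact (hX₀ _).2 ⟨dElt e, hA e he, congrArg QuotientGroup.mk (dElt_mul x e)⟩
  · intro ξ hξ
    obtain ⟨b, hb, rfl⟩ := (hX₀ ξ).1 hξ
    obtain ⟨e, ⟨he, hclass⟩, huniq⟩ := hA' (GeneralLinearGroup.det b) ⟨b, hb, rfl⟩
    have hdet : GeneralLinearGroup.det (dElt x * b : GLf k n) = x * GeneralLinearGroup.det b := by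
      rw [map_mul, det_dElt hn]
    refine ⟨f' e, ⟨Finset.mem_image_of_mem _ he, ?_⟩, ?_⟩
    · obtain ⟨δ, h1, h2⟩ := finClass_eq_iff.1 hclass
      obtain ⟨γ, h3, h4⟩ := exists_toFin_mem hn hL'.isOpen δ (dElt (x * e)) (dElt x * b) (by
        rw [det_dElt hn, hdet]
        exact h2)
      refine ⟨γ, mem_arithGroup.2 ⟨toInf_mem_posGL.2 (by rw [h3]; exact h1), ?_⟩, ?_⟩
      · have h5 := mul_mem (mul_mem hb (hle h4)) (inv_mem (hA e he))
        convert! h5 using 1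
        rw [dElt_mul]
        group
      · rw [mul_assoc] at h4
        exact QuotientGroup.eq.2 h4
    · rintro _ ⟨hξ', γ, hγ, hγ'⟩
      obtain ⟨e', he', rfl⟩ := Finset.mem_image.1 hξ'
      have h1 := (QuotientGroup.eq.1 hγ' : (dElt x * b)⁻¹ * (toFin γ * dElt (x * e')) ∈ L')
      refine congrArg f' (huniq e' ⟨he', finClass_eq_iff.2 ⟨GeneralLinearGroup.det γ,
        toInf_mem_posGL.1 (mem_arithGroup.1 hγ).1, ?_⟩⟩)
      refine ⟨_, inv_mem h1, ?_⟩
      rw [map_inv, map_mul, map_mul, map_inv, hdet, det_dElt hn, det_toFin]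
      simp only [_root_.mul_inv_rev, inv_inv]
  · intro γ hγ ξ hξ σ
    obtain ⟨g, rfl⟩ := QuotientGroup.mk_surjective ξ
    have h1 := hz.inv γ hγ σ
    simp only [P, isPos_smul (mem_arithGroup.1 hγ).1, hact, hout, h1, pullback_smul φ.2.1,
      mem_invariantsOf_dual.1 hu γ hγ]
  · intro ξ hξ
    obtain ⟨C, hC, h1⟩ := exists_isCompact_of_mem_compactCochains hK.isCompact φ.2.1 hL.isOpen x
      (jEmb ξ.out * (h * t), ξ.out * (h' * t'))
    refine hz.finiteSupportMod hC fun σ hσ => ?_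
    simp only [P, ne_eq, ite_eq_right_iff, Classical.not_imp] at hσ
    refine ⟨fun h0 => hσ.2 (by simp [h0]), h1 σ fun h0 => hσ.2 ?_⟩
    rw [pullback, h0, map_zero, mul_zero]

end

section

section Classes

variable {k : Type*} [Field k] [NumberField k] {n : ℕ}

theorem arithGroup_le_mul {L : Subgroup (GLf k n)} {d : (Af k)ˣ} (hd : dElt d ∈ L) (x : (Af k)ˣ) :
    arithGroup L x ≤ arithGroup L (x * d) := by
  intro γ hγ
  obtain ⟨h1, h2⟩ := mem_arithGroup.1 hγ
  refine mem_arithGroup.2 ⟨h1, ?_⟩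
  convert! mul_mem (mul_mem (inv_mem hd) h2) hd using 1
  rw [dElt_mul]
  group

/-- Elements of `det(L)` which become equivalent differ by a unit in `U_L`. -/
theorem exists_unit_of_finClass_eq {L L' : Subgroup (GLf k n)} (hle : L' ≤ L) {x d d' : (Af k)ˣ}
    (hd : d ∈ detLevel L) (hd' : d' ∈ detLevel L) (h : finClass L' (x * d) = finClass L' (x * d')) :
    ∃ δ ∈ unitGroup L, d⁻¹ * (principal k δ).2⁻¹ * d' ∈ detLevel L' := by
  obtain ⟨δ, h1, h2⟩ := finClass_eq_iff.1 h
  have h3 : (x * d)⁻¹ * (principal k δ).2⁻¹ * (x * d') = d⁻¹ * (principal k δ).2⁻¹ * d' :=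
    Additive.ofMul.injective (by simp only [ofMul_mul, ofMul_inv]; abel)
  rw [h3] at h2
  refine ⟨δ, mem_unitGroup.2 ⟨h1, ?_⟩, h2⟩
  have h4 : (principal k δ).2 = d⁻¹ * d' * (d⁻¹ * (principal k δ).2⁻¹ * d')⁻¹ :=
    Additive.ofMul.injective (by simp only [ofMul_mul, ofMul_inv]; abel)
  rw [h4]
  exact mul_mem (mul_mem (inv_mem hd) hd') (inv_mem (detLevel_mono hle h2))

theorem finClass_eq_of_unit {L L' : Subgroup (GLf k n)} {x d d' : (Af k)ˣ} {δ : kˣ}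
    (hδ : δ ∈ unitGroup L) (h : d⁻¹ * (principal k δ).2⁻¹ * d' ∈ detLevel L') :
    finClass L' (x * d) = finClass L' (x * d') := by
  refine finClass_eq_iff.2 ⟨δ, (mem_unitGroup.1 hδ).1, ?_⟩
  have h3 : (x * d)⁻¹ * (principal k δ).2⁻¹ * (x * d') = d⁻¹ * (principal k δ).2⁻¹ * d' :=
    Additive.ofMul.injective (by simp only [ofMul_mul, ofMul_inv]; abel)
  rwa [h3]

/-- A fibre of the map from `det(L) / det(L')` to classes has `(U_L : U_{L'})` elements. -/
theorem card_fiber_eq_relIndex {L L' : Subgroup (GLf k n)} (hle : L' ≤ L) (x : (Af k)ˣ)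
    {ι : Type*} [DecidableEq ι] (R : Finset ι) (d : ι → (Af k)ˣ) (hd : ∀ r ∈ R, d r ∈ detLevel L)
    (hR : ∀ y ∈ detLevel L, ∃! r, r ∈ R ∧ (d r)⁻¹ * y ∈ detLevel L') {s : ι} (hs : s ∈ R)
    [DecidablePred fun r => finClass L' (x * d r) = finClass L' (x * d s)] :
    (R.filter fun r => finClass L' (x * d r) = finClass L' (x * d s)).card =
      (unitGroup L').relIndex (unitGroup L) := by
  let S := {r // r ∈ R.filter fun r => finClass L' (x * d r) = finClass L' (x * d s)}
  have hS : ∀ r : S, ∃ δ ∈ unitGroup L, (d r.1)⁻¹ * (principal k δ).2⁻¹ * d s ∈ detLevel L' :=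
    fun r => exists_unit_of_finClass_eq hle (hd _ (Finset.mem_filter.1 r.2).1) (hd s hs)
      (Finset.mem_filter.1 r.2).2
  choose δ hδ hδ' using hS
  let f : S → unitGroup L ⧸ (unitGroup L').subgroupOf (unitGroup L) :=
    fun r => QuotientGroup.mk ⟨δ r, hδ r⟩
  have hunit : ∀ ε ∈ unitGroup L, ε ∈ unitGroup L' ↔ (principal k ε).2 ∈ detLevel L' := fun ε hε =>
    ⟨fun h => (mem_unitGroup.1 h).2, fun h => mem_unitGroup.2 ⟨(mem_unitGroup.1 hε).1, h⟩⟩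
  have hf : ∀ (r : S) (ε : kˣ) (hε : ε ∈ unitGroup L), f r = QuotientGroup.mk ⟨ε, hε⟩ ↔
      (d r.1)⁻¹ * (principal k ε).2⁻¹ * d s ∈ detLevel L' := by
    intro r ε hε
    have h1 : f r = QuotientGroup.mk ⟨ε, hε⟩ ↔ (δ r)⁻¹ * ε ∈ unitGroup L' := QuotientGroup.eq
    rw [h1, hunit _ (mul_mem (inv_mem (hδ r)) hε), map_mul, map_inv, Prod.snd_mul, Prod.snd_inv]
    have h2 : (d r.1)⁻¹ * (principal k ε).2⁻¹ * d s = ((d r.1)⁻¹ * (principal k (δ r)).2⁻¹ * d s) *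
        ((principal k (δ r)).2⁻¹ * (principal k ε).2)⁻¹ :=
      Additive.ofMul.injective (by simp only [ofMul_mul, ofMul_inv]; abel)
    rw [h2, Subgroup.mul_mem_cancel_left _ (hδ' r), inv_mem_iff]
  have hbij : Function.Bijective f := by
    constructor
    · intro r r' h
      have h1 := (hf r (δ r') (hδ r')).1 h
      have h2 := hδ' r'
      have h3 := mul_mem h1 (inv_mem h2)
      have h4 : (d r.1)⁻¹ * (principal k (δ r')).2⁻¹ * d s *
          ((d r'.1)⁻¹ * (principal k (δ r')).2⁻¹ * d s)⁻¹ = (d r.1)⁻¹ * d r'.1 :=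
        Additive.ofMul.injective (by simp only [ofMul_mul, ofMul_inv]; abel)
      rw [h4] at h3
      have hr := (Finset.mem_filter.1 r.2).1
      have hr' := (Finset.mem_filter.1 r'.2).1
      exact Subtype.ext ((hR _ (hd _ hr')).unique ⟨hr, h3⟩ ⟨hr', by
        rw [inv_mul_cancel]
        exact one_mem _⟩)
    · intro o
      induction o using QuotientGroup.induction_on with | H ε =>
      obtain ⟨r, ⟨hr, hr'⟩, -⟩ := hR ((principal k ε.1).2⁻¹ * d s)
        (mul_mem (inv_mem (mem_unitGroup.1 ε.2).2) (hd s hs))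
      rw [← mul_assoc] at hr'
      exact ⟨⟨r, Finset.mem_filter.2 ⟨hr, finClass_eq_of_unit ε.2 hr'⟩⟩, (hf _ _ ε.2).2 hr'⟩
  have := Nat.card_eq_of_bijective f hbij
  rw [Subgroup.relIndex, Subgroup.index, ← this, Nat.card_eq_fintype_card, Fintype.card_coe]

end Classes

variable {k : Type*} [Field k] [NumberField k] {n : ℕ} {E M₁ M₂ : Type*} [Field E] [CharZero E]
  [AddCommGroup M₁] [Module E M₁] [AddCommGroup M₂] [Module E M₂] [FiniteDimensional E M₁]
  [FiniteDimensional E M₂]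
  {ρ₁ : Representation E (GLk k (n + 1)) M₁} {ρ₂ : Representation E (GLk k n) M₂}
  {J : AdGroup k (n + 1)} {J' : AdGroup k n}
  {K : Subgroup (GLf k (n + 1))} {K' : Subgroup (GLf k n)}

/-- The distribution relation in the presence of neat arithmetic groups. -/
theorem smul_modularSymbol_eq_sum_of_neat (hn : 1 ≤ n) (hρ₁ : IsAlgebraicRep ρ₁)
    (hρ₂ : IsAlgebraicRep ρ₂) (F : FundamentalClasses k n) (hK : IsLevel K) (hK' : IsLevel K')
    {h t : GLf k (n + 1)} {h' t' : GLf k n}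
    (hle : diagLevel K K' (h * t) (h' * t') ≤ diagLevel K K' h h')
    (htrans : IsTransitive K K' h t h' t')
    {l : HC ρ₁ ρ₂ J J' K K' (degree k n)} {κ : E} (hl : IsHeckeEigenclass t t' l κ)
    {L₀ : Subgroup (GLf k n)} (hL₀ : IsLevel L₀) (hle₀ : diagLevel K K' h h' ≤ L₀)
    (hneat : ∀ c, ∀ γ ∈ arithGroup L₀ c, IsNeatElement γ)
    (x : (Af k)ˣ) (A : Finset (Af k)ˣ) (hA : ∀ e ∈ A, dElt e ∈ diagLevel K K' h h')
    (hA' : ∀ d ∈ detLevel (diagLevel K K' h h'), ∃! e, e ∈ A ∧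
      finClass (diagLevel K K' (h * t) (h' * t')) (x * e) =
        finClass (diagLevel K K' (h * t) (h' * t')) (x * d)) :
    κ • modularSymbol F l h h' x = ∑ e ∈ A, modularSymbol F l (h * t) (h' * t') (x * e) := by
  have hL := isLevel_diagLevel hK hK' h h'
  refine (isAlgebraicRep_diagRep hρ₁ hρ₂).eq_of_forall_invariant
    (hasUnipotents_arithGroup hL.isOpen x) ?_ ?_ fun u hu => ?_
  · exact Submodule.smul_mem _ _ (modularSymbol_mem_invariantsOf hρ₁ hρ₂ F hK hK' l h h' x)
  · refine Submodule.sum_mem _ fun e he γ hγ => ?_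
    exact diagRep_modularSymbol_of_neat hρ₁ hρ₂ F hK hK' l _ _ hL₀.isCompact (x * e) (hneat _)
      (arithGroup_mono hle₀ _ (arithGroup_le_mul (hA e he) x hγ))
  · rw [map_smul, smul_eq_mul, map_sum]
    exact mul_apply_modularSymbol_eq_sum hn hρ₁ hρ₂ F hK hK' hle htrans hl x A hA hA' hu

/-- The distribution relation. -/
theorem relIndex_smul_modularSymbol_eq_sum (hn : 1 ≤ n) (hρ₁ : IsAlgebraicRep ρ₁)
    (hρ₂ : IsAlgebraicRep ρ₂) (F : FundamentalClasses k n) (hK : IsLevel K) (hK' : IsLevel K')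
    {h t : GLf k (n + 1)} {h' t' : GLf k n}
    (hle : diagLevel K K' (h * t) (h' * t') ≤ diagLevel K K' h h')
    (htrans : IsTransitive K K' h t h' t')
    {l : HC ρ₁ ρ₂ J J' K K' (degree k n)} {κ : E} (hl : IsHeckeEigenclass t t' l κ)
    (x : (Af k)ˣ) {ι : Type*} (R : Finset ι) (d : ι → (Af k)ˣ)
    (hd : ∀ r ∈ R, dElt (d r) ∈ diagLevel K K' h h')
    (hR : ∀ y ∈ detLevel (diagLevel K K' h h'), ∃! r, r ∈ R ∧
      (d r)⁻¹ * y ∈ detLevel (diagLevel K K' (h * t) (h' * t'))) :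
    (unitGroup (diagLevel K K' (h * t) (h' * t'))).relIndex (unitGroup (diagLevel K K' h h')) •
      κ • modularSymbol F l h h' x =
      ∑ r ∈ R, modularSymbol F l (h * t) (h' * t') (x * d r) := by
  classical
  have hL := isLevel_diagLevel hK hK' h h'
  have : Nonempty ι := ⟨(hR 1 (one_mem _)).exists.choose⟩
  have hd' : ∀ r ∈ R, d r ∈ detLevel (diagLevel K K' h h') := fun r hr =>
    ⟨_, hd r hr, det_dElt hn _⟩
  refine (isAlgebraicRep_diagRep hρ₁ hρ₂).eq_of_forall_invariant
    (hasUnipotents_arithGroup hL.isOpen x) ?_ ?_ fun u hu => ?_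
  · exact nsmul_mem (Submodule.smul_mem _ _
      (modularSymbol_mem_invariantsOf hρ₁ hρ₂ F hK hK' l h h' x)) _
  · intro γ hγ
    have hδ : GeneralLinearGroup.det γ ∈ unitGroup (diagLevel K K' h h') := by
      rw [← map_det_arithGroup hn hL.isOpen x]
      exact ⟨γ, hγ, rfl⟩
    set δ := (principal k (GeneralLinearGroup.det γ)).2 with hδdef
    have hδ2 : δ ∈ detLevel (diagLevel K K' h h') := (mem_unitGroup.1 hδ).2
    rw [map_sum]
    choose! π hπ hπ' using fun y hy => (hR y hy)
    have hmem : ∀ ε ∈ detLevel (diagLevel K K' h h'), ∀ r ∈ R,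
      ε * d r ∈ detLevel (diagLevel K K' h h') := fun ε hε r hr => mul_mem hε (hd' r hr)
    have hπ2 : ∀ ε ∈ detLevel (diagLevel K K' h h'), ∀ r ∈ R,
        π (ε⁻¹ * d (π (ε * d r))) = r := by
      intro ε hε r hr
      have h1 := hπ _ (hmem ε hε r hr)
      refine (hπ' _ (hmem ε⁻¹ (inv_mem hε) _ h1.1) r ⟨hr, ?_⟩).symm
      convert! inv_mem h1.2 using 1
      rw [_root_.mul_inv_rev, _root_.mul_inv_rev, inv_inv, mul_assoc]
    refine Finset.sum_bij' (fun r _ => π (δ * d r)) (fun r _ => π (δ⁻¹ * d r))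
      (fun r hr => (hπ _ (hmem δ hδ2 r hr)).1) (fun r hr => (hπ _ (hmem _ (inv_mem hδ2) r hr)).1)
      (fun r hr => hπ2 δ hδ2 r hr) (fun r hr => ?_) fun r hr => ?_
    · have := hπ2 δ⁻¹ (inv_mem hδ2) r hr
      rwa [inv_inv] at this
    · symm
      refine modularSymbol_eq_diagRep hn hρ₁ hρ₂ F hK hK' l _ _ γ (mem_unitGroup.1 hδ).1 ?_
      convert! inv_mem (hπ _ (hmem δ hδ2 r hr)).2 using 1
      rw [← hδdef]
      exact Additive.ofMul.injective (by simp only [ofMul_mul, ofMul_inv]; abel)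
  · set L := diagLevel K K' h h'
    set L' := diagLevel K K' (h * t) (h' * t')
    let cl : ι → ClassSet L' := fun r => finClass L' (x * d r)
    have hconst : ∀ r ∈ R, ∀ r' ∈ R, cl r = cl r' →
        u (modularSymbol F l (h * t) (h' * t') (x * d r)) =
          u (modularSymbol F l (h * t) (h' * t') (x * d r')) := by
      intro r hr r' hr' hcl
      obtain ⟨δ, hδ, h1⟩ := exists_unit_of_finClass_eq hle (hd' r hr) (hd' r' hr') hcl
      have h2 := hδ
      rw [← map_det_arithGroup hn hL.isOpen x] at h2
      obtain ⟨γ, hγ, rfl⟩ := h2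
      rw [modularSymbol_eq_diagRep hn hρ₁ hρ₂ F hK hK' l _ _ γ (x := x * d r) (x' := x * d r')
        (mem_unitGroup.1 hδ).1, mem_invariantsOf_dual.1 hu γ hγ]
      convert! h1 using 1
      exact Additive.ofMul.injective (by simp only [ofMul_mul, ofMul_inv]; abel)
    have hsel : ∀ c ∈ R.image cl, ∃ r ∈ R, cl r = c := fun c hc => Finset.mem_image.1 hc
    choose! s hs hs' using hsel
    have hsinj : Set.InjOn (fun c => d (s c)) (R.image cl) := by
      intro c hc c' hc' h1
      rw [← hs' c hc, ← hs' c' hc']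
      exact congrArg (fun y => finClass L' (x * y)) h1
    rw [map_nsmul, map_smul, smul_eq_mul, map_sum,
      mul_apply_modularSymbol_eq_sum hn hρ₁ hρ₂ F hK hK' hle htrans hl x
        ((R.image cl).image fun c => d (s c)) ?_ ?_ hu,
      Finset.sum_image hsinj, Finset.smul_sum,
      ← Finset.sum_fiberwise_of_maps_to (fun r hr => Finset.mem_image_of_mem cl hr)]
    · refine Finset.sum_congr rfl fun c hc => ?_
      rw [Finset.sum_congr rfl fun r hr => hconst r (Finset.mem_filter.1 hr).1 (s c) (hs c hc)
        ((Finset.mem_filter.1 hr).2.trans (hs' c hc).symm), Finset.sum_const]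
      congr 1
      refine (card_fiber_eq_relIndex hle x R d hd' hR (hs c hc)).symm.trans (congrArg Finset.card ?_)
      refine Finset.filter_congr fun r _ => ?_
      have h2 : finClass L' (x * d (s c)) = c := hs' c hc
      rw [h2]
    · intro e he
      obtain ⟨c, hc, rfl⟩ := Finset.mem_image.1 he
      exact hd _ (hs c hc)
    · intro y hy
      obtain ⟨r, ⟨hr, hr'⟩, -⟩ := hR y hy
      have hcl : cl r = finClass L' (x * y) := by
        refine finClass_eq_of_inv_mul_mem ?_
        convert! hr' using 1
        rw [_root_.mul_inv_rev, mul_assoc, inv_mul_cancel_left]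
      have hcm : cl r ∈ R.image cl := Finset.mem_image_of_mem cl hr
      refine ⟨d (s (cl r)), ⟨Finset.mem_image_of_mem _ hcm, (hs' _ hcm).trans hcl⟩, ?_⟩
      rintro e ⟨he, he'⟩
      obtain ⟨c, hc, rfl⟩ := Finset.mem_image.1 he
      have : c = cl r := by
        rw [← hs' c hc, hcl]
        exact he'
      simp only [this]

end

section

section Local

variable {F Γ₀ : Type*} [Field F] [LinearOrderedCommGroupWithZero Γ₀] (v : Valuation F Γ₀) (τ : Γ₀)
  {m : ℕ}

/-- Integral matrices which are invertible and upper triangular modulo elements of size at most `τ`. -/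
structure IsIwahori (M : Matrix (Fin m) (Fin m) F) : Prop where
  le_one : ∀ i j, v (M i j) ≤ 1
  diag : ∀ i, v (M i i) = 1
  lower : ∀ i j, j < i → v (M i j) ≤ τ

/-- Integral upper triangular unipotent matrices. -/
structure IsUpper (u : Matrix (Fin m) (Fin m) F) : Prop where
  le_one : ∀ i j, v (u i j) ≤ 1
  diag : ∀ i, u i i = 1
  lower : ∀ i j, j < i → u i j = 0

variable {v τ}

theorem valuation_det_sub_prod_le {M : Matrix (Fin m) (Fin m) F} (h1 : ∀ i j, v (M i j) ≤ 1)
    (h2 : ∀ i j, j < i → v (M i j) ≤ τ) : v (M.det - ∏ i, M i i) ≤ τ := by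
  rw [Matrix.det_apply, ← Finset.add_sum_erase _ _ (Finset.mem_univ (1 : Equiv.Perm (Fin m)))]
  simp only [Equiv.Perm.sign_one, one_smul, Equiv.Perm.coe_one, id_eq, add_sub_cancel_left]
  refine v.map_sum_le fun σ hσ => ?_
  have hex : ∃ i, i < σ i := by
    by_contra hcon
    have hle : ∀ i, σ i ≤ i := fun i => not_lt.1 fun hi => hcon ⟨i, hi⟩
    refine (Finset.mem_erase.1 hσ).1 (Equiv.ext fun i => ?_)
    have hsum : ∑ i, (σ i : ℕ) = ∑ i : Fin m, (i : ℕ) := Equiv.sum_comp σ fun i : Fin m => (i : ℕ)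
    exact Fin.ext ((Finset.sum_eq_sum_iff_of_le fun i _ => Fin.le_def.1 (hle i)).1 hsum i
      (Finset.mem_univ i))
  obtain ⟨i, hi⟩ := hex
  have hsign : v (Equiv.Perm.sign σ • ∏ i, M (σ i) i) = v (∏ i, M (σ i) i) := by
    rcases Int.units_eq_one_or (Equiv.Perm.sign σ) with h | h <;> simp [h]
  rw [hsign, map_prod, ← Finset.mul_prod_erase _ _ (Finset.mem_univ i)]
  exact (mul_le_mul' (h2 _ _ hi) (Finset.prod_le_one' fun j _ => h1 _ _)).trans (mul_one τ).le

theorem valuation_det_le_one {M : Matrix (Fin m) (Fin m) F} (h1 : ∀ i j, v (M i j) ≤ 1) :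
    v M.det ≤ 1 := by
  have h2 := valuation_det_sub_prod_le h1 fun i j _ => h1 i j
  have h3 : v (∏ i, M i i) ≤ 1 := by
    rw [map_prod]
    exact Finset.prod_le_one' fun i _ => h1 i i
  rw [← sub_add_cancel M.det (∏ i, M i i)]
  exact v.map_add_le h2 h3

theorem isIwahori_iff (hτ : τ < 1) {M : Matrix (Fin m) (Fin m) F} :
    IsIwahori v τ M ↔ (∀ i j, v (M i j) ≤ 1) ∧ v M.det = 1 ∧ ∀ i j, j < i → v (M i j) ≤ τ := by
  have key : (∀ i j, v (M i j) ≤ 1) → (∀ i j, j < i → v (M i j) ≤ τ) →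
      (v M.det = 1 ↔ ∏ i, v (M i i) = 1) := by
    intro h1 h2
    have h3 := (valuation_det_sub_prod_le h1 h2).trans_lt hτ
    rw [← map_prod]
    constructor
    · intro h
      rw [← h] at h3 ⊢
      exact (v.map_eq_of_sub_lt (by rwa [v.map_sub_swap])).symm ▸ rfl
    · intro h
      rw [← h] at h3
      rw [v.map_eq_of_sub_lt h3, h]
  constructor
  · intro h
    exact ⟨h.le_one, (key h.le_one h.lower).2 (Finset.prod_eq_one fun i _ => h.diag i), h.lower⟩
  · rintro ⟨h1, h2, h3⟩
    refine ⟨h1, fun i => ?_, h3⟩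
    have h4 := (key h1 h3).1 h2
    exact le_antisymm (h1 i i) (by
      rw [← h4, ← Finset.mul_prod_erase _ _ (Finset.mem_univ i)]
      exact (mul_le_mul' le_rfl (Finset.prod_le_one' fun j _ => h1 j j)).trans (mul_one _).le)

theorem IsUpper.det_eq_one {u : Matrix (Fin m) (Fin m) F} (hu : IsUpper v u) : u.det = 1 := by
  rw [Matrix.det_of_isUpperTriangular (fun i j h => hu.lower i j h)]
  exact Finset.prod_eq_one fun i _ => hu.diag i

theorem IsUpper.inv {u : Matrix (Fin m) (Fin m) F} (hu : IsUpper v u) : IsUpper v u⁻¹ := by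
  have hdet : IsUnit u.det := by rw [hu.det_eq_one]; exact isUnit_one
  have hinv : Invertible u := Matrix.invertibleOfIsUnitDet u hdet
  have hlow : ∀ i j, j < i → u⁻¹ i j = 0 := by
    have h1 : u.BlockTriangular id := fun i j h => hu.lower i j h
    exact fun i j h => Matrix.blockTriangular_inv_of_blockTriangular h1 h
  refine ⟨fun i j => ?_, fun i => ?_, hlow⟩
  · rw [Matrix.inv_def, hu.det_eq_one, Ring.inverse_one, one_smul, Matrix.adjugate_apply]
    refine valuation_det_le_one fun a b => ?_
    rw [Matrix.updateRow_apply]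
    split_ifs
    · rw [Pi.single_apply]
      split_ifs <;> simp
    · exact hu.le_one a b
  · have h1 := congrFun (congrFun (Matrix.mul_nonsing_inv u hdet) i) i
    rw [Matrix.mul_apply, Matrix.one_apply_eq, Finset.sum_eq_single_of_mem i (Finset.mem_univ i),
      hu.diag, one_mul] at h1
    · exact h1
    · intro j _ hj
      rcases lt_or_gt_of_ne hj with h | h
      · rw [hu.lower i j h, zero_mul]
      · rw [hlow j i h, mul_zero]

theorem IsIwahori.map_eq_one_of_sub {x y : F} (hτ : τ < 1) (hx : v x = 1) (h : v (y - x) ≤ τ) : v y = 1 := by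
  rw [v.map_eq_of_sub_lt (x := x) (by rw [hx]; exact h.trans_lt hτ), hx]

/-- The Iwahori decomposition. -/
theorem IsIwahori.exists_eq_mul (hτ : τ < 1) : ∀ {m : ℕ} {a : Matrix (Fin m) (Fin m) F}, IsIwahori v τ a →
    ∃ u l : Matrix (Fin m) (Fin m) F, IsUpper v u ∧ IsIwahori v τ l ∧ (∀ i j, i < j → l i j = 0) ∧
      a = u * l := by
  intro m
  induction m with
  | zero =>
    intro a ha
    exact ⟨1, a, ⟨fun i => i.elim0, fun i => i.elim0, fun i => i.elim0⟩, ha, fun i => i.elim0, by simp⟩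
  | succ m ih =>
    intro a ha
    set d := a (Fin.last m) (Fin.last m) with hd
    have hd1 : v d = 1 := ha.diag _
    have hd0 : d ≠ 0 := by
      intro h0
      rw [h0, map_zero] at hd1
      exact zero_ne_one hd1
    have hsmall : ∀ i j : Fin m, v (a i.castSucc (Fin.last m) / d * a (Fin.last m) j.castSucc) ≤ τ := by
      intro i j
      rw [map_mul, map_div₀, hd1, div_one]
      exact (mul_le_mul' (ha.le_one _ _) (ha.lower _ _ (Fin.castSucc_lt_last j))).trans (one_mul τ).le
    obtain ⟨u, l, hu, hl, hl', hul⟩ := ih (a := Matrix.of fun i j : Fin m => a i.castSucc j.castSucc -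
        a i.castSucc (Fin.last m) / d * a (Fin.last m) j.castSucc) (by
      refine ⟨fun i j => ?_, fun i => ?_, fun i j hij => ?_⟩
      · exact v.map_sub_le (ha.le_one _ _) ((hsmall i j).trans hτ.le)
      · refine IsIwahori.map_eq_one_of_sub hτ (ha.diag i.castSucc) ?_
        rw [Matrix.of_apply, sub_sub_cancel_left, Valuation.map_neg]
        exact hsmall i i
      · exact v.map_sub_le (ha.lower _ _ hij) (hsmall i j))
    have hul' : ∀ i j : Fin m, a i.castSucc j.castSucc = (u * l) i j +
        a i.castSucc (Fin.last m) / d * a (Fin.last m) j.castSucc := by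
      intro i j
      rw [← hul, Matrix.of_apply, sub_add_cancel]
    let u' : Matrix (Fin (m + 1)) (Fin (m + 1)) F := fun i j =>
      Fin.lastCases (Fin.lastCases (motive := fun _ => F) 1 (fun _ => 0) j)
        (fun i' => Fin.lastCases (motive := fun _ => F) (a i'.castSucc (Fin.last m) / d)
          (fun j' => u i' j') j) i
    let l' : Matrix (Fin (m + 1)) (Fin (m + 1)) F := fun i j =>
      Fin.lastCases (a (Fin.last m) j)
        (fun i' => Fin.lastCases (motive := fun _ => F) 0 (fun j' => l i' j') j) i
    have hu1 : ∀ i j : Fin m, u' i.castSucc j.castSucc = u i j := by simp [u']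
    have hu2 : ∀ i : Fin m, u' i.castSucc (Fin.last m) = a i.castSucc (Fin.last m) / d := by simp [u']
    have hu3 : ∀ j : Fin m, u' (Fin.last m) j.castSucc = 0 := by simp [u']
    have hu4 : u' (Fin.last m) (Fin.last m) = 1 := by simp [u']
    have hl1 : ∀ i j : Fin m, l' i.castSucc j.castSucc = l i j := by simp [l']
    have hl2 : ∀ i : Fin m, l' i.castSucc (Fin.last m) = 0 := by simp [l']
    have hl3 : ∀ j, l' (Fin.last m) j = a (Fin.last m) j := by simp [l']
    refine ⟨u', l', ⟨fun i j => ?_, fun i => ?_, fun i j hij => ?_⟩, ⟨fun i j => ?_, fun i => ?_,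
      fun i j hij => ?_⟩, fun i j hij => ?_, ?_⟩
    · cases i using Fin.lastCases with
      | last => cases j using Fin.lastCases <;> simp [hu3, hu4]
      | cast i =>
        cases j using Fin.lastCases with
        | last => rw [hu2, map_div₀, hd1, div_one]; exact ha.le_one _ _
        | cast j => rw [hu1]; exact hu.le_one i j
    · cases i using Fin.lastCases with
      | last => exact hu4
      | cast i => rw [hu1]; exact hu.diag i
    · cases j using Fin.lastCases with
      | last => exact absurd hij (not_lt.2 (Fin.le_last i))
      | cast j =>
        cases i using Fin.lastCases with
        | last => exact hu3 j
        | cast i => rw [hu1]; exact hu.lower i j hij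
    · cases i using Fin.lastCases with
      | last => rw [hl3]; exact ha.le_one _ _
      | cast i =>
        cases j using Fin.lastCases with
        | last => simp [hl2]
        | cast j => rw [hl1]; exact hl.le_one i j
    · cases i using Fin.lastCases with
      | last => rw [hl3]; exact hd1
      | cast i => rw [hl1]; exact hl.diag i
    · cases i using Fin.lastCases with
      | last => rw [hl3]; exact ha.lower _ _ hij
      | cast i =>
        cases j using Fin.lastCases with
        | last => simp [hl2]
        | cast j => rw [hl1]; exact hl.lower i j hij
    · cases i using Fin.lastCases with
      | last => exact absurd hij (not_lt.2 (Fin.le_last j))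
      | cast i =>
        cases j using Fin.lastCases with
        | last => exact hl2 i
        | cast j => rw [hl1]; exact hl' i j hij
    · ext i j
      rw [Matrix.mul_apply, Fin.sum_univ_castSucc]
      cases i using Fin.lastCases with
      | last => simp [hu3, hu4, hl3]
      | cast i =>
        cases j using Fin.lastCases with
        | last => simp [hu2, hl2, hl3, ← hd, hd0]
        | cast j => simp only [hu1, hu2, hl1, hl3]; rw [hul', Matrix.mul_apply]

/-- An upper unipotent matrix can be rescaled so as to fix a vector whose entries decrease. -/
theorem IsUpper.exists_scaling {u : Matrix (Fin m) (Fin m) F} (hu : IsUpper v u) {ζ : Fin m → F}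
    (hζ : ∀ i, ζ i ≠ 0) (hζ' : ∀ i j, i < j → v (ζ j) ≤ τ * v (ζ i)) :
    ∃ δ : Fin m → F, (∀ i, v (δ i - 1) ≤ τ) ∧ ∀ i, ∑ j, u i j * (δ j * ζ j) = ζ i := by
  have hdet : IsUnit u.det := by rw [hu.det_eq_one]; exact isUnit_one
  have hui := hu.inv
  refine ⟨fun i => (u⁻¹ *ᵥ ζ) i / ζ i, fun i => ?_, fun i => ?_⟩
  · have h1 : (u⁻¹ *ᵥ ζ) i / ζ i - 1 = ∑ j ∈ Finset.univ.erase i, u⁻¹ i j * ζ j / ζ i := by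
      rw [Matrix.mulVec, dotProduct, Finset.sum_div,
        ← Finset.add_sum_erase _ _ (Finset.mem_univ i), hui.diag, one_mul, div_self (hζ i),
        add_sub_cancel_left]
    rw [h1]
    refine v.map_sum_le fun j hj => ?_
    rcases lt_or_gt_of_ne (Finset.mem_erase.1 hj).1 with h | h
    · rw [hui.lower i j h, zero_mul, zero_div, map_zero]
      exact zero_le
    · rw [map_div₀, map_mul]
      refine div_le_of_le_mul₀ zero_le zero_le ?_
      exact (mul_le_mul' (hui.le_one i j) (hζ' i j h)).trans (one_mul _).le
  · have h1 : ∀ j, (u⁻¹ *ᵥ ζ) j / ζ j * ζ j = (u⁻¹ *ᵥ ζ) j := fun j => div_mul_cancel₀ _ (hζ j)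
    simp only [h1]
    change (u *ᵥ (u⁻¹ *ᵥ ζ)) i = ζ i
    rw [Matrix.mulVec_mulVec, Matrix.mul_nonsing_inv u hdet, Matrix.one_mulVec]

end Local

end

section

section Conj

variable {R : Type*} [CommRing R] {m n : ℕ}

theorem val_diagGL (f : Fin m → Rˣ) : (diagGL f).val = Matrix.diagonal fun i => (f i : R) := rfl

theorem diagGL_mul (f g : Fin m → Rˣ) : diagGL (f * g) = diagGL f * diagGL g := by
  unfold diagGL
  rw [← map_mul, ← map_mul]

theorem diagGL_one : diagGL (1 : Fin m → Rˣ) = 1 := by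
  unfold diagGL
  rw [map_one, map_one]

theorem diagGL_inv (f : Fin m → Rˣ) : (diagGL f)⁻¹ = diagGL f⁻¹ := by
  rw [inv_eq_iff_mul_eq_one, ← diagGL_mul, mul_inv_cancel, diagGL_one]

theorem diagGL_pow (f : Fin m → Rˣ) (V : ℕ) : diagGL f ^ V = diagGL (f ^ V) := by
  unfold diagGL
  rw [← map_pow, ← map_pow]

theorem diagGL_conj_apply (f : Fin m → Rˣ) (b : GL (Fin m) R) (i j : Fin m) :
    ((diagGL f)⁻¹ * b * diagGL f).val i j = ((f i)⁻¹ : Rˣ) * b.val i j * (f j : R) := by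
  rw [diagGL_inv]
  simp only [Units.val_mul, val_diagGL, Matrix.diagonal_mul, Matrix.mul_diagonal, Pi.inv_apply]

/-- `diag(π^n, π^{n-1}, …)`. -/
def powDiag (m n : ℕ) (π : Rˣ) : GL (Fin m) R := diagGL fun i => π ^ (n - i.val)

theorem jEmb_powDiag (π : Rˣ) : jEmb (powDiag n n π) = powDiag (n + 1) n π := by
  ext i j
  cases i using Fin.lastCases with
  | last =>
    cases j using Fin.lastCases with
    | last => rw [jEmb_last_last]; simp [powDiag, val_diagGL]
    | cast j =>
      rw [jEmb_last_castSucc, powDiag, val_diagGL, Matrix.diagonal_apply_ne]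
      exact (Fin.castSucc_lt_last j).ne'
  | cast i =>
    cases j using Fin.lastCases with
    | last =>
      rw [jEmb_castSucc_last, powDiag, val_diagGL, Matrix.diagonal_apply_ne]
      exact (Fin.castSucc_lt_last i).ne
    | cast j =>
      rw [jEmb_castSucc_castSucc]
      simp only [powDiag, val_diagGL, Matrix.diagonal_apply, Fin.castSucc_inj, Fin.val_castSucc]

theorem powDiag_conj_apply (π : Rˣ) (V : ℕ) (b : GL (Fin m) R) (i j : Fin m) :
    ((powDiag m n π ^ V)⁻¹ * b * powDiag m n π ^ V).val i j =
      (((π ^ (n - i.val)) ^ V)⁻¹ : Rˣ) * b.val i j * (((π ^ (n - j.val)) ^ V : Rˣ) : R) := by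
  rw [powDiag, diagGL_pow, diagGL_conj_apply]
  rfl

/-- The matrix `(w, e; 0, 1)`. -/
def IsMagic (H : GL (Fin (n + 1)) R) : Prop :=
  ∀ i j : Fin (n + 1), H.val i j = if j.val = n ∨ i.val + j.val + 1 = n then 1 else 0

section Magic

variable {H : GL (Fin (n + 1)) R} (hH : IsMagic H) (b : GL (Fin n) R)

theorem IsMagic.apply_cast_cast (hH : IsMagic H) (i j : Fin n) :
    H.val i.castSucc j.castSucc = if j = i.rev then 1 else 0 := by
  rw [hH]
  have : (j.castSucc.val = n ∨ i.castSucc.val + j.castSucc.val + 1 = n) ↔ j = i.rev := by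
    rw [Fin.ext_iff, Fin.val_rev]
    simp only [Fin.val_castSucc]
    omega
  simp only [this]

theorem IsMagic.apply_last (hH : IsMagic H) (i : Fin (n + 1)) : H.val i (Fin.last n) = 1 := by
  rw [hH, if_pos (Or.inl (Fin.val_last n))]

theorem IsMagic.last_apply_cast (hH : IsMagic H) (j : Fin n) : H.val (Fin.last n) j.castSucc = 0 := by
  rw [hH, if_neg]
  simp only [Fin.val_castSucc, Fin.val_last]
  omega

/-- Conjugation of `diag(b, 1)` by the matrix `(w, e; 0, 1)`. -/
theorem IsMagic.conj_eq (hH : IsMagic H) (b : GL (Fin n) R) {N : Matrix (Fin (n + 1)) (Fin (n + 1)) R}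
    (h1 : ∀ i j : Fin n, N i.castSucc j.castSucc = b.val i.rev j.rev)
    (h2 : ∀ i : Fin n, N i.castSucc (Fin.last n) = ∑ j, b.val i.rev j - 1)
    (h3 : ∀ j : Fin n, N (Fin.last n) j.castSucc = 0) (h4 : N (Fin.last n) (Fin.last n) = 1) :
    (H⁻¹ * jEmb b * H).val = N := by
  have key : H.val * N = (jEmb b).val * H.val := by
    ext i j
    rw [Matrix.mul_apply, Matrix.mul_apply, Fin.sum_univ_castSucc, Fin.sum_univ_castSucc]
    cases i using Fin.lastCases with
    | last =>
      cases j using Fin.lastCases with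
      | last => simp [hH.last_apply_cast, hH.apply_last, jEmb_last_castSucc, jEmb_last_last, h4]
      | cast j => simp [hH.last_apply_cast, hH.apply_last, jEmb_last_castSucc, jEmb_last_last, h3]
    | cast i =>
      cases j using Fin.lastCases with
      | last =>
        simp [hH.apply_cast_cast, hH.apply_last, jEmb_castSucc_castSucc, jEmb_castSucc_last, h2, h4]
      | cast j =>
        have hrev : ∀ x : Fin n, j = x.rev ↔ x = j.rev := fun x => by rw [eq_comm, Fin.rev_eq_iff]
        simp [hH.apply_cast_cast, hH.last_apply_cast, hH.apply_last, jEmb_castSucc_castSucc,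
          jEmb_castSucc_last, h1, h3, hrev]
  rw [Units.val_mul, Units.val_mul, Matrix.mul_assoc, ← key, ← Matrix.mul_assoc, ← Units.val_mul,
    inv_mul_cancel, Units.val_one, Matrix.one_mul]

/-- The conjugate of `diag(b, 1)` which enters the definition of `K(h t^V, t'^V)`. -/
def magicConj (H : GL (Fin (n + 1)) R) (π : Rˣ) (V : ℕ) (b : GL (Fin n) R) : GL (Fin (n + 1)) R :=
  (H * powDiag (n + 1) n π ^ V)⁻¹ * jEmb b * (H * powDiag (n + 1) n π ^ V)

theorem magicConj_eq_conj (H : GL (Fin (n + 1)) R) (π : Rˣ) (V : ℕ) (b : GL (Fin n) R) :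
    magicConj H π V b = (powDiag (n + 1) n π ^ V)⁻¹ * (H⁻¹ * jEmb b * H) * powDiag (n + 1) n π ^ V := by
  unfold magicConj
  group

variable (π : Rˣ) (V : ℕ)

theorem IsMagic.conj_apply (hH : IsMagic H) (b : GL (Fin n) R) :
    (∀ i j : Fin n, (H⁻¹ * jEmb b * H).val i.castSucc j.castSucc = b.val i.rev j.rev) ∧
    (∀ i : Fin n, (H⁻¹ * jEmb b * H).val i.castSucc (Fin.last n) = ∑ j, b.val i.rev j - 1) ∧
    (∀ j : Fin n, (H⁻¹ * jEmb b * H).val (Fin.last n) j.castSucc = 0) ∧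
    (H⁻¹ * jEmb b * H).val (Fin.last n) (Fin.last n) = 1 := by
  rw [hH.conj_eq b (N := fun i j => Fin.lastCases
    (Fin.lastCases (motive := fun _ => R) 1 (fun _ => 0) j)
    (fun i' => Fin.lastCases (motive := fun _ => R) (∑ j, b.val i'.rev j - 1)
      (fun j' => b.val i'.rev j'.rev) j) i)] <;> simp

theorem magicConj_cast_cast (hH : IsMagic H) (i j : Fin n) :
    (magicConj H π V b).val i.castSucc j.castSucc =
      (((π ^ (n - i.val)) ^ V)⁻¹ : Rˣ) * b.val i.rev j.rev * (((π ^ (n - j.val)) ^ V : Rˣ) : R) := by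
  rw [magicConj_eq_conj, powDiag_conj_apply, (hH.conj_apply b).1]
  rfl

theorem magicConj_cast_last (hH : IsMagic H) (i : Fin n) :
    (magicConj H π V b).val i.castSucc (Fin.last n) =
      (((π ^ (n - i.val)) ^ V)⁻¹ : Rˣ) * (∑ j, b.val i.rev j - 1) := by
  rw [magicConj_eq_conj, powDiag_conj_apply, (hH.conj_apply b).2.1]
  simp

theorem magicConj_last_cast (hH : IsMagic H) (j : Fin n) :
    (magicConj H π V b).val (Fin.last n) j.castSucc = 0 := by
  rw [magicConj_eq_conj, powDiag_conj_apply, (hH.conj_apply b).2.2.1]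
  simp

theorem magicConj_last_last (hH : IsMagic H) :
    (magicConj H π V b).val (Fin.last n) (Fin.last n) = 1 := by
  rw [magicConj_eq_conj, powDiag_conj_apply, (hH.conj_apply b).2.2.2]
  simp

end Magic

end Conj

section Local

variable {F Γ₀ : Type*} [Field F] [LinearOrderedCommGroupWithZero Γ₀] {v : Valuation F Γ₀} {τ : Γ₀}
  {n : ℕ} {π : Fˣ}

theorem valuation_scale_le_one (hπ : v (π : F) ≤ 1) (V : ℕ) {a b : ℕ} (hab : a ≤ b) :
    v ((((π ^ a) ^ V)⁻¹ : Fˣ) : F) * v (((π ^ b) ^ V : Fˣ) : F) ≤ 1 := by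
  obtain ⟨c, rfl⟩ := Nat.exists_eq_add_of_le hab
  rw [← map_mul, ← Units.val_mul, pow_add, mul_pow, inv_mul_cancel_left, Units.val_pow_eq_pow_val,
    Units.val_pow_eq_pow_val, map_pow, map_pow]
  exact pow_le_one₀ zero_le (pow_le_one₀ zero_le hπ)

theorem valuation_scale_le (hπ1 : v (π : F) ≤ 1) {V : ℕ} {a b : ℕ} (hab : a < b) :
    v ((((π ^ a) ^ V)⁻¹ : Fˣ) : F) * v (((π ^ b) ^ V : Fˣ) : F) ≤ v (π : F) ^ V := by
  obtain ⟨c, rfl⟩ := Nat.exists_eq_add_of_lt hab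
  rw [← map_mul, ← Units.val_mul, add_assoc, pow_add, mul_pow, inv_mul_cancel_left,
    Units.val_pow_eq_pow_val, Units.val_pow_eq_pow_val, map_pow, map_pow, ← pow_mul]
  exact pow_le_pow_of_le_one zero_le hπ1 (Nat.le_mul_of_pos_left V (Nat.succ_pos c))

theorem valuation_pow_le (hπ : v (π : F) ≤ τ) (hτ : τ < 1) {V : ℕ} (hV : 1 ≤ V) :
    v (π : F) ^ V ≤ τ :=
  (pow_le_pow_of_le_one zero_le (hπ.trans hτ.le) hV).trans (by rwa [pow_one])

theorem valuation_inv_mul (a : Fˣ) : v ((a⁻¹ : Fˣ) : F) * v (a : F) = 1 := by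
  rw [← map_mul, ← Units.val_mul, inv_mul_cancel, Units.val_one, map_one]

end Local

end

section

section Local

variable {F Γ₀ : Type*} [Field F] [LinearOrderedCommGroupWithZero Γ₀] {v : Valuation F Γ₀} {τ : Γ₀}
  {m n N : ℕ} {π : Fˣ}

theorem valuation_powDiag_conj_le_of_le (hπ : v (π : F) ≤ 1) (V : ℕ) (b : GL (Fin m) F)
    {i j : Fin m} (hij : j ≤ i) :
    v (((powDiag m N π ^ V)⁻¹ * b * powDiag m N π ^ V).val i j) ≤ v (b.val i j) := by
  rw [powDiag_conj_apply, map_mul, map_mul, mul_right_comm]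
  exact mul_le_of_le_one_left zero_le (valuation_scale_le_one hπ V (by have : j.val ≤ i.val := hij; omega))

theorem valuation_powDiag_conj_diag (V : ℕ) (b : GL (Fin m) F) (i : Fin m) :
    v (((powDiag m N π ^ V)⁻¹ * b * powDiag m N π ^ V).val i i) = v (b.val i i) := by
  rw [powDiag_conj_apply, map_mul, map_mul, mul_right_comm, valuation_inv_mul, one_mul]

/-- Conjugation by `diag(π^N, π^{N-1}, …)` contracts lower triangular matrices. -/
theorem IsIwahori.powDiag_conj_of_lower (hπ : v (π : F) ≤ 1) (V : ℕ) {b : GL (Fin m) F}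
    (hb : IsIwahori v τ b.val) (hb' : ∀ i j, i < j → b.val i j = 0) :
    IsIwahori v τ ((powDiag m N π ^ V)⁻¹ * b * powDiag m N π ^ V).val where
  le_one i j := by
    rcases le_or_gt j i with h | h
    · exact (valuation_powDiag_conj_le_of_le hπ V b h).trans (hb.le_one i j)
    · rw [powDiag_conj_apply, hb' i j h, mul_zero, zero_mul, map_zero]
      exact zero_le
  diag i := by rw [valuation_powDiag_conj_diag, hb.diag]
  lower i j h := (valuation_powDiag_conj_le_of_le hπ V b h.le).trans (hb.lower i j h)

theorem IsIwahori.det_ne_zero (hτ : τ < 1) {M : Matrix (Fin m) (Fin m) F} (hM : IsIwahori v τ M) :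
    M.det ≠ 0 := fun h => by
  have := ((isIwahori_iff hτ).1 hM).2.1
  rw [h, map_zero] at this
  exact zero_ne_one this

/-- Scaling the rows of a matrix in the Iwahori subgroup by units. -/
theorem IsIwahori.diagonal_inv_mul {l : Matrix (Fin m) (Fin m) F} (hl : IsIwahori v τ l)
    {δ : Fin m → F} (hδ : ∀ i, v (δ i) = 1) : IsIwahori v τ (Matrix.diagonal (fun i => (δ i)⁻¹) * l) := by
  have h : ∀ i j, v ((Matrix.diagonal (fun i => (δ i)⁻¹) * l) i j) = v (l i j) := fun i j => by
    rw [Matrix.diagonal_mul, map_mul, map_inv₀, hδ, inv_one, one_mul]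
  exact ⟨fun i j => by rw [h]; exact hl.le_one i j, fun i => by rw [h]; exact hl.diag i,
    fun i j hij => by rw [h]; exact hl.lower i j hij⟩

theorem IsUpper.isIwahori_mul_diagonal {u : Matrix (Fin m) (Fin m) F} (hu : IsUpper v u)
    {δ : Fin m → F} (hδ : ∀ i, v (δ i) = 1) : IsIwahori v τ (u * Matrix.diagonal δ) := by
  have h : ∀ i j, v ((u * Matrix.diagonal δ) i j) = v (u i j) := fun i j => by
    rw [Matrix.mul_diagonal, map_mul, hδ, mul_one]
  refine ⟨fun i j => by rw [h]; exact hu.le_one i j, fun i => by rw [h, hu.diag, map_one],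
    fun i j hij => by rw [h, hu.lower i j hij, map_zero]; exact zero_le⟩

/-- The factor `Δ⁻¹ l` of `a = (u Δ) (Δ⁻¹ l)` is contracted by conjugation. -/
theorem IsIwahori.powDiag_conj_inv_mul (hπ : v (π : F) ≤ 1) {a x : GL (Fin m) F}
    {u l : Matrix (Fin m) (Fin m) F} {δ : Fin m → F} (hl : IsIwahori v τ l)
    (hl' : ∀ i j, i < j → l i j = 0) (hδ : ∀ i, v (δ i) = 1) (ha : a.val = u * l)
    (hx : x.val = u * Matrix.diagonal δ) :
    IsIwahori v τ ((powDiag m N π)⁻¹ * (x⁻¹ * a) * powDiag m N π).val := by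
  have hδ0 : ∀ i, δ i ≠ 0 := fun i h => by
    have := hδ i
    rw [h, map_zero] at this
    exact zero_ne_one this
  have h1 : (x⁻¹ * a).val = Matrix.diagonal (fun i => (δ i)⁻¹) * l := by
    have h2 : x.val * (Matrix.diagonal (fun i => (δ i)⁻¹) * l) = a.val := by
      rw [hx, Matrix.mul_assoc, ← Matrix.mul_assoc _ _ l, Matrix.diagonal_mul_diagonal, ha]
      simp [hδ0]
    rw [Units.val_mul, ← h2, ← Matrix.mul_assoc, ← Units.val_mul, inv_mul_cancel, Units.val_one,
      Matrix.one_mul]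
  have h3 : IsIwahori v τ (x⁻¹ * a).val := by
    rw [h1]
    exact hl.diagonal_inv_mul hδ
  have := h3.powDiag_conj_of_lower (N := N) hπ 1 fun i j hij => by
    rw [h1, Matrix.diagonal_mul, hl' i j hij, mul_zero]
  rwa [pow_one] at this

theorem exists_conj_val_eq (hτ : τ < 1) (V : ℕ) {Y : Matrix (Fin n) (Fin n) F}
    (hY : IsIwahori v τ Y) :
    ∃ b : GL (Fin n) F, ((powDiag n n π ^ V)⁻¹ * b * powDiag n n π ^ V).val = Y ∧
      ∀ i j, b.val i j = (((π ^ (n - i.val)) ^ V : Fˣ) : F) * Y i j * (((π ^ (n - j.val)) ^ V)⁻¹ : Fˣ) := by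
  set y := GeneralLinearGroup.mkOfDetNeZero Y (hY.det_ne_zero hτ) with hy
  have hyY : y.val = Y := rfl
  refine ⟨powDiag n n π ^ V * y * (powDiag n n π ^ V)⁻¹, ?_, fun i j => ?_⟩
  · rw [← hyY]
    congr 1
    group
  · have := powDiag_conj_apply (m := n) (n := n) π V (powDiag n n π ^ V * y * (powDiag n n π ^ V)⁻¹) i j
    rw [show (powDiag n n π ^ V)⁻¹ * (powDiag n n π ^ V * y * (powDiag n n π ^ V)⁻¹) * powDiag n n π ^ V
      = y by group, hyY] at this
    rw [this]
    simp only [← mul_assoc, Units.mul_inv, one_mul]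
    simp only [mul_assoc, Units.mul_inv, mul_one]

/-- A matrix in the Iwahori subgroup is the product of an upper triangular matrix which fixes `ζ` and a
matrix which is contracted by conjugation. -/
theorem IsIwahori.exists_fix (hτ : τ < 1) (hπ : v (π : F) ≤ 1) {a : GL (Fin m) F}
    (ha : IsIwahori v τ a.val) {ζ : Fin m → F} (hζ : ∀ i, ζ i ≠ 0)
    (hζ' : ∀ i j, i < j → v (ζ j) ≤ τ * v (ζ i)) :
    ∃ x₀ : Matrix (Fin m) (Fin m) F, IsIwahori v τ x₀ ∧ (∀ i j, j < i → x₀ i j = 0) ∧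
      (∀ i, ∑ j, x₀ i j * ζ j = ζ i) ∧ ∀ x : GL (Fin m) F, x.val = x₀ →
        IsIwahori v τ ((powDiag m N π)⁻¹ * (x⁻¹ * a) * powDiag m N π).val := by
  obtain ⟨u, l, hu, hl, hl', hul⟩ := ha.exists_eq_mul hτ
  obtain ⟨δ, hδ, hsum⟩ := hu.exists_scaling hζ hζ'
  have hδ1 : ∀ i, v (δ i) = 1 := fun i => IsIwahori.map_eq_one_of_sub hτ (map_one v) (hδ i)
  refine ⟨u * Matrix.diagonal δ, hu.isIwahori_mul_diagonal hδ1, fun i j h => ?_, fun i => ?_,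
    fun x hx => IsIwahori.powDiag_conj_inv_mul hπ hl hl' hδ1 hul hx⟩
  · rw [Matrix.mul_diagonal, hu.lower i j h, zero_mul]
  · rw [← hsum i]
    exact Finset.sum_congr rfl fun j _ => by rw [Matrix.mul_diagonal, mul_assoc]

theorem valuation_inv_le_mul (hτ : τ < 1) (hπ : v (π : F) ≤ τ) {V : ℕ} (hV : 1 ≤ V) {a b : ℕ}
    (hab : a < b) :
    v ((((π ^ a) ^ V)⁻¹ : Fˣ) : F) ≤ τ * v ((((π ^ b) ^ V)⁻¹ : Fˣ) : F) := by
  have h := (valuation_scale_le (V := V) (hπ.trans hτ.le) hab).trans (valuation_pow_le hπ hτ hV)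
  refine le_of_eq_of_le ?_ (mul_le_mul_left h _)
  rw [mul_assoc, mul_comm (v (((π ^ b) ^ V : Fˣ) : F)), valuation_inv_mul, mul_one]

/-- Reversal of the order of the coordinates turns upper triangular matrices into lower triangular
ones. -/
theorem IsIwahori.reverse (hτ : τ < 1) (hπ : v (π : F) ≤ τ) {V : ℕ} (hV : 1 ≤ V)
    {z w : Matrix (Fin n) (Fin n) F} (hz : IsIwahori v τ z) (hz' : ∀ i j, j < i → z i j = 0)
    {P : Fin n → Fˣ} (hP : ∀ i, P i = (π ^ (n - i.val)) ^ V)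
    (hw : ∀ i j, w i j = ((P i)⁻¹ : Fˣ) * ((P i.rev : F) * z i.rev j.rev * ((P j.rev)⁻¹ : Fˣ)) * P j) :
    IsIwahori v τ w ∧ ∀ i j, i < j → w i j = 0 := by
  have hπ1 := hπ.trans hτ.le
  have hup : ∀ i j, i < j → w i j = 0 := fun i j h => by
    rw [hw, hz' _ _ (Fin.rev_lt_rev.2 h), mul_zero, zero_mul, mul_zero, zero_mul]
  have hlow : ∀ i j, j < i → v (w i j) ≤ τ := fun i j hij => by
    have h1 : v (((P j.rev)⁻¹ : Fˣ) : F) * v (P i.rev : F) ≤ 1 := by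
      rw [hP, hP]
      refine valuation_scale_le_one hπ1 V ?_
      simp only [Fin.val_rev]
      omega
    have h2 : v (((P i)⁻¹ : Fˣ) : F) * v (P j : F) ≤ τ := by
      rw [hP, hP]
      exact (valuation_scale_le hπ1 (by omega)).trans (valuation_pow_le hπ hτ hV)
    have h3 : v (w i j) = v (((P i)⁻¹ : Fˣ) : F) * v (P j : F) *
        (v (((P j.rev)⁻¹ : Fˣ) : F) * v (P i.rev : F) * v (z i.rev j.rev)) := by
      simp only [hw, map_mul, mul_comm, mul_left_comm]
    rw [h3]
    exact (mul_le_of_le_one_right' (mul_le_one' h1 (hz.le_one _ _))).trans h2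
  have hdiag : ∀ i, v (w i i) = 1 := fun i => by
    rw [hw, ← hz.diag i.rev, mul_right_comm (P i.rev : F), Units.mul_inv, one_mul, mul_right_comm,
      Units.inv_mul, one_mul]
  refine ⟨⟨fun i j => ?_, hdiag, hlow⟩, hup⟩
  rcases lt_trichotomy i j with h | rfl | h
  · rw [hup i j h, map_zero]
    exact zero_le
  · exact (hdiag i).le
  · exact (hlow i j h).trans hτ.le

theorem isIwahori_magicConj {H : GL (Fin (n + 1)) F} (hH : IsMagic H) {V : ℕ} {b : GL (Fin n) F}
    (hw : IsIwahori v τ fun i j => (magicConj H π V b).val i.castSucc j.castSucc)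
    (hl : ∀ i : Fin n, v ((magicConj H π V b).val i.castSucc (Fin.last n)) ≤ 1) :
    IsIwahori v τ (magicConj H π V b).val := by
  have h0 : ∀ (j : Fin n) (c : Γ₀), v ((magicConj H π V b).val (Fin.last n) j.castSucc) ≤ c :=
    fun j c => by rw [magicConj_last_cast _ _ _ hH, map_zero]; exact zero_le
  have h1 : v ((magicConj H π V b).val (Fin.last n) (Fin.last n)) = 1 := by
    rw [magicConj_last_last _ _ _ hH, map_one]
  refine ⟨fun i j => ?_, fun i => ?_, fun i j hij => ?_⟩
  · cases i using Fin.lastCases <;> cases j using Fin.lastCases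
    exacts [h1.le, h0 _ _, hl _, hw.le_one _ _]
  · cases i using Fin.lastCases
    exacts [h1, hw.diag _]
  · cases j using Fin.lastCases with
    | last => exact absurd hij (Fin.le_last _).not_gt
    | cast j =>
      cases i using Fin.lastCases with
      | last => exact h0 _ _
      | cast i => exact hw.lower i j (by simpa using hij)

theorem exists_magicConj_left (hτ : τ < 1) (hπ : v (π : F) ≤ τ) {V : ℕ} (hV : 1 ≤ V)
    {H : GL (Fin (n + 1)) F} (hH : IsMagic H) {a : GL (Fin (n + 1)) F} (ha : IsIwahori v τ a.val) :
    ∃ b : GL (Fin n) F, IsIwahori v τ (magicConj H π V b).val ∧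
      IsIwahori v τ ((powDiag n n π ^ V)⁻¹ * b * powDiag n n π ^ V).val ∧
      IsIwahori v τ ((powDiag (n + 1) n π)⁻¹ * ((magicConj H π V b)⁻¹ * a) * powDiag (n + 1) n π).val := by
  set P : Fin (n + 1) → Fˣ := fun i => (π ^ (n - i.val)) ^ V with hP
  set ζ : Fin (n + 1) → F := fun i => if i = Fin.last n then 1 else -(((P i)⁻¹ : Fˣ) : F) with hζ
  have hvζ : ∀ i, v (ζ i) = v (((P i)⁻¹ : Fˣ) : F) := fun i => by
    by_cases h : i = Fin.last n <;> simp [hζ, hP, h]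
  obtain ⟨x₀, hx₀, hup, hrow, hconj⟩ := ha.exists_fix (N := n) hτ (hπ.trans hτ.le) (ζ := ζ) (fun i => by
      rw [← v.ne_zero_iff, hvζ]; exact v.ne_zero_iff.2 (P i)⁻¹.ne_zero) (fun i j hij => by
    rw [hvζ, hvζ]
    exact valuation_inv_le_mul hτ hπ hV (by have : i.val < j.val := hij; omega))
  have hlast : x₀ (Fin.last n) (Fin.last n) = 1 := by
    have := hrow (Fin.last n)
    rw [Finset.sum_eq_single (Fin.last n) (fun j _ hj => by
      rw [hup _ _ (lt_of_le_of_ne (Fin.le_last j) hj), zero_mul]) (by simp)] at this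
    simpa [hζ] using this
  obtain ⟨hY, -⟩ := IsIwahori.reverse (z := fun i j : Fin n => x₀ i.castSucc j.castSucc)
    (P := fun i => P i.castSucc) hτ hπ hV ⟨fun i j => hx₀.le_one _ _, fun i => hx₀.diag _,
      fun i j h => hx₀.lower _ _ h⟩ (fun i j h => hup _ _ h) (fun i => rfl) (fun i j => rfl)
  obtain ⟨b, hb, hbv⟩ := exists_conj_val_eq (π := π) hτ V hY
  have hbx : ∀ i j : Fin n, b.val i.rev j.rev = (P i.castSucc : F) *
      x₀ i.castSucc j.castSucc * (((P j.castSucc)⁻¹ : Fˣ) : F) := fun i j => by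
    have hP' : ∀ i : Fin n, (π ^ (n - i.val)) ^ V = P i.castSucc := fun i => rfl
    rw [hbv, hP', hP']
    simp only [Fin.rev_rev, Units.val_inv_eq_inv_val]
    field_simp
  have hx : (magicConj H π V b).val = x₀ := by
    ext i j
    cases i using Fin.lastCases with
    | last =>
      cases j using Fin.lastCases with
      | last => rw [magicConj_last_last _ _ _ hH, hlast]
      | cast j => rw [magicConj_last_cast _ _ _ hH, hup _ _ (Fin.castSucc_lt_last j)]
    | cast i =>
      have hPi : (π ^ (n - i.val)) ^ V = P i.castSucc := rfl
      cases j using Fin.lastCases with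
      | last =>
        rw [magicConj_cast_last _ _ _ hH, hPi, ← Equiv.sum_comp Fin.revPerm]
        simp only [Fin.revPerm_apply, hbx]
        have h1 := hrow i.castSucc
        rw [Fin.sum_univ_castSucc] at h1
        simp only [hζ, Fin.castSucc_ne_last, if_false, if_true, mul_one, mul_neg] at h1
        rw [Finset.sum_neg_distrib] at h1
        rw [mul_sub, Finset.mul_sum, mul_one]
        simp only [← mul_assoc, Units.inv_mul, one_mul]
        linear_combination -h1
      | cast j =>
        have hPj : (π ^ (n - j.val)) ^ V = P j.castSucc := rfl
        rw [magicConj_cast_cast _ _ _ hH, hPi, hPj, hbx]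
        simp only [Units.val_inv_eq_inv_val]
        field_simp
  exact ⟨b, by rwa [hx], by rwa [hb], hconj _ hx⟩

theorem exists_magicConj_right (hτ : τ < 1) (hπ : v (π : F) ≤ τ) {V : ℕ} (hV : 1 ≤ V)
    {H : GL (Fin (n + 1)) F} (hH : IsMagic H) {a : GL (Fin n) F} (ha : IsIwahori v τ a.val) :
    ∃ b : GL (Fin n) F, IsIwahori v τ (magicConj H π V b).val ∧
      IsIwahori v τ ((powDiag n n π ^ V)⁻¹ * b * powDiag n n π ^ V).val ∧
      IsIwahori v τ ((powDiag (n + 1) n π)⁻¹ * magicConj H π V b * powDiag (n + 1) n π).val ∧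
      IsIwahori v τ ((powDiag n n π)⁻¹ * (((powDiag n n π ^ V)⁻¹ * b * powDiag n n π ^ V)⁻¹ * a) *
        powDiag n n π).val := by
  obtain ⟨y₀, hy₀, hup, hrow, hconj⟩ := ha.exists_fix (N := n) hτ (hπ.trans hτ.le)
    (ζ := fun i => (((π ^ (n - i.val)) ^ V)⁻¹ : Fˣ)) (fun i => Units.ne_zero _) (fun i j hij =>
      valuation_inv_le_mul hτ hπ hV (by have : i.val < j.val := hij; omega))
  obtain ⟨b, hb, hbv⟩ := exists_conj_val_eq (π := π) hτ V hy₀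
  have hbsum : ∀ i, ∑ j, b.val i j = 1 := fun i => by
    simp only [hbv, mul_assoc]
    rw [← Finset.mul_sum, hrow, Units.mul_inv]
  obtain ⟨hw, hw'⟩ := IsIwahori.reverse (w := fun i j => (magicConj H π V b).val i.castSucc j.castSucc)
    hτ hπ hV hy₀ hup (fun i => rfl) (fun i j => by rw [magicConj_cast_cast _ _ _ hH, hbv])
  have hlow : ∀ i j, i < j → (magicConj H π V b).val i j = 0 := by
    intro i j hij
    cases i using Fin.lastCases with
    | last => exact absurd hij (Fin.le_last _).not_gt
    | cast i =>
      cases j using Fin.lastCases with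
      | last => rw [magicConj_cast_last _ _ _ hH, hbsum, sub_self, mul_zero]
      | cast j => exact hw' i j (by simpa using hij)
  have hx := isIwahori_magicConj hH hw fun i => by
    rw [hlow _ _ (Fin.castSucc_lt_last i), map_zero]
    exact zero_le
  refine ⟨b, hx, by rwa [hb], ?_, hconj _ hb⟩
  have := hx.powDiag_conj_of_lower (N := n) (hπ.trans hτ.le) 1 hlow
  rwa [pow_one] at this

end Local

end

section

section Local

variable {F Γ₀ : Type*} [Field F] [LinearOrderedCommGroupWithZero Γ₀] {v : Valuation F Γ₀} {τ : Γ₀}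
  {n : ℕ} {π : Fˣ} {H : GL (Fin (n + 1)) F}

/-- The valuation of an entry of `b` in terms of the corresponding entry of the conjugate. -/
theorem valuation_le_of_scale {V a c : ℕ} {z : F} (hπ : v (π : F) ≤ 1) (hac : c < a)
    (h : v ((((π ^ a) ^ V)⁻¹ : Fˣ) * z * (((π ^ c) ^ V : Fˣ) : F)) ≤ 1) : v z ≤ v (π : F) ^ V := by
  have h1 : z = ((((π ^ c) ^ V)⁻¹ : Fˣ) : F) * (((π ^ a) ^ V : Fˣ) : F) *
      ((((π ^ a) ^ V)⁻¹ : Fˣ) * z * (((π ^ c) ^ V : Fˣ) : F)) := by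
    simp only [Units.val_inv_eq_inv_val]
    field_simp
  rw [h1, map_mul, map_mul]
  exact (mul_le_of_le_one_right' h).trans (valuation_scale_le hπ hac)

theorem valuation_scale_self (A : Fˣ) (z : F) : v (((A⁻¹ : Fˣ) : F) * z * (A : F)) = v z := by
  rw [map_mul, map_mul, mul_right_comm, valuation_inv_mul, one_mul]

theorem valuation_apply_le_of_isIwahori (hH : IsMagic H) (hπ : v (π : F) ≤ 1) {V : ℕ}
    {b : GL (Fin n) F} (hx : IsIwahori v τ (magicConj H π V b).val)
    (hy : IsIwahori v τ ((powDiag n n π ^ V)⁻¹ * b * powDiag n n π ^ V).val) {i j : Fin n}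
    (hij : i ≠ j) : v (b.val i j) ≤ v (π : F) ^ V := by
  rcases lt_or_gt_of_ne hij with h | h
  · have h1 := hy.le_one i j
    rw [powDiag_conj_apply] at h1
    have : i.val < j.val := h
    exact valuation_le_of_scale hπ (by omega) h1
  · have h1 := hx.le_one i.rev.castSucc j.rev.castSucc
    rw [magicConj_cast_cast _ _ _ hH, Fin.rev_rev, Fin.rev_rev] at h1
    have : j.val < i.val := h
    exact valuation_le_of_scale hπ (by simp only [Fin.val_rev]; omega) h1

theorem valuation_apply_self_of_isIwahori {V : ℕ} {b : GL (Fin n) F}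
    (hy : IsIwahori v τ ((powDiag n n π ^ V)⁻¹ * b * powDiag n n π ^ V).val) (i : Fin n) :
    v (b.val i i) = 1 := by
  rw [← hy.diag i, valuation_powDiag_conj_diag]

theorem powDiag_conj_succ (m N V : ℕ) (b : GL (Fin m) F) :
    (powDiag m N π ^ V)⁻¹ * b * powDiag m N π ^ V = powDiag m N π *
      ((powDiag m N π ^ (V + 1))⁻¹ * b * powDiag m N π ^ (V + 1)) * (powDiag m N π)⁻¹ := by
  rw [pow_succ]
  group

theorem powDiag_conj_inv_apply (m N : ℕ) (b : GL (Fin m) F) (i j : Fin m) :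
    (powDiag m N π * b * (powDiag m N π)⁻¹).val i j =
      ((π ^ (N - i.val) : Fˣ) : F) * b.val i j * (((π ^ (N - j.val))⁻¹ : Fˣ) : F) := by
  rw [powDiag, diagGL_inv]
  simp only [Units.val_mul, val_diagGL, Matrix.diagonal_mul, Matrix.mul_diagonal, Pi.inv_apply]

/-- Conjugation by the inverse of `diag(π^N, π^{N-1}, …)` preserves integrality above the diagonal. -/
theorem IsIwahori.of_powDiag_conj_succ {m N V : ℕ} (hπ : v (π : F) ≤ 1) (hτ : τ < 1)
    {b : GL (Fin m) F}
    (hb : IsIwahori v τ ((powDiag m N π ^ (V + 1))⁻¹ * b * powDiag m N π ^ (V + 1)).val)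
    (hlow : ∀ i j, j < i → v (((powDiag m N π ^ V)⁻¹ * b * powDiag m N π ^ V).val i j) ≤ τ) :
    IsIwahori v τ ((powDiag m N π ^ V)⁻¹ * b * powDiag m N π ^ V).val where
  le_one i j := by
    rcases lt_or_ge j i with h | h
    · exact (hlow i j h).trans hτ.le
    · rw [powDiag_conj_succ, powDiag_conj_inv_apply, map_mul, map_mul, mul_right_comm, mul_comm (v _)]
      have h1 := valuation_scale_le_one hπ 1 (a := N - j.val) (b := N - i.val)
        (by have : i.val ≤ j.val := h; omega)
      rw [pow_one, pow_one] at h1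
      exact mul_le_one' h1 (hb.le_one i j)
  diag i := by
    rw [← hb.diag i, valuation_powDiag_conj_diag, valuation_powDiag_conj_diag]
  lower := hlow

/-- The groups `K(ϖ^V)` decrease. -/
theorem isIwahori_of_succ (hH : IsMagic H) (hτ : τ < 1) (hπ : v (π : F) ≤ τ) {V : ℕ}
    {b : GL (Fin n) F} (hx : IsIwahori v τ (magicConj H π (V + 1) b).val)
    (hy : IsIwahori v τ ((powDiag n n π ^ (V + 1))⁻¹ * b * powDiag n n π ^ (V + 1)).val) :
    IsIwahori v τ (magicConj H π V b).val ∧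
      IsIwahori v τ ((powDiag n n π ^ V)⁻¹ * b * powDiag n n π ^ V).val := by
  have hπ1 := hπ.trans hτ.le
  have hoff : ∀ {i j : Fin n}, i ≠ j → v (b.val i j) ≤ τ := fun h =>
    (valuation_apply_le_of_isIwahori hH hπ1 hx hy h).trans (valuation_pow_le hπ hτ (Nat.le_add_left 1 V))
  constructor
  · rw [magicConj_eq_conj] at hx ⊢
    refine hx.of_powDiag_conj_succ hπ1 hτ fun i j hij => ?_
    refine (valuation_powDiag_conj_le_of_le hπ1 V _ hij.le).trans ?_
    cases i using Fin.lastCases with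
    | last =>
      cases j using Fin.lastCases with
      | last => exact absurd hij (lt_irrefl _)
      | cast j => rw [(hH.conj_apply b).2.2.1, map_zero]; exact zero_le
    | cast i =>
      cases j using Fin.lastCases with
      | last => exact absurd hij (Fin.le_last _).not_gt
      | cast j =>
        have hij' : j < i := by simpa using hij
        rw [(hH.conj_apply b).1]
        exact hoff (Fin.rev_lt_rev.2 hij').ne
  · exact hy.of_powDiag_conj_succ hπ1 hτ fun i j hij =>
      (valuation_powDiag_conj_le_of_le hπ1 V _ hij.le).trans (hoff hij.ne')

theorem valuation_prod_sub_one_le {ι : Type*} (s : Finset ι) {f : ι → F} {c : Γ₀} (hc : c ≤ 1)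
    (hf : ∀ i ∈ s, v (f i - 1) ≤ c) : v (∏ i ∈ s, f i - 1) ≤ c := by
  classical
  induction s using Finset.induction_on with
  | empty => simp
  | insert a s ha ih =>
    rw [Finset.prod_insert ha]
    have h1 := ih fun i hi => hf i (Finset.mem_insert_of_mem hi)
    have h2 := hf a (Finset.mem_insert_self a s)
    have h3 : v (f a) ≤ 1 := by
      rw [show f a = (f a - 1) + 1 by ring]
      exact v.map_add_le (h2.trans hc) (map_one v).le
    rw [show f a * ∏ i ∈ s, f i - 1 = f a * (∏ i ∈ s, f i - 1) + (f a - 1) by ring]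
    refine v.map_add_le ?_ h2
    rw [map_mul]
    exact (mul_le_of_le_one_left' h3).trans h1

/-- The determinants of the elements of `K(ϖ^V)` are congruent to `1`. -/
theorem valuation_det_sub_one_le (hH : IsMagic H) (hπ : v (π : F) ≤ 1) {V : ℕ}
    {b : GL (Fin n) F} (hx : IsIwahori v τ (magicConj H π V b).val)
    (hy : IsIwahori v τ ((powDiag n n π ^ V)⁻¹ * b * powDiag n n π ^ V).val) :
    v (b.val.det - 1) ≤ v (π : F) ^ V := by
  have hoff : ∀ {i j : Fin n}, i ≠ j → v (b.val i j) ≤ v (π : F) ^ V := fun h =>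
    valuation_apply_le_of_isIwahori hH hπ hx hy h
  have hc : v (π : F) ^ V ≤ 1 := pow_le_one₀ zero_le hπ
  have hdiag : ∀ i, v (b.val i i - 1) ≤ v (π : F) ^ V := fun i => by
    have h1 := hx.le_one i.rev.castSucc (Fin.last n)
    rw [magicConj_cast_last _ _ _ hH, Fin.rev_rev] at h1
    have h2 : v (∑ j, b.val i j - 1) ≤ v (π : F) ^ V := by
      refine valuation_le_of_scale (V := V) (a := n - i.rev.val) (c := 0) hπ
        (by simp only [Fin.val_rev]; omega) ?_
      simpa using h1
    have h3 : b.val i i - 1 = (∑ j, b.val i j - 1) - ∑ j ∈ Finset.univ.erase i, b.val i j := by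
      rw [← Finset.add_sum_erase _ _ (Finset.mem_univ i)]
      ring
    rw [h3]
    exact v.map_sub_le h2 (v.map_sum_le fun j hj => hoff (Finset.ne_of_mem_erase hj).symm)
  have h4 := valuation_det_sub_prod_le (v := v) (τ := v (π : F) ^ V) (M := b.val) (fun i j => by
    by_cases h : i = j
    · subst h
      exact (valuation_apply_self_of_isIwahori hy i).le
    · exact (hoff h).trans hc) (fun i j hij => hoff hij.ne')
  rw [show b.val.det - 1 = (b.val.det - ∏ i, b.val i i) + (∏ i, b.val i i - 1) by ring]
  exact v.map_add_le h4 (valuation_prod_sub_one_le _ hc fun i _ => hdiag i)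

/-- The elements `diag(e, 1, …, 1)` with `e ≡ 1` lie in `K(ϖ^V)`. -/
theorem isIwahori_dElt (hH : IsMagic H) (hτ : τ < 1) (hπ : v (π : F) ≤ τ) {V : ℕ} (hV : 1 ≤ V)
    {e : Fˣ} (he : v ((e : F) - 1) ≤ v (π : F) ^ V) :
    IsIwahori v τ (magicConj H π V (dElt e)).val ∧
      IsIwahori v τ ((powDiag n n π ^ V)⁻¹ * dElt e * powDiag n n π ^ V).val := by
  have hπ1 := hπ.trans hτ.le
  have he1 : v (e : F) = 1 := IsIwahori.map_eq_one_of_sub hτ (map_one v)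
    (he.trans (valuation_pow_le hπ hτ hV))
  have hoff : ∀ {i j : Fin n}, i ≠ j → (dElt e : GL (Fin n) F).val i j = 0 := fun h => by
    rw [val_dElt, Matrix.diagonal_apply_ne _ h]
  have hdiag : ∀ i : Fin n, (dElt e : GL (Fin n) F).val i i = if i.val = 0 then (e : F) else 1 :=
    fun i => by rw [val_dElt, Matrix.diagonal_apply_eq]
  have hsum : ∀ i : Fin n, ∑ j, (dElt e : GL (Fin n) F).val i j = if i.val = 0 then (e : F) else 1 :=
    fun i => by
      rw [Finset.sum_eq_single i (fun j _ hj => hoff hj.symm) (by simp), hdiag]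
  have hvdiag : ∀ i : Fin n, v ((dElt e : GL (Fin n) F).val i i) = 1 := fun i => by
    rw [hdiag]
    split_ifs
    · exact he1
    · exact map_one v
  have hxlast : ∀ i : Fin n, v ((magicConj H π V (dElt e)).val i.castSucc (Fin.last n)) ≤ 1 := by
    intro i
    rw [magicConj_cast_last _ _ _ hH, hsum]
    split_ifs with h
    · rw [Fin.val_rev] at h
      rw [show n - i.val = 1 by omega, pow_one, map_mul]
      calc _ ≤ v (((π ^ V)⁻¹ : Fˣ) : F) * v (π : F) ^ V := mul_le_mul_right he _
        _ = 1 := by rw [← map_pow, ← Units.val_pow_eq_pow_val, valuation_inv_mul]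
    · simp
  have hscale : ∀ (A : Fin n → Fˣ) (f : Fin n → Fin n), Function.Injective f → IsIwahori v τ
      fun i j => (((A i)⁻¹ : Fˣ) : F) * (dElt e : GL (Fin n) F).val (f i) (f j) * (A j : F) := by
    intro A f hf
    have h0 : ∀ {i j : Fin n} (c : Γ₀), i ≠ j →
        v ((((A i)⁻¹ : Fˣ) : F) * (dElt e : GL (Fin n) F).val (f i) (f j) * (A j : F)) ≤ c :=
      fun c h => by rw [hoff (hf.ne h), mul_zero, zero_mul, map_zero]; exact zero_le
    have h1 := fun i => (valuation_scale_self (v := v) (A i) _).trans (hvdiag (f i))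
    refine ⟨fun i j => ?_, h1, fun i j hij => h0 _ hij.ne'⟩
    by_cases h : i = j
    · subst h
      exact (h1 i).le
    · exact h0 _ h
  constructor
  · refine isIwahori_magicConj hH ?_ hxlast
    simp only [magicConj_cast_cast _ _ _ hH]
    exact hscale _ _ Fin.rev_injective
  · have h1 := hscale (fun i => (π ^ (n - i.val)) ^ V) id Function.injective_id
    exact (congrArg (IsIwahori v τ) (Matrix.ext fun i j => powDiag_conj_apply π V _ i j)).mpr h1

end Local

end

section

variable {k : Type*} [Field k] [NumberField k] {m n : ℕ}

theorem af_ext {a b : Af k} (h : ∀ q, evalAf q a = evalAf q b) : a = b :=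
  RestrictedProduct.ext _ _ h

theorem finite_above {p : ℕ} (hp : p ≠ 0) : {q : HeightOneSpectrum (𝓞 k) | Above p q}.Finite := by
  have h0 : Ideal.span {(p : 𝓞 k)} ≠ 0 := by
    rw [Ne, Ideal.zero_eq_bot, Ideal.span_singleton_eq_bot]
    exact_mod_cast hp
  refine (Ideal.finite_factors h0).subset fun q hq => ?_
  rw [Set.mem_ofPred_eq, Ideal.dvd_span_singleton]
  exact hq

/-- Families of local elements with integral components away from `p` define finite adeles. -/
theorem exists_evalAf_eq {p : ℕ} (hp : p ≠ 0) (f : ∀ q : HeightOneSpectrum (𝓞 k), q.adicCompletion k)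
    (hf : ∀ q, ¬ Above p q → Valued.v (f q) ≤ 1) : ∃ a : Af k, ∀ q, evalAf q a = f q :=
  ⟨⟨f, (finite_above hp).subset fun q hq => by
    by_contra h
    exact hq (hf q h)⟩, fun _ => rfl⟩

/-- The component of an adelic matrix at `q`. -/
noncomputable def locAt (q : HeightOneSpectrum (𝓞 k)) : GLf k m →* GL (Fin m) (q.adicCompletion k) :=
  GeneralLinearGroup.map (evalAf q)

theorem locAt_apply (q : HeightOneSpectrum (𝓞 k)) (g : GLf k m) (i j : Fin m) :
    (locAt q g).val i j = evalAf q (g.val i j) := rfl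

theorem locAt_jEmb (q : HeightOneSpectrum (𝓞 k)) (g : GLf k n) :
    locAt q (jEmb g) = jEmb (locAt q g) := map_jEmb _ _

/-- The component of an idele at `q`. -/
noncomputable def unitAt (q : HeightOneSpectrum (𝓞 k)) : (Af k)ˣ →* (q.adicCompletion k)ˣ :=
  Units.map (evalAf q).toMonoidHom

theorem val_unitAt (q : HeightOneSpectrum (𝓞 k)) (x : (Af k)ˣ) :
    (unitAt q x : q.adicCompletion k) = evalAf q x.val := rfl

theorem det_locAt (q : HeightOneSpectrum (𝓞 k)) (g : GLf k m) :
    GeneralLinearGroup.det (locAt q g) = unitAt q (GeneralLinearGroup.det g) := det_map _ _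

theorem locAt_dElt (q : HeightOneSpectrum (𝓞 k)) (c : (Af k)ˣ) :
    locAt q (dElt c : GLf k m) = dElt (unitAt q c) := map_dElt _ _

theorem locAt_powDiag (q : HeightOneSpectrum (𝓞 k)) (N : ℕ) (ϖ : (Af k)ˣ) :
    locAt q (powDiag m N ϖ) = powDiag m N (unitAt q ϖ) := by
  refine Units.ext (Matrix.ext fun i j => ?_)
  rw [locAt_apply, powDiag, powDiag, val_diagGL, val_diagGL, Matrix.diagonal_apply,
    Matrix.diagonal_apply]
  split_ifs
  · rw [← map_pow]
    rfl
  · exact map_zero (evalAf q)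

theorem powDiag_one {R : Type*} [CommRing R] (N : ℕ) : powDiag m N (1 : Rˣ) = 1 := by
  rw [powDiag, ← diagGL_one]
  congr 1
  funext i
  exact one_pow _

/-- Adelic matrices with given components at `p` and trivial components away from `p`. -/
theorem exists_locAt_eq {p : ℕ} (hp : p ≠ 0)
    (f : ∀ q : HeightOneSpectrum (𝓞 k), Above p q → GL (Fin m) (q.adicCompletion k)) :
    ∃ b : GLf k m, (∀ q (hq : Above p q), locAt q b = f q hq) ∧ ∀ q, ¬ Above p q → locAt q b = 1 := by
  classical
  let f' : ∀ q : HeightOneSpectrum (𝓞 k), GL (Fin m) (q.adicCompletion k) :=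
    fun q => if hq : Above p q then f q hq else 1
  have hf' : ∀ q, ¬ Above p q → f' q = 1 := fun q hq => dif_neg hq
  have hone : ∀ (q : HeightOneSpectrum (𝓞 k)) (i j : Fin m),
      Valued.v ((1 : GL (Fin m) (q.adicCompletion k)).val i j) ≤ 1 := fun q i j => by
    rw [Units.val_one, Matrix.one_apply]
    split_ifs
    · exact (map_one _).le
    · rw [map_zero]; exact zero_le
  choose M hM using fun i j => exists_evalAf_eq hp (fun q => (f' q).val i j)
    (fun q hq => by rw [hf' q hq]; exact hone q i j)
  choose N hN using fun i j => exists_evalAf_eq hp (fun q => (f' q)⁻¹.val i j)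
    (fun q hq => by rw [hf' q hq, inv_one]; exact hone q i j)
  have hM' : ∀ q, (Matrix.of M).map (evalAf q) = (f' q).val := fun q => Matrix.ext fun i j => hM i j q
  have hN' : ∀ q, (Matrix.of N).map (evalAf q) = (f' q)⁻¹.val := fun q => Matrix.ext fun i j => hN i j q
  have hmul : ∀ {A B : Matrix (Fin m) (Fin m) (Af k)},
      (∀ q, A.map (evalAf q) * B.map (evalAf q) = 1) → A * B = 1 := fun {A B} h => by
    refine Matrix.ext fun i j => af_ext fun q => ?_
    have h1 : (A * B).map (evalAf q) = (1 : Matrix (Fin m) (Fin m) (Af k)).map (evalAf q) := by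
      rw [Matrix.map_mul, h q, Matrix.map_one _ (map_zero _) (map_one _)]
    exact congrFun (congrFun h1 i) j
  let b : GLf k m := ⟨Matrix.of M, Matrix.of N, hmul fun q => by
      rw [hM', hN', ← Units.val_mul, mul_inv_cancel, Units.val_one], hmul fun q => by
      rw [hM', hN', ← Units.val_mul, inv_mul_cancel, Units.val_one]⟩
  have hb : ∀ q, locAt q b = f' q := fun q => Units.ext (hM' q)
  exact ⟨b, fun q hq => by rw [hb]; exact dif_pos hq, fun q hq => by rw [hb, hf' q hq]⟩

theorem exists_unitAt_eq {p : ℕ} (hp : p ≠ 0)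
    (f : ∀ q : HeightOneSpectrum (𝓞 k), Above p q → (q.adicCompletion k)ˣ) :
    ∃ b : (Af k)ˣ, (∀ q (hq : Above p q), unitAt q b = f q hq) ∧ ∀ q, ¬ Above p q → unitAt q b = 1 := by
  obtain ⟨b, h1, h2⟩ := exists_locAt_eq (m := 1) hp fun q hq => dElt (f q hq)
  refine ⟨GeneralLinearGroup.det b, fun q hq => ?_, fun q hq => ?_⟩
  · rw [← det_locAt, h1 q hq, det_dElt le_rfl]
  · rw [← det_locAt, h2 q hq, map_one]

theorem exp_neg_lt_one {r : ℕ} (hr : 0 < r) : WithZero.exp (-(r : ℤ)) < 1 := by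
  rw [← WithZero.exp_zero, WithZero.exp_lt_exp]
  omega

theorem isIwahoriAt_iff {r : ℕ} (hr : 0 < r) {q : HeightOneSpectrum (𝓞 k)} {g : GLf k m} :
    IsIwahoriAt r q g ↔ IsIwahori Valued.v (WithZero.exp (-(r : ℤ))) (locAt q g).val := by
  rw [isIwahori_iff (exp_neg_lt_one hr)]
  have h1 : (locAt q g).val.det = (g.val.det : Af k) q := by
    have := congrArg Units.val (det_locAt q g)
    rw [GeneralLinearGroup.val_det_apply, val_unitAt, GeneralLinearGroup.val_det_apply] at this
    exact this
  rw [h1]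
  rfl

theorem HasIwahoriComponent.mem_of_eq_away {p r : ℕ} (hp : p ≠ 0) (hr : 0 < r)
    {L : Subgroup (GLf k m)} (hL : HasIwahoriComponent p r L) {g g' : GLf k m} (hg : g ∈ L)
    (h1 : ∀ q, Above p q → IsIwahori Valued.v (WithZero.exp (-(r : ℤ))) (locAt q g').val)
    (h2 : ∀ q, ¬ Above p q → locAt q g' = locAt q g) : g' ∈ L := by
  have hmem : ∀ e : GLf k m, (∀ q, Above p q → IsIwahori Valued.v (WithZero.exp (-(r : ℤ))) (locAt q e).val) →
      (∀ q, ¬ Above p q → locAt q e = 1) → e ∈ L := fun e he1 he2 =>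
    hL.2 e (fun q hq => (isIwahoriAt_iff hr).2 (he1 q hq)) fun q hq i j => by
      have h3 := congrArg (fun M : GL (Fin m) (q.adicCompletion k) => M.val i j) (he2 q hq)
      have h4 := congrArg (fun M : GL (Fin m) (q.adicCompletion k) => M.val i j) (map_one (locAt (m := m) q))
      exact h3.trans h4.symm
  obtain ⟨e, he1, he2⟩ := exists_locAt_eq hp fun q _ => locAt q g'
  have he : e ∈ L := hmem e (fun q hq => by rw [he1 q hq]; exact h1 q hq) he2
  have h5 : g⁻¹ * g' ∈ L := by
    refine hmem _ (fun q hq => ?_) fun q hq => ?_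
    · rw [map_mul, ← he1 q hq, ← map_mul]
      exact (isIwahoriAt_iff hr).1 (hL.1 _ (mul_mem (inv_mem hg) he) q hq)
    · rw [map_mul, map_inv, h2 q hq, inv_mul_cancel]
  simpa using mul_mem hg h5

theorem HasIwahoriComponent.isIwahori {p r : ℕ} (hr : 0 < r) {L : Subgroup (GLf k m)}
    (hL : HasIwahoriComponent p r L) {g : GLf k m} (hg : g ∈ L) {q : HeightOneSpectrum (𝓞 k)}
    (hq : Above p q) : IsIwahori Valued.v (WithZero.exp (-(r : ℤ))) (locAt q g).val :=
  (isIwahoriAt_iff hr).1 (hL.1 g hg q hq)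

theorem HasMagicComponent.isMagic {p : ℕ} {h : GLf k (n + 1)} (hh : HasMagicComponent p h)
    {q : HeightOneSpectrum (𝓞 k)} (hq : Above p q) : IsMagic (locAt q h) :=
  fun i j => hh q hq i j

end

section

variable {k : Type*} [Field k] [NumberField k] {m n p : ℕ} {ϖ : (Af k)ˣ}
  {K : Subgroup (GLf k (n + 1))} {K' : Subgroup (GLf k n)} {h : GLf k (n + 1)}

/-- The assumptions on the components at `p` of the levels and of the translating element. -/
structure IsLevelDatum (p m : ℕ) (ϖ : (Af k)ˣ) (K : Subgroup (GLf k (n + 1)))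
    (K' : Subgroup (GLf k n)) (h : GLf k (n + 1)) : Prop where
  ne_zero : p ≠ 0
  pos : 0 < m
  valuation_le : ∀ q, Above p q → Valued.v (ϖ.val q) ≤ WithZero.exp (-(m : ℤ))
  eq_one : ∀ q, ¬ Above p q → ϖ.val q = 1
  left : HasIwahoriComponent p m K
  right : HasIwahoriComponent p m K'
  magic : HasMagicComponent p h

theorem tElt_eq_powDiag (n : ℕ) (ϖ : (Af k)ˣ) : tElt n ϖ = powDiag (n + 1) n ϖ := jEmb_powDiag ϖ

theorem locAt_tElt (q : HeightOneSpectrum (𝓞 k)) (n : ℕ) (ϖ : (Af k)ˣ) :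
    locAt q (tElt n ϖ) = powDiag (n + 1) n (unitAt q ϖ) := by
  rw [tElt_eq_powDiag, locAt_powDiag]

theorem locAt_tElt' (q : HeightOneSpectrum (𝓞 k)) (n : ℕ) (ϖ : (Af k)ˣ) :
    locAt q (tElt' n ϖ) = powDiag n n (unitAt q ϖ) := locAt_powDiag q n ϖ

theorem locAt_magicConj (q : HeightOneSpectrum (𝓞 k)) (h : GLf k (n + 1)) (ϖ : (Af k)ˣ) (V : ℕ)
    (b : GLf k n) :
    locAt q ((h * tElt n ϖ ^ V)⁻¹ * jEmb b * (h * tElt n ϖ ^ V)) =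
      magicConj (locAt q h) (unitAt q ϖ) V (locAt q b) := by
  simp only [map_mul, map_inv, map_pow, locAt_jEmb, locAt_tElt, magicConj]

theorem locAt_conj (q : HeightOneSpectrum (𝓞 k)) (ϖ : (Af k)ˣ) (V : ℕ) (b : GLf k n) :
    locAt q ((tElt' n ϖ ^ V)⁻¹ * b * tElt' n ϖ ^ V) =
      (powDiag n n (unitAt q ϖ) ^ V)⁻¹ * locAt q b * powDiag n n (unitAt q ϖ) ^ V := by
  simp only [map_mul, map_inv, map_pow, locAt_tElt']

theorem magicConj_one_left {R : Type*} [CommRing R] (H : GL (Fin (n + 1)) R) (V : ℕ) (b : GL (Fin n) R) :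
    magicConj H 1 V b = H⁻¹ * jEmb b * H := by
  rw [magicConj, powDiag_one, one_pow, mul_one]

namespace IsLevelDatum

theorem unitAt_eq_one (D : IsLevelDatum p m ϖ K K' h) {q : HeightOneSpectrum (𝓞 k)} (hq : ¬ Above p q) :
    unitAt q ϖ = 1 := Units.ext (D.eq_one q hq)

theorem lt_one (D : IsLevelDatum p m ϖ K K' h) : WithZero.exp (-(m : ℤ)) < 1 := exp_neg_lt_one D.pos

theorem valuation_unitAt_le (D : IsLevelDatum p m ϖ K K' h) {q : HeightOneSpectrum (𝓞 k)}
    (hq : Above p q) : Valued.v (unitAt q ϖ : q.adicCompletion k) ≤ WithZero.exp (-(m : ℤ)) :=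
  D.valuation_le q hq

theorem isIwahori_of_mem (D : IsLevelDatum p m ϖ K K' h) {V : ℕ} {b : GLf k n}
    (hb : b ∈ levelAt K K' h ϖ V) {q : HeightOneSpectrum (𝓞 k)} (hq : Above p q) :
    IsIwahori Valued.v (WithZero.exp (-(m : ℤ))) (magicConj (locAt q h) (unitAt q ϖ) V (locAt q b)).val ∧
      IsIwahori Valued.v (WithZero.exp (-(m : ℤ)))
        ((powDiag n n (unitAt q ϖ) ^ V)⁻¹ * locAt q b * powDiag n n (unitAt q ϖ) ^ V).val := by
  obtain ⟨h1, h2⟩ := mem_diagLevel.1 hb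
  have h3 := D.left.isIwahori D.pos h1 hq
  have h4 := D.right.isIwahori D.pos h2 hq
  rw [locAt_magicConj] at h3
  rw [locAt_conj] at h4
  exact ⟨h3, h4⟩

/-- Membership in `K(ϖ^V)` can be checked at `p` for elements which agree away from `p` with an element
of some `K(ϖ^W)`. -/
theorem mem_levelAt (D : IsLevelDatum p m ϖ K K' h) {V W : ℕ} {b b₀ : GLf k n}
    (hb₀ : b₀ ∈ levelAt K K' h ϖ W) (haway : ∀ q, ¬ Above p q → locAt q b = locAt q b₀)
    (hx : ∀ q, Above p q → IsIwahori Valued.v (WithZero.exp (-(m : ℤ)))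
      (magicConj (locAt q h) (unitAt q ϖ) V (locAt q b)).val)
    (hy : ∀ q, Above p q → IsIwahori Valued.v (WithZero.exp (-(m : ℤ)))
      ((powDiag n n (unitAt q ϖ) ^ V)⁻¹ * locAt q b * powDiag n n (unitAt q ϖ) ^ V).val) :
    b ∈ levelAt K K' h ϖ V := by
  obtain ⟨h1, h2⟩ := mem_diagLevel.1 hb₀
  refine mem_diagLevel.2 ⟨D.left.mem_of_eq_away D.ne_zero D.pos h1 (fun q hq => ?_) fun q hq => ?_,
    D.right.mem_of_eq_away D.ne_zero D.pos h2 (fun q hq => ?_) fun q hq => ?_⟩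
  · rw [locAt_magicConj]
    exact hx q hq
  · rw [locAt_magicConj, locAt_magicConj, D.unitAt_eq_one hq, magicConj_one_left, magicConj_one_left,
      haway q hq]
  · rw [locAt_conj]
    exact hy q hq
  · rw [locAt_conj, locAt_conj, D.unitAt_eq_one hq, powDiag_one, one_pow, one_pow, haway q hq]

theorem levelAt_succ_le (D : IsLevelDatum p m ϖ K K' h) (V : ℕ) :
    levelAt K K' h ϖ (V + 1) ≤ levelAt K K' h ϖ V := fun b hb => by
  have h1 := fun q (hq : Above p q) => isIwahori_of_succ (D.magic.isMagic hq) D.lt_one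
    (D.valuation_unitAt_le hq) (D.isIwahori_of_mem hb hq).1 (D.isIwahori_of_mem hb hq).2
  exact D.mem_levelAt hb (fun _ _ => rfl) (fun q hq => (h1 q hq).1) fun q hq => (h1 q hq).2

theorem levelAt_antitone (D : IsLevelDatum p m ϖ K K' h) : Antitone (levelAt K K' h ϖ) :=
  antitone_nat_of_succ_le D.levelAt_succ_le

/-- `K(ϖ^V)` acts transitively on the cosets which enter the Hecke operator. -/
theorem isTransitive (D : IsLevelDatum p m ϖ K K' h) {V : ℕ} (hV : 1 ≤ V) :
    IsTransitive K K' (h * tElt n ϖ ^ V) (tElt n ϖ) (tElt' n ϖ ^ V) (tElt' n ϖ) := by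
  intro g hg g' hg'
  obtain ⟨a, ha, c, hc, rfl⟩ := DoubleCoset.mem_doubleCoset.1 hg
  obtain ⟨a', ha', c', hc', rfl⟩ := DoubleCoset.mem_doubleCoset.1 hg'
  have hone : (1 : GLf k n) ∈ levelAt K K' h ϖ V := one_mem _
  choose f₁ hx₁ hy₁ hc₁ using fun (q : HeightOneSpectrum (𝓞 k)) (hq : Above p q) =>
    exists_magicConj_left D.lt_one (D.valuation_unitAt_le hq) hV (D.magic.isMagic hq)
      (D.left.isIwahori D.pos ha hq)
  obtain ⟨b₁, hb₁, hb₁'⟩ := exists_locAt_eq D.ne_zero f₁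
  have hmem₁ : b₁ ∈ levelAt K K' h ϖ V := D.mem_levelAt hone
    (fun q hq => by rw [hb₁' q hq, map_one]) (fun q hq => by rw [hb₁ q hq]; exact hx₁ q hq)
    (fun q hq => by rw [hb₁ q hq]; exact hy₁ q hq)
  have hleft₁ : (tElt n ϖ)⁻¹ * (((h * tElt n ϖ ^ V)⁻¹ * jEmb b₁ * (h * tElt n ϖ ^ V))⁻¹ * a) * tElt n ϖ ∈ K := by
    refine D.left.mem_of_eq_away D.ne_zero D.pos ha (fun q hq => ?_) fun q hq => ?_
    · rw [map_mul, map_mul, map_mul, map_inv, map_inv, locAt_magicConj, locAt_tElt, hb₁ q hq]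
      exact hc₁ q hq
    · rw [map_mul, map_mul, map_mul, map_inv, map_inv, locAt_magicConj, locAt_tElt, hb₁' q hq,
        D.unitAt_eq_one hq, powDiag_one, magicConj_one_left, map_one]
      simp
  have ha'' : ((tElt' n ϖ ^ V)⁻¹ * b₁ * tElt' n ϖ ^ V)⁻¹ * a' ∈ K' :=
    mul_mem (inv_mem (mem_diagLevel.1 hmem₁).2) ha'
  set a'' := ((tElt' n ϖ ^ V)⁻¹ * b₁ * tElt' n ϖ ^ V)⁻¹ * a' with ha''def
  choose f₂ hx₂ hy₂ hl₂ hr₂ using fun (q : HeightOneSpectrum (𝓞 k)) (hq : Above p q) =>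
    exists_magicConj_right D.lt_one (D.valuation_unitAt_le hq) hV (D.magic.isMagic hq)
      (D.right.isIwahori D.pos ha'' hq)
  obtain ⟨b₂, hb₂, hb₂'⟩ := exists_locAt_eq D.ne_zero f₂
  have hmem₂ : b₂ ∈ levelAt K K' h ϖ V := D.mem_levelAt hone
    (fun q hq => by rw [hb₂' q hq, map_one]) (fun q hq => by rw [hb₂ q hq]; exact hx₂ q hq)
    (fun q hq => by rw [hb₂ q hq]; exact hy₂ q hq)
  have hleft₂ : (tElt n ϖ)⁻¹ * ((h * tElt n ϖ ^ V)⁻¹ * jEmb b₂ * (h * tElt n ϖ ^ V)) * tElt n ϖ ∈ K := by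
    refine D.left.mem_of_eq_away D.ne_zero D.pos (one_mem K) (fun q hq => ?_) fun q hq => ?_
    · rw [map_mul, map_mul, map_inv, locAt_magicConj, locAt_tElt, hb₂ q hq]
      exact hl₂ q hq
    · rw [map_mul, map_mul, map_inv, locAt_magicConj, locAt_tElt, hb₂' q hq,
        D.unitAt_eq_one hq, powDiag_one, magicConj_one_left, map_one, map_one]
      simp
  have hright₂ : (tElt' n ϖ)⁻¹ * (((tElt' n ϖ ^ V)⁻¹ * b₂ * tElt' n ϖ ^ V)⁻¹ * a'') * tElt' n ϖ ∈ K' := by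
    refine D.right.mem_of_eq_away D.ne_zero D.pos ha'' (fun q hq => ?_) fun q hq => ?_
    · rw [map_mul, map_mul, map_mul, map_inv, map_inv, locAt_conj, locAt_tElt', hb₂ q hq]
      exact hr₂ q hq
    · rw [map_mul, map_mul, map_mul, map_inv, map_inv, locAt_conj, locAt_tElt', hb₂' q hq,
        D.unitAt_eq_one hq, powDiag_one]
      simp
  refine ⟨b₁ * b₂, mul_mem hmem₁ hmem₂, ?_, ?_⟩
  · have h1 := mul_mem (inv_mem hc) (mul_mem (inv_mem hleft₁) hleft₂)
    refine (congrArg (· ∈ K) ?_).mp h1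
    simp only [map_mul]
    group
  · have h1 := mul_mem (inv_mem hc') (inv_mem hright₂)
    refine (congrArg (· ∈ K') ?_).mp h1
    rw [ha''def]
    group

theorem dElt_mem (D : IsLevelDatum p m ϖ K K' h) {V : ℕ} (hV : 1 ≤ V) {e : (Af k)ˣ}
    (he : ∀ q, Above p q → Valued.v (evalAf q e.val - 1) ≤ Valued.v (evalAf q ϖ.val) ^ V)
    (he' : ∀ q, ¬ Above p q → unitAt q e = 1) : dElt e ∈ levelAt K K' h ϖ V := by
  have h1 := fun q (hq : Above p q) => isIwahori_dElt (D.magic.isMagic hq) D.lt_one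
    (D.valuation_unitAt_le hq) hV (e := unitAt q e) (he q hq)
  refine D.mem_levelAt (W := V) (one_mem _) (fun q hq => ?_) (fun q hq => ?_) fun q hq => ?_
  · rw [locAt_dElt, he' q hq, dElt_one, map_one]
  · rw [locAt_dElt]
    exact (h1 q hq).1
  · rw [locAt_dElt]
    exact (h1 q hq).2

theorem mem_detLevel (D : IsLevelDatum p m ϖ K K' h) (hn : 1 ≤ n) {V : ℕ} (hV : 1 ≤ V) {e : (Af k)ˣ}
    (he : ∀ q, Above p q → Valued.v (evalAf q e.val - 1) ≤ Valued.v (evalAf q ϖ.val) ^ V)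
    (he' : ∀ q, ¬ Above p q → unitAt q e = 1) : e ∈ detLevel (levelAt K K' h ϖ V) :=
  ⟨dElt e, D.dElt_mem hV he he', det_dElt hn e⟩

theorem valuation_sub_one_le (D : IsLevelDatum p m ϖ K K' h) {V : ℕ} {d : (Af k)ˣ}
    (hd : d ∈ detLevel (levelAt K K' h ϖ V)) {q : HeightOneSpectrum (𝓞 k)} (hq : Above p q) :
    Valued.v (evalAf q d.val - 1) ≤ Valued.v (evalAf q ϖ.val) ^ V := by
  obtain ⟨b, hb, rfl⟩ := hd
  have h1 := valuation_det_sub_one_le (D.magic.isMagic hq) ((D.valuation_unitAt_le hq).trans D.lt_one.le)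
    (D.isIwahori_of_mem hb hq).1 (D.isIwahori_of_mem hb hq).2
  rw [← GeneralLinearGroup.val_det_apply, det_locAt] at h1
  exact h1

/-- Elements of `det K(ϖ^V)` are products of their components at `p` and away from `p`. -/
theorem exists_eq_mul_of_mem_detLevel (D : IsLevelDatum p m ϖ K K' h) {V : ℕ} {d : (Af k)ˣ}
    (hd : d ∈ detLevel (levelAt K K' h ϖ V)) :
    ∃ e : (Af k)ˣ, (∀ q, Above p q → unitAt q e = unitAt q d) ∧ (∀ q, ¬ Above p q → unitAt q e = 1) ∧
      ∀ W, e⁻¹ * d ∈ detLevel (levelAt K K' h ϖ W) := by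
  obtain ⟨b, hb, rfl⟩ := hd
  obtain ⟨b₁, h1, h2⟩ := exists_locAt_eq D.ne_zero fun q _ => locAt q b
  refine ⟨GeneralLinearGroup.det b₁, fun q hq => ?_, fun q hq => ?_, fun W => ?_⟩
  · rw [← det_locAt, ← det_locAt, h1 q hq]
  · rw [← det_locAt, h2 q hq, map_one]
  · rw [← map_inv, ← map_mul]
    have hone : (1 : GLf k n) ∈ levelAt K K' h ϖ W := one_mem _
    refine ⟨b₁⁻¹ * b, D.mem_levelAt hb (fun q hq => ?_) (fun q hq => ?_) (fun q hq => ?_), rfl⟩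
    · rw [map_mul, map_inv, h2 q hq, inv_one, one_mul]
    · have h3 := (D.isIwahori_of_mem hone hq).1
      rwa [map_mul, map_inv, h1 q hq, inv_mul_cancel, ← map_one (locAt q)]
    · have h3 := (D.isIwahori_of_mem hone hq).2
      rwa [map_mul, map_inv, h1 q hq, inv_mul_cancel, ← map_one (locAt q)]

end IsLevelDatum

end

section

variable {k : Type*} [Field k] [NumberField k] {m n p : ℕ} {ϖ : (Af k)ˣ}
  {K : Subgroup (GLf k (n + 1))} {K' : Subgroup (GLf k n)} {h : GLf k (n + 1)}

theorem mem_Op {a : Af k} : a ∈ Op k p ↔ (∀ q, Above p q → Valued.v (evalAf q a) ≤ 1) ∧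
    ∀ q, ¬ Above p q → evalAf q a = 0 := Iff.rfl

theorem evalAf_Op_le {a : Af k} (ha : a ∈ Op k p) {q : HeightOneSpectrum (𝓞 k)} (hq : Above p q) :
    Valued.v (evalAf q a) ≤ 1 := ha.1 q hq

theorem evalAf_Op_eq {a : Af k} (ha : a ∈ Op k p) {q : HeightOneSpectrum (𝓞 k)} (hq : ¬ Above p q) :
    evalAf q a = 0 := ha.2 q hq

namespace IsLevelDatum

theorem valuation_pow_lt_one (D : IsLevelDatum p m ϖ K K' h) {V : ℕ} (hV : 1 ≤ V)
    {q : HeightOneSpectrum (𝓞 k)} (hq : Above p q) : Valued.v (evalAf q ϖ.val) ^ V < 1 :=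
  (valuation_pow_le (D.valuation_unitAt_le hq) D.lt_one hV).trans_lt D.lt_one

/-- `x + a ϖ^V` is an idele which differs from `x` by an element `d` with `d ≡ 1` modulo `ϖ^V`. -/
theorem exists_translate (D : IsLevelDatum p m ϖ K K' h) {V : ℕ} (hV : 1 ≤ V) {x : (Af k)ˣ}
    (hx : ∀ q, Above p q → Valued.v (evalAf q x.val) = 1) {a : Af k} (ha : a ∈ Op k p) :
    ∃ d : (Af k)ˣ, (x * d).val = x.val + a * ϖ.val ^ V ∧
      (∀ q, Above p q → Valued.v (evalAf q d.val - 1) ≤ Valued.v (evalAf q ϖ.val) ^ V) ∧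
      ∀ q, ¬ Above p q → unitAt q d = 1 := by
  have hv : ∀ q, Above p q →
      Valued.v (evalAf q (1 + a * ϖ.val ^ V * (x⁻¹ : (Af k)ˣ).val) - 1) ≤ Valued.v (evalAf q ϖ.val) ^ V := by
    intro q hq
    have h1 : Valued.v (evalAf q (x⁻¹ : (Af k)ˣ).val) = 1 := by
      have h2 := valuation_inv_mul (v := Valued.v) (unitAt q x)
      rw [← map_inv, val_unitAt, val_unitAt, hx q hq, mul_one] at h2
      exact h2
    rw [map_add, map_one, add_sub_cancel_left, map_mul, map_mul, map_mul, map_mul, h1, mul_one, map_pow,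
      map_pow]
    exact mul_le_of_le_one_left' (evalAf_Op_le ha hq)
  have hne : ∀ q, Above p q → evalAf q (1 + a * ϖ.val ^ V * (x⁻¹ : (Af k)ˣ).val) ≠ 0 := by
    intro q hq h0
    have h1 := (hv q hq).trans_lt (D.valuation_pow_lt_one hV hq)
    rw [h0, zero_sub, Valuation.map_neg, map_one] at h1
    exact lt_irrefl _ h1
  obtain ⟨d, hd, hd'⟩ := exists_unitAt_eq D.ne_zero fun q hq => Units.mk0 _ (hne q hq)
  have hd1 : ∀ q, Above p q → evalAf q d.val = evalAf q (1 + a * ϖ.val ^ V * (x⁻¹ : (Af k)ˣ).val) :=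
    fun q hq => congrArg Units.val (hd q hq)
  refine ⟨d, af_ext fun q => ?_, fun q hq => by rw [hd1 q hq]; exact hv q hq, hd'⟩
  by_cases hq : Above p q
  · rw [Units.val_mul, map_mul, hd1 q hq, ← map_mul]
    congr 1
    rw [mul_add, mul_one, mul_comm x.val, mul_assoc, Units.inv_mul, mul_one]
  · have h1 := congrArg Units.val (hd' q hq)
    rw [val_unitAt, Units.val_one] at h1
    rw [Units.val_mul, map_mul, h1, mul_one, map_add, map_mul, evalAf_Op_eq ha hq, zero_mul, add_zero]

/-- The elements of `det K(ϖ^V)` are, up to elements of all `det K(ϖ^W)`, quotients of ideles of the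
form `x + s ϖ^V`. -/
theorem exists_Op_of_mem_detLevel (D : IsLevelDatum p m ϖ K K' h) {V : ℕ} {x : (Af k)ˣ}
    (hx : ∀ q, Above p q → Valued.v (evalAf q x.val) = 1) {d : (Af k)ˣ}
    (hd : d ∈ detLevel (levelAt K K' h ϖ V)) :
    ∃ s ∈ Op k p, ∃ e : (Af k)ˣ, (x * e).val = x.val + s * ϖ.val ^ V ∧
      (∀ q, ¬ Above p q → unitAt q e = 1) ∧ ∀ W, e⁻¹ * d ∈ detLevel (levelAt K K' h ϖ W) := by
  obtain ⟨e, he, he', hmem⟩ := D.exists_eq_mul_of_mem_detLevel hd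
  refine ⟨x.val * (e.val - 1) * ((ϖ⁻¹ ^ V : (Af k)ˣ)).val, mem_Op.2 ⟨fun q hq => ?_, fun q hq => ?_⟩, e, ?_, he', hmem⟩
  · have h1 := congrArg Units.val (he q hq)
    rw [val_unitAt, val_unitAt] at h1
    rw [map_mul, map_mul, map_mul, map_mul, hx q hq, one_mul, map_sub, map_one, h1]
    have h2 := D.valuation_sub_one_le hd hq
    have h3 := valuation_inv_mul (v := Valued.v) (unitAt q ϖ ^ V)
    rw [← map_pow, ← map_inv, val_unitAt, val_unitAt, Units.val_pow_eq_pow_val, map_pow, map_pow,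
      mul_comm, ← inv_pow] at h3
    exact (mul_le_mul_left h2 _).trans h3.le
  · have h1 := congrArg Units.val (he' q hq)
    rw [val_unitAt, Units.val_one] at h1
    rw [map_mul, map_mul, map_sub, map_one, h1, sub_self, mul_zero, zero_mul]
  · rw [mul_assoc, ← Units.val_pow_eq_pow_val, ← Units.val_mul, inv_pow, inv_mul_cancel, Units.val_one,
      mul_one, Units.val_mul]
    ring

/-- Two ideles `x + a ϖ^V` and `x + b ϖ^V` differ by an element of `det K(ϖ^{V+1})` if and only if `a`
and `b` are congruent modulo `ϖ`. -/
theorem inv_mul_mem_detLevel_iff (D : IsLevelDatum p m ϖ K K' h) (hn : 1 ≤ n) {V : ℕ}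
    {x : (Af k)ˣ} (hx : ∀ q, Above p q → Valued.v (evalAf q x.val) = 1) {a b : Af k}
    (ha : a ∈ Op k p) (hb : b ∈ Op k p) {d e : (Af k)ˣ} (hd : (x * d).val = x.val + a * ϖ.val ^ V)
    (hd1 : ∀ q, Above p q → Valued.v (evalAf q d.val) = 1)
    (hd' : ∀ q, ¬ Above p q → unitAt q d = 1)
    (he : (x * e).val = x.val + b * ϖ.val ^ V)
    (he' : ∀ q, ¬ Above p q → unitAt q e = 1) :
    d⁻¹ * e ∈ detLevel (levelAt K K' h ϖ (V + 1)) ↔ ∃ c ∈ Op k p, b - a = ϖ.val * c := by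
  have hϖ0 : ∀ q, Valued.v (evalAf q ϖ.val) ≠ 0 := fun q =>
    (Valuation.ne_zero_iff _).2 (evalAf_unit_ne_zero ϖ q)
  have key : ∀ q, Above p q → Valued.v (evalAf q (d⁻¹ * e : (Af k)ˣ).val - 1) =
      Valued.v (evalAf q (b - a)) * Valued.v (evalAf q ϖ.val) ^ V := by
    intro q hq
    have h1 : x.val * d.val * ((d⁻¹ * e : (Af k)ˣ).val - 1) = (b - a) * ϖ.val ^ V := by
      rw [← Units.val_mul x d, mul_sub, mul_one, ← Units.val_mul, mul_assoc, mul_inv_cancel_left, he, hd]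
      ring
    have h2 := congrArg (fun z => Valued.v (evalAf q z)) h1
    simp only [map_mul, map_pow, hx q hq, hd1 q hq, one_mul] at h2
    rw [← h2, map_sub (evalAf q), map_one (evalAf q)]
  constructor
  · intro hmem
    refine ⟨(ϖ⁻¹ : (Af k)ˣ).val * (b - a), mem_Op.2 ⟨fun q hq => ?_, fun q hq => ?_⟩, by
      rw [Units.mul_inv_cancel_left]⟩
    · have h1 := D.valuation_sub_one_le hmem hq
      rw [key q hq, pow_succ', mul_le_mul_iff_left₀ (pow_pos (zero_lt_iff.2 (hϖ0 q)) V)] at h1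
      rw [map_mul, map_mul]
      have h3 := valuation_inv_mul (v := Valued.v) (unitAt q ϖ)
      rw [← map_inv, val_unitAt, val_unitAt] at h3
      exact (mul_le_mul_right h1 _).trans h3.le
    · rw [map_mul, map_sub, evalAf_Op_eq ha hq, evalAf_Op_eq hb hq, sub_self, mul_zero]
  · rintro ⟨c, hc, hbc⟩
    refine D.mem_detLevel hn (Nat.le_add_left 1 V) (fun q hq => ?_) fun q hq => ?_
    · rw [key q hq, hbc, map_mul, map_mul, pow_succ']
      refine mul_le_mul_left ?_ _
      exact mul_le_of_le_one_right' (evalAf_Op_le hc hq)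
    · rw [map_mul, map_inv, hd' q hq, he' q hq, inv_one, one_mul]

end IsLevelDatum

section Relations

variable {E M₁ M₂ : Type*} [Field E] [CharZero E] [AddCommGroup M₁] [Module E M₁]
  [FiniteDimensional E M₁] [AddCommGroup M₂] [Module E M₂] [FiniteDimensional E M₂]
  {ρ₁ : Representation E (GLk k (n + 1)) M₁} {ρ₂ : Representation E (GLk k n) M₂}
  {J : AdGroup k (n + 1)} {J' : AdGroup k n}

theorem levelAt_succ (K : Subgroup (GLf k (n + 1))) (K' : Subgroup (GLf k n)) (h : GLf k (n + 1))
    (ϖ : (Af k)ˣ) (V : ℕ) : levelAt K K' h ϖ (V + 1) =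
      diagLevel K K' (h * tElt n ϖ ^ V * tElt n ϖ) (tElt' n ϖ ^ V * tElt' n ϖ) := by
  rw [levelAt, pow_succ, pow_succ, mul_assoc]

theorem muTilde_succ {κ : E} (F : FundamentalClasses k n) (l : HC ρ₁ ρ₂ J J' K K' (degree k n))
    (V : ℕ) (x : (Af k)ˣ) : muTilde F l κ h ϖ (V + 1) x = (κ ^ (V + 1))⁻¹ •
      modularSymbol F l (h * tElt n ϖ ^ V * tElt n ϖ) (tElt' n ϖ ^ V * tElt' n ϖ) x := by
  rw [muTilde, pow_succ (tElt n ϖ), pow_succ (tElt' n ϖ), mul_assoc]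

theorem relIndex_smul_muTilde_eq_sum (hn : 1 ≤ n) (hρ₁ : IsAlgebraicRep ρ₁)
    (hρ₂ : IsAlgebraicRep ρ₂) (F : FundamentalClasses k n) (hK : IsLevel K) (hK' : IsLevel K')
    (D : IsLevelDatum p m ϖ K K' h) {l : HC ρ₁ ρ₂ J J' K K' (degree k n)} {κ : E} (hκ : κ ≠ 0)
    (hl : IsHeckeEigenclass (tElt n ϖ) (tElt' n ϖ) l κ) {V : ℕ} (hV : 1 ≤ V) (x : (Af k)ˣ)
    {ι : Type*} (R : Finset ι) (d : ι → (Af k)ˣ) (hd : ∀ r ∈ R, dElt (d r) ∈ levelAt K K' h ϖ V)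
    (hR : ∀ y ∈ detLevel (levelAt K K' h ϖ V), ∃! r, r ∈ R ∧
      (d r)⁻¹ * y ∈ detLevel (levelAt K K' h ϖ (V + 1))) :
    (unitGroup (levelAt K K' h ϖ (V + 1))).relIndex (unitGroup (levelAt K K' h ϖ V)) •
      muTilde F l κ h ϖ V x = ∑ r ∈ R, muTilde F l κ h ϖ (V + 1) (x * d r) := by
  have hle := D.levelAt_succ_le V
  rw [levelAt_succ] at hR hle ⊢
  have h1 := relIndex_smul_modularSymbol_eq_sum hn hρ₁ hρ₂ F hK hK' hle (D.isTransitive hV) hl x R d hd hR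
  simp only [muTilde_succ]
  rw [← Finset.smul_sum, ← h1, muTilde, ← Nat.cast_smul_eq_nsmul E, ← Nat.cast_smul_eq_nsmul E, smul_smul,
    smul_smul, smul_smul]
  congr 1
  unfold levelAt
  field_simp
  ring

theorem muTilde_eq_sum_of_neat (hn : 1 ≤ n) (hρ₁ : IsAlgebraicRep ρ₁)
    (hρ₂ : IsAlgebraicRep ρ₂) (F : FundamentalClasses k n) (hK : IsLevel K) (hK' : IsLevel K')
    (D : IsLevelDatum p m ϖ K K' h) {l : HC ρ₁ ρ₂ J J' K K' (degree k n)} {κ : E} (hκ : κ ≠ 0)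
    (hl : IsHeckeEigenclass (tElt n ϖ) (tElt' n ϖ) l κ)
    (hneat : ∀ c, ∀ γ ∈ arithGroup (levelAt K K' h ϖ 0) c, IsNeatElement γ)
    {V : ℕ} (hV : 1 ≤ V) (x : (Af k)ˣ) (A : Finset (Af k)ˣ)
    (hA : ∀ e ∈ A, dElt e ∈ levelAt K K' h ϖ V)
    (hA' : ∀ d ∈ detLevel (levelAt K K' h ϖ V), ∃! e, e ∈ A ∧
      finClass (levelAt K K' h ϖ (V + 1)) (x * e) = finClass (levelAt K K' h ϖ (V + 1)) (x * d)) :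
    muTilde F l κ h ϖ V x = ∑ e ∈ A, muTilde F l κ h ϖ (V + 1) (x * e) := by
  have hle := D.levelAt_succ_le V
  rw [levelAt_succ] at hA' hle
  have h1 := smul_modularSymbol_eq_sum_of_neat hn hρ₁ hρ₂ F hK hK' hle (D.isTransitive hV) hl
    (L₀ := levelAt K K' h ϖ 0) (isLevel_diagLevel hK hK' _ _) (D.levelAt_antitone (Nat.zero_le V)) hneat
    x A hA hA'
  simp only [muTilde_succ]
  rw [← Finset.smul_sum, ← h1, muTilde, smul_smul]
  congr 1
  field_simp
  ring

/-- The distribution relations in terms of the ideles `x + a ϖ^V`. -/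
theorem exists_distribution_relations (hn : 1 ≤ n) (hρ₁ : IsAlgebraicRep ρ₁)
    (hρ₂ : IsAlgebraicRep ρ₂) (F : FundamentalClasses k n) (hK : IsLevel K) (hK' : IsLevel K')
    (D : IsLevelDatum p m ϖ K K' h) {l : HC ρ₁ ρ₂ J J' K K' (degree k n)} {κ : E} (hκ : κ ≠ 0)
    (hl : IsHeckeEigenclass (tElt n ϖ) (tElt' n ϖ) l κ) {V : ℕ} (hV : 1 ≤ V) {x : (Af k)ˣ}
    (hx : ∀ q, Above p q → Valued.v (x.val q) = 1) :
    ∃ y : Af k → (Af k)ˣ, (∀ a ∈ Op k p, (y a).val = x.val + a * ϖ.val ^ V) ∧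
      (∀ R : Finset (Af k), IsRepresentatives p ϖ R →
        (unitGroup (levelAt K K' h ϖ (V + 1))).relIndex (unitGroup (levelAt K K' h ϖ V)) •
            muTilde F l κ h ϖ V x = ∑ a ∈ R, muTilde F l κ h ϖ (V + 1) (y a)) ∧
      ((∀ c, ∀ γ ∈ arithGroup (levelAt K K' h ϖ 0) c, IsNeatElement γ) →
        ∀ A : Finset (Af k), (∀ a ∈ A, a ∈ Op k p) →
        (∀ b ∈ Op k p, ∃! a, a ∈ A ∧ finClass (levelAt K K' h ϖ (V + 1)) (y a) =
          finClass (levelAt K K' h ϖ (V + 1)) (y b)) →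
        muTilde F l κ h ϖ V x = ∑ a ∈ A, muTilde F l κ h ϖ (V + 1) (y a)) := by
  classical
  choose! d hd using fun (a : Af k) (ha : a ∈ Op k p) => D.exists_translate hV hx ha
  have hmem : ∀ a ∈ Op k p, dElt (d a) ∈ levelAt K K' h ϖ V := fun a ha =>
    D.dElt_mem hV (hd a ha).2.1 (hd a ha).2.2
  have hd1 : ∀ a ∈ Op k p, ∀ q, Above p q → Valued.v (evalAf q (d a).val) = 1 := fun a ha q hq =>
    IsIwahori.map_eq_one_of_sub (D.valuation_pow_lt_one hV hq) (map_one _) ((hd a ha).2.1 q hq)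
  refine ⟨fun a => x * d a, fun a ha => (hd a ha).1, fun R hR => ?_, fun hneat A hA hA' => ?_⟩
  · refine relIndex_smul_muTilde_eq_sum hn hρ₁ hρ₂ F hK hK' D hκ hl hV x R d
      (fun r hr => hmem r (hR.1 r hr)) fun y hy => ?_
    obtain ⟨s, hs, e, he, he', hall⟩ := D.exists_Op_of_mem_detLevel hx hy
    have hiff : ∀ r ∈ R, ((d r)⁻¹ * y ∈ detLevel (levelAt K K' h ϖ (V + 1)) ↔
        ∃ c ∈ Op k p, s - r = ϖ.val * c) := fun r hr => by
      have hr' := hR.1 r hr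
      rw [← D.inv_mul_mem_detLevel_iff hn hx hr' hs (hd r hr').1 (hd1 r hr') (hd r hr').2.2 he he',
        ← Subgroup.mul_mem_cancel_right _ (y := (d r)⁻¹ * e) (hall (V + 1)), mul_assoc,
        mul_inv_cancel_left]
    obtain ⟨r, ⟨hr, hc⟩, huniq⟩ := hR.2 s hs
    exact ⟨r, ⟨hr, (hiff r hr).2 hc⟩, fun r' hr' => huniq r' ⟨hr'.1, (hiff r' hr'.1).1 hr'.2⟩⟩
  · have hinj : Set.InjOn d A := fun a ha a' ha' haa' => by
      obtain ⟨_, _, huniq⟩ := hA' a (hA a ha)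
      rw [huniq a ⟨ha, rfl⟩, huniq a' ⟨ha', by simp only [haa']⟩]
    rw [muTilde_eq_sum_of_neat hn hρ₁ hρ₂ F hK hK' D hκ hl hneat hV x (A.image d)
      (fun e he => ?_) (fun y hy => ?_), Finset.sum_image hinj]
    · obtain ⟨a, ha, rfl⟩ := Finset.mem_image.1 he
      exact hmem a (hA a ha)
    · obtain ⟨s, hs, e, he, -, hall⟩ := D.exists_Op_of_mem_detLevel hx hy
      have hse : x * d s = x * e := Units.ext ((hd s hs).1.trans he.symm)
      have hclass : finClass (levelAt K K' h ϖ (V + 1)) (x * d s) =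
          finClass (levelAt K K' h ϖ (V + 1)) (x * y) := by
        refine finClass_eq_of_inv_mul_mem ?_
        rw [hse]
        have := hall (V + 1)
        simpa [mul_assoc] using this
      obtain ⟨a, ⟨ha, hac⟩, huniq⟩ := hA' s hs
      refine ⟨d a, ⟨Finset.mem_image_of_mem d ha, hac.trans hclass⟩, ?_⟩
      rintro _ ⟨he2, hcl⟩
      obtain ⟨a', ha', rfl⟩ := Finset.mem_image.1 he2
      rw [huniq a' ⟨ha', hcl.trans hclass.symm⟩]

end Relations

end

section

section Limit

variable {E M X : Type*} [Field E] [AddCommGroup M] [Module E M] [TopologicalSpace X]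

theorem apply_eq_of_le {C : ℕ → Type*} {π : ∀ v, X → C v} (hπ : ∀ v s s', π (v + 1) s = π (v + 1) s' → π v s = π v s')
    {v w : ℕ} (hvw : v ≤ w) {s s' : X} (h : π w s = π w s') : π v s = π v s' := by
  induction w, hvw using Nat.le_induction with
  | base => exact h
  | succ w _ ih => exact ih (hπ w s s' h)

/-- Compatible families of functions on a projective system of finite sets are distributions on the
limit. -/
theorem existsUnique_distribution {C : ℕ → Type*} [∀ v, Fintype (C v)] [∀ v, DecidableEq (C v)]
    {π : ∀ v, X → C v} (hsurj : ∀ v, Function.Surjective (π v)) {pr : ∀ v, C (v + 1) → C v}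
    (hpr : ∀ v s, pr v (π (v + 1) s) = π v s) (hclopen : ∀ v c, IsClopen (π v ⁻¹' {c}))
    (hfac : ∀ f : LocallyConstant X E, ∃ v, ∀ s s', π v s = π v s' → f s = f s')
    {μ : ∀ v, C v → M} (hμ : ∀ v, 1 ≤ v → ∀ c, μ v c = ∑ c' with pr v c' = c, μ (v + 1) c') :
    ∃! D : LocallyConstant X E →ₗ[E] M, ∀ v, 1 ≤ v → ∀ c,
      D (LocallyConstant.charFn E (hclopen v c)) = μ v c := by
  choose σ hσ using hsurj
  have hπ : ∀ v s s', π (v + 1) s = π (v + 1) s' → π v s = π v s' := fun v s s' h => by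
    rw [← hpr v s, ← hpr v s', h]
  let S : ∀ v, LocallyConstant X E → M := fun v f => ∑ c, f (σ v c) • μ v c
  have hsucc : ∀ (f : LocallyConstant X E) (v : ℕ), 1 ≤ v →
      (∀ s s', π v s = π v s' → f s = f s') → S (v + 1) f = S v f := by
    intro f v hv hf
    simp only [S]
    rw [← Finset.sum_fiberwise (s := Finset.univ) (g := pr v)]
    refine Finset.sum_congr rfl fun c _ => ?_
    rw [hμ v hv c, Finset.smul_sum]
    refine Finset.sum_congr rfl fun c' hc' => ?_
    congr 1
    refine hf _ _ ?_
    rw [hσ, ← hpr, hσ, (Finset.mem_filter.1 hc').2]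
  have hstab : ∀ (f : LocallyConstant X E) {v w : ℕ}, 1 ≤ v → v ≤ w →
      (∀ s s', π v s = π v s' → f s = f s') → S w f = S v f := by
    intro f v w hv hvw hf
    induction w, hvw using Nat.le_induction with
    | base => rfl
    | succ w hvw ih =>
      rw [hsucc f w (hv.trans hvw) fun s s' h => hf s s' (apply_eq_of_le hπ hvw h), ih]
  have hfac' : ∀ f : LocallyConstant X E, ∃ v, 1 ≤ v ∧ ∀ s s', π v s = π v s' → f s = f s' := fun f => by
    obtain ⟨v, hv⟩ := hfac f
    exact ⟨v + 1, Nat.le_add_left 1 v, fun s s' h => hv s s' (hπ v s s' h)⟩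
  choose N hN1 hN using hfac'
  let D : LocallyConstant X E →ₗ[E] M :=
    { toFun := fun f => S (N f) f
      map_add' := fun f g => by
        obtain ⟨w, h1, h2, h3⟩ : ∃ w, N (f + g) ≤ w ∧ N f ≤ w ∧ N g ≤ w :=
          ⟨max (N (f + g)) (max (N f) (N g)), by simp, by simp, by simp⟩
        rw [← hstab (f + g) (hN1 _) h1 (hN _), ← hstab f (hN1 _) h2 (hN _),
          ← hstab g (hN1 _) h3 (hN _)]
        simp only [S, LocallyConstant.coe_add, Pi.add_apply, add_smul, Finset.sum_add_distrib]
      map_smul' := fun a f => by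
        obtain ⟨w, h1, h2⟩ : ∃ w, N (a • f) ≤ w ∧ N f ≤ w :=
          ⟨max (N (a • f)) (N f), by simp, by simp⟩
        rw [← hstab (a • f) (hN1 _) h1 (hN _), ← hstab f (hN1 _) h2 (hN _)]
        simp only [S, LocallyConstant.coe_smul, Pi.smul_apply, smul_eq_mul, mul_smul, Finset.smul_sum,
          RingHom.id_apply] }
  have hDS : ∀ (f : LocallyConstant X E) (v : ℕ), 1 ≤ v → (∀ s s', π v s = π v s' → f s = f s') →
      D f = S v f := fun f v hv hf => by
    change S (N f) f = _
    rw [← hstab f (hN1 f) (le_max_left _ _ : _ ≤ max (N f) v) (hN f),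
      ← hstab f hv (le_max_right _ _ : _ ≤ max (N f) v) hf]
  have hchar : ∀ v c s, LocallyConstant.charFn E (hclopen v c) s = if π v s = c then 1 else 0 := by
    intro v c s
    classical
    rw [LocallyConstant.coe_charFn, Set.indicator_apply]
    exact if_congr Iff.rfl rfl rfl
  refine ⟨D, fun v hv c => ?_, fun D' hD' => LinearMap.ext fun f => ?_⟩
  · rw [hDS _ v hv fun s s' h => by rw [hchar, hchar, h]]
    simp only [S, hchar, hσ, ite_smul, one_smul, zero_smul, Finset.sum_ite_eq', Finset.mem_univ, if_true]
  · rw [hDS f (N f) (hN1 f) (hN f)]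
    have h1 : f = ∑ c, f (σ (N f) c) • LocallyConstant.charFn E (hclopen (N f) c) := by
      ext s
      have h2 : ∀ T : Finset (C (N f)), (∑ c ∈ T, f (σ (N f) c) • LocallyConstant.charFn E (hclopen (N f) c)) s =
          ∑ c ∈ T, f (σ (N f) c) * LocallyConstant.charFn E (hclopen (N f) c) s := fun T => by
        induction T using Finset.induction_on with
        | empty => rfl
        | insert a T ha ih =>
          rw [Finset.sum_insert ha, Finset.sum_insert ha, ← ih]
          rfl
      rw [h2]
      simp only [hchar, mul_ite, mul_one, mul_zero, Finset.sum_ite_eq, Finset.mem_univ, if_true]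
      exact hN f _ _ (hσ _ _).symm
    conv_lhs => rw [h1]
    rw [map_sum]
    exact Finset.sum_congr rfl fun c _ => by rw [map_smul, hD' _ (hN1 f)]

end Limit

end

section

variable {k : Type*} [Field k] [NumberField k] {m n p : ℕ} {ϖ : (Af k)ˣ}
  {K : Subgroup (GLf k (n + 1))} {K' : Subgroup (GLf k n)} {h : GLf k (n + 1)}

/-- The projection `C(L') → C(L)`. -/
noncomputable def classMap {L L' : Subgroup (GLf k n)} (hle : L' ≤ L) : ClassSet L' → ClassSet L :=
  Subgroup.quotientMapOfLE (sup_le_sup_left (Subgroup.prod_mono le_rfl (detLevel_mono hle)) _)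

theorem classMap_ideleClass {L L' : Subgroup (GLf k n)} (hle : L' ≤ L)
    (y : (InfiniteAdeleRing k)ˣ × (Af k)ˣ) : classMap hle (ideleClass L' y) = ideleClass L y := rfl

theorem classMap_finClass {L L' : Subgroup (GLf k n)} (hle : L' ≤ L) (x : (Af k)ˣ) :
    classMap hle (finClass L' x) = finClass L x := rfl

theorem finClass_eq_of_le {L L' : Subgroup (GLf k n)} (hle : L' ≤ L) {x y : (Af k)ˣ}
    (hxy : finClass L' x = finClass L' y) : finClass L x = finClass L y := by
  rw [← classMap_finClass hle, hxy, classMap_finClass]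

theorem ideleClass_surjective (L : Subgroup (GLf k n)) : Function.Surjective (ideleClass L) :=
  QuotientGroup.mk_surjective

/-- If the class of an idele of level `L` is represented by a finite idele `x₀`, then its class of a
smaller level `L'` is represented by an element of `x₀ det(L)`. -/
theorem exists_finClass_eq {L : Subgroup (GLf k n)} (L' : Subgroup (GLf k n))
    {y : (InfiniteAdeleRing k)ˣ × (Af k)ˣ} {x₀ : (Af k)ˣ} (hx₀ : finClass L x₀ = ideleClass L y) :
    ∃ d ∈ detLevel L, finClass L' (x₀ * d) = ideleClass L' y := by
  have h1 : ((1, x₀) : (InfiniteAdeleRing k)ˣ × (Af k)ˣ)⁻¹ * y ∈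
      (principal k).range ⊔ (posUnits k).prod (detLevel L) := QuotientGroup.eq.1 hx₀
  obtain ⟨_, ⟨δ, rfl⟩, ⟨a, d⟩, had, h2⟩ := Subgroup.mem_sup.1 h1
  obtain ⟨ha, hd⟩ := Subgroup.mem_prod.1 had
  refine ⟨d, hd, QuotientGroup.eq.2 ?_⟩
  refine Subgroup.mem_sup.2 ⟨principal k δ, ⟨δ, rfl⟩, (a, 1), Subgroup.mem_prod.2 ⟨ha, one_mem _⟩, ?_⟩
  have h3 : y = (1, x₀) * (principal k δ * (a, d)) := by rw [h2, mul_inv_cancel_left]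
  rw [h3]
  have h4 : ((1, x₀ * d) : (InfiniteAdeleRing k)ˣ × (Af k)ˣ) = (1, x₀) * (1, d) := by simp
  have h5 : ((a, d) : (InfiniteAdeleRing k)ˣ × (Af k)ˣ) = (a, 1) * (1, d) := by simp
  rw [h4, h5]
  exact Additive.ofMul.injective (by simp only [ofMul_mul, ofMul_inv]; abel)

section Limit

theorem ClassLimit.classMap_apply (hle : ∀ v, levelAt K K' h ϖ (v + 1) ≤ levelAt K K' h ϖ v)
    (s : ClassLimit K K' h ϖ) (v : ℕ) : classMap (hle v) (s.val (v + 1)) = s.val v := by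
  obtain ⟨y, h1, h2⟩ := s.2 v
  rw [← h1, ← h2, classMap_ideleClass]

theorem ClassLimit.apply_surjective (v : ℕ) :
    Function.Surjective fun s : ClassLimit K K' h ϖ => s.val v := fun c => by
  obtain ⟨y, rfl⟩ := ideleClass_surjective _ c
  exact ⟨⟨fun w => ideleClass _ y, fun w => ⟨y, rfl, rfl⟩⟩, rfl⟩

theorem ClassLimit.compactSpace (hfin : ∀ v, Finite (ClassSet (levelAt K K' h ϖ v))) :
    CompactSpace (ClassLimit K K' h ϖ) := by
  refine isCompact_iff_compactSpace.1 (IsClosed.isCompact ?_)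
  have h1 : {s : ∀ v : ℕ, ClassSet (levelAt K K' h ϖ v) | ∀ v, ∃ y,
      ideleClass (levelAt K K' h ϖ (v + 1)) y = s (v + 1) ∧ ideleClass (levelAt K K' h ϖ v) y = s v} =
      ⋂ v, (fun s => (s (v + 1), s v)) ⁻¹' {c : ClassSet (levelAt K K' h ϖ (v + 1)) ×
        ClassSet (levelAt K K' h ϖ v) | ∃ y, ideleClass _ y = c.1 ∧ ideleClass _ y = c.2} := by
    ext s
    simp
  have h2 : IsClosed {s : ∀ v : ℕ, ClassSet (levelAt K K' h ϖ v) | ∀ v, ∃ y,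
      ideleClass (levelAt K K' h ϖ (v + 1)) y = s (v + 1) ∧ ideleClass (levelAt K K' h ϖ v) y = s v} := by
    rw [h1]
    exact isClosed_iInter fun v => (isClosed_discrete _).preimage
      ((continuous_apply _).prodMk (continuous_apply _))
  exact h2

/-- Locally constant functions on the limit factor through a finite level. -/
theorem ClassLimit.exists_factor (hle : ∀ v, levelAt K K' h ϖ (v + 1) ≤ levelAt K K' h ϖ v)
    (hfin : ∀ v, Finite (ClassSet (levelAt K K' h ϖ v))) {E : Type*}
    (f : LocallyConstant (ClassLimit K K' h ϖ) E) :
    ∃ v, ∀ s s' : ClassLimit K K' h ϖ, s.val v = s'.val v → f s = f s' := by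
  have := ClassLimit.compactSpace hfin
  have hcompat : ∀ {v w : ℕ}, v ≤ w → ∀ {s s' : ClassLimit K K' h ϖ}, s.val w = s'.val w →
      s.val v = s'.val v := fun hvw => apply_eq_of_le (X := ClassLimit K K' h ϖ)
    (π := fun v s => s.val v) (fun v s s' hs => by
      rw [← ClassLimit.classMap_apply hle s, ← ClassLimit.classMap_apply hle s']
      exact congrArg _ hs) hvw
  have hloc : ∀ s : ClassLimit K K' h ϖ, ∃ v, ∀ s' : ClassLimit K K' h ϖ, s'.val v = s.val v → f s' = f s := by
    intro s
    have h1 : f ⁻¹' {f s} ∈ nhds s := (f.isLocallyConstant.isOpen_fiber (f s)).mem_nhds rfl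
    obtain ⟨U, hU, hUs⟩ := mem_nhds_induced Subtype.val s _ |>.1 h1
    rw [nhds_pi, Filter.mem_pi'] at hU
    obtain ⟨I, t, ht, hsub⟩ := hU
    refine ⟨I.sup id, fun s' hs' => hUs (hsub fun i hi => ?_)⟩
    have h2 : s'.val i = s.val i := hcompat (Finset.le_sup (f := id) hi) hs'
    exact (congrArg (· ∈ t i) h2).mpr (mem_of_mem_nhds (ht i))
  choose N hN using hloc
  obtain ⟨T, hT⟩ := isCompact_univ.elim_finite_subcover
    (fun s : ClassLimit K K' h ϖ => cylinder (s.val (N s))) (fun s => (isClopen_cylinder _).isOpen)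
    (fun s _ => Set.mem_iUnion.2 ⟨s, rfl⟩)
  refine ⟨T.sup N, fun s s' hss' => ?_⟩
  obtain ⟨r, hr⟩ := Set.mem_iUnion.1 (hT (Set.mem_univ s))
  obtain ⟨hrT, hsr⟩ := Set.mem_iUnion.1 hr
  have h2 : s.val (N r) = r.val (N r) := hsr
  have h3 := hcompat (Finset.le_sup (f := N) hrT) hss'
  rw [hN r s h2, hN r s' (h3.symm.trans h2)]

end Limit

end

section

variable {k : Type*} [Field k] [NumberField k] {m n p : ℕ} {ϖ : (Af k)ˣ}
  {K : Subgroup (GLf k (n + 1))} {K' : Subgroup (GLf k n)} {h : GLf k (n + 1)}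
  {E M₁ M₂ : Type*} [Field E] [CharZero E] [AddCommGroup M₁] [Module E M₁]
  [FiniteDimensional E M₁] [AddCommGroup M₂] [Module E M₂] [FiniteDimensional E M₂]
  {ρ₁ : Representation E (GLk k (n + 1)) M₁} {ρ₂ : Representation E (GLk k n) M₂}
  {J : AdGroup k (n + 1)} {J' : AdGroup k n}

theorem muTilde_mem_invariantsOf (hρ₁ : IsAlgebraicRep ρ₁) (hρ₂ : IsAlgebraicRep ρ₂)
    (F : FundamentalClasses k n) (hK : IsLevel K) (hK' : IsLevel K')
    (l : HC ρ₁ ρ₂ J J' K K' (degree k n)) (κ : E) (V : ℕ) (x : (Af k)ˣ) :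
    muTilde F l κ h ϖ V x ∈
      invariantsOf (diagRep ρ₁ ρ₂) (arithGroup (levelAt K K' h ϖ V) x : Set (GLk k n)) :=
  Submodule.smul_mem _ _ (modularSymbol_mem_invariantsOf hρ₁ hρ₂ F hK hK' l _ _ x)

theorem muTilde_mem_hullInvariants (hρ₁ : IsAlgebraicRep ρ₁) (hρ₂ : IsAlgebraicRep ρ₂)
    (F : FundamentalClasses k n) (hK : IsLevel K) (hK' : IsLevel K')
    (l : HC ρ₁ ρ₂ J J' K K' (degree k n)) (κ : E) (V : ℕ) (x : (Af k)ˣ) :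
    muTilde F l κ h ϖ V x ∈ hullInvariants ρ₁ ρ₂ := fun g hg =>
  (isAlgebraicRep_diagRep hρ₁ hρ₂).mem_invariantsOf_zariskiClosure
    (muTilde_mem_invariantsOf hρ₁ hρ₂ F hK hK' l κ V x) g
    (hg _ (isTorsionFreeArithmetic_arithGroup (isLevel_diagLevel hK hK' _ _) x))

/-- The classes of level `K(ϖ^{V+1})` over the class of `x` of level `K(ϖ^V)` are represented by the
ideles `x e` with `diag(e, 1, …, 1)` in `K(ϖ^V)`. -/
theorem IsLevelDatum.exists_finClass_mul_eq (D : IsLevelDatum p m ϖ K K' h) {V : ℕ} (hV : 1 ≤ V)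
    {x : (Af k)ˣ} {c : ClassSet (levelAt K K' h ϖ (V + 1))}
    (hc : classMap (D.levelAt_succ_le V) c = finClass (levelAt K K' h ϖ V) x) :
    ∃ e, dElt e ∈ levelAt K K' h ϖ V ∧ finClass (levelAt K K' h ϖ (V + 1)) (x * e) = c := by
  obtain ⟨y, rfl⟩ := ideleClass_surjective _ c
  rw [classMap_ideleClass] at hc
  obtain ⟨d, hd, hdc⟩ := exists_finClass_eq (levelAt K K' h ϖ (V + 1)) hc.symm
  obtain ⟨e, he, he', hall⟩ := D.exists_eq_mul_of_mem_detLevel hd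
  refine ⟨e, D.dElt_mem hV (fun q hq => ?_) he', ?_⟩
  · have h1 := congrArg Units.val (he q hq)
    rw [val_unitAt, val_unitAt] at h1
    rw [h1]
    exact D.valuation_sub_one_le hd hq
  · rw [← hdc]
    refine finClass_eq_of_inv_mul_mem ?_
    simpa [mul_assoc] using hall (V + 1)

/-- `μ̃_l` defines a distribution on `C(K(p^∞))`. -/
theorem existsUnique_muTilde_distribution (hn : 1 ≤ n) (hρ₁ : IsAlgebraicRep ρ₁)
    (hρ₂ : IsAlgebraicRep ρ₂) (F : FundamentalClasses k n) (hK : IsLevel K) (hK' : IsLevel K')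
    (D : IsLevelDatum p m ϖ K K' h) {l : HC ρ₁ ρ₂ J J' K K' (degree k n)} {κ : E} (hκ : κ ≠ 0)
    (hl : IsHeckeEigenclass (tElt n ϖ) (tElt' n ϖ) l κ)
    (hneat : ∀ c, ∀ γ ∈ arithGroup (levelAt K K' h ϖ 0) c, IsNeatElement γ)
    {rep : ClassSet (levelAt K K' h ϖ 0) → (Af k)ˣ}
    (hrep : ∀ c, finClass (levelAt K K' h ϖ 0) (rep c) = c) :
    ∃! 𝒟 : LocallyConstant (ClassLimit K K' h ϖ) E →ₗ[E] hullInvariants ρ₁ ρ₂,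
      ∀ v, 1 ≤ v → ∀ x : (Af k)ˣ,
        (rep (finClass (levelAt K K' h ϖ 0) x))⁻¹ * x ∈ detLevel (levelAt K K' h ϖ 0) →
        (𝒟 (LocallyConstant.charFn E
            (isClopen_cylinder (finClass (levelAt K K' h ϖ v) x))) : M₁ ⊗[E] M₂) =
          muTilde F l κ h ϖ v x := by
  classical
  have hfin : ∀ v, Finite (ClassSet (levelAt K K' h ϖ v)) := fun v =>
    finite_classSet hn (isLevel_diagLevel hK hK' _ _).isOpen
  have hfint : ∀ v, Fintype (ClassSet (levelAt K K' h ϖ v)) := fun v => Fintype.ofFinite _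
  have hle := D.levelAt_succ_le
  have hle₀ : ∀ v, levelAt K K' h ϖ v ≤ levelAt K K' h ϖ 0 := fun v => D.levelAt_antitone (Nat.zero_le v)
  let good : (Af k)ˣ → Prop := fun x =>
    (rep (finClass (levelAt K K' h ϖ 0) x))⁻¹ * x ∈ detLevel (levelAt K K' h ϖ 0)
  have hgood : ∀ {x d : (Af k)ˣ}, good x → d ∈ detLevel (levelAt K K' h ϖ 0) → good (x * d) := by
    intro x d hx hd
    have h1 : finClass (levelAt K K' h ϖ 0) (x * d) = finClass (levelAt K K' h ϖ 0) x :=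
      (finClass_eq_of_inv_mul_mem (by simpa using hd)).symm
    simp only [good, h1, ← mul_assoc]
    exact mul_mem hx hd
  have hex : ∀ v (c : ClassSet (levelAt K K' h ϖ v)), ∃ x, good x ∧ finClass (levelAt K K' h ϖ v) x = c := by
    intro v c
    obtain ⟨y, rfl⟩ := ideleClass_surjective _ c
    obtain ⟨d, hd, hdc⟩ := exists_finClass_eq (levelAt K K' h ϖ v)
      (hrep (ideleClass (levelAt K K' h ϖ 0) y))
    refine ⟨_, hgood ?_ hd, hdc⟩
    simp only [good, hrep, inv_mul_cancel]
    exact one_mem _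
  have hwd : ∀ {v : ℕ} {x x' : (Af k)ˣ}, good x → good x' →
      finClass (levelAt K K' h ϖ v) x = finClass (levelAt K K' h ϖ v) x' →
      muTilde F l κ h ϖ v x' = muTilde F l κ h ϖ v x := by
    intro v x x' hx hx' hcl
    have h0 := finClass_eq_of_le (hle₀ v) hcl
    have h1 : x⁻¹ * x' ∈ detLevel (levelAt K K' h ϖ 0) := by
      have h2 := mul_mem (inv_mem hx) hx'
      rw [h0] at h2
      simpa [mul_assoc] using h2
    rw [muTilde, muTilde, modularSymbol_eq_of_finClass_eq hn hρ₁ hρ₂ F hK hK' l _ _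
      (isLevel_diagLevel hK hK' _ _ : IsLevel (levelAt K K' h ϖ 0)) (hle₀ v) x x' (hneat x) h1 hcl]
  choose X hX hXc using hex
  let μ : ∀ v, ClassSet (levelAt K K' h ϖ v) → hullInvariants ρ₁ ρ₂ := fun v c =>
    ⟨muTilde F l κ h ϖ v (X v c), muTilde_mem_hullInvariants hρ₁ hρ₂ F hK hK' l κ v _⟩
  have hμ : ∀ v, 1 ≤ v → ∀ c, μ v c = ∑ c' with classMap (hle v) c' = c, μ (v + 1) c' := by
    intro v hv c
    choose! e he using fun c' (hc' : classMap (hle v) c' = c) =>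
      D.exists_finClass_mul_eq hv (hc'.trans (hXc v c).symm)
    have hinj : Set.InjOn e (Finset.univ.filter fun c' => classMap (hle v) c' = c) := fun a ha b hb hab => by
      rw [← (he a (Finset.mem_filter.1 ha).2).2, ← (he b (Finset.mem_filter.1 hb).2).2, hab]
    refine Subtype.ext ?_
    rw [Submodule.coe_sum]
    change muTilde F l κ h ϖ v (X v c) = _
    rw [muTilde_eq_sum_of_neat hn hρ₁ hρ₂ F hK hK' D hκ hl hneat hv (X v c)
      ((Finset.univ.filter fun c' => classMap (hle v) c' = c).image e) (fun a ha => ?_)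
      (fun d hd => ?_), Finset.sum_image hinj]
    · refine Finset.sum_congr rfl fun c' hc' => ?_
      obtain ⟨h1, h2⟩ := he c' (Finset.mem_filter.1 hc').2
      have h3 : e c' ∈ detLevel (levelAt K K' h ϖ 0) :=
        ⟨_, hle₀ v h1, det_dElt hn (e c')⟩
      exact hwd (hX _ _) (hgood (hX v c) h3) ((hXc _ _).trans h2.symm)
    · obtain ⟨c', hc', rfl⟩ := Finset.mem_image.1 ha
      exact (he c' (Finset.mem_filter.1 hc').2).1
    · have hc' : classMap (hle v) (finClass (levelAt K K' h ϖ (v + 1)) (X v c * d)) = c := by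
        rw [classMap_finClass, ← hXc v c]
        exact (finClass_eq_of_inv_mul_mem (by simpa [hXc v c] using hd)).symm
      refine ⟨e (finClass (levelAt K K' h ϖ (v + 1)) (X v c * d)),
        ⟨Finset.mem_image_of_mem e (Finset.mem_filter.2 ⟨Finset.mem_univ _, hc'⟩), (he _ hc').2⟩, ?_⟩
      rintro _ ⟨ha, hcl⟩
      obtain ⟨c'', hc'', rfl⟩ := Finset.mem_image.1 ha
      rw [← hcl, (he c'' (Finset.mem_filter.1 hc'').2).2]
  obtain ⟨𝒟, h𝒟, huniq⟩ := existsUnique_distribution (E := E) (X := ClassLimit K K' h ϖ)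
    (C := fun v => ClassSet (levelAt K K' h ϖ v)) (π := fun v s => s.val v)
    (fun v => ClassLimit.apply_surjective v) (pr := fun v => classMap (hle v))
    (fun v s => ClassLimit.classMap_apply hle s v) (fun v c => isClopen_cylinder c)
    (fun f => ClassLimit.exists_factor hle hfin f) hμ
  refine ⟨𝒟, fun v hv x hx => ?_, fun 𝒟' h𝒟' => huniq 𝒟' fun v hv c => Subtype.ext ?_⟩
  · exact (congrArg Subtype.val (h𝒟 v hv (finClass (levelAt K K' h ϖ v) x))).trans
      (hwd hx (hX _ _) (hXc _ _).symm)
  · have h1 := h𝒟' v hv (X v c) (hX v c)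
    refine Eq.trans ?_ h1
    congr 3
    simp only [hXc]
    rfl

end

end RankinSelberg

theorem theorem5p5 {k : Type*} [Field k] [NumberField k] (p : ℕ) (hp : p.Prime)
    (n : ℕ) (hn : 1 ≤ n)
    -- the coefficients: `M₁ = M_μ(E)` and `M₂ = M_ν(E)`
    {E M₁ M₂ : Type*} [Field E] [CharZero E] [AddCommGroup M₁] [Module E M₁] [FiniteDimensional E M₁]
    [AddCommGroup M₂] [Module E M₂] [FiniteDimensional E M₂]
    (ρ₁ : Representation E (GLk k (n + 1)) M₁) (ρ₂ : Representation E (GLk k n) M₂)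
    (hρ₁ : IsAlgebraicRep ρ₁) (hρ₂ : IsAlgebraicRep ρ₂)
    (J : AdGroup k (n + 1)) (J' : AdGroup k n) (F : FundamentalClasses k n)
    -- the element `ϖ` of `𝒪_p`, as an idele with components `1` away from `p`
    (m : ℕ) (hm : 0 < m) (ϖ : (Af k)ˣ)
    (hϖ : ∀ q, Above p q → Valued.v (ϖ.val q) ≤ WithZero.exp (-(m : ℤ)))
    (hϖ' : ∀ q, ¬ Above p q → ϖ.val q = 1)
    (K : Subgroup (GLf k (n + 1))) (K' : Subgroup (GLf k n)) (hK : IsLevel K) (hK' : IsLevel K')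
    (hKp : HasIwahoriComponent p m K) (hKp' : HasIwahoriComponent p m K')
    (h : GLf k (n + 1)) (hh : HasMagicComponent p h)
    -- the `U_p`-eigenclass
    (l : HC ρ₁ ρ₂ J J' K K' (degree k n)) (κ : E) (hκ : κ ≠ 0)
    (hl : IsHeckeEigenclass (tElt n ϖ) (tElt' n ϖ) l κ) :
    -- the modular symbols are well defined, so that `μ̃_l(x + (ϖ^v))` lies in `H⁰(Γ_x^(v); M)`
    (∀ v, 1 ≤ v → ∀ x : (Af k)ˣ,
      (∃! w, IsModularSymbolValue F l (h * tElt n ϖ ^ v) (tElt' n ϖ ^ v) x w) ∧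
      muTilde F l κ h ϖ v x ∈
        invariantsOf (diagRep ρ₁ ρ₂) (arithGroup (levelAt K K' h ϖ v) x : Set (GLk k n))) ∧
    -- `μ̃_l(x + (ϖ^v))` only depends on the coset `x det(K(ϖ^v))`
    (∀ v, 1 ≤ v → ∀ x : (Af k)ˣ, ∀ u ∈ detLevel (levelAt K K' h ϖ v),
      muTilde F l κ h ϖ v (x * u) = muTilde F l κ h ϖ v x) ∧
    -- the distribution relation
    (∀ v, 1 ≤ v → ∀ x : (Af k)ˣ, (∀ q, Above p q → Valued.v (x.val q) = 1) →
      ∃ y : Af k → (Af k)ˣ, (∀ a ∈ Op k p, (y a).val = x.val + a * ϖ.val ^ v) ∧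
        -- summation over all `a` modulo `ϖ`
        (∀ R : Finset (Af k), IsRepresentatives p ϖ R →
          (unitGroup (levelAt K K' h ϖ (v + 1))).relIndex (unitGroup (levelAt K K' h ϖ v)) •
              muTilde F l κ h ϖ v x =
            ∑ a ∈ R, muTilde F l κ h ϖ (v + 1) (y a)) ∧
        -- summation over the classes `x + a ϖ^v + (ϖ^{v+1})` in `C(K(ϖ^{v+1}))`
        ((∀ c, ∀ γ ∈ arithGroup (levelAt K K' h ϖ 0) c, IsNeatElement γ) →
          ∀ A : Finset (Af k), (∀ a ∈ A, a ∈ Op k p) →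
          (∀ b ∈ Op k p, ∃! a, a ∈ A ∧ finClass (levelAt K K' h ϖ (v + 1)) (y a) =
            finClass (levelAt K K' h ϖ (v + 1)) (y b)) →
          muTilde F l κ h ϖ v x = ∑ a ∈ A, muTilde F l κ h ϖ (v + 1) (y a))) ∧
    -- the distribution on `C(K(p^∞))`
    ((∀ c, ∀ γ ∈ arithGroup (levelAt K K' h ϖ 0) c, IsNeatElement γ) →
      ∀ rep : ClassSet (levelAt K K' h ϖ 0) → (Af k)ˣ,
        (∀ c, finClass (levelAt K K' h ϖ 0) (rep c) = c) →
      ∃! D : LocallyConstant (ClassLimit K K' h ϖ) E →ₗ[E] hullInvariants ρ₁ ρ₂,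
        ∀ v, 1 ≤ v → ∀ x : (Af k)ˣ,
          (rep (finClass (levelAt K K' h ϖ 0) x))⁻¹ * x ∈ detLevel (levelAt K K' h ϖ 0) →
          (D (LocallyConstant.charFn E
              (isClopen_cylinder (finClass (levelAt K K' h ϖ v) x))) : M₁ ⊗[E] M₂) =
            muTilde F l κ h ϖ v x) := by
  have D : IsLevelDatum p m ϖ K K' h := ⟨hp.ne_zero, hm, hϖ, hϖ', hKp, hKp', hh⟩
  refine ⟨fun v _ x => ⟨existsUnique_isModularSymbolValue hρ₁ hρ₂ F hK hK' l _ _ x,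
    muTilde_mem_invariantsOf hρ₁ hρ₂ F hK hK' l κ v x⟩, fun v _ x u hu => ?_,
    fun v hv x hx => exists_distribution_relations hn hρ₁ hρ₂ F hK hK' D hκ hl hv hx,
    fun hneat rep hrep =>
      existsUnique_muTilde_distribution hn hρ₁ hρ₂ F hK hK' D hκ hl hneat hrep⟩
  rw [muTilde, muTilde, modularSymbol_mul hn hρ₁ hρ₂ F hK hK' l _ _ x hu]
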